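/- Let $\mathcal G=(\mathcal V,\mathcal E)$ be a finite directed acyclic network with unit-capacity edges (parallel edges allowed), with distinct source nodes $S_1,\dots,S_s$ and a set $\mathcal T$ of sinks, none of which is a source. Let $\mathbb F_p$ be the finite field with $p$ elements ($p$ a prime power), let $z\ge 0$, and for a nonempty set $\mathcal S'$ of sources let $m_{\mathcal S'}$ be the smallest min-cut capacity between $\mathcal S'$ and any sink. Let $R_1,\dots,R_s\ge 0$ be integers with $$\sum_{i\in I}R_i\le m_{\{S_i:\,i\in I\}}-2z\qquad\text{for all nonempty } I\subseteq\{1,\dots,s\},$$ put $n_i=R_i+2z$ (assumed $\ge 1$), $p_i=p^{n_1\cdots n_i}$, $p_0=p$, let $\mathbb F_{p_0}\subseteq\mathbb F_{p_1}\subseteq\dots\subseteq\mathbb F_{p_s}$ be the tower of extensions, fix a basis of each $\mathbb F_{p_i}$ over $\mathbb F_{p_{i-1}}$, and fold blocks of $n_1\cdots n_i$ columns over $\mathbb F_p$ into single columns over $\mathbb F_{p_i}$ (and unfold) with respect to the bases of products of these basis elements. *Encoding.* The information of $S_i$ is a matrix over $\mathbb F_p$ of size $R_i\times k\,n_1\cdots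 n_s$; folded over $\mathbb F_{p_i}$ it is a matrix $X_i$. Let $G_i=\big(g_{i,j}^{\,p_{i-1}^{\,r}}\big)_{1\le j\le n_i,\ 0\le r<R_i}$ be the generator matrix of a Gabidulin code, where $g_{i,1},\dots,g_{i,n_i}\in\mathbb F_{p_i}$ are linearly independent over $\mathbb F_{p_{i-1}}$, and let $M_i'$ be $G_iX_i$ unfolded over $\mathbb F_p$. Source $S_i$ sends the $n_i$ rows of $$M_i=[\,O_{n_i\times n_1}\ \cdots\ I_{n_i}\ \cdots\ O_{n_i\times n_s}\ \ M_i'\,]$$ (identity in header block $i$) as packets of length $\ell=\sum_i n_i+k\prod_i n_i$. *Network.* On each edge the transmitting node sends a linear combination, with independent uniformly random local coding coefficients in $\mathbb F_p$, of its own source packets and of the packets that it has received. An adversary adds arbitrary packets on at most $z$ edges; edges and packets may depend on the network, the coding coefficients and the information. A sink receives the $B\times\ell$ matrix $Y$ of the packets on its $B$ incoming edges. *Claim.* There is a decoding algorithm (one program for all parameters and fields, which is given only $s,k,z,p,B,R_1,\dots,R_s$, a description of the code, and $Y$, and knows nothing about the network) with the following properties. 1. Decoding is successive: for $i=s,s-1,\dots,1$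 the information of $S_i$ is decoded from the current matrix $Y$ by a map that does not depend on the network, and then $Y$ is replaced by $Y-Y_iM_i$, where $Y_i$ is header block $i$ of $Y$ and $M_i$ is the message matrix that belongs to the decoded information. 2. For each fixed $s$ the number of steps on every input $Y$ is bounded by a polynomial in $B$, $k$, $\sum_i n_i$ and $\log p$, with constants that depend only on $s$. Here an operation in $\mathbb F_p$ counts as one step and operations on integers are charged by bit length. 3. For each sink, with probability at least $1-s|\mathcal E|/p$ over the local coding coefficients, the algorithm recovers the information of all sources correctly, whatever this information is and whatever the adversary injects on at most $z$ edges. -/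

import Mathlib

noncomputable section

open scoped Classical

namespace NetCode

/-! ### Networks and cuts -/

/-- A finite delay-free acyclic network: a directed multigraph whose edges all have unit capacity
(a link of larger capacity is a family of parallel edges). -/
structure Network (V E : Type*) where
  /-- the node that transmits on an edge -/
  tail : E → V
  /-- the node that receives from an edge -/
  head : E → V
  /-- there is no directed cycle -/
  acyclic : ∀ e, ¬ Relation.TransGen (fun e₁ e₂ => head e₁ = tail e₂) e e

/-- The capacity of a minimum cut that separates the set `A` of nodes from the node `t`
(it is `⊤` if `t ∈ A`). -/
def Network.minCut {V E : Type*} (net : Network V E) (A : Set V) (t : V) : ℕ∞ :=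
  ⨅ (U : Set V) (_ : A ⊆ U) (_ : t ∉ U), {e : E | net.tail e ∈ U ∧ net.head e ∉ U}.encard

/-- The minimum over all sinks of the min-cut capacity between `A` and the sink. -/
def Network.multicastCut {V E : Type*} (net : Network V E) (A : Set V) (sinks : Set V) : ℕ∞ :=
  ⨅ t ∈ sinks, net.minCut A t

/-- Adjacency of edges of a finite acyclic network is well founded. -/
theorem Network.wf {V E : Type*} [Finite E] (net : Network V E) :
    WellFounded (fun e₁ e₂ : E => net.head e₁ = net.tail e₂) := by
  have : Std.Irrefl (Relation.TransGen (fun e₁ e₂ : E => net.head e₁ = net.tail e₂)) :=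
    ⟨net.acyclic⟩
  have hw := Finite.wellFounded_of_trans_of_irrefl
    (Relation.TransGen (fun e₁ e₂ : E => net.head e₁ = net.tail e₂))
  exact Subrelation.wf (r := Relation.TransGen (fun e₁ e₂ : E => net.head e₁ = net.tail e₂))
    (fun {a b} (h : net.head a = net.tail b) => Relation.TransGen.single h) hw

/-! ### Shape of packets and messages -/

section Shape

variable {s : ℕ}

/-- The number `n i = R i + 2 z` of packets of source `i`. -/
abbrev len (R : Fin s → ℕ) (z : ℕ) : Fin s → ℕ := fun i => R i + 2 * z

/-- The header positions of a packet: one block of `n i` positions for each source `i`. -/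
abbrev Header (n : Fin s → ℕ) : Type := Σ i, Fin (n i)

/-- The payload positions of a packet: `k` blocks of `∏ i, n i` positions. -/
abbrev Payload (n : Fin s → ℕ) (k : ℕ) : Type := Fin k × (∀ i, Fin (n i))

/-- All positions of a packet: header, then payload. -/
abbrev Position (n : Fin s → ℕ) (k : ℕ) : Type := Header n ⊕ Payload n k

/-- The information of all sources: source `i` has an `R i × (k ∏ n)` matrix over the base field. -/
abbrev Info (K : Type*) (R : Fin s → ℕ) (z k : ℕ) : Type _ :=
  ∀ i, Matrix (Fin (R i)) (Payload (len R z) k) K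

/-- The position in memory order of a payload position, the index of the first source varying
fastest. -/
def payloadEquiv (n : Fin s → ℕ) (k : ℕ) : Payload n k ≃ Fin (k * ∏ i, n i) :=
  ((Equiv.refl _).prodCongr finPiFinEquiv).trans finProdFinEquiv

/-- The position in memory order of a packet position. -/
def positionEquiv (n : Fin s → ℕ) (k : ℕ) :
    Position n k ≃ Fin ((∑ i, n i) + k * ∏ i, n i) :=
  (finSigmaFinEquiv.sumCongr (payloadEquiv n k)).trans finSumFinEquiv

end Shape

/-! ### The multiple-field-extension Gabidulin code -/

/-- The public data of the code: a tower `K = F 0 ≤ F 1 ≤ ⋯ ≤ F s = L` of finite fields with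
`[F i : K] = n 0 ⋯ n (i - 1)`, for every step of the tower a basis that is used for folding and
unfolding, and for every step the evaluation points of the Gabidulin code of that source. -/
structure TowerCode (K L : Type*) [Field K] [Field L] [Algebra K L] {s : ℕ}
    (n : Fin s → ℕ) where
  F : Fin (s + 1) → IntermediateField K L
  mono : Monotone F
  finrank_F : ∀ l, Module.finrank K (F l) = ∏ j : Fin s with j.castSucc < l, n j
  finrank_top : Module.finrank K L = ∏ j, n j
  /-- the basis of `F (i + 1)` over `F i` -/
  α : ∀ i, Fin (n i) → L
  α_mem : ∀ i j, α i j ∈ F i.succ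
  α_indep : ∀ i : Fin s, LinearIndependent (F i.castSucc) (α i)
  /-- the evaluation points of the Gabidulin code over `F (i + 1)` -/
  g : ∀ i, Fin (n i) → L
  g_mem : ∀ i j, g i j ∈ F i.succ
  g_indep : ∀ i : Fin s, LinearIndependent (F i.castSucc) (g i)

namespace TowerCode

variable {K L : Type*} [Field K] [Fintype K] [Field L] [Algebra K L] {s : ℕ}

/-- Folding of a matrix over `K` into a matrix over the field `F (i + 1)` of source `i`, with
respect to the basis of products of `α 0, …, α i`. Consecutive blocks of `n 0 ⋯ n i` columns
become one column. -/
def fold {n : Fin s → ℕ} (C : TowerCode K L n) {k : ℕ} {ρ : Type*} (i : Fin s)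
    (A : Matrix ρ (Payload n k) K) :
    Matrix ρ (Fin k × (∀ j : {j : Fin s // ¬ j ≤ i}, Fin (n j))) L :=
  Matrix.of fun r c => ∑ lo : (∀ j : {j : Fin s // j ≤ i}, Fin (n j)),
    A r (c.1, (Equiv.piEquivPiSubtypeProd (fun j : Fin s => j ≤ i) (fun j => Fin (n j))).symm
      (lo, c.2)) • ∏ j : {j : Fin s // j ≤ i}, C.α j.1 (lo j)

/-- Unfolding, the inverse of folding (on the matrices with entries in `F (i + 1)`). -/
def unfold {n : Fin s → ℕ} (C : TowerCode K L n) {k : ℕ} {ρ : Type*} (i : Fin s)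
    (A : Matrix ρ (Fin k × (∀ j : {j : Fin s // ¬ j ≤ i}, Fin (n j))) L) :
    Matrix ρ (Payload n k) K :=
  Function.invFun (C.fold i) A

variable {R : Fin s → ℕ} {z : ℕ} (C : TowerCode K L (len R z))

/-- The generator matrix `n i × R i` of the Gabidulin code of source `i`: with `Q` the size of
`F i`, the row of an evaluation point `g` is `g, g ^ Q, g ^ Q ^ 2, …`. -/
def gen (i : Fin s) : Matrix (Fin (len R z i)) (Fin (R i)) L :=
  Matrix.of fun j r =>
    C.g i j ^ ((Fintype.card K ^ (∏ l : Fin s with l < i, len R z l)) ^ (r : ℕ))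

/-- The message matrix of source `i`: the header is zero except for an identity matrix in block
`i`, the payload is the unfolded Gabidulin codeword of the folded information. -/
def message {k : ℕ} (i : Fin s) (X : Matrix (Fin (R i)) (Payload (len R z) k) K) :
    Matrix (Fin (len R z i)) (Position (len R z) k) K :=
  Matrix.of fun j => Sum.elim
    (fun h => if h = ⟨i, j⟩ then 1 else 0)
    (fun c => C.unfold i (C.gen i * C.fold i X) j c)

/-- Cancelling source `i`: the sink computes its own header block `Y i` for this source times the
message matrix that belongs to the decoded information `X`, and subtracts it. -/
def cancel {k B : ℕ} (i : Fin s) (X : Matrix (Fin (R i)) (Payload (len R z) k) K)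
    (Y : Matrix (Fin B) (Position (len R z) k) K) :
    Matrix (Fin B) (Position (len R z) k) K :=
  Y - Y.submatrix id (fun j : Fin (len R z i) => Sum.inl ⟨i, j⟩) * C.message i X

/-- What is left of the received matrix when the last `m` sources have been decoded, each by its
stage decoder `δ i`, and cancelled, the last source first. -/
def residual (C : TowerCode K L (len R z)) {k B : ℕ}
    (δ : ∀ i, Matrix (Fin B) (Position (len R z) k) K →
      Matrix (Fin (R i)) (Payload (len R z) k) K)
    (Y : Matrix (Fin B) (Position (len R z) k) K) :
    ℕ → Matrix (Fin B) (Position (len R z) k) K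
  | 0 => Y
  | m + 1 =>
    if h : m < s then
      C.cancel (Fin.rev ⟨m, h⟩) (δ (Fin.rev ⟨m, h⟩) (residual C δ Y m)) (residual C δ Y m)
    else residual C δ Y m

/-- Successive decoding: source `i` is decoded from what is left when all later sources have been
decoded and cancelled. -/
def successive {k B : ℕ}
    (δ : ∀ i, Matrix (Fin B) (Position (len R z) k) K →
      Matrix (Fin (R i)) (Payload (len R z) k) K)
    (Y : Matrix (Fin B) (Position (len R z) k) K) : Info K R z k :=
  fun i => δ i (C.residual δ Y (Fin.rev i))

/-! ### Random linear network coding with an adversary -/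

/-- Local coding coefficients: for every edge `e`, a coefficient for every source packet and one
for every other edge. Only those of packets available at the tail of `e` are used. -/
abbrev Coeffs (K : Type*) (n : Fin s → ℕ) (E : Type*) : Type _ := (Header n ⊕ E) → E → K

/-- The packet received on each edge: the node at the tail forms the linear combination, with the
local coding coefficients, of its own source packets (if it is a source) and of the packets it has
received; the adversary adds `Z e`. -/
def packet {k : ℕ} {V E : Type*} [Fintype E] (net : Network V E) (src : Fin s → V)
    (ω : Coeffs K (len R z) E) (X : Info K R z k)
    (Z : E → Position (len R z) k → K) : E → Position (len R z) k → K :=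
  net.wf.fix fun e rec =>
    (∑ h : Header (len R z),
      if src h.1 = net.tail e then ω (Sum.inl h) e • C.message h.1 (X h.1) h.2 else 0) +
    (∑ e' : E, if h : net.head e' = net.tail e then ω (Sum.inr e') e • rec e' h else 0) +
    Z e

/-- The recursion that determines the packets. -/
theorem packet_eq {k : ℕ} {V E : Type*} [Fintype E] (net : Network V E) (src : Fin s → V)
    (ω : Coeffs K (len R z) E) (X : Info K R z k)
    (Z : E → Position (len R z) k → K) (e : E) :
    C.packet net src ω X Z e =
      (∑ h : Header (len R z),
        if src h.1 = net.tail e then ω (Sum.inl h) e • C.message h.1 (X h.1) h.2 else 0) +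
      (∑ e' : E, if net.head e' = net.tail e then ω (Sum.inr e') e • C.packet net src ω X Z e'
        else 0) + Z e := by
  rw [packet, WellFounded.fix_eq]
  simp only [dite_eq_ite]

/-- The matrix of the packets that arrive at the sink `t`, in some order `ord`. -/
def received {k B : ℕ} {V E : Type*} [Fintype E] (net : Network V E) (src : Fin s → V) {t : V}
    (ord : Fin B ≃ {e : E // net.head e = t}) (ω : Coeffs K (len R z) E) (X : Info K R z k)
    (Z : E → Position (len R z) k → K) : Matrix (Fin B) (Position (len R z) k) K :=
  Matrix.of fun b => C.packet net src ω X Z (ord b)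

end TowerCode

/-! ### Algorithms over a field

A random access machine with a memory for natural numbers and a memory for field elements. One
program, independent of the field, works on all inputs. Every arithmetic operation in the field
costs one unit, and so does every control step; operations on natural numbers are charged by the
bit length of their results. Field elements influence the control flow only through zero tests. -/

/-- Expressions for natural numbers; `cell a` is the content of the memory cell number `a`. -/
inductive IntExp
  | lit (c : ℕ)
  | cell (a : IntExp)
  | add (a b : IntExp)
  | sub (a b : IntExp)
  | mul (a b : IntExp)
  | div (a b : IntExp)
  | log2 (a : IntExp)

/-- The value of an expression in a memory. -/
def IntExp.eval (m : ℕ → ℕ) : IntExp → ℕ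
  | lit c => c
  | cell a => m (a.eval m)
  | add a b => a.eval m + b.eval m
  | sub a b => a.eval m - b.eval m
  | mul a b => a.eval m * b.eval m
  | div a b => a.eval m / b.eval m
  | log2 a => Nat.log 2 (a.eval m)

/-- The cost of evaluating an expression: for every operation, one plus the bit length of its
result. -/
def IntExp.cost (m : ℕ → ℕ) : IntExp → ℕ
  | lit c => 1 + c.size
  | cell a => a.cost m + (1 + (m (a.eval m)).size)
  | add a b => a.cost m + b.cost m + (1 + (a.eval m + b.eval m).size)
  | sub a b => a.cost m + b.cost m + (1 + (a.eval m - b.eval m).size)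
  | mul a b => a.cost m + b.cost m + (1 + (a.eval m * b.eval m).size)
  | div a b => a.cost m + b.cost m + (1 + (a.eval m / b.eval m).size)
  | log2 a => a.cost m + (1 + (Nat.log 2 (a.eval m)).size)

/-- Expressions for field elements. -/
inductive FldExp
  | zero
  | one
  | cell (a : IntExp)
  | add (x y : FldExp)
  | sub (x y : FldExp)
  | mul (x y : FldExp)
  | inv (x : FldExp)

/-- The value of an expression. -/
def FldExp.eval {K : Type*} [Field K] (m : ℕ → ℕ) (f : ℕ → K) : FldExp → K
  | zero => 0
  | one => 1
  | cell a => f (a.eval m)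
  | add x y => x.eval m f + y.eval m f
  | sub x y => x.eval m f - y.eval m f
  | mul x y => x.eval m f * y.eval m f
  | inv x => (x.eval m f)⁻¹

/-- The cost of evaluating an expression. -/
def FldExp.cost (m : ℕ → ℕ) : FldExp → ℕ
  | zero => 1
  | one => 1
  | cell a => a.cost m + 1
  | add x y => x.cost m + y.cost m + 1
  | sub x y => x.cost m + y.cost m + 1
  | mul x y => x.cost m + y.cost m + 1
  | inv x => x.cost m + 1

/-- Programs. `loop r e P` evaluates `e` once and then runs `P` that many times, with the number of
the current round written to the integer cell `r` before each round. -/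
inductive Prog
  | skip
  | setInt (a e : IntExp)
  | setFld (a : IntExp) (x : FldExp)
  | seq (P Q : Prog)
  | ifLt (a b : IntExp) (P Q : Prog)
  | ifZero (x : FldExp) (P Q : Prog)
  | loop (r : ℕ) (e : IntExp) (P : Prog)

/-- The memory of the machine. -/
@[ext]
structure Store (K : Type*) where
  int : ℕ → ℕ
  fld : ℕ → K

/-- The effect of a program on the memory, and the number of steps that it takes. -/
def Prog.run {K : Type*} [Field K] : Prog → Store K → Store K × ℕ
  | skip, S => (S, 1)
  | setInt a e, S =>
    (⟨Function.update S.int (a.eval S.int) (e.eval S.int), S.fld⟩,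
      a.cost S.int + e.cost S.int + 1)
  | setFld a x, S =>
    (⟨S.int, Function.update S.fld (a.eval S.int) (x.eval S.int S.fld)⟩,
      a.cost S.int + x.cost S.int + 1)
  | seq P Q, S =>
    ((Q.run (P.run S).1).1, (P.run S).2 + (Q.run (P.run S).1).2 + 1)
  | ifLt a b P Q, S =>
    if a.eval S.int < b.eval S.int
    then ((P.run S).1, a.cost S.int + b.cost S.int + (P.run S).2 + 1)
    else ((Q.run S).1, a.cost S.int + b.cost S.int + (Q.run S).2 + 1)
  | ifZero x P Q, S =>
    if x.eval S.int S.fld = 0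
    then ((P.run S).1, x.cost S.int + (P.run S).2 + 1)
    else ((Q.run S).1, x.cost S.int + (Q.run S).2 + 1)
  | loop r e P, S =>
    Nat.rec (motive := fun _ => Store K × ℕ) (S, e.cost S.int + 1)
      (fun i A =>
        ((P.run ⟨Function.update A.1.int r i, A.1.fld⟩).1,
          A.2 + (1 + i.size) + (P.run ⟨Function.update A.1.int r i, A.1.fld⟩).2))
      (e.eval S.int)

/-! ### Input and output of the decoder -/

/-- The entries of a matrix, row by row. -/
def rowMajor {K : Type*} {a b : ℕ} (A : Fin a → Fin b → K) : List K :=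
  List.ofFn fun x : Fin (a * b) => A (finProdFinEquiv.symm x).1 (finProdFinEquiv.symm x).2

namespace TowerCode

variable {K L : Type*} [Field K] [Fintype K] [Field L] [Algebra K L] {s : ℕ}
  {R : Fin s → ℕ} {z : ℕ} (C : TowerCode K L (len R z))

/-- The basis of `L` over `K` that consists of the products of the bases of the tower. -/
def prodBasis (c : Fin (∏ i, len R z i)) : L := ∏ i, C.α i (finPiFinEquiv.symm c i)

/-- The coordinates of an element of `L` in the product basis. -/
def coords (x : L) : Fin (∏ i, len R z i) → K :=
  Function.invFun (fun v : Fin (∏ i, len R z i) → K => ∑ c, v c • C.prodBasis c) x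

/-- The description of the code, as a list of elements of `K`: the structure constants of `L` in
the product basis, and in this basis the coordinates of the bases of the steps of the tower and of
the evaluation points. -/
def description : List K :=
  rowMajor (fun (ab : Fin ((∏ i, len R z i) * ∏ i, len R z i)) (c : Fin (∏ i, len R z i)) =>
    C.coords (C.prodBasis (finProdFinEquiv.symm ab).1 * C.prodBasis (finProdFinEquiv.symm ab).2)
      c) ++
  rowMajor (fun (h : Fin (∑ i, len R z i)) (c : Fin (∏ i, len R z i)) =>
    C.coords (C.α (finSigmaFinEquiv.symm h).1 (finSigmaFinEquiv.symm h).2) c) ++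
  rowMajor (fun (h : Fin (∑ i, len R z i)) (c : Fin (∏ i, len R z i)) =>
    C.coords (C.g (finSigmaFinEquiv.symm h).1 (finSigmaFinEquiv.symm h).2) c)

/-- The memory in which the decoder starts: the numbers `s, k, z, p, B, R 0, …, R (s - 1)`, where
`p` is the size of the base field and `B` the number of received packets (the integer cells from
`5` to `31` are free work space); the description of the code; and the received matrix. Nothing about the network is known. -/
def input {k B : ℕ} (Y : Matrix (Fin B) (Position (len R z) k) K) : Store K where
  int a := ([s, k, z, Fintype.card K, B] ++ List.replicate 27 0 ++ List.ofFn R).getD a 0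
  fld a := (C.description ++
    rowMajor (fun b c => Y b ((positionEquiv (len R z) k).symm c))).getD a 0

end TowerCode

/-- The memory holds, in its first field cells, the information matrices of all sources, stacked
and row by row. -/
def Store.Holds {K : Type*} {s : ℕ} {R : Fin s → ℕ} {z k : ℕ} (S : Store K)
    (X : Info K R z k) : Prop :=
  ∀ (i : Fin s) (r : Fin (R i)) (c : Payload (len R z) k),
    S.fld ((finSigmaFinEquiv ⟨i, r⟩ : Fin (∑ i, R i)) * (k * ∏ i, len R z i) +
      payloadEquiv (len R z) k c) = X i r c

end NetCode

end

/-! Decoding. A block of `∏ n` payload symbols is read as one element of `L`. Read this way, the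
codeword of source `j` consists of the values, at the points `g j l`, of a linearized polynomial
`f_j` in the `C.q j`-power map; its coefficients are the information of `j` (`elt_message`). Power
maps are `K`-linear and the network combines packets over `K`. Hence a received payload `w b` is the
sum of the `f_j (y b j)` plus errors from at most `z` edges, where `y b j` combines the points `g j
l` as the received header prescribes. Forged headers do no further harm: the codewords that they
announce are subtracted from the error (`successive_eq`).

Suppose the sources after `i` are cancelled. Some nonzero linearized polynomial `Λ` in the `C.q
i`-power map, with `z + 1` coefficients, annihilates the errors (`exists_annihilator`). Apply it to
`w b`. The generator entries of an earlier source lie in `F i.castSucc`, the field over which `Λ` is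
linear. So that source contributes a combination of the values of `Λ` at its information, with known
coefficients, and source `i` contributes `Λ ∘ f_i` at `y b i`. Taking these values, the coefficients
of `Λ ∘ f_i` and those of `Λ` as independent unknowns, up to sign, gives a homogeneous linear
system, the key equation. Conversely, let `N` and `Λ` belong to any solution. What each source
packet contributes is linear over `F i.castSucc` in the coordinates of stage `i`. If the packets at
the sink span these coordinates, all contributions lie in a space of dimension at most `z`. Thus `N
+ Λ ∘ f_i`, with `R i + z` coefficients, maps `R i + 2 z` independent points into that space, has
too many zeros, and vanishes (`coeff_eq_zero_of_keyValue`). Linearized polynomials have no zero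
divisors, so `N` and a nonzero `Λ` determine `f_i`. It is found from a second system, which is
linear over `K` only, because the unknown coefficients occur in powers (`decodeCol_eq`).

Probability. The edges are processed in a topological order, keeping every set of nodes around the
sink able to acquire the whole stage space from what it has and the edges still to come. Dimension
and cut size are submodular, so the sets without slack that the next edge enters lie in a largest
one. The new packet therefore only has to avoid one subspace that does not contain everything
available at its tail (`exists_avoid`). A random column of coefficients fails with probability at
most `1 / |K|`. The subset rate conditions are what is needed at the start (`finrank_le_span`,
`ncard_not_decodable`). A union bound over edges and sources gives `s |E| / |K|`. The good event
concerns the transfer matrix alone, so information and injections may be chosen afterwards.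

Algorithm. The decoder is written in a language of array statements whose meaning is a function on
arrays (`Stm.sem`). Compilation to the machine is proved correct once (`Stm.compile_run`). Compiled
code writes no integers except loop counters and reads its numbers of rounds from cells, so a bound
for the cells bounds the running time (`Prog.Tame.within`, `Prog.cost_le`). A short preparation
replaces the size of the base field by its binary digits, after which every cell is polynomially
bounded. -/

set_option linter.unusedSectionVars false

noncomputable section
open scoped Classical
namespace NetCode

/-! ### Random linear network coding spans the message space -/

section Flow

variable {V E I K A A' : Type*} [Field K] [Fintype E] [Fintype I]
  [AddCommGroup A] [Module K A] [AddCommGroup A'] [Module K A']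

/-- The vectors carried by the edges when source packet `h` carries `μ h` and `Z e` is added on
edge `e`. -/
def Network.flow (net : Network V E) (loc : I → V) (ω : I ⊕ E → E → K) (μ : I → A) (Z : E → A) :
    E → A :=
  net.wf.fix fun e rec =>
    (∑ h : I, if loc h = net.tail e then ω (Sum.inl h) e • μ h else 0) +
    (∑ e' : E, if h : net.head e' = net.tail e then ω (Sum.inr e') e • rec e' h else 0) + Z e

theorem Network.flow_eq (net : Network V E) (loc : I → V) (ω : I ⊕ E → E → K) (μ : I → A)
    (Z : E → A) (e : E) :
    net.flow loc ω μ Z e =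
      (∑ h : I, if loc h = net.tail e then ω (Sum.inl h) e • μ h else 0) +
      (∑ e' : E, if net.head e' = net.tail e then ω (Sum.inr e') e • net.flow loc ω μ Z e'
        else 0) + Z e := by
  rw [Network.flow, WellFounded.fix_eq]
  simp only [dite_eq_ite]

/-- Each edge forms a linear combination whose coefficients do not depend on what the packets are.
Running the network on unit vectors therefore yields transfer coefficients that serve all messages
and all injections. -/
theorem Network.map_flow (net : Network V E) (loc : I → V) (ω : I ⊕ E → E → K) (μ : I → A)
    (Z : E → A) (f : A →ₗ[K] A') (e : E) :
    f (net.flow loc ω μ Z e) = net.flow loc ω (fun h => f (μ h)) (fun e => f (Z e)) e := by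
  induction e using net.wf.induction with
  | _ e ih =>
    rw [net.flow_eq, net.flow_eq, map_add, map_add, map_sum, map_sum]
    congr 2
    · refine Finset.sum_congr rfl fun h _ => ?_
      split_ifs <;> simp
    · refine Finset.sum_congr rfl fun e' _ => ?_
      split_ifs with h
      · rw [map_smul, ih e' h]
      · simp

/-- A packet depends only on the coefficients of edges upstream of it, and `D` is closed under
predecessors. So the coefficients of an unprocessed edge can be drawn afresh without changing what
is known. -/
theorem Network.flow_congr (net : Network V E) (loc : I → V) {ω ω' : I ⊕ E → E → K} (μ : I → A)
    (Z : E → A) (D : Finset E) (hD : ∀ e ∈ D, ∀ e', net.head e' = net.tail e → e' ∈ D)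
    (h : ∀ x, ∀ e ∈ D, ω x e = ω' x e) (e : E) (he : e ∈ D) :
    net.flow loc ω μ Z e = net.flow loc ω' μ Z e := by
  induction e using net.wf.induction with
  | _ e ih =>
    rw [net.flow_eq, net.flow_eq]
    congr 2
    · refine Finset.sum_congr rfl fun x _ => ?_
      rw [h _ e he]
    · refine Finset.sum_congr rfl fun e' _ => ?_
      split_ifs with h'
      · rw [h _ e he, ih e' h' (hD e he e' h')]
      · rfl

end Flow

/-! ### Submodularity and the effect of processing one edge -/

section Step

variable {V E I 𝕜 W : Type*} [Finite V] [Fintype E] [Field 𝕜] [AddCommGroup W] [Module 𝕜 W]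
  [FiniteDimensional 𝕜 W]

/-- The space spanned by the source packets at the nodes of `A` and the packets that these nodes
have received on edges in `D`. -/
def Network.avail (𝕜 : Type*) {W : Type*} [Field 𝕜] [AddCommGroup W] [Module 𝕜 W]
    (net : Network V E) (loc : I → V) (γ : I → W) (c : E → W) (D : Finset E) (A : Set V) :
    Submodule 𝕜 W :=
  Submodule.span 𝕜 (γ '' {h | loc h ∈ A} ∪ c '' {e | e ∈ D ∧ net.head e ∈ A})

/-- The edges outside `D` that enter `A`. -/
def Network.entering (net : Network V E) (D : Finset E) (A : Set V) : Finset E :=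
  Finset.univ.filter fun e => e ∉ D ∧ net.tail e ∉ A ∧ net.head e ∈ A

/-- Every set of nodes that contains `t` can still acquire the whole space. -/
def Network.Sufficient (𝕜 : Type*) {W : Type*} [Field 𝕜] [AddCommGroup W] [Module 𝕜 W]
    (net : Network V E) (loc : I → V) (γ : I → W) (t : V) (c : E → W) (D : Finset E) : Prop :=
  ∀ A : Set V, t ∈ A →
    Module.finrank 𝕜 W ≤
      Module.finrank 𝕜 (net.avail 𝕜 loc γ c D A) + (net.entering D A).card

variable (net : Network V E) (loc : I → V) (γ : I → W) (t : V)

theorem Network.avail_union (c : E → W) (D : Finset E) (A B : Set V) :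
    net.avail 𝕜 loc γ c D (A ∪ B) = net.avail 𝕜 loc γ c D A ⊔ net.avail 𝕜 loc γ c D B := by
  rw [avail, avail, avail, ← Submodule.span_union]
  congr 1
  ext x
  simp only [Set.mem_union, Set.mem_image, Set.mem_ofPred_eq]
  grind

theorem Network.avail_mono (c : E → W) (D : Finset E) {A B : Set V} (h : A ⊆ B) :
    net.avail 𝕜 loc γ c D A ≤ net.avail 𝕜 loc γ c D B := by
  rw [← Set.union_eq_self_of_subset_left h, net.avail_union]
  exact le_sup_left

/-- Submodularity of the cut function, checked edge by edge. Only unprocessed edges between `A \ B`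
and `B \ A`, in either direction, make the inequality strict. -/
theorem Network.entering_submodular (D : Finset E) (A B : Set V) :
    (net.entering D (A ∪ B)).card + (net.entering D (A ∩ B)).card ≤
      (net.entering D A).card + (net.entering D B).card := by
  simp only [entering, Finset.card_filter]
  rw [← Finset.sum_add_distrib, ← Finset.sum_add_distrib]
  refine Finset.sum_le_sum fun e _ => ?_
  by_cases h0 : e ∈ D <;> by_cases h1 : net.tail e ∈ A <;> by_cases h2 : net.tail e ∈ B <;>
    by_cases h3 : net.head e ∈ A <;> by_cases h4 : net.head e ∈ B <;> simp [h0, h1, h2, h3, h4]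

theorem Network.avail_congr {c c' : E → W} {D : Finset E} (h : ∀ e ∈ D, c' e = c e) (A : Set V) :
    net.avail 𝕜 loc γ c' D A = net.avail 𝕜 loc γ c D A := by
  rw [avail, avail]
  congr 2
  exact Set.image_congr fun e he => h e he.1

/-- When an edge all of whose predecessors are processed is processed, sufficiency survives as soon
as the new packet avoids one subspace that does not contain everything available to its tail. -/
theorem Network.exists_avoid {c : E → W} {D : Finset E}
    (hs : net.Sufficient 𝕜 loc γ t c D) {e : E} (he : e ∉ D)
    (hpred : ∀ e', net.head e' = net.tail e → e' ∈ D) :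
    (∀ c' : E → W, (∀ e ∈ D, c' e = c e) → net.Sufficient 𝕜 loc γ t c' (insert e D)) ∨
    ∃ H : Submodule 𝕜 W,
      ((∃ h, loc h = net.tail e ∧ γ h ∉ H) ∨ ∃ e', net.head e' = net.tail e ∧ c e' ∉ H) ∧
      ∀ c' : E → W, (∀ e ∈ D, c' e = c e) → c' e ∉ H →
        net.Sufficient 𝕜 loc γ t c' (insert e D) := by
  -- These are the only sets endangered by processing `e`: they lose `e` as an entering edge and
  -- have no slack.
  let tight : Set V → Prop := fun A => t ∈ A ∧ net.tail e ∉ A ∧ net.head e ∈ A ∧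
    Module.finrank 𝕜 (net.avail 𝕜 loc γ c D A) + (net.entering D A).card = Module.finrank 𝕜 W
  have havail_le : ∀ (c' : E → W), (∀ e ∈ D, c' e = c e) → ∀ A,
      net.avail 𝕜 loc γ c D A ≤ net.avail 𝕜 loc γ c' (insert e D) A := by
    intro c' hc' A
    rw [← net.avail_congr loc γ hc']
    refine Submodule.span_mono (Set.union_subset_union_right _ (Set.image_mono ?_))
    exact fun x hx => ⟨Finset.mem_insert_of_mem hx.1, hx.2⟩
  have hcount : ∀ A, (net.entering (insert e D) A).card =
      (net.entering D A).card - if net.tail e ∉ A ∧ net.head e ∈ A then 1 else 0 := by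
    intro A
    have : net.entering (insert e D) A = (net.entering D A).erase e := by
      ext x; simp only [entering, Finset.mem_filter, Finset.mem_univ, true_and,
        Finset.mem_insert, Finset.mem_erase]; tauto
    rw [this]
    split_ifs with h
    · rw [Finset.card_erase_of_mem]
      simp [entering, he, h]
    · rw [Finset.erase_eq_of_notMem]; · rfl
      simp only [entering, Finset.mem_filter, Finset.mem_univ, true_and]; tauto
  -- sets that are not tight stay sufficient
  have hslack : ∀ (c' : E → W), (∀ e ∈ D, c' e = c e) → ∀ A, t ∈ A → ¬ tight A →
      Module.finrank 𝕜 W ≤ Module.finrank 𝕜 (net.avail 𝕜 loc γ c' (insert e D) A) +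
        (net.entering (insert e D) A).card := by
    intro c' hc' A hA hnt
    have h1 := hs A hA
    have h2 := Submodule.finrank_mono (havail_le c' hc' A)
    rw [hcount]
    split_ifs with h
    · have : Module.finrank 𝕜 (net.avail 𝕜 loc γ c D A) + (net.entering D A).card ≠
          Module.finrank 𝕜 W := fun h' => hnt ⟨hA, h.1, h.2, h'⟩
      omega
    · omega
  by_cases hex : ∃ A, tight A
  · right
    obtain ⟨A₀, hA₀⟩ := hex
    obtain ⟨B, -, hB⟩ := Set.Finite.exists_le_maximal (Set.toFinite {A | tight A}) hA₀
    have hBt : tight B := hB.1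
    -- Uncrossing: dimension and cut size are both submodular, and union and intersection are both
    -- sufficient. Hence the union of two tight sets is tight, and a maximal tight set contains all
    -- others.
    have hunion : ∀ A, tight A → A ⊆ B := by
      intro A hA
      have h1 := hs (A ∪ B) (Or.inl hA.1)
      have h2 := hs (A ∩ B) ⟨hA.1, hBt.1⟩
      have h3 := net.entering_submodular D A B
      have h4 := Submodule.finrank_sup_add_finrank_inf_eq
        (net.avail 𝕜 loc γ c D A) (net.avail 𝕜 loc γ c D B)
      rw [← net.avail_union] at h4
      have h5 : Module.finrank 𝕜 (net.avail 𝕜 loc γ c D (A ∩ B)) ≤ Module.finrank 𝕜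
          ((net.avail 𝕜 loc γ c D A) ⊓ (net.avail 𝕜 loc γ c D B) : Submodule 𝕜 W) :=
        Submodule.finrank_mono (le_inf (net.avail_mono loc γ c D Set.inter_subset_left)
          (net.avail_mono loc γ c D Set.inter_subset_right))
      have h6 := hA.2.2.2
      have h7 := hBt.2.2.2
      have ht : tight (A ∪ B) := by
        refine ⟨Or.inl hA.1, ?_, Or.inl hA.2.2.1, by omega⟩
        rintro (h | h)
        · exact hA.2.1 h
        · exact hBt.2.1 h
      exact Set.subset_union_left.trans (hB.2 ht Set.subset_union_right)
    refine ⟨net.avail 𝕜 loc γ c D B, ?_, ?_⟩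
    -- Otherwise adding the tail of `e` to `B` would not raise the dimension. It would remove `e`
    -- from the entering edges and add none, since all edges into the tail are processed. This
    -- contradicts the sufficiency of the larger set.
    · by_contra! hno
      obtain ⟨hn1, hn2⟩ := hno
      have hle : net.avail 𝕜 loc γ c D (B ∪ {net.tail e}) ≤ net.avail 𝕜 loc γ c D B := by
        rw [net.avail_union]
        refine sup_le le_rfl (Submodule.span_le.2 ?_)
        rintro x (⟨h, hh, rfl⟩ | ⟨e', ⟨-, he'⟩, rfl⟩)
        · exact hn1 h hh
        · exact hn2 e' he'
      have h1 := hs (B ∪ {net.tail e}) (Or.inl hBt.1)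
      have h2 := Submodule.finrank_mono hle
      have h3 : (net.entering D (B ∪ {net.tail e})).card < (net.entering D B).card := by
        refine Finset.card_lt_card (Finset.ssubset_iff_subset_ne.2 ⟨?_, ?_⟩)
        · intro x hx
          simp only [entering, Finset.mem_filter, Finset.mem_univ, true_and, Set.mem_union,
            Set.mem_singleton_iff, not_or] at hx ⊢
          refine ⟨hx.1, hx.2.1.1, hx.2.2.resolve_right fun h => hx.1 (hpred x h)⟩
        · intro h
          have : e ∈ net.entering D (B ∪ {net.tail e}) := by
            rw [h]; simp [entering, he, hBt.2.1, hBt.2.2.1]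
          simp [entering] at this
      have h4 := hBt.2.2.2
      omega
    · intro c' hc' hce A hA
      by_cases hA' : tight A
      -- The new packet lies outside what `B`, and hence `A`, already has. The dimension grows and
      -- makes up for the lost edge.
      · have hlt : net.avail 𝕜 loc γ c D A < net.avail 𝕜 loc γ c' (insert e D) A := by
          refine lt_of_le_of_ne (havail_le c' hc' A) fun h => hce ?_
          have : c' e ∈ net.avail 𝕜 loc γ c' (insert e D) A :=
            Submodule.subset_span (Or.inr ⟨e, ⟨Finset.mem_insert_self _ _, hA'.2.2.1⟩, rfl⟩)
          rw [← h] at this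
          exact net.avail_mono loc γ c D (hunion A hA') this
        have h1 := Submodule.finrank_lt_finrank_of_lt hlt
        have h2 := hA'.2.2.2
        rw [hcount, if_pos ⟨hA'.2.1, hA'.2.2.1⟩]
        omega
      · exact hslack c' hc' A hA hA'
  · left
    intro c' hc' A hA
    exact hslack c' hc' A hA fun h => hex ⟨A, h⟩

end Step

/-! ### Counting the coding coefficients that destroy sufficiency -/

section Count

variable {V E I K 𝕜 W : Type*} [Finite V] [Fintype E] [Fintype I] [Field K] [Fintype K]
  [Field 𝕜] [Algebra K 𝕜] [AddCommGroup W] [Module 𝕜 W] [Module K W] [IsScalarTower K 𝕜 W]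
  [FiniteDimensional 𝕜 W]

/-- A proper subspace has codimension at least one. This is where the failure probability `1 / |K|`
per edge comes from. -/
theorem card_submodule_mul_le {J : Type*} [Fintype J] (S : Submodule K (J → K)) (hS : S ≠ ⊤) :
    Nat.card S * Nat.card K ≤ Nat.card (J → K) := by
  have h1 : Module.finrank K S < Module.finrank K (J → K) := Submodule.finrank_lt hS
  rw [Module.natCard_eq_pow_finrank (K := K) (V := S),
    Module.natCard_eq_pow_finrank (K := K) (V := J → K), ← pow_succ]
  exact Nat.pow_le_pow_right Nat.card_pos h1

/-- If for fixed values of all other columns at most a fraction `1 / q` of the columns `e` is bad,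
then the whole fraction is at most `1 / q`. -/
theorem card_filter_le_of_column_aux {J E β : Type*} [Fintype J] [Fintype E] [Fintype β] (e : E)
    (P : (J → E → β) → Prop) (q : ℕ)
    (h : ∀ ω : J → E → β, (Finset.univ.filter fun x : J → β =>
      P fun j => Function.update (ω j) e (x j)).card * q ≤ Fintype.card (J → β)) :
    (Finset.univ.filter P).card * q ≤ Fintype.card (J → E → β) := by
  by_cases hne : Nonempty (J → β)
  swap
  · have : IsEmpty (J → E → β) := ⟨fun ω => hne ⟨fun j => ω j e⟩⟩
    simp
  have hpos : 0 < Fintype.card (J → β) := Fintype.card_pos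
  refine Nat.le_of_mul_le_mul_right ?_ hpos
  have key : (Finset.univ.filter P).card * Fintype.card (J → β) =
      ∑ ω : J → E → β, (Finset.univ.filter fun x : J → β =>
        P fun j => Function.update (ω j) e (x j)).card := by
    simp only [Finset.card_filter]
    rw [← Finset.sum_product']
    rw [Finset.sum_mul]
    simp only [← Finset.card_univ (α := J → β), ite_mul, one_mul, zero_mul]
    have h2 : ∀ ω : J → E → β, (if P ω then (Finset.univ : Finset (J → β)).card else 0) =
        ∑ _x : J → β, if P ω then 1 else 0 := by
      intro ω; split_ifs <;> simp
    simp only [h2]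
    rw [← Finset.sum_product']
    -- Pairs of a coefficient matrix and a fresh column are counted twice. Exchanging the fresh
    -- column with column `e` is an involution on such pairs.
    refine Finset.sum_nbij' (fun a => (fun j => Function.update (a.1 j) e (a.2 j),
        fun j => a.1 j e))
      (fun a => (fun j => Function.update (a.1 j) e (a.2 j), fun j => a.1 j e)) ?_ ?_ ?_ ?_ ?_
    · simp
    · simp
    · rintro ⟨a, b⟩ -; simp
    · rintro ⟨a, b⟩ -; simp
    · rintro ⟨a, b⟩ -; simp
  calc (Finset.univ.filter P).card * q * Fintype.card (J → β)
      = (Finset.univ.filter P).card * Fintype.card (J → β) * q := by ring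
    _ = ∑ ω : J → E → β, (Finset.univ.filter fun x : J → β =>
        P fun j => Function.update (ω j) e (x j)).card * q := by rw [key, Finset.sum_mul]
    _ ≤ ∑ _ω : J → E → β, Fintype.card (J → β) := Finset.sum_le_sum fun ω _ => h ω
    _ = Fintype.card (J → E → β) * Fintype.card (J → β) := by simp

theorem ncard_mul_le_of_forall_not {α : Type*} {P : α → Prop} (h : ∀ x, ¬ P x) (q n : ℕ) :
    {x | P x}.ncard * q ≤ n := by
  rw [Set.eq_empty_of_forall_notMem (s := {x | P x}) h]
  simp

theorem ncard_le_of_column {J E β : Type*} [Finite J] [Finite E] [Finite β] (e : E)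
    (P : (J → E → β) → Prop) (q : ℕ)
    (h : ∀ ω : J → E → β, {x : J → β | P fun j => Function.update (ω j) e (x j)}.ncard * q ≤
      Nat.card (J → β)) :
    {ω | P ω}.ncard * q ≤ Nat.card (J → E → β) := by
  have := Fintype.ofFinite J
  have := Fintype.ofFinite E
  have := Fintype.ofFinite β
  have key := card_filter_le_of_column_aux e P q fun ω => by
    have := h ω
    rwa [Set.ncard_eq_toFinset_card', Set.toFinset_ofPred, Nat.card_eq_fintype_card] at this
  rwa [Set.ncard_eq_toFinset_card', Set.toFinset_ofPred, Nat.card_eq_fintype_card]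

/-- The packet formed on edge `e` as a function of the local coding coefficients of `e`. -/
def Network.columnMap (net : Network V E) (loc : I → V) (γ : I → W) (c : E → W) (e : E) :
    (I ⊕ E → K) →ₗ[K] W where
  toFun x := (∑ h : I, if loc h = net.tail e then x (Sum.inl h) • γ h else 0) +
    ∑ e' : E, if net.head e' = net.tail e then x (Sum.inr e') • c e' else 0
  map_add' x y := by
    simp only [Pi.add_apply, add_smul]
    rw [add_add_add_comm, ← Finset.sum_add_distrib, ← Finset.sum_add_distrib]
    congr 1 <;> refine Finset.sum_congr rfl fun _ _ => ?_ <;> split_ifs <;> simp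
  map_smul' a x := by
    simp only [Pi.smul_apply, smul_assoc, RingHom.id_apply, smul_add, Finset.smul_sum]
    congr 1 <;> refine Finset.sum_congr rfl fun _ _ => ?_ <;> split_ifs <;> simp

/-- Fix the coefficients of all edges but `e`. Then the packets on `D`, their sufficiency and the
subspace to be avoided are fixed too. The bad columns lie in the preimage of that subspace under
`columnMap`, which is a subspace over `K` although the packets live over the larger field. -/
theorem Network.card_sufficient_not_insert (net : Network V E) (loc : I → V) (γ : I → W) (t : V)
    {D : Finset E} (hclosed : ∀ e ∈ D, ∀ e', net.head e' = net.tail e → e' ∈ D) {e : E}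
    (he : e ∉ D) (hpred : ∀ e', net.head e' = net.tail e → e' ∈ D) :
    {ω : I ⊕ E → E → K | net.Sufficient 𝕜 loc γ t (net.flow loc ω γ 0) D ∧
      ¬ net.Sufficient 𝕜 loc γ t (net.flow loc ω γ 0) (insert e D)}.ncard * Nat.card K ≤
      Nat.card (I ⊕ E → E → K) := by
  refine ncard_le_of_column e _ _ fun ω => ?_
  set c := net.flow loc ω γ 0 with hc
  have hagree : ∀ x : I ⊕ E → K, ∀ e' ∈ D,
      net.flow loc (fun j => Function.update (ω j) e (x j)) γ 0 e' = c e' := by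
    intro x e' he'
    refine net.flow_congr loc γ 0 D hclosed ?_ e' he'
    intro j e'' he''
    rw [Function.update_of_ne]
    rintro rfl; exact he he''
  by_cases hs : net.Sufficient 𝕜 loc γ t c D
  swap
  · refine ncard_mul_le_of_forall_not (fun x hx => ?_) _ _
    refine hs fun A hA => ?_
    rw [← net.avail_congr loc γ (hagree x)]
    exact hx.1 A hA
  rcases net.exists_avoid loc γ t hs he hpred with hgood | ⟨H, hgen, hgood⟩
  · refine ncard_mul_le_of_forall_not (fun x hx => ?_) _ _
    exact hx.2 (hgood _ (hagree x))
  let f : (I ⊕ E → K) →ₗ[K] W := net.columnMap loc γ c e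
  have hf : ∀ x, net.flow loc (fun j => Function.update (ω j) e (x j)) γ 0 e = f x := by
    intro x
    rw [net.flow_eq]
    simp only [Function.update_self, Pi.zero_apply, add_zero, f, Network.columnMap,
      LinearMap.coe_mk, AddHom.coe_mk]
    congr 1
    refine Finset.sum_congr rfl fun e' _ => ?_
    split_ifs with h
    · rw [hagree x e' (hpred e' h)]
    · rfl
  let S : Submodule K (I ⊕ E → K) := (H.restrictScalars K).comap f
  -- Unit columns forward each packet available at the tail, and one of these packets is outside
  -- `H`.
  have hS : S ≠ ⊤ := by
    intro htop
    have hall : ∀ x, f x ∈ H := fun x => by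
      have : x ∈ S := htop ▸ Submodule.mem_top
      exact this
    rcases hgen with ⟨h, hh, hn⟩ | ⟨e', he', hn⟩
    · apply hn
      have := hall (Pi.single (Sum.inl h) 1)
      have h1 : f (Pi.single (Sum.inl h) 1) = γ h := by
        simp only [f, Network.columnMap, LinearMap.coe_mk, AddHom.coe_mk]
        rw [Finset.sum_eq_single h, Finset.sum_eq_zero]
        · simp [hh]
        · intro e' _; simp
        · intro b _ hb; simp [hb]
        · simp
      rwa [h1] at this
    · apply hn
      have := hall (Pi.single (Sum.inr e') 1)
      have h1 : f (Pi.single (Sum.inr e') 1) = c e' := by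
        simp only [f, Network.columnMap, LinearMap.coe_mk, AddHom.coe_mk]
        rw [Finset.sum_eq_zero, Finset.sum_eq_single e']
        · simp [he']
        · intro b _ hb; simp [hb]
        · simp
        · intro h _; simp
      rwa [h1] at this
  refine le_trans (Nat.mul_le_mul_right _ ?_) (card_submodule_mul_le S hS)
  rw [← SetLike.coe_sort_coe, Nat.card_coe_set_eq]
  refine Set.ncard_le_ncard (fun x hx => ?_) (Set.toFinite _)
  by_contra hxS
  refine hx.2 (hgood _ (hagree x) ?_)
  rw [hf]
  exact hxS

/-- Processing the edges one by one, each step loses sufficiency for at most a fraction `1 / |K|`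
of the local coding coefficients. -/
theorem Network.card_not_sufficient (net : Network V E) (loc : I → V) (γ : I → W) (t : V)
    (h0 : ∀ c : E → W, net.Sufficient 𝕜 loc γ t c ∅) (m : ℕ) (hm : m ≤ Fintype.card E) :
    ∃ D : Finset E, D.card = m ∧ (∀ e ∈ D, ∀ e', net.head e' = net.tail e → e' ∈ D) ∧
      {ω : I ⊕ E → E → K |
        ¬ net.Sufficient 𝕜 loc γ t (net.flow loc ω γ 0) D}.ncard * Nat.card K ≤
      m * Nat.card (I ⊕ E → E → K) := by
  induction m with
  | zero => exact ⟨∅, by simp [h0]⟩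
  | succ m ih =>
    obtain ⟨D, hcard, hclosed, hD⟩ := ih (by omega)
    have hne : ∃ e, e ∉ D := by
      by_contra! h
      have : D = Finset.univ := Finset.eq_univ_iff_forall.2 h
      rw [this, Finset.card_univ] at hcard
      omega
    -- A minimal unprocessed edge has all its predecessors processed, so this runs through a
    -- topological order.
    let e := net.wf.min {e | e ∉ D} hne
    have he : e ∉ D := net.wf.min_mem {e | e ∉ D} hne
    have hpred : ∀ e', net.head e' = net.tail e → e' ∈ D := by
      intro e' he'
      by_contra h
      exact net.wf.not_lt_min {e | e ∉ D} h he'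
    refine ⟨insert e D, by rw [Finset.card_insert_of_notMem he, hcard], ?_, ?_⟩
    · intro x hx e' he'
      rcases Finset.mem_insert.1 hx with rfl | hx
      · exact Finset.mem_insert_of_mem (hpred e' he')
      · exact Finset.mem_insert_of_mem (hclosed x hx e' he')
    have hstep := net.card_sufficient_not_insert (K := K) loc γ t hclosed he hpred (𝕜 := 𝕜)
    have hsub : {ω : I ⊕ E → E → K |
        ¬ net.Sufficient 𝕜 loc γ t (net.flow loc ω γ 0) (insert e D)} ⊆
        {ω | ¬ net.Sufficient 𝕜 loc γ t (net.flow loc ω γ 0) D} ∪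
        {ω | net.Sufficient 𝕜 loc γ t (net.flow loc ω γ 0) D ∧
          ¬ net.Sufficient 𝕜 loc γ t (net.flow loc ω γ 0) (insert e D)} := by
      intro ω hω
      by_cases h : net.Sufficient 𝕜 loc γ t (net.flow loc ω γ 0) D
      · exact Or.inr ⟨h, hω⟩
      · exact Or.inl h
    refine (Nat.mul_le_mul_right _ ((Set.ncard_le_ncard hsub (Set.toFinite _)).trans
      (Set.ncard_union_le _ _))).trans ?_
    rw [add_mul, add_mul, one_mul]
    exact add_le_add hD hstep

/-- If no cut is smaller than the dimension demands, the packets that arrive at `t` span the whole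
space, except for a fraction `|E| / |K|` of the local coding coefficients. -/
theorem Network.card_span_ne_top (net : Network V E) (loc : I → V) (γ : I → W) (t : V)
    (ht : ∀ h, loc h ≠ t)
    (hcut : ∀ A : Set V, t ∈ A → Module.finrank 𝕜 W ≤
      Module.finrank 𝕜 (Submodule.span 𝕜 (γ '' {h | loc h ∈ A})) +
        {e | net.tail e ∉ A ∧ net.head e ∈ A}.ncard) :
    {ω : I ⊕ E → E → K |
      Submodule.span 𝕜 (net.flow loc ω γ 0 '' {e | net.head e = t}) ≠ ⊤}.ncard * Nat.card K ≤
      Fintype.card E * Nat.card (I ⊕ E → E → K) := by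
  -- Before any edge is processed, sufficiency is the cut condition and the packets on edges play no
  -- role.
  have h0 : ∀ c : E → W, net.Sufficient 𝕜 loc γ t c ∅ := by
    intro c A hA
    have := hcut A hA
    have he : {e | e ∈ (∅ : Finset E) ∧ net.head e ∈ A} = ∅ := by ext; simp
    rw [avail, he, Set.image_empty, Set.union_empty]
    simp only [entering, Finset.notMem_empty, not_false_eq_true, true_and]
    rwa [Set.ncard_eq_toFinset_card', Set.toFinset_ofPred] at this
  obtain ⟨D, hcard, -, hD⟩ := net.card_not_sufficient (K := K) loc γ t h0 (Fintype.card E) le_rfl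
  have hDu : D = Finset.univ := (Finset.card_eq_iff_eq_univ D).1 hcard
  refine le_trans (Nat.mul_le_mul_right _ (Set.ncard_le_ncard ?_ (Set.toFinite _))) hD
  intro ω hω hs
  apply hω
  -- Now no edge is left to enter `{t}`, and no source packet is there. Sufficiency of this set says
  -- that the packets received at `t` span.
  have h1 := hs {t} rfl
  have h2 : net.entering D {t} = ∅ := by rw [hDu]; simp [entering]
  have h3 : net.avail 𝕜 loc γ (net.flow loc ω γ 0) D {t} =
      Submodule.span 𝕜 (net.flow loc ω γ 0 '' {e | net.head e = t}) := by
    rw [avail, hDu]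
    congr 1
    have : {h | loc h ∈ ({t} : Set V)} = ∅ := by
      ext h; simp [ht h]
    rw [this]; simp
  rw [h2, h3, Finset.card_empty, add_zero] at h1
  exact Submodule.eq_top_of_finrank_eq (le_antisymm (Submodule.finrank_le _) h1)

end Count

end NetCode
end

noncomputable section
open scoped Classical
namespace NetCode

/-! ### The product basis of the tower -/

/-- The tower law for independence, by induction on the height: the products of the lower steps are
independent over `K` and lie in the field over which the last step is independent. -/
theorem linearIndependent_tower_prod {K L : Type*} [Field K] [Field L] [Algebra K L] :
    ∀ (s : ℕ) (n : Fin s → ℕ) (F : Fin (s + 1) → IntermediateField K L), Monotone F →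
      ∀ α : ∀ i, Fin (n i) → L, (∀ i j, α i j ∈ F i.succ) →
      (∀ i : Fin s, LinearIndependent (F i.castSucc) (α i)) →
      LinearIndependent K fun d : ∀ i, Fin (n i) => ∏ i, α i (d i) := by
  intro s
  induction s with
  | zero =>
    intro n F _ α _ _
    have := LinearIndependent.of_subsingleton (R := K) (v := fun d : ∀ i, Fin (n i) =>
      ∏ i, α i (d i)) (fun i => i.elim0) (by simp)
    exact this
  | succ s ih =>
    intro n F hF α hmem hind
    let E := F (Fin.last s).castSucc
    have h1 := ih (fun i => n i.castSucc) (fun i => F i.castSucc)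
      (fun a b h => hF (Fin.castSucc_le_castSucc_iff.2 h)) (fun i => α i.castSucc)
      (fun i j => hmem i.castSucc j) (fun i => hind i.castSucc)
    have hE : ∀ d : ∀ i : Fin s, Fin (n i.castSucc), ∏ i, α i.castSucc (d i) ∈ E := by
      intro d
      refine prod_mem fun i _ => hF ?_ (hmem i.castSucc (d i))
      rw [Fin.le_def]
      simp only [Fin.val_succ, Fin.val_castSucc, Fin.val_last]
      omega
    have h2 : LinearIndependent K fun d : ∀ i : Fin s, Fin (n i.castSucc) =>
        (⟨∏ i, α i.castSucc (d i), hE d⟩ : E) :=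
      LinearIndependent.of_comp E.val.toLinearMap h1
    have h3 := linearIndependent_smul h2 (hind (Fin.last s))
    have h4 := h3.comp (fun d : ∀ i : Fin (s + 1), Fin (n i) =>
      ((fun i => d i.castSucc, d (Fin.last s)) :
        (∀ i : Fin s, Fin (n i.castSucc)) × Fin (n (Fin.last s)))) ?_
    · convert h4 using 2 with d
      rw [Fin.prod_univ_castSucc]
      rfl
    · intro d d' h
      simp only [Prod.mk.injEq] at h
      funext i
      refine Fin.lastCases h.2 (fun i => congrFun h.1 i) i

namespace TowerCode

section General

variable {K L : Type*} [Field K] [Field L] [Algebra K L] {s : ℕ} {n : Fin s → ℕ}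
  (C : TowerCode K L n)

/-- Products of the basis elements of the steps of the tower. -/
def prodElt (d : ∀ i, Fin (n i)) : L := ∏ i, C.α i (d i)

theorem linearIndependent_prodElt : LinearIndependent K C.prodElt :=
  linearIndependent_tower_prod s n C.F C.mono C.α C.α_mem C.α_indep

/-- The product of the lengths is the degree of a finite extension, so no factor is zero. -/
theorem len_pos (C : TowerCode K L n) [FiniteDimensional K L] (i : Fin s) : 0 < n i := by
  have h : 0 < Module.finrank K L := Module.finrank_pos
  rw [C.finrank_top] at h
  exact Nat.pos_of_ne_zero fun h0 => by
    rw [Finset.prod_eq_zero (Finset.mem_univ i) h0] at h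
    exact lt_irrefl _ h

theorem prod_len_pos (C : TowerCode K L n) [FiniteDimensional K L] : 0 < ∏ i, n i :=
  Finset.prod_pos fun i _ => C.len_pos i

/-- The element of the top field with the given coordinates. -/
def elt (v : (∀ i, Fin (n i)) → K) : L := ∑ d, v d • C.prodElt d

/-- Products of basis elements of the lower steps of the tower. -/
def lowElt (i : Fin s) (lo : ∀ j : {j : Fin s // j ≤ i}, Fin (n j)) : L :=
  ∏ j : {j : Fin s // j ≤ i}, C.α j.1 (lo j)

/-- Products of basis elements of the higher steps of the tower. -/
def highElt (i : Fin s) (hi : ∀ j : {j : Fin s // ¬ j ≤ i}, Fin (n j)) : L :=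
  ∏ j : {j : Fin s // ¬ j ≤ i}, C.α j.1 (hi j)

theorem prodElt_split (i : Fin s) (lo : ∀ j : {j : Fin s // j ≤ i}, Fin (n j))
    (hi : ∀ j : {j : Fin s // ¬ j ≤ i}, Fin (n j)) :
    C.prodElt ((Equiv.piEquivPiSubtypeProd (fun j : Fin s => j ≤ i) (fun j => Fin (n j))).symm
      (lo, hi)) = C.lowElt i lo * C.highElt i hi := by
  rw [prodElt, lowElt, highElt, ← Fintype.prod_subtype_mul_prod_subtype (fun j => j ≤ i)]
  congr 1 <;> refine Finset.prod_congr rfl fun j _ => ?_ <;>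
    rw [Equiv.piEquivPiSubtypeProd_symm_apply]
  · rw [dif_pos j.2]
  · rw [dif_neg j.2]

/-- Regrouping the product basis: folding takes care of the lower steps, and the higher steps are
expanded afterwards. Hence all stages can be analysed in the top field, one symbol per payload
block, whatever the field of the source is. -/
theorem elt_row {k : ℕ} {ρ : Type*} (i : Fin s) (A : Matrix ρ (Payload n k) K) (r : ρ)
    (κ : Fin k) :
    C.elt (fun d => A r (κ, d)) = ∑ hi, C.fold i A r (κ, hi) * C.highElt i hi := by
  rw [elt, ← (Equiv.piEquivPiSubtypeProd (fun j : Fin s => j ≤ i)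
    (fun j => Fin (n j))).symm.sum_comp, Fintype.sum_prod_type, Finset.sum_comm]
  refine Finset.sum_congr rfl fun hi _ => ?_
  simp only [fold, Matrix.of_apply, Finset.sum_mul]
  refine Finset.sum_congr rfl fun lo _ => ?_
  rw [prodElt_split, smul_mul_assoc]
  rfl

/-- Complete each low product by the same high product. The results belong to the product basis, and
multiplication by a fixed element is linear, so a relation among the low products would carry over.
-/
theorem linearIndependent_lowElt [FiniteDimensional K L] (i : Fin s) :
    LinearIndependent K (C.lowElt i) := by
  let hi : ∀ j : {j : Fin s // ¬ j ≤ i}, Fin (n j) := fun j => ⟨0, C.len_pos j⟩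
  have h := C.linearIndependent_prodElt.comp
    (fun lo => (Equiv.piEquivPiSubtypeProd (fun j : Fin s => j ≤ i)
      (fun j => Fin (n j))).symm (lo, hi))
    (fun a b hab => by simpa using hab)
  have h2 : C.prodElt ∘ (fun lo => (Equiv.piEquivPiSubtypeProd (fun j : Fin s => j ≤ i)
      (fun j => Fin (n j))).symm (lo, hi)) =
      LinearMap.mulRight K (C.highElt i hi) ∘ C.lowElt i := by
    funext lo
    simp [prodElt_split]
  rw [h2] at h
  exact LinearIndependent.of_comp _ h

theorem lowElt_mem (i : Fin s) (lo : ∀ j : {j : Fin s // j ≤ i}, Fin (n j)) :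
    C.lowElt i lo ∈ C.F i.succ :=
  (C.F i.succ).prod_mem fun j _ => C.mono (Fin.succ_le_succ_iff.2 j.2) (C.α_mem j.1 (lo j))

/-- There are as many low products as the degree of `F i.succ` over `K`, so being independent they
form a basis of it. -/
theorem exists_low_coords [FiniteDimensional K L] (i : Fin s) {x : L} (hx : x ∈ C.F i.succ) :
    ∃ v : (∀ j : {j : Fin s // j ≤ i}, Fin (n j)) → K, ∑ lo, v lo • C.lowElt i lo = x := by
  let b : (∀ j : {j : Fin s // j ≤ i}, Fin (n j)) → C.F i.succ :=
    fun lo => ⟨C.lowElt i lo, C.lowElt_mem i lo⟩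
  have hb : LinearIndependent K b :=
    LinearIndependent.of_comp (C.F i.succ).val.toLinearMap (C.linearIndependent_lowElt i)
  have hcard : Fintype.card (∀ j : {j : Fin s // j ≤ i}, Fin (n j)) =
      Module.finrank K (C.F i.succ) := by
    rw [C.finrank_F, Fintype.card_pi]
    simp only [Fintype.card_fin]
    rw [Finset.prod_subtype (Finset.univ.filter fun j : Fin s => j.castSucc < i.succ)
      (p := fun j => j ≤ i)]
    intro j
    rw [Finset.mem_filter, Fin.castSucc_lt_succ_iff]
    exact and_iff_right (Finset.mem_univ _)
  have : Nonempty (∀ j : {j : Fin s // j ≤ i}, Fin (n j)) := ⟨fun j => ⟨0, C.len_pos j⟩⟩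
  let B := basisOfLinearIndependentOfCardEqFinrank hb hcard
  refine ⟨B.repr ⟨x, hx⟩, ?_⟩
  have h := congrArg (C.F i.succ).val (B.sum_repr ⟨x, hx⟩)
  rw [map_sum] at h
  simpa [B, b] using h

/-- Unfolding is only a chosen preimage. It is meaningful because folding is onto the matrices with
entries in `F i.succ`, the rows being coordinates over the low products. -/
theorem fold_unfold [FiniteDimensional K L] {k : ℕ} {ρ : Type*} (i : Fin s)
    (M : Matrix ρ (Fin k × (∀ j : {j : Fin s // ¬ j ≤ i}, Fin (n j))) L)
    (hM : ∀ r c, M r c ∈ C.F i.succ) : C.fold i (C.unfold i M) = M := by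
  refine Function.invFun_eq (f := C.fold i) ?_
  choose v hv using fun r c => C.exists_low_coords i (hM r c)
  let e := Equiv.piEquivPiSubtypeProd (fun j : Fin s => j ≤ i) (fun j => Fin (n j))
  refine ⟨Matrix.of fun r c => v r (c.1, (e c.2).2) (e c.2).1, ?_⟩
  ext r c
  rw [← hv r c]
  simp only [fold, Matrix.of_apply]
  refine Finset.sum_congr rfl fun lo _ => ?_
  rw [Equiv.apply_symm_apply]
  rfl

theorem fold_mem {k : ℕ} {ρ : Type*} (i : Fin s) (A : Matrix ρ (Payload n k) K) (r c) :
    C.fold i A r c ∈ C.F i.succ := by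
  simp only [fold, Matrix.of_apply]
  exact (C.F i.succ).sum_mem fun lo _ => (C.F i.succ).toSubalgebra.smul_mem (C.lowElt_mem i lo) _

theorem g_mem_of_lt {i j : Fin s} (h : j < i) (l) : C.g j l ∈ C.F i.castSucc :=
  C.mono (Fin.succ_le_castSucc_iff.2 h) (C.g_mem j l)

end General

/-! ### Frobenius powers, codewords and coordinates in the product basis -/

section Message

variable {K L : Type*} [Field K] [Fintype K] [Field L] [Algebra K L] {s : ℕ}
  {R : Fin s → ℕ} {z : ℕ} (C : TowerCode K L (len R z))

/-- The size of the field over which the Gabidulin code of source `i` is linear. -/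
def q (_C : TowerCode K L (len R z)) (i : Fin s) : ℕ := Fintype.card K ^ (∏ l : Fin s with l < i,
    len R z l)

theorem gen_apply (i : Fin s) (j r) : C.gen i j r = C.g i j ^ (C.q i ^ (r : ℕ)) := rfl

/-- The power map that generates the Galois group over `F i`. -/
def frob (_C : TowerCode K L (len R z)) (i : Fin s) : L →ₐ[K] L :=
  FiniteField.frobeniusAlgHom K L ^ (∏ l : Fin s with l < i, len R z l)

theorem frobeniusAlgHom_pow_apply (m : ℕ) (x : L) :
    (FiniteField.frobeniusAlgHom K L ^ m) x = x ^ (Fintype.card K ^ m) := by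
  induction m generalizing x with
  | zero => simp
  | succ m ih =>
    rw [pow_succ, AlgHom.mul_apply, ih, FiniteField.coe_frobeniusAlgHom]
    change (x ^ _) ^ _ = _
    rw [← pow_mul, pow_succ, mul_comm]

theorem frob_pow_apply (i : Fin s) (m : ℕ) (x : L) : (C.frob i ^ m) x = x ^ (C.q i ^ m) := by
  rw [frob, ← pow_mul, frobeniusAlgHom_pow_apply, q, pow_mul]

theorem gen_mem (i : Fin s) (j r) : C.gen i j r ∈ C.F i.succ :=
  pow_mem (C.g_mem i j) _

/-- In the top field, the payload of a message is the Gabidulin codeword of the information. -/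
theorem elt_message [FiniteDimensional K L] {k : ℕ} (i : Fin s)
    (X : Matrix (Fin (R i)) (Payload (len R z) k) K) (j : Fin (len R z i)) (κ : Fin k) :
    C.elt (fun d => C.message i X j (Sum.inr (κ, d))) =
      ∑ r, C.gen i j r * C.elt (fun d => X r (κ, d)) := by
  -- Codeword entries stay in the field of the source, without which unfolding and folding again
  -- would not return them.
  have hm : ∀ r c, (C.gen i * C.fold i X) r c ∈ C.F i.succ := by
    intro r c
    rw [Matrix.mul_apply]
    exact (C.F i.succ).sum_mem fun x _ => mul_mem (C.gen_mem i r x) (C.fold_mem i X x c)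
  have h1 : C.elt (fun d => C.message i X j (Sum.inr (κ, d))) =
      C.elt (fun d => C.unfold i (C.gen i * C.fold i X) j (κ, d)) := rfl
  rw [h1, C.elt_row i, C.fold_unfold i _ hm]
  simp only [C.elt_row i X, Matrix.mul_apply, Finset.sum_mul, Finset.mul_sum]
  rw [Finset.sum_comm]
  simp only [mul_assoc]

variable [FiniteDimensional K L]

theorem linearIndependent_prodBasis : LinearIndependent K C.prodBasis :=
  C.linearIndependent_prodElt.comp _ finPiFinEquiv.symm.injective

/-- The product basis as a basis. -/
def basis : Module.Basis (Fin (∏ i, len R z i)) K L :=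
  have : Nonempty (Fin (∏ i, len R z i)) := ⟨⟨0, C.prod_len_pos⟩⟩
  basisOfLinearIndependentOfCardEqFinrank C.linearIndependent_prodBasis
    (by rw [Fintype.card_fin, C.finrank_top])

theorem basis_apply (c) : C.basis c = C.prodBasis c := by
  have : Nonempty (Fin (∏ i, len R z i)) := ⟨⟨0, C.prod_len_pos⟩⟩
  rw [basis, coe_basisOfLinearIndependentOfCardEqFinrank]

theorem sum_coords (x : L) : ∑ c, C.coords x c • C.prodBasis c = x := by
  refine Function.invFun_eq (f := fun v : Fin (∏ i, len R z i) → K =>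
    ∑ c, v c • C.prodBasis c) ⟨fun c => C.basis.repr x c, ?_⟩
  have := C.basis.sum_repr x
  simpa only [basis_apply] using this

theorem coords_eq (x : L) (c) : C.coords x c = C.basis.repr x c := by
  conv_rhs => rw [← C.sum_coords x]
  simp only [← basis_apply]
  rw [C.basis.repr_sum_self]

theorem coords_sum_smul (v : Fin (∏ i, len R z i) → K) (c) :
    C.coords (∑ c, v c • C.prodBasis c) c = v c := by
  rw [coords_eq]
  simp only [← basis_apply]
  rw [C.basis.repr_sum_self]

theorem coords_sub (x y : L) (c) : C.coords (x - y) c = C.coords x c - C.coords y c := by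
  simp [coords_eq]

theorem coords_smul (a : K) (x : L) (c) : C.coords (a • x) c = a * C.coords x c := by
  simp [coords_eq]

theorem coords_sum {ι : Type*} (S : Finset ι) (f : ι → L) (c) :
    C.coords (∑ x ∈ S, f x) c = ∑ x ∈ S, C.coords (f x) c := by
  simp [coords_eq, map_sum]

theorem coords_zero (c) : C.coords 0 c = 0 := by
  simp [coords_eq]

theorem coords_ext {x y : L} (h : ∀ c, C.coords x c = C.coords y c) : x = y := by
  rw [← C.sum_coords x, ← C.sum_coords y]
  exact Finset.sum_congr rfl fun c _ => by rw [h]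

theorem coords_prodBasis (a c) : C.coords (C.prodBasis a) c = if c = a then 1 else 0 := by
  rw [coords_eq, ← basis_apply, Module.Basis.repr_self, Finsupp.single_apply]
  simp [eq_comm]

theorem coords_elt (v : (∀ i, Fin (len R z i)) → K) (c) :
    C.coords (C.elt v) c = v (finPiFinEquiv.symm c) := by
  have : C.elt v = ∑ c, v (finPiFinEquiv.symm c) • C.prodBasis c := by
    rw [elt, ← finPiFinEquiv.symm.sum_comp]
    rfl
  rw [this, C.coords_sum_smul fun c => v (finPiFinEquiv.symm c)]

/-- Multiplication through the structure constants, which the description of the code supplies. This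
is how the program multiplies in the top field. -/
theorem coords_mul (x y : L) (c) :
    C.coords (x * y) c = ∑ a, ∑ b, C.coords x a * C.coords y b *
      C.coords (C.prodBasis a * C.prodBasis b) c := by
  conv_lhs => rw [← C.sum_coords x, ← C.sum_coords y, Finset.sum_mul_sum]
  simp only [coords_sum, smul_mul_smul_comm, coords_smul]

/-- Frobenius maps are `K`-linear, so one matrix over `K` per map is enough to apply them. -/
theorem coords_algHom (f : L →ₐ[K] L) (x : L) (c) :
    C.coords (f x) c = ∑ a, C.coords x a * C.coords (f (C.prodBasis a)) c := by
  conv_lhs => rw [← C.sum_coords x, map_sum]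
  simp only [coords_sum, map_smul, coords_smul]

end Message

end TowerCode

end NetCode
end

noncomputable section
open scoped Classical
namespace NetCode

/-! ### Solving homogeneous linear systems -/

section Kernel

variable {K : Type*} [Field K] {U : ℕ}

/-- The last index that satisfies `p`. -/
def lastSat (p : Fin U → Prop) (h : ∃ v, p v) : Fin U :=
  (Finset.univ.filter p).max' (by obtain ⟨v, hv⟩ := h; exact ⟨v, by simp [hv]⟩)

theorem lastSat_spec (p : Fin U → Prop) (h : ∃ v, p v) : p (lastSat p h) :=
  (Finset.mem_filter.1 (Finset.max'_mem (Finset.univ.filter p) _)).2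

/-- A loop that overwrites its result at every hit ends with the last hit, characterized in this
form. -/
theorem lastSat_eq {p : Fin U → Prop} (h : ∃ v, p v) {v : Fin U} (hv : p v)
    (hmax : ∀ v', v < v' → ¬ p v') : lastSat p h = v := by
  by_contra hne
  have h1 : v ≤ lastSat p h := Finset.le_max' _ _ (by simp [hv])
  exact hmax _ (lt_of_le_of_ne h1 (Ne.symm hne)) (lastSat_spec p h)

/-- Apply `f 0, f 1, …` in this order, the first `t` of them. -/
def iterUpTo {α : Type*} {n : ℕ} (f : Fin n → α → α) (x : α) : ℕ → α
  | 0 => x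
  | t + 1 => if h : t < n then f ⟨t, h⟩ (iterUpTo f x t) else iterUpTo f x t

theorem iterUpTo_succ {α : Type*} {n : ℕ} (f : Fin n → α → α) (x : α) (t : Fin n) :
    iterUpTo f x (t + 1) = f t (iterUpTo f x t) := by
  rw [iterUpTo, dif_pos t.2]

/-- One step of elimination: the vectors `V v` are made orthogonal to the row `a`, with the help
of the last one that is not. -/
def elimStep (a : Fin U → K) (V : Fin U → Fin U → K) : Fin U → Fin U → K :=
  if h : ∃ v, ∑ u, a u * V v u ≠ 0 then fun v u =>
    V v u - (∑ u, a u * V v u) * (∑ u, a u * V (lastSat _ h) u)⁻¹ * V (lastSat _ h) u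
  else V

/-- Generators of the solution space of a homogeneous system with `n₁ * n₂` equations. -/
def kernelOf {n₁ n₂ : ℕ} (a : Fin n₁ → Fin n₂ → Fin U → K) : Fin U → Fin U → K :=
  iterUpTo (fun i V => iterUpTo (fun j V => elimStep (a i j) V) V n₂)
    (fun v u => if u = v then 1 else 0) n₁

/-- The last vector that does not vanish on `J`. -/
def selectFrom (J : Fin U → Prop) (V : Fin U → Fin U → K) : Fin U → K :=
  if h : ∃ v, ∃ u, J u ∧ V v u ≠ 0 then V (lastSat _ h) else 0

/-- The vectors `V v` generate the space of the vectors orthogonal to all rows in `P`. -/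
def GeneratesKernel (P : Set (Fin U → K)) (V : Fin U → Fin U → K) : Prop :=
  (∀ a ∈ P, ∀ v, ∑ u, a u * V v u = 0) ∧
    ∀ w : Fin U → K, (∀ a ∈ P, ∑ u, a u * w u = 0) → ∃ c : Fin U → K, ∀ u, w u = ∑ v, c v * V v u

theorem sum_mul_sum_comm {a w : Fin U → K} {c : Fin U → K} {V : Fin U → Fin U → K}
    (h : ∀ u, w u = ∑ v, c v * V v u) :
    ∑ u, a u * w u = ∑ v, c v * ∑ u, a u * V v u := by
  simp only [h, Finset.mul_sum]
  rw [Finset.sum_comm]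
  exact Finset.sum_congr rfl fun _ _ => Finset.sum_congr rfl fun _ _ => by ring

/-- If `w` is generated with coefficients `c` and is orthogonal to `a`, then the sum of the `c v`
times the products of `a` with `V v` is zero. So the corrections cancel, and the same `c` generates
`w` from the new vectors. The pivot itself becomes zero, so the number of vectors never changes and
nothing has to be reordered. -/
theorem GeneratesKernel.elimStep {P : Set (Fin U → K)} {V : Fin U → Fin U → K}
    (hV : GeneratesKernel P V) (a : Fin U → K) :
    GeneratesKernel (insert a P) (elimStep a V) := by
  unfold NetCode.elimStep
  split_ifs with h
  · set p := lastSat _ h with hp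
    have hpne : ∑ u, a u * V p u ≠ 0 := lastSat_spec _ h
    have hrow : ∀ (b : Fin U → K) v, ∑ u, b u *
        (V v u - (∑ u, a u * V v u) * (∑ u, a u * V p u)⁻¹ * V p u) =
        (∑ u, b u * V v u) - (∑ u, a u * V v u) * (∑ u, a u * V p u)⁻¹ * ∑ u, b u * V p u := by
      intro b v
      rw [Finset.mul_sum _ _ ((∑ u, a u * V v u) * (∑ u, a u * V p u)⁻¹), ← Finset.sum_sub_distrib]
      exact Finset.sum_congr rfl fun _ _ => by ring
    refine ⟨?_, ?_⟩
    · rintro b (rfl | hb) v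
      · rw [hrow, mul_assoc, inv_mul_cancel₀ hpne, mul_one, sub_self]
      · rw [hrow, hV.1 b hb, hV.1 b hb, mul_zero, sub_zero]
    · intro w hw
      obtain ⟨c, hc⟩ := hV.2 w fun b hb => hw b (Or.inr hb)
      refine ⟨c, fun u => ?_⟩
      have h0 := hw a (Or.inl rfl)
      rw [sum_mul_sum_comm hc] at h0
      have h2 : ∑ v, c v * (V v u - (∑ u, a u * V v u) * (∑ u, a u * V p u)⁻¹ * V p u) =
          ∑ v, c v * V v u - (∑ v, c v * ∑ u, a u * V v u) * ((∑ u, a u * V p u)⁻¹ * V p u) := by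
        rw [Finset.sum_mul, ← Finset.sum_sub_distrib]
        exact Finset.sum_congr rfl fun _ _ => by ring
      rw [h2, h0, zero_mul, sub_zero, hc u]
  · push Not at h
    refine ⟨?_, fun w hw => hV.2 w fun b hb => hw b (Or.inr hb)⟩
    rintro b (rfl | hb) v
    · exact h v
    · exact hV.1 b hb v

/-- The unit vectors generate the solutions of the empty system, and each elimination step adds one
row. The two nested inductions follow the two loops of the program: rows over the top field, then
their coordinates. -/
theorem generatesKernel_kernelOf {n₁ n₂ : ℕ} (a : Fin n₁ → Fin n₂ → Fin U → K) :
    GeneratesKernel {r | ∃ i j, r = a i j} (kernelOf a) := by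
  have hin : ∀ (P : Set (Fin U → K)) V (i : Fin n₁), GeneratesKernel P V → ∀ t ≤ n₂,
      GeneratesKernel (P ∪ {r | ∃ j : Fin n₂, j.val < t ∧ r = a i j})
        (iterUpTo (fun j V => NetCode.elimStep (a i j) V) V t) := by
    intro P V i hV t
    induction t with
    | zero => intro _; simpa [iterUpTo] using hV
    | succ t ih =>
      intro ht
      have h1 := (ih (by omega)).elimStep (a i ⟨t, ht⟩)
      rw [iterUpTo, dif_pos (show t < n₂ from ht)]
      convert h1 using 1
      ext r
      simp only [Set.mem_union, Set.mem_ofPred_eq, Set.mem_insert_iff]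
      constructor
      · rintro (h | ⟨j, hj, rfl⟩)
        · exact Or.inr (Or.inl h)
        · rcases Nat.lt_succ_iff_lt_or_eq.1 hj with hj | hj
          · exact Or.inr (Or.inr ⟨j, hj, rfl⟩)
          · left; congr 1; exact Fin.ext hj
      · rintro (rfl | h | ⟨j, hj, rfl⟩)
        · exact Or.inr ⟨⟨t, ht⟩, Nat.lt_succ_self t, rfl⟩
        · exact Or.inl h
        · exact Or.inr ⟨j, hj.trans (Nat.lt_succ_self t), rfl⟩
  have hout : ∀ t ≤ n₁, GeneratesKernel {r | ∃ i : Fin n₁, i.val < t ∧ ∃ j, r = a i j}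
      (iterUpTo (fun i V => iterUpTo (fun j V => NetCode.elimStep (a i j) V) V n₂)
        (fun v u => if u = v then 1 else 0) t) := by
    intro t
    induction t with
    | zero =>
      intro _
      refine ⟨by rintro b ⟨i, hi, -⟩; exact absurd hi (Nat.not_lt_zero _), fun w _ => ⟨w,
          fun u => ?_⟩⟩
      simp [iterUpTo]
    | succ t ih =>
      intro ht
      have h1 := hin _ _ ⟨t, ht⟩ (ih (by omega)) n₂ le_rfl
      rw [iterUpTo, dif_pos (show t < n₁ from ht)]
      convert h1 using 1
      ext r
      simp only [Set.mem_union, Set.mem_ofPred_eq]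
      constructor
      · rintro ⟨i, hi, j, rfl⟩
        rcases Nat.lt_succ_iff_lt_or_eq.1 hi with hi | hi
        · exact Or.inl ⟨i, hi, j, rfl⟩
        · exact Or.inr ⟨j, j.2, by congr 1; exact Fin.ext hi⟩
      · rintro (⟨i, hi, j, rfl⟩ | ⟨j, hj, rfl⟩)
        · exact ⟨i, hi.trans (Nat.lt_succ_self t), j, rfl⟩
        · exact ⟨⟨t, ht⟩, Nat.lt_succ_self t, j, rfl⟩
  convert hout n₁ le_rfl using 1
  swap
  · rfl
  ext r
  exact ⟨fun ⟨i, j, h⟩ => ⟨i, i.2, j, h⟩, fun ⟨i, _, j, h⟩ => ⟨i, j, h⟩⟩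

/-- If all generators vanished on `J`, so would every solution, among them `w`. One witness is thus
enough to know that the scan succeeds. -/
theorem selectFrom_spec {P : Set (Fin U → K)} {V : Fin U → Fin U → K} (hV : GeneratesKernel P V)
    (J : Fin U → Prop) {w : Fin U → K} (hw : ∀ a ∈ P, ∑ u, a u * w u = 0) {u : Fin U} (hu : J u)
    (hwu : w u ≠ 0) :
    (∀ a ∈ P, ∑ u, a u * selectFrom J V u = 0) ∧ ∃ u, J u ∧ selectFrom J V u ≠ 0 := by
  have h : ∃ v, ∃ u, J u ∧ V v u ≠ 0 := by
    by_contra! h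
    obtain ⟨c, hc⟩ := hV.2 w hw
    apply hwu
    rw [hc u]
    exact Finset.sum_eq_zero fun v _ => by rw [h v u hu, mul_zero]
  rw [selectFrom, dif_pos h]
  exact ⟨fun a ha => hV.1 a ha _, lastSat_spec _ h⟩

end Kernel

namespace TowerCode

variable {K L : Type*} [Field K] [Fintype K] [Field L] [Algebra K L] {s : ℕ}
  {R : Fin s → ℕ} {z : ℕ} (C : TowerCode K L (len R z))

/-! ### The stage decoder -/

section Unknowns

/-- The number of the slots of a group of unknowns. -/
def width (_C : TowerCode K L (len R z)) : ℕ := (∑ i, len R z i) + 1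

/-- The number of unknowns over the base field: `s + 1` groups of slots for elements of the top
field. -/
abbrev unknowns : ℕ := (s + 1) * C.width * ∏ i, len R z i

/-- The unknown in slot `m` of group `j`. -/
def block (v : Fin C.unknowns → K) (j m : ℕ) : L :=
  ∑ c : Fin (∏ i, len R z i),
    (if h : (j * C.width + m) * (∏ i, len R z i) + c < C.unknowns then v ⟨_, h⟩ else 0) •
      C.prodBasis c

/-- The base field coordinate of slot 0 of the last group. -/
def scale (v : Fin C.unknowns → K) : K :=
  if h : s * C.width * (∏ i, len R z i) < C.unknowns then v ⟨_, h⟩ else 0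

/-- Group, slot and coordinate number of an unknown. -/
def slot (u : Fin C.unknowns) : Fin (s + 1) × Fin C.width × Fin (∏ i, len R z i) :=
  let p := finProdFinEquiv.symm u
  ((finProdFinEquiv.symm p.1).1, (finProdFinEquiv.symm p.1).2, p.2)

/-- The coefficients that multiply the unknowns in the key equation of source `i`. -/
def keyCoeff {B : ℕ} (i : Fin s) (y : Fin B → Fin s → L) (w : Fin B → L) (b : Fin B)
    (j m : ℕ) : L :=
  if h : j < s then
    if (j < i ∧ m < R ⟨j, h⟩) ∨ (j = i ∧ m < R i + z) then y b ⟨j, h⟩ ^ (C.q ⟨j, h⟩ ^ m) else 0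
  else if m < z + 1 then w b ^ (C.q i ^ m) else 0

/-- The key equation of source `i`, as a system with coefficients in the top field. -/
def keySystem {B : ℕ} (i : Fin s) (y : Fin B → Fin s → L) (w : Fin B → L) (b : Fin B)
    (u : Fin C.unknowns) : L :=
  C.prodBasis (C.slot u).2.2 * C.keyCoeff i y w b (C.slot u).1 (C.slot u).2.1

/-- The equations for the quotient of two linearized polynomials, which the blocks of `v` hold. -/
def quotSystem (i : Fin s) (v : Fin C.unknowns → K) (ρ : Fin (len R z i))
    (u : Fin C.unknowns) : L :=
  if (C.slot u).1.val = 0 then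
    if (C.slot u).2.1.val < R i ∧ (C.slot u).2.1.val ≤ ρ ∧ ρ - (C.slot u).2.1.val < z + 1 then
      C.block v s (ρ - (C.slot u).2.1) *
        C.prodBasis (C.slot u).2.2 ^ (C.q i ^ (ρ - (C.slot u).2.1 : ℕ))
    else 0
  else if u.val = s * C.width * ∏ i, len R z i then
    if ρ.val < R i + z then C.block v i ρ else 0
  else 0

/-- A solution of a system with coefficients in the top field that does not vanish on the `cnt`
unknowns from the start of the last group on. -/
def solve {n : ℕ} (T : Fin n → Fin C.unknowns → L) (cnt : ℕ) : Fin C.unknowns → K :=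
  selectFrom (fun u => s * C.width * (∏ i, len R z i) ≤ u ∧
      u.val < s * C.width * (∏ i, len R z i) + cnt)
    (kernelOf fun b (c : Fin (∏ i, len R z i)) u => C.coords (T b u) c)

/-- The solution of the key equation of source `i`. -/
def keySolution {B : ℕ} (i : Fin s) (y : Fin B → Fin s → L) (w : Fin B → L) :
    Fin C.unknowns → K :=
  C.solve (C.keySystem i y w) ((z + 1) * ∏ i, len R z i)

/-- Decoding of one column of source `i`: `y b j` is the element that packet `b` combines from the
evaluation points of source `j`, and `w b` its payload. -/
def decodeCol {B : ℕ} (i : Fin s) (y : Fin B → Fin s → L) (w : Fin B → L) (r : Fin (R i)) : L :=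
  let v := C.solve (C.quotSystem i (C.keySolution i y w)) 1
  (C.scale v)⁻¹ • C.block v 0 r

variable {C}

theorem keyCoeff_congr {B : ℕ} {i : Fin s} {y y' : Fin B → Fin s → L} (w : Fin B → L)
    (h : ∀ b j, j ≤ i → y b j = y' b j) (b : Fin B) (j m : ℕ) :
    C.keyCoeff i y w b j m = C.keyCoeff i y' w b j m := by
  unfold keyCoeff
  split_ifs with h1 h2
  · rw [h b ⟨j, h1⟩]
    rw [Fin.le_def]
    rcases h2 with h2 | h2
    · exact h2.1.le
    · exact h2.1.le
  · rfl
  · rfl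
  · rfl

/-- The key equation of source `i` involves no later source. Since cancellation changes only header
blocks of later sources, the decoder may use the points of the matrix as received. -/
theorem decodeCol_congr {B : ℕ} {i : Fin s} {y y' : Fin B → Fin s → L} (w : Fin B → L)
    (h : ∀ b j, j ≤ i → y b j = y' b j) : C.decodeCol i y w = C.decodeCol i y' w := by
  have : C.keySystem i y w = C.keySystem i y' w := by
    funext b u
    rw [keySystem, keySystem, keyCoeff_congr w h]
  funext r
  rw [decodeCol, decodeCol, keySolution, keySolution, this]

variable (C)

theorem slot_uix (j : Fin (s + 1)) (m : Fin C.width) (c : Fin (∏ i, len R z i)) :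
    C.slot (finProdFinEquiv (finProdFinEquiv (j, m), c)) = (j, m, c) := by
  simp only [slot, Equiv.symm_apply_apply]

theorem uix_val (j : Fin (s + 1)) (m : Fin C.width) (c : Fin (∏ i, len R z i)) :
    (finProdFinEquiv (finProdFinEquiv (j, m), c)).val =
      (j * C.width + m) * (∏ i, len R z i) + c := by
  simp only [finProdFinEquiv_apply_val]; ring

theorem uix_slot (u : Fin C.unknowns) :
    u.val = ((C.slot u).1 * C.width + (C.slot u).2.1) * (∏ i, len R z i) + (C.slot u).2.2 := by
  rw [← uix_val]
  simp only [slot, Prod.mk.eta, Equiv.apply_symm_apply]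

/-- For a legitimate group and slot, the range test in `block` always succeeds. -/
theorem block_eq (v : Fin C.unknowns → K) (j : Fin (s + 1)) (m : Fin C.width) :
    C.block v j m = ∑ c, v (finProdFinEquiv (finProdFinEquiv (j, m), c)) • C.prodBasis c := by
  unfold block
  refine Finset.sum_congr rfl fun c _ => ?_
  have h : (j * C.width + m) * (∏ i, len R z i) + c < C.unknowns := by
    rw [← uix_val]; exact Fin.is_lt _
  rw [dif_pos h]
  congr 2
  exact Fin.ext (C.uix_val j m c).symm

theorem sum_unknowns {M : Type*} [AddCommMonoid M] (f : Fin C.unknowns → M) :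
    ∑ u, f u = ∑ j, ∑ m, ∑ c, f (finProdFinEquiv (finProdFinEquiv (j, m), c)) := by
  rw [← (finProdFinEquiv (m := (s + 1) * C.width) (n := ∏ i, len R z i)).sum_comp,
    Fintype.sum_prod_type, ← finProdFinEquiv.sum_comp, Fintype.sum_prod_type]

end Unknowns

variable [FiniteDimensional K L]

/-- An equation over the top field with unknowns in `K` is the system of its coordinate equations
over `K`. Exhibiting one solution that is nonzero in the window guarantees that the computed one is
nonzero there as well. -/
theorem solve_spec {n : ℕ} (T : Fin n → Fin C.unknowns → L) (cnt : ℕ) {w : Fin C.unknowns → K}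
    (hw : ∀ b, ∑ u, w u • T b u = 0) {u : Fin C.unknowns}
    (hu : s * C.width * (∏ i, len R z i) ≤ u ∧
      u.val < s * C.width * (∏ i, len R z i) + cnt) (hwu : w u ≠ 0) :
    (∀ b, ∑ u, C.solve T cnt u • T b u = 0) ∧
      ∃ u : Fin C.unknowns, (s * C.width * (∏ i, len R z i) ≤ u ∧
        u.val < s * C.width * (∏ i, len R z i) + cnt) ∧ C.solve T cnt u ≠ 0 := by
  have key : ∀ (v : Fin C.unknowns → K) b c,
      ∑ u, C.coords (T b u) c * v u = C.coords (∑ u, v u • T b u) c := by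
    intro v b c
    rw [coords_sum]
    exact Finset.sum_congr rfl fun u _ => by rw [coords_smul, mul_comm]
  have h := selectFrom_spec (generatesKernel_kernelOf
    fun b (c : Fin (∏ i, len R z i)) u => C.coords (T b u) c)
    (fun u : Fin C.unknowns => s * C.width * (∏ i, len R z i) ≤ u ∧
      u.val < s * C.width * (∏ i, len R z i) + cnt) (w := w) (by
      rintro a ⟨b, c, rfl⟩
      rw [key, hw, coords_zero]) hu hwu
  refine ⟨fun b => C.coords_ext fun c => ?_, h.2⟩
  rw [← key, coords_zero]
  exact h.1 _ ⟨b, c, rfl⟩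

end TowerCode

end NetCode
end

noncomputable section
open scoped Classical
namespace NetCode
namespace TowerCode

variable {K L : Type*} [Field K] [Fintype K] [Field L] [Algebra K L] {s : ℕ}
  {R : Fin s → ℕ} {z : ℕ} (C : TowerCode K L (len R z))

/-! ### Linearized polynomials -/

theorem q_pos (i : Fin s) : 0 < C.q i := pow_pos Fintype.card_pos _

theorem one_lt_q [FiniteDimensional K L] (i : Fin s) : 1 < C.q i :=
  Nat.one_lt_pow (Finset.prod_pos fun l _ => C.len_pos l).ne' Fintype.one_lt_card

theorem natCard_F [FiniteDimensional K L] (i : Fin s) : Nat.card (C.F i.castSucc) = C.q i := by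
  rw [Module.natCard_eq_pow_finrank (K := K), C.finrank_F, Nat.card_eq_fintype_card, q]
  congr 1

/-- The field has `C.q i` elements, so its elements are fixed by the corresponding power map. This
is what makes `linPoly` linear over it. -/
theorem pow_q_of_mem [FiniteDimensional K L] (i : Fin s) {a : L} (ha : a ∈ C.F i.castSucc)
    (m : ℕ) : a ^ (C.q i ^ m) = a := by
  have : Finite (C.F i.castSucc) := Nat.finite_of_card_ne_zero (by
    rw [natCard_F]; exact (C.q_pos i).ne')
  have := Fintype.ofFinite (C.F i.castSucc)
  have h : a ^ C.q i = a := by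
    have h1 := FiniteField.pow_card (⟨a, ha⟩ : C.F i.castSucc)
    rw [← Nat.card_eq_fintype_card, C.natCard_F] at h1
    exact congrArg Subtype.val h1
  induction m with
  | zero => simp
  | succ m ih => rw [pow_succ, pow_mul, ih, h]

theorem add_pow_q (i : Fin s) (m : ℕ) (x y : L) :
    (x + y) ^ (C.q i ^ m) = x ^ (C.q i ^ m) + y ^ (C.q i ^ m) := by
  simp only [← frob_pow_apply, map_add]

theorem sub_pow_q (i : Fin s) (m : ℕ) (x y : L) :
    (x - y) ^ (C.q i ^ m) = x ^ (C.q i ^ m) - y ^ (C.q i ^ m) := by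
  simp only [← frob_pow_apply, map_sub]

theorem smul_pow_q (i : Fin s) (m : ℕ) (a : K) (x : L) :
    (a • x) ^ (C.q i ^ m) = a • x ^ (C.q i ^ m) := by
  simp only [← frob_pow_apply, map_smul]

theorem sum_pow_q {ι : Type*} (S : Finset ι) (f : ι → L) (i : Fin s) (m : ℕ) :
    (∑ x ∈ S, f x) ^ (C.q i ^ m) = ∑ x ∈ S, f x ^ (C.q i ^ m) := by
  simp only [← frob_pow_apply, map_sum]

theorem zero_pow_q (i : Fin s) (m : ℕ) : (0 : L) ^ (C.q i ^ m) = 0 :=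
  zero_pow (pow_pos (C.q_pos i) m).ne'

/-- The linearized polynomial with coefficients `c 0, …, c (M - 1)`. -/
def linPoly [FiniteDimensional K L] (i : Fin s) (c : ℕ → L) (M : ℕ) : L →ₗ[C.F i.castSucc] L where
  toFun x := ∑ m ∈ Finset.range M, c m * x ^ (C.q i ^ m)
  map_add' x y := by
    rw [← Finset.sum_add_distrib]
    exact Finset.sum_congr rfl fun m _ => by rw [add_pow_q, mul_add]
  map_smul' a x := by
    rw [RingHom.id_apply, Finset.smul_sum]
    refine Finset.sum_congr rfl fun m _ => ?_
    rw [Algebra.smul_def, Algebra.smul_def, mul_pow]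
    have : (algebraMap (C.F i.castSucc) L a) ^ (C.q i ^ m) = algebraMap (C.F i.castSucc) L a :=
      C.pow_q_of_mem i a.2 m
    rw [this, mul_left_comm]

variable [FiniteDimensional K L]

theorem linPoly_apply (i : Fin s) (c : ℕ → L) (M : ℕ) (x : L) :
    C.linPoly i c M x = ∑ m ∈ Finset.range M, c m * x ^ (C.q i ^ m) := rfl

theorem linPoly_smul (i : Fin s) (c : ℕ → L) (M : ℕ) (a : K) (x : L) :
    C.linPoly i c M (a • x) = a • C.linPoly i c M x := by
  rw [linPoly_apply, linPoly_apply, Finset.smul_sum]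
  exact Finset.sum_congr rfl fun m _ => by rw [smul_pow_q, mul_smul_comm]

/-- This lets the annihilator of the errors pass through the generator entries of earlier sources,
so that interference stays linear. -/
theorem linPoly_mul_of_mem (i : Fin s) (c : ℕ → L) (M : ℕ) {a : L} (ha : a ∈ C.F i.castSucc)
    (x : L) : C.linPoly i c M (a * x) = a * C.linPoly i c M x := by
  have := (C.linPoly i c M).map_smul (⟨a, ha⟩ : C.F i.castSucc) x
  simpa [Algebra.smul_def] using this

/-- A linearized polynomial with many zeros vanishes. -/
theorem linPoly_coeff_eq_zero (i : Fin s) (c : ℕ → L) (M : ℕ)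
    (h : M ≤ Module.finrank (C.F i.castSucc) (C.linPoly i c M).ker) : ∀ m < M, c m = 0 := by
  have hfin : Finite L := Module.finite_of_finite K
  have := Fintype.ofFinite L
  let P : Polynomial L := ∑ m ∈ Finset.range M, Polynomial.C (c m) * Polynomial.X ^ (C.q i ^ m)
  have hP : P = 0 := by
    refine Polynomial.eq_zero_of_natDegree_lt_card_of_eval_eq_zero' P
      (Finset.univ.filter fun x => x ∈ (C.linPoly i c M).ker) ?_ ?_
    · intro x hx
      have : C.linPoly i c M x = 0 := (Finset.mem_filter.1 hx).2
      rw [← this, linPoly_apply]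
      simp [P, Polynomial.eval_finsetSum]
    · rw [← Fintype.card_subtype, ← Nat.card_eq_fintype_card]
      have hc : Nat.card (C.linPoly i c M).ker =
          C.q i ^ Module.finrank (C.F i.castSucc) (C.linPoly i c M).ker := by
        rw [Module.natCard_eq_pow_finrank (K := C.F i.castSucc), natCard_F]
      change _ < Nat.card (C.linPoly i c M).ker
      rw [hc]
      refine lt_of_lt_of_le ?_ (Nat.pow_le_pow_right (C.q_pos i) h)
      -- The zero set has at least `q ^ M` elements while the degree is at most `q ^ (M - 1)`.
      -- Without coefficients this exponent makes no sense, but then the polynomial is zero.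
      rcases M.eq_zero_or_pos with rfl | hM
      · simp [P]
      · refine lt_of_le_of_lt (Polynomial.natDegree_sum_le_of_forall_le _ _ (n := C.q i ^ (M - 1))
          fun m hm => ?_) (Nat.pow_lt_pow_right (C.one_lt_q i) (by omega))
        refine (Polynomial.natDegree_C_mul_X_pow_le _ _).trans
          (Nat.pow_le_pow_right (C.q_pos i) ?_)
        have := Finset.mem_range.1 hm
        omega
  intro m hm
  have h1 := congrArg (fun p => Polynomial.coeff p (C.q i ^ m)) hP
  simp only [P, Polynomial.finsetSum_coeff, Polynomial.coeff_C_mul, Polynomial.coeff_X_pow,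
    Polynomial.coeff_zero] at h1
  rw [Finset.sum_eq_single m] at h1
  · simpa using h1
  · intro b _ hb
    rw [if_neg, mul_zero]
    intro he
    exact hb (Nat.pow_right_injective (C.one_lt_q i) he).symm
  · intro h'; exact absurd (Finset.mem_range.2 hm) h'

/-- A linearized polynomial that maps many independent elements into a small space vanishes. -/
theorem linPoly_coeff_eq_zero_of_mem (i : Fin s) (c : ℕ → L) (M : ℕ)
    (S : Submodule (C.F i.castSucc) L)
    (hS : M + Module.finrank (C.F i.castSucc) S ≤ len R z i)
    (h : ∀ l, C.linPoly i c M (C.g i l) ∈ S) : ∀ m < M, c m = 0 := by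
  have : FiniteDimensional (C.F i.castSucc) L := Module.Finite.right K _ L
  refine C.linPoly_coeff_eq_zero i c M ?_
  let V := Submodule.span (C.F i.castSucc) (Set.range (C.g i))
  have hV : Module.finrank (C.F i.castSucc) V = len R z i := by
    have := finrank_span_eq_card (C.g_indep i)
    rwa [Fintype.card_fin] at this
  -- Rank and nullity on the span of the evaluation points: its dimension is `n i` and the image
  -- lies in `S`, so the kernel has dimension at least `M`.
  let f := (C.linPoly i c M).domRestrict V
  have h1 := f.finrank_range_add_finrank_ker
  have h2 : Module.finrank (C.F i.castSucc) f.range ≤ Module.finrank (C.F i.castSucc) S := by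
    refine Submodule.finrank_mono ?_
    rintro _ ⟨⟨x, hx⟩, rfl⟩
    have h3 : V ≤ S.comap (C.linPoly i c M) := by
      refine Submodule.span_le.2 ?_
      rintro _ ⟨l, rfl⟩
      exact h l
    exact h3 hx
  have h3 : Module.finrank (C.F i.castSucc) f.ker ≤
      Module.finrank (C.F i.castSucc) (C.linPoly i c M).ker := by
    have := LinearMap.finrank_le_finrank_of_injective
      (f := (V.subtype.comp f.ker.subtype).codRestrict (C.linPoly i c M).ker (by
        rintro ⟨⟨x, hx⟩, hk⟩
        exact hk)) (by
        intro a b hab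
        have := congrArg Subtype.val hab
        exact Subtype.ext (Subtype.ext this))
    exact this
  omega

/-- The coefficients of the composition of `∑ lam a X ^ q ^ a` and `∑ x r X ^ q ^ r`. -/
def compCoeff (i : Fin s) (lam : ℕ → L) (x : Fin (R i) → L) (ρ : ℕ) : L :=
  ∑ r : Fin (R i), if r.val ≤ ρ ∧ ρ - r.val < z + 1 then
    lam (ρ - r) * x r ^ (C.q i ^ (ρ - r)) else 0

theorem sum_range_shift {M : Type*} [AddCommMonoid M] (F : ℕ → ℕ → M) {r t n : ℕ} (h : r + t ≤ n) :
    ∑ m ∈ Finset.range n, (if r ≤ m ∧ m - r < t then F (m - r) m else 0) =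
      ∑ a ∈ Finset.range t, F a (a + r) := by
  rw [← Finset.sum_filter]
  refine Finset.sum_bij' (fun m _ => m - r) (fun a _ => a + r) ?_ ?_ ?_ ?_ ?_
  · intro m hm
    simp only [Finset.mem_filter, Finset.mem_range] at hm ⊢
    omega
  · intro a ha
    simp only [Finset.mem_filter, Finset.mem_range] at ha ⊢
    omega
  · intro m hm
    simp only [Finset.mem_filter, Finset.mem_range] at hm
    omega
  · intro a ha
    omega
  · intro m hm
    simp only [Finset.mem_filter, Finset.mem_range] at hm
    congr 1
    omega

/-- Raising `x r * t ^ q ^ r` to the power `q ^ a` gives `x r ^ q ^ a * t ^ q ^ (a + r)`. With `a ≤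
z` and `r < R i` the exponents `a + r` stay below `R i + z`, which fixes the number of coefficients.
-/
theorem linPoly_compCoeff (i : Fin s) (lam : ℕ → L) (x : Fin (R i) → L) (t : L) :
    C.linPoly i (C.compCoeff i lam x) (R i + z) t =
      C.linPoly i lam (z + 1) (∑ r : Fin (R i), x r * t ^ (C.q i ^ r.val)) := by
  simp only [linPoly_apply, compCoeff, Finset.sum_mul, sum_pow_q, Finset.mul_sum]
  rw [Finset.sum_comm]
  conv_rhs => rw [Finset.sum_comm]
  refine Finset.sum_congr rfl fun r _ => ?_
  simp only [ite_mul, zero_mul]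
  rw [sum_range_shift (fun a m => lam a * x r ^ C.q i ^ a * t ^ C.q i ^ m)
    (show r.val + (z + 1) ≤ R i + z by omega)]
  refine Finset.sum_congr rfl fun a _ => ?_
  rw [mul_pow, ← pow_mul, ← pow_add, mul_assoc, add_comm]

/-- Linearized polynomials have no zero divisors. -/
theorem compCoeff_injective (i : Fin s) (lam : ℕ → L) (hlam : ∃ a < z + 1, lam a ≠ 0)
    (x x' : Fin (R i) → L)
    (h : ∀ ρ < R i + z, C.compCoeff i lam x ρ = C.compCoeff i lam x' ρ) : x = x' := by
  by_contra hne
  have hex : ∃ r, ∃ h : r < R i, x ⟨r, h⟩ - x' ⟨r, h⟩ ≠ 0 := by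
    by_contra! hall
    exact hne (funext fun r => sub_eq_zero.1 (hall r r.2))
  -- Take the lowest nonzero coefficients of the two factors. The coefficient of the composition at
  -- the sum of their indices is a single product; all other terms contain a vanishing factor.
  let r₀ := Nat.find hex
  obtain ⟨hr₀, hx⟩ := Nat.find_spec hex
  let a₀ := Nat.find hlam
  obtain ⟨ha₀, hl⟩ := Nat.find_spec hlam
  have hρ := h (a₀ + r₀) (by
    have : r₀ < R i := hr₀
    have : a₀ < z + 1 := ha₀
    omega)
  rw [← sub_eq_zero, compCoeff, compCoeff, ← Finset.sum_sub_distrib,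
    Finset.sum_eq_single (⟨r₀, hr₀⟩ : Fin (R i))] at hρ
  · simp only at hρ
    rw [if_pos (by constructor <;> [omega; (have : a₀ < z + 1 := ha₀; omega)]),
      if_pos (by constructor <;> [omega; (have : a₀ < z + 1 := ha₀; omega)]), ← mul_sub,
      ← sub_pow_q, Nat.add_sub_cancel] at hρ
    rcases mul_eq_zero.1 hρ with h0 | h0
    · exact hl h0
    · exact hx (pow_eq_zero_iff (pow_pos (C.q_pos i) a₀).ne' |>.1 h0)
  · intro r _ hr
    split_ifs with hc
    · rw [← mul_sub, ← sub_pow_q]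
      rcases lt_or_gt_of_ne (fun h' => hr (Fin.ext h') : r.val ≠ r₀) with hlt | hgt
      · have := Nat.find_min hex hlt
        push Not at this
        rw [this r.2, zero_pow_q, mul_zero]
      · have hmin := Nat.find_min hlam (m := a₀ + r₀ - r.val) (by
          change _ < a₀
          omega)
        push Not at hmin
        rw [hmin hc.2, zero_mul]
    · rw [sub_zero]
  · intro h'; exact absurd (Finset.mem_univ _) h'

/-- Few elements have a nonzero annihilating linearized polynomial. -/
theorem exists_annihilator (i : Fin s) {E : Type*} (S : Finset E) (hS : S.card ≤ z) (ε : E → L) :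
    ∃ lam : ℕ → L, (∃ a < z + 1, lam a ≠ 0) ∧ ∀ e ∈ S, C.linPoly i lam (z + 1) (ε e) = 0 := by
  let f : (Fin (z + 1) → L) →ₗ[L] (S → L) :=
    { toFun := fun c e => ∑ a, c a * ε e ^ (C.q i ^ a.val)
      map_add' := fun c d => by
        funext e; simp [add_mul, Finset.sum_add_distrib]
      map_smul' := fun t c => by
        funext e; simp [Finset.mul_sum, mul_assoc] }
  -- There are `z + 1` unknown coefficients and at most `z` linear conditions.
  have hlt : Module.finrank L (S → L) < Module.finrank L (Fin (z + 1) → L) := by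
    simp; omega
  obtain ⟨c, hc, hne⟩ := Submodule.exists_mem_ne_zero_of_ne_bot
    (LinearMap.ker_ne_bot_of_finrank_lt (f := f) hlt)
  obtain ⟨a, ha⟩ := Function.ne_iff.1 hne
  refine ⟨fun m => if h : m < z + 1 then c ⟨m, h⟩ else 0,
    ⟨a, a.2, by
      beta_reduce
      rw [dif_pos a.2]
      exact ha⟩, ?_⟩
  intro e he
  have h1 := congrFun (LinearMap.mem_ker.1 hc) ⟨e, he⟩
  simp only [f, LinearMap.coe_mk, AddHom.coe_mk, Pi.zero_apply] at h1
  rw [linPoly_apply, Finset.sum_range]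
  exact (Finset.sum_congr rfl fun a _ => by rw [dif_pos a.2]).trans h1

end TowerCode
end NetCode
end

noncomputable section
open scoped Classical
namespace NetCode
namespace TowerCode

variable {K L : Type*} [Field K] [Fintype K] [Field L] [Algebra K L] {s : ℕ}
  {R : Fin s → ℕ} {z : ℕ} (C : TowerCode K L (len R z)) [FiniteDimensional K L]

/-! ### Correctness of the stage decoder -/

/-- The symbol of the top field that source packet `h` carries. -/
def codeword (X : ∀ j, Fin (R j) → L) (h : Header (len R z)) : L :=
  ∑ r, C.gen h.1 h.2 r * X h.1 r

/-- Coordinates for what matters to the decoder of source `i`: the information of the earlier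
sources and the packets of source `i`. -/
abbrev StageIdx (_C : TowerCode K L (len R z)) (i : Fin s) : Type :=
  (Σ j : {j // j < i}, Fin (R j)) ⊕ Fin (len R z i)

theorem gen_mem_of_lt {i j : Fin s} (h : j < i) (l r) : C.gen j l r ∈ C.F i.castSucc :=
  pow_mem (C.g_mem_of_lt h l) _

/-- The vector of source packet `h` in the coordinates of stage `i`. -/
def stageVec (i : Fin s) (h : Header (len R z)) : C.StageIdx i → C.F i.castSucc :=
  Sum.elim
    (fun p => ∑ l, if h = ⟨p.1.1, l⟩ then ⟨C.gen p.1.1 l p.2, C.gen_mem_of_lt p.1.2 l p.2⟩ else 0)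
    (fun l => if h = ⟨i, l⟩ then 1 else 0)

/-- The transfer matrix of the header suffices for the decoder of source `i`. -/
def Decodable {B : ℕ} (i : Fin s) (Tr : Fin B → Header (len R z) → K) : Prop :=
  Submodule.span (C.F i.castSucc) (Set.range fun b => ∑ h, Tr b h • C.stageVec i h) = ⊤

theorem sum_fin_ite_lt {M : Type*} [AddCommMonoid M] (f : ℕ → M) {t n : ℕ} (h : t ≤ n) :
    ∑ m : Fin n, (if m.val < t then f m else 0) = ∑ m ∈ Finset.range t, f m := by
  rw [Fin.sum_univ_eq_sum_range (fun m => if m < t then f m else 0), ← Finset.sum_filter]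
  congr 1
  ext m
  simp only [Finset.mem_filter, Finset.mem_range]
  omega

theorem len_lt_width (j : Fin s) : len R z j < C.width :=
  Nat.lt_succ_of_le (Finset.single_le_sum (f := len R z) (fun _ _ => Nat.zero_le _)
    (Finset.mem_univ j))

/-- The left hand side of the key equation. -/
def keyValue {B : ℕ} (i : Fin s) (y : Fin B → Fin s → L) (w : Fin B → L) (uu : Fin s → ℕ → L)
    (nu lam : ℕ → L) (b : Fin B) : L :=
  (∑ j : Fin s, if j < i then ∑ r ∈ Finset.range (R j), uu j r * y b j ^ (C.q j ^ r) else 0) +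
    C.linPoly i nu (R i + z) (y b i) + C.linPoly i lam (z + 1) (w b)

/-- The guards in `keyCoeff` truncate the slots to `R j`, `R i + z` and `z + 1`; the width of a
group exceeds all three, so nothing is cut off. -/
theorem sum_keySystem {B : ℕ} (i : Fin s) (y : Fin B → Fin s → L) (w : Fin B → L)
    (v : Fin C.unknowns → K) (b : Fin B) :
    ∑ u, v u • C.keySystem i y w b u =
      C.keyValue i y w (fun j => C.block v j) (C.block v i) (C.block v s) b := by
  have h1 : ∑ u, v u • C.keySystem i y w b u =
      ∑ j : Fin (s + 1), ∑ m : Fin C.width, C.block v j m * C.keyCoeff i y w b j m := by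
    rw [sum_unknowns]
    refine Finset.sum_congr rfl fun j _ => Finset.sum_congr rfl fun m _ => ?_
    rw [block_eq, Finset.sum_mul]
    refine Finset.sum_congr rfl fun c _ => ?_
    rw [keySystem, slot_uix, smul_mul_assoc]
  rw [h1, Fin.sum_univ_castSucc, keyValue]
  have hlast : ∑ m : Fin C.width, C.block v (Fin.last s) m * C.keyCoeff i y w b (Fin.last s) m =
      C.linPoly i (C.block v s) (z + 1) (w b) := by
    have hz : z + 1 ≤ C.width := by
      have := C.len_lt_width i
      simp only [len] at this
      omega
    rw [linPoly_apply, ← sum_fin_ite_lt _ hz]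
    refine Finset.sum_congr rfl fun m _ => ?_
    rw [keyCoeff, dif_neg (by simp)]
    split_ifs <;> simp
  rw [hlast]
  congr 1
  have h2 : ∀ j : Fin s, ∑ m : Fin C.width,
      C.block v j.castSucc m * C.keyCoeff i y w b j.castSucc m =
      (if j < i then ∑ r ∈ Finset.range (R j), C.block v j r * y b j ^ (C.q j ^ r) else 0) +
        if j = i then C.linPoly i (C.block v i) (R i + z) (y b i) else 0 := by
    intro j
    have hw := C.len_lt_width j
    simp only [len] at hw
    rcases lt_trichotomy j i with h | h | h
    · rw [if_pos h, if_neg h.ne, add_zero, ← sum_fin_ite_lt _ (show R j ≤ C.width by omega)]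
      refine Finset.sum_congr rfl fun m _ => ?_
      rw [keyCoeff, dif_pos (by simp)]
      have : ¬ (j.val = i.val) := fun h' => h.ne (Fin.ext h')
      have h' : j.val < i.val := h
      simp [this, h]
    · subst h
      rw [if_neg (lt_irrefl _), if_pos rfl, zero_add, linPoly_apply,
        ← sum_fin_ite_lt _ (show R j + z ≤ C.width by omega)]
      refine Finset.sum_congr rfl fun m _ => ?_
      rw [keyCoeff, dif_pos (by simp)]
      simp
    · rw [if_neg h.not_gt, if_neg h.ne', add_zero]
      refine Finset.sum_eq_zero fun m _ => ?_
      rw [keyCoeff, dif_pos (by simp), if_neg, mul_zero]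
      have h' : i.val < j.val := h
      simp only [Fin.val_castSucc]
      omega
  rw [Finset.sum_congr rfl fun j _ => h2 j, Finset.sum_add_distrib,
    Finset.sum_ite_eq' Finset.univ i, if_pos (Finset.mem_univ i)]

/-- The contribution of source packet `h` to the key equation. -/
def keyResidue (i : Fin s) (X : ∀ j, Fin (R j) → L) (uu : Fin s → ℕ → L) (nu lam : ℕ → L)
    (h : Header (len R z)) : L :=
  if h.1 < i then
    ∑ r : Fin (R h.1), C.gen h.1 h.2 r * (C.linPoly i lam (z + 1) (X h.1 r) + uu h.1 r)
  else if h.1 = i then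
    C.linPoly i (fun m => nu m + C.compCoeff i lam (X i) m) (R i + z) (C.g h.1 h.2)
  else 0

theorem pow_q_sum_smul_g (j : Fin s) (Y : Fin (len R z j) → K) (r : ℕ) :
    (∑ l, Y l • C.g j l) ^ (C.q j ^ r) = ∑ l, Y l • C.g j l ^ (C.q j ^ r) := by
  rw [sum_pow_q]
  exact Finset.sum_congr rfl fun l _ => by rw [smul_pow_q]

theorem linPoly_add_coeff (i : Fin s) (c d : ℕ → L) (M : ℕ) (x : L) :
    C.linPoly i (fun m => c m + d m) M x = C.linPoly i c M x + C.linPoly i d M x := by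
  simp only [linPoly_apply, add_mul, Finset.sum_add_distrib]

theorem linPoly_sum_smul {ι : Type*} (S : Finset ι) (i : Fin s) (c : ℕ → L) (M : ℕ) (a : ι → K)
    (x : ι → L) :
    C.linPoly i c M (∑ t ∈ S, a t • x t) = ∑ t ∈ S, a t • C.linPoly i c M (x t) := by
  rw [map_sum]
  exact Finset.sum_congr rfl fun t _ => by rw [linPoly_smul]

section Setting

variable {B : ℕ} {E : Type*} {i : Fin s} {Y : Fin B → Header (len R z) → K} {S : Finset E}
  {U : Fin B → E → K} {X : ∀ j, Fin (R j) → L} {ε : E → L} {y : Fin B → Fin s → L}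
  {w : Fin B → L}

/-- Everything in the key equation is `K`-linear in the received packet, so it splits into
contributions of source packets and of errors. For `j < i` the generator entries pass through `lam`;
for `j = i` the composition with the information polynomial appears; later sources are already
cancelled. -/
theorem keyValue_eq (hy : ∀ b j, j ≤ i → y b j = ∑ l, Y b ⟨j, l⟩ • C.g j l)
    (hw : ∀ b, w b = (∑ h, if h.1 ≤ i then Y b h • C.codeword X h else 0) +
      ∑ e ∈ S, U b e • ε e) (uu : Fin s → ℕ → L) (nu lam : ℕ → L) (b : Fin B) :
    C.keyValue i y w uu nu lam b =
      (∑ h, Y b h • C.keyResidue i X uu nu lam h) +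
        ∑ e ∈ S, U b e • C.linPoly i lam (z + 1) (ε e) := by
  have hwb : C.linPoly i lam (z + 1) (w b) =
      (∑ j : Fin s, ∑ l, if j ≤ i then
        Y b ⟨j, l⟩ • C.linPoly i lam (z + 1) (C.codeword X ⟨j, l⟩) else 0) +
      ∑ e ∈ S, U b e • C.linPoly i lam (z + 1) (ε e) := by
    rw [hw, map_add, linPoly_sum_smul, map_sum, Fintype.sum_sigma]
    congr 1
    refine Finset.sum_congr rfl fun j _ => Finset.sum_congr rfl fun l _ => ?_
    split_ifs
    · rw [linPoly_smul]
    · rw [map_zero]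
  have hnu : C.linPoly i nu (R i + z) (y b i) =
      ∑ j : Fin s, if j = i then C.linPoly i nu (R i + z) (y b j) else 0 := by
    rw [Finset.sum_ite_eq' Finset.univ i, if_pos (Finset.mem_univ i)]
  rw [keyValue, hwb, ← add_assoc, hnu, ← Finset.sum_add_distrib, ← Finset.sum_add_distrib,
    Fintype.sum_sigma]
  congr 1
  refine Finset.sum_congr rfl fun j _ => ?_
  rcases lt_trichotomy j i with h | h | h
  · simp only [if_pos h, if_neg h.ne, if_pos h.le, add_zero, keyResidue]
    rw [hy b j h.le]
    simp only [pow_q_sum_smul_g, Finset.mul_sum, Finset.sum_range, Finset.smul_sum]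
    rw [Finset.sum_comm, ← Finset.sum_add_distrib]
    refine Finset.sum_congr rfl fun l _ => ?_
    rw [codeword, map_sum, Finset.smul_sum, ← Finset.sum_add_distrib]
    refine Finset.sum_congr rfl fun r _ => ?_
    rw [C.linPoly_mul_of_mem i lam _ (C.gen_mem_of_lt h l r), gen_apply, mul_smul_comm, ← smul_add,
      mul_add, add_comm, mul_comm (uu j r)]
  · subst h
    simp only [if_neg (lt_irrefl j), if_pos le_rfl, zero_add, keyResidue, ↓reduceIte]
    rw [hy b j le_rfl, linPoly_sum_smul, ← Finset.sum_add_distrib]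
    refine Finset.sum_congr rfl fun l _ => ?_
    have hc : C.codeword X ⟨j, l⟩ = ∑ r, X j r * C.g j l ^ (C.q j ^ r.val) :=
      Finset.sum_congr rfl fun r _ => by rw [gen_apply, mul_comm]
    rw [linPoly_add_coeff, linPoly_compCoeff, smul_add, hc]
  · simp only [if_neg h.not_gt, if_neg h.ne', if_neg h.not_ge, add_zero, keyResidue, smul_zero,
      Finset.sum_const_zero]

/-- The key equation forces the quotient of its solutions. -/
theorem coeff_eq_zero_of_keyValue (hy : ∀ b j, j ≤ i → y b j = ∑ l, Y b ⟨j, l⟩ • C.g j l)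
    (hw : ∀ b, w b = (∑ h, if h.1 ≤ i then Y b h • C.codeword X h else 0) +
      ∑ e ∈ S, U b e • ε e) {Tr : Fin B → Header (len R z) → K} (hS : S.card ≤ z)
    {Zh : E → Header (len R z) → K}
    (hY : ∀ b h, Y b h = Tr b h + ∑ e ∈ S, U b e * Zh e h)
    (hgood : C.Decodable i Tr) (uu : Fin s → ℕ → L) (nu lam : ℕ → L)
    (h0 : ∀ b, C.keyValue i y w uu nu lam b = 0) :
    ∀ m < R i + z, nu m + C.compCoeff i lam (X i) m = 0 := by
  let ψ := C.keyResidue i X uu nu lam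
  -- Passing from the received header to the true transfer matrix moves the forged part of the
  -- header into the error terms. There are still at most `z` of them, so `T` has dimension at most
  -- `z`.
  let t : E → L := fun e => C.linPoly i lam (z + 1) (ε e) + ∑ h, Zh e h • ψ h
  let T : Submodule (C.F i.castSucc) L :=
    Submodule.span (C.F i.castSucc) ((S.image t : Finset L) : Set L)
  have hT : Module.finrank (C.F i.castSucc) T ≤ z :=
    (finrank_span_finset_le_card _).trans (Finset.card_image_le.trans hS)
  have hsum : ∀ b, ∑ h, Tr b h • ψ h ∈ T := by
    intro b
    have h1 := C.keyValue_eq hy hw uu nu lam b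
    rw [h0] at h1
    have h2 : ∑ h, Tr b h • ψ h = -∑ e ∈ S, U b e • t e := by
      rw [eq_neg_iff_add_eq_zero, h1]
      simp only [hY, add_smul, Finset.sum_add_distrib, t, smul_add, Finset.sum_smul,
        Finset.smul_sum, mul_smul]
      rw [Finset.sum_comm (s := Finset.univ) (t := S)]
      abel
    rw [h2]
    refine neg_mem (sum_mem fun e he => ?_)
    have : U b e • t e = (algebraMap K (C.F i.castSucc) (U b e)) • t e := by
      rw [algebraMap_smul]
    rw [this]
    exact Submodule.smul_mem _ _ (Submodule.subset_span (by
      rw [Finset.coe_image]; exact Set.mem_image_of_mem _ he))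
  -- The residue of a source packet is a linear function of its stage vector. An earlier source
  -- enters through `R j` coordinates only, because the unknowns of the key equation meet its
  -- packets through its generator matrix.
  let Ψ : (C.StageIdx i → C.F i.castSucc) →ₗ[C.F i.castSucc] L :=
    Fintype.linearCombination (C.F i.castSucc) (Sum.elim
      (fun p => C.linPoly i lam (z + 1) (X p.1.1 p.2) + uu p.1.1 p.2)
      (fun l => ψ ⟨i, l⟩))
  have hΨ : ∀ h, Ψ (C.stageVec i h) = ψ h := by
    rintro ⟨j, l⟩
    have e1 : Ψ (C.stageVec i ⟨j, l⟩) =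
        (∑ p : (Σ j : {j // j < i}, Fin (R j)), ∑ l' : Fin (len R z p.1.1),
          if (⟨j, l⟩ : Header (len R z)) = ⟨p.1.1, l'⟩ then
            C.gen p.1.1 l' p.2 * (C.linPoly i lam (z + 1) (X p.1.1 p.2) + uu p.1.1 p.2) else 0) +
        ∑ l' : Fin (len R z i), if (⟨j, l⟩ : Header (len R z)) = ⟨i, l'⟩ then ψ ⟨i, l'⟩ else 0 := by
      simp only [Ψ, Fintype.linearCombination_apply, Fintype.sum_sum_type, stageVec, Sum.elim_inl,
        Sum.elim_inr, Finset.sum_smul, ite_smul, one_smul, zero_smul]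
      rfl
    rw [e1, Fintype.sum_sigma]
    rcases lt_trichotomy j i with h | h | h
    · rw [Finset.sum_eq_single (⟨j, h⟩ : {j // j < i}), Finset.sum_eq_zero (s := Finset.univ)
        (f := fun l' : Fin (len R z i) =>
          if (⟨j, l⟩ : Header (len R z)) = ⟨i, l'⟩ then ψ ⟨i, l'⟩ else 0), add_zero]
      · simp only [ψ, keyResidue, if_pos h]
        refine Finset.sum_congr rfl fun r _ => ?_
        rw [Finset.sum_eq_single l]
        · simp
        · intro l' _ hl
          rw [if_neg]
          intro he
          rw [Sigma.mk.injEq] at he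
          exact hl (eq_of_heq he.2).symm
        · intro h'; exact absurd (Finset.mem_univ _) h'
      · intro l' _
        rw [if_neg]
        intro he
        exact h.ne (congrArg Sigma.fst he)
      · intro j' _ hj'
        refine Finset.sum_eq_zero fun r _ => Finset.sum_eq_zero fun l' _ => ?_
        rw [if_neg]
        intro he
        exact hj' (Subtype.ext (congrArg Sigma.fst he).symm)
      · intro h'; exact absurd (Finset.mem_univ _) h'
    · subst h
      rw [Finset.sum_eq_zero, zero_add, Finset.sum_eq_single l]
      · simp
      · intro l' _ hl
        rw [if_neg]
        intro he
        rw [Sigma.mk.injEq] at he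
        exact hl (eq_of_heq he.2).symm
      · intro h'; exact absurd (Finset.mem_univ _) h'
      · intro j' _
        refine Finset.sum_eq_zero fun r _ => Finset.sum_eq_zero fun l' _ => ?_
        rw [if_neg]
        intro he
        exact j'.2.ne (congrArg Sigma.fst he).symm
    · rw [Finset.sum_eq_zero, Finset.sum_eq_zero, add_zero]
      · simp only [ψ, keyResidue, if_neg h.not_gt, if_neg h.ne']
      · intro l' _
        rw [if_neg]
        intro he
        exact h.ne' (congrArg Sigma.fst he)
      · intro j' _
        refine Finset.sum_eq_zero fun r _ => Finset.sum_eq_zero fun l' _ => ?_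
        rw [if_neg]
        intro he
        exact (j'.2.trans h).ne (congrArg Sigma.fst he).symm
  -- The received stage vectors span and are mapped into `T`. So every vector is, including those of
  -- single packets of source `i`, which the sink never sees separately.
  have hall : ∀ x, Ψ x ∈ T := by
    have h1 : (⊤ : Submodule (C.F i.castSucc) _) ≤ T.comap Ψ := by
      rw [← hgood]
      refine Submodule.span_le.2 ?_
      rintro _ ⟨b, rfl⟩
      change Ψ _ ∈ T
      rw [map_sum]
      have : ∀ h, Ψ (Tr b h • C.stageVec i h) = Tr b h • ψ h := by
        intro h
        rw [← algebraMap_smul (C.F i.castSucc), map_smul, hΨ, algebraMap_smul]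
      simp only [this]
      exact hsum b
    exact fun x => h1 Submodule.mem_top
  -- The redundancy `2 z` is used up here: `R i + z` coefficients and an image of dimension at most
  -- `z` fit into `n i = R i + 2 z`.
  refine C.linPoly_coeff_eq_zero_of_mem i _ (R i + z) T ?_ fun l => ?_
  · simp only [len]; omega
  · have h1 := hall (C.stageVec i ⟨i, l⟩)
    rw [hΨ] at h1
    simpa [ψ, keyResidue] using h1

end Setting

end TowerCode
end NetCode
end

/-! ### Solvability of the two linear systems and correctness of one decoded column -/

noncomputable section
open scoped Classical
namespace NetCode
namespace TowerCode

variable {K L : Type*} [Field K] [Fintype K] [Field L] [Algebra K L] {s : ℕ}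
  {R : Fin s → ℕ} {z : ℕ} (C : TowerCode K L (len R z)) [FiniteDimensional K L]

/-- The unknowns whose blocks are given. -/
def ofBlocks (β : ℕ → ℕ → L) (u : Fin C.unknowns) : K :=
  C.coords (β (C.slot u).1 (C.slot u).2.1) (C.slot u).2.2

theorem block_ofBlocks (β : ℕ → ℕ → L) {j m : ℕ} (hj : j ≤ s) (hm : m < C.width) :
    C.block (C.ofBlocks β) j m = β j m := by
  have h := C.block_eq (C.ofBlocks β) ⟨j, Nat.lt_succ_of_le hj⟩ ⟨m, hm⟩
  simp only at h
  rw [h]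
  simp only [ofBlocks, slot_uix]
  rw [sum_coords]

theorem coords_block (v : Fin C.unknowns → K) (u : Fin C.unknowns) :
    C.coords (C.block v (C.slot u).1 (C.slot u).2.1) (C.slot u).2.2 = v u := by
  rw [block_eq, C.coords_sum_smul fun c => v _]
  congr 1
  apply Fin.ext
  rw [uix_val]
  exact (C.uix_slot u).symm

theorem width_pos : 0 < C.width := Nat.succ_pos _

theorem scale_index_lt : s * C.width * (∏ i, len R z i) < C.unknowns := by
  have h1 := C.width_pos
  have h2 := C.prod_len_pos
  have h3 : 0 < C.width * ∏ i, len R z i := Nat.mul_pos h1 h2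
  have : C.unknowns = s * C.width * (∏ i, len R z i) + C.width * ∏ i, len R z i := by
    rw [unknowns]; ring
  omega

theorem slot_scale_index : C.slot ⟨_, C.scale_index_lt⟩ =
    (Fin.last s, ⟨0, C.width_pos⟩, ⟨0, C.prod_len_pos⟩) := by
  rw [← slot_uix]
  congr 1
  apply Fin.ext
  rw [uix_val]
  simp

/-- Mixed radix digits with `N` and `W` as the lower bases: a number in a window that starts the
last group and consists of whole slots has the leading digit `σ` and a small middle digit. -/
theorem digits_of_mem_last {u j m c W N σ t : ℕ} (hu : u = (j * W + m) * N + c) (hj : j ≤ σ)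
    (hm : m < W) (hc : c < N) (h : σ * W * N ≤ u ∧ u < σ * W * N + t * N) : j = σ ∧ m < t := by
  have hjs : j = σ := by
    by_contra hne
    have hlt : j + 1 ≤ σ := by omega
    have e1 : (j + 1) * W * N ≤ σ * W * N := by gcongr
    have e2 : (m + 1) * N ≤ W * N := by gcongr; exact hm
    have e4 : (j + 1) * W * N = j * W * N + W * N := by ring
    have e5 : (m + 1) * N = m * N + N := by ring
    have e6 : (j * W + m) * N = j * W * N + m * N := by ring
    omega
  refine ⟨hjs, ?_⟩
  subst hjs
  by_contra hge
  have e1 : t * N ≤ m * N := by gcongr; omega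
  have e6 : (j * W + m) * N = j * W * N + m * N := by ring
  omega

theorem slot_last {u : Fin C.unknowns} {t : ℕ}
    (h : s * C.width * (∏ i, len R z i) ≤ u.val ∧
      u.val < s * C.width * (∏ i, len R z i) + t * ∏ i, len R z i) :
    (C.slot u).1.val = s ∧ (C.slot u).2.1.val < t := by
  have := (C.slot u).1.2
  exact digits_of_mem_last (C.uix_slot u) (by omega) (C.slot u).2.1.2 (C.slot u).2.2.2 h

theorem keyValue_congr {B : ℕ} (i : Fin s) (y : Fin B → Fin s → L) (w : Fin B → L)
    {uu uu' : Fin s → ℕ → L} {nu nu' lam lam' : ℕ → L} (b : Fin B)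
    (h1 : ∀ j, j < i → ∀ r < R j, uu j r = uu' j r) (h2 : ∀ m < R i + z, nu m = nu' m)
    (h3 : ∀ m < z + 1, lam m = lam' m) :
    C.keyValue i y w uu nu lam b = C.keyValue i y w uu' nu' lam' b := by
  unfold keyValue
  congr 1
  · congr 1
    · refine Finset.sum_congr rfl fun j _ => ?_
      split_ifs with h
      · exact Finset.sum_congr rfl fun r hr => by rw [h1 j h r (Finset.mem_range.1 hr)]
      · rfl
    · rw [linPoly_apply, linPoly_apply]
      exact Finset.sum_congr rfl fun m hm => by rw [h2 m (Finset.mem_range.1 hm)]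
  · rw [linPoly_apply, linPoly_apply]
    exact Finset.sum_congr rfl fun m hm => by rw [h3 m (Finset.mem_range.1 hm)]

/-- The unknown coefficients of the quotient occur in powers, so the equation is not linear over the
top field. With coordinates in `K` as unknowns it is, the basis elements being raised to these
powers. One extra unknown, `scale`, multiplies the numerator and makes the system homogeneous. -/
theorem sum_quotSystem (i : Fin s) (v₁ v : Fin C.unknowns → K) (ρ : Fin (len R z i)) :
    ∑ u, v u • C.quotSystem i v₁ ρ u =
      C.compCoeff i (C.block v₁ s) (fun r => C.block v 0 r) ρ +
        C.scale v • (if ρ.val < R i + z then C.block v₁ i ρ else 0) := by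
  have hsplit : ∀ u, v u • C.quotSystem i v₁ ρ u =
      (if (C.slot u).1.val = 0 then v u •
        (if (C.slot u).2.1.val < R i ∧ (C.slot u).2.1.val ≤ ρ ∧ ρ - (C.slot u).2.1.val < z + 1 then
          C.block v₁ s (ρ - (C.slot u).2.1) *
            C.prodBasis (C.slot u).2.2 ^ (C.q i ^ (ρ - (C.slot u).2.1 : ℕ)) else 0) else 0) +
      (if u = ⟨_, C.scale_index_lt⟩ then
        v u • (if ρ.val < R i + z then C.block v₁ i ρ else 0) else 0) := by
    intro u
    have hiff : u.val = s * C.width * (∏ i, len R z i) ↔ u = ⟨_, C.scale_index_lt⟩ :=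
      ⟨fun h => Fin.ext h, fun h => congrArg Fin.val h⟩
    by_cases h0 : (C.slot u).1.val = 0
    · have hne : u ≠ ⟨_, C.scale_index_lt⟩ := by
        rintro rfl
        rw [slot_scale_index, Fin.val_last] at h0
        have := i.2
        omega
      rw [quotSystem, if_pos h0, if_pos h0, if_neg hne, add_zero]
    · rw [quotSystem, if_neg h0, if_neg h0, zero_add]
      by_cases h1 : u = ⟨_, C.scale_index_lt⟩
      · rw [if_pos (hiff.2 h1), if_pos h1]
      · rw [if_neg (fun h => h1 (hiff.1 h)), if_neg h1, smul_zero]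
  rw [Finset.sum_congr rfl fun u _ => hsplit u, Finset.sum_add_distrib,
    Finset.sum_ite_eq' Finset.univ, if_pos (Finset.mem_univ _)]
  congr 1
  · rw [sum_unknowns, Finset.sum_eq_single (0 : Fin (s + 1))]
    · have hw := C.len_lt_width i
      simp only [len] at hw
      rw [compCoeff, ← Finset.sum_range (fun r => if r ≤ ρ.val ∧ ρ.val - r < z + 1 then
        C.block v₁ s (ρ - r) * C.block v 0 r ^ (C.q i ^ (ρ.val - r)) else 0),
        ← sum_fin_ite_lt _ (show R i ≤ C.width by omega)]
      refine Finset.sum_congr rfl fun m _ => ?_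
      have hb := C.block_eq v 0 m
      rw [Fin.val_zero] at hb
      simp only [slot_uix, Fin.val_zero, if_true]
      split_ifs with h1 h2 h3 h4 h5
      · rw [hb, sum_pow_q, Finset.mul_sum]
        refine Finset.sum_congr rfl fun c _ => ?_
        rw [smul_pow_q, mul_smul_comm]
      · exact absurd ⟨h1.2.1, h1.2.2⟩ h3
      · exact absurd h1.1 h2
      · exact absurd ⟨h4, h5⟩ h1
      · simp
      · simp
    · intro j _ hj
      refine Finset.sum_eq_zero fun m _ => Finset.sum_eq_zero fun c _ => ?_
      rw [slot_uix, if_neg]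
      exact fun h => hj (Fin.ext h)
    · intro h'; exact absurd (Finset.mem_univ _) h'
  · rw [scale, dif_pos C.scale_index_lt]

theorem compCoeff_smul (i : Fin s) (lam : ℕ → L) (a : K) (x : Fin (R i) → L) (ρ : ℕ) :
    C.compCoeff i lam (fun r => a • x r) ρ = a • C.compCoeff i lam x ρ := by
  rw [compCoeff, compCoeff, Finset.smul_sum]
  refine Finset.sum_congr rfl fun r _ => ?_
  split_ifs
  · rw [smul_pow_q, mul_smul_comm]
  · rw [smul_zero]

theorem compCoeff_eq_zero (i : Fin s) (lam : ℕ → L) (x : Fin (R i) → L) {ρ : ℕ}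
    (h : R i + z ≤ ρ) : C.compCoeff i lam x ρ = 0 := by
  refine Finset.sum_eq_zero fun r _ => ?_
  rw [if_neg]
  have := r.2
  omega

/-- The stage decoder recovers the information of source `i` from what is left of the received
payload, if errors were injected on at most `z` edges. -/
theorem decodeCol_eq {B : ℕ} {E : Type*} {i : Fin s} {Y : Fin B → Header (len R z) → K}
    {S : Finset E} {U : Fin B → E → K} {X : ∀ j, Fin (R j) → L} {ε : E → L}
    {y : Fin B → Fin s → L} {w : Fin B → L}
    (hy : ∀ b j, j ≤ i → y b j = ∑ l, Y b ⟨j, l⟩ • C.g j l)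
    (hw : ∀ b, w b = (∑ h, if h.1 ≤ i then Y b h • C.codeword X h else 0) +
      ∑ e ∈ S, U b e • ε e) {Tr : Fin B → Header (len R z) → K} (hS : S.card ≤ z)
    {Zh : E → Header (len R z) → K}
    (hY : ∀ b h, Y b h = Tr b h + ∑ e ∈ S, U b e * Zh e h)
    (hgood : C.Decodable i Tr) : C.decodeCol i y w = X i := by
  have hN := C.prod_len_pos
  have hWi : R i + 2 * z < C.width := C.len_lt_width i
  -- the key equation has a solution that annihilates the errors
  obtain ⟨lam₀, ⟨a, ha, hane⟩, hann⟩ := C.exists_annihilator i S hS ε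
  -- The intended solution: minus the values of the annihilator at the information of earlier
  -- sources, minus the coefficients of the composition for source `i`, and the annihilator itself
  -- in the last group.
  let β : ℕ → ℕ → L := fun j m => if h : j < s then
      if j = i then -C.compCoeff i lam₀ (X i) m
      else if hm : m < R ⟨j, h⟩ then -C.linPoly i lam₀ (z + 1) (X ⟨j, h⟩ ⟨m, hm⟩) else 0
    else lam₀ m
  have hβ : ∀ b, ∑ u, C.ofBlocks β u • C.keySystem i y w b u = 0 := by
    intro b
    rw [sum_keySystem, C.keyValue_congr i y w b (uu' := fun j => β j) (nu' := β i) (lam' := lam₀),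
      C.keyValue_eq hy hw]
    · rw [Finset.sum_eq_zero, Finset.sum_eq_zero, add_zero]
      · intro e he
        rw [hann e he, smul_zero]
      · rintro ⟨j, l⟩ _
        rw [keyResidue]
        split_ifs with h1 h2
        · rw [Finset.sum_eq_zero, smul_zero]
          intro r _
          have h3 : ¬ j.val = i.val := fun h => (ne_of_lt h1) (Fin.ext h)
          simp [β, h3]
        · simp only at h2
          subst h2
          rw [linPoly_apply, Finset.sum_eq_zero, smul_zero]
          intro m _
          simp [β]
        · rw [smul_zero]
    · intro j hj r hr
      have hWj := C.len_lt_width j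
      exact C.block_ofBlocks β j.2.le (lt_of_lt_of_le hr (by simp only [len] at hWj; omega))
    · intro m hm
      exact C.block_ofBlocks β i.2.le (by omega)
    · intro m hm
      rw [C.block_ofBlocks β le_rfl (by omega)]
      simp [β]
  -- The denominator must not vanish. The search window consists of the `z + 1` slots of the
  -- denominator, and this is a nonzero coordinate in it.
  obtain ⟨c, hc⟩ : ∃ c, C.coords (lam₀ a) c ≠ 0 := by
    by_contra! h
    exact hane (C.coords_ext fun c => by rw [h, coords_zero])
  have haW : a < C.width := by omega
  obtain ⟨hv₁, u₁, hu₁, hvu₁⟩ := C.solve_spec (C.keySystem i y w) ((z + 1) * ∏ i, len R z i) hβ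
    (u := finProdFinEquiv (finProdFinEquiv (Fin.last s, ⟨a, haW⟩), c)) (by
      rw [uix_val, Fin.val_last]
      have e1 : (s * C.width + a) * (∏ i, len R z i) =
        s * C.width * (∏ i, len R z i) + a * ∏ i, len R z i := by ring
      have e2 : (a + 1) * (∏ i, len R z i) ≤ (z + 1) * ∏ i, len R z i := by gcongr; omega
      have e3 : (a + 1) * (∏ i, len R z i) = a * (∏ i, len R z i) + ∏ i, len R z i := by ring
      have := c.2
      rw [e1]
      omega) (by
      rw [ofBlocks, slot_uix]
      simpa [β] using hc)
  change ∀ b, ∑ u, C.keySolution i y w u • _ = 0 at hv₁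
  change C.keySolution i y w u₁ ≠ 0 at hvu₁
  set v₁ := C.keySolution i y w with hv₁def
  have hlam : ∃ a < z + 1, C.block v₁ s a ≠ 0 := by
    obtain ⟨h1, h2⟩ := C.slot_last hu₁
    refine ⟨_, h2, fun h0 => hvu₁ ?_⟩
    rw [← C.coords_block v₁ u₁, h1, h0, coords_zero]
  have hquot : ∀ m < R i + z, C.block v₁ i m + C.compCoeff i (C.block v₁ s) (X i) m = 0 :=
    C.coeff_eq_zero_of_keyValue hy hw hS hY hgood _ _ _ fun b => by
      rw [← sum_keySystem]; exact hv₁ b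
  -- the quotient system is solved by the information
  let β₂ : ℕ → ℕ → L := fun j m => if j = 0 then if hm : m < R i then X i ⟨m, hm⟩ else 0
    else C.prodBasis ⟨0, hN⟩
  have hs0 : s ≠ 0 := by have := i.2; omega
  -- Slots outside group 0 are filled with the first basis element, whose leading coordinate is one.
  -- Of these, the system sees only the scale unknown. As `s` is positive, the last group does not
  -- collide with group 0.
  have hsc : C.ofBlocks β₂ ⟨_, C.scale_index_lt⟩ = 1 := by
    rw [ofBlocks, slot_scale_index]
    simp [β₂, hs0, coords_prodBasis]
  have hβ₂ : ∀ ρ, ∑ u, C.ofBlocks β₂ u • C.quotSystem i v₁ ρ u = 0 := by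
    intro ρ
    rw [sum_quotSystem]
    have hX : (fun r : Fin (R i) => C.block (C.ofBlocks β₂) 0 r) = X i := by
      funext r
      rw [C.block_ofBlocks β₂ (Nat.zero_le _) (by have := r.2; omega)]
      simp [β₂]
    rw [hX, scale, dif_pos C.scale_index_lt, hsc, one_smul]
    split_ifs with h
    · rw [add_comm]; exact hquot ρ h
    · rw [C.compCoeff_eq_zero i _ _ (not_lt.1 h), add_zero]
  obtain ⟨hv₂, u₂, hu₂, hvu₂⟩ := C.solve_spec (C.quotSystem i v₁) 1 hβ₂
    (u := ⟨_, C.scale_index_lt⟩) (by constructor <;> simp) (by rw [hsc]; exact one_ne_zero)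
  have hu₂' : u₂ = ⟨_, C.scale_index_lt⟩ := Fin.ext (by simp only; omega)
  rw [hu₂'] at hvu₂
  have hdec : C.decodeCol i y w = fun r : Fin (R i) => (C.scale (C.solve (C.quotSystem i v₁) 1))⁻¹ •
      C.block (C.solve (C.quotSystem i v₁) 1) 0 r := rfl
  rw [hdec]
  set v₂ := C.solve (C.quotSystem i v₁) 1
  have hscale : C.scale v₂ ≠ 0 := by rw [scale, dif_pos C.scale_index_lt]; exact hvu₂
  -- After division by the scale, the computed quotient and the true information have the same
  -- composition with the nonzero denominator, namely minus the numerator.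
  refine C.compCoeff_injective i (C.block v₁ s) hlam _ _ fun ρ hρ => ?_
  have h1 := hv₂ ⟨ρ, by simp only [len]; omega⟩
  rw [sum_quotSystem, if_pos (by exact hρ)] at h1
  simp only at h1
  have h2 := hquot ρ hρ
  rw [compCoeff_smul, eq_neg_of_add_eq_zero_left h1, eq_neg_of_add_eq_zero_right h2, smul_neg,
    inv_smul_smul₀ hscale]

end TowerCode
end NetCode
end

noncomputable section
open scoped Classical
namespace NetCode
namespace TowerCode

variable {K L : Type*} [Field K] [Fintype K] [Field L] [Algebra K L] {s : ℕ}
  {R : Fin s → ℕ} {z : ℕ} (C : TowerCode K L (len R z))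

/-! ### Successive decoding -/

section Successive

variable {k B : ℕ}

/-- The element that packet `b` combines from the evaluation points of source `j`. -/
def points (Y : Matrix (Fin B) (Position (len R z) k) K) (b : Fin B) (j : Fin s) : L :=
  ∑ l, Y b (Sum.inl ⟨j, l⟩) • C.g j l

/-- Block `κ` of the payload of packet `b`, as an element of the top field. -/
def payload (Y : Matrix (Fin B) (Position (len R z) k) K) (κ : Fin k) (b : Fin B) : L :=
  C.elt fun d => Y b (Sum.inr (κ, d))

/-- The decoder of source `i`. -/
def stage (i : Fin s) (Y : Matrix (Fin B) (Position (len R z) k) K) :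
    Matrix (Fin (R i)) (Payload (len R z) k) K :=
  Matrix.of fun r c =>
    C.coords (C.decodeCol i (C.points Y) (C.payload Y c.1) r) (finPiFinEquiv c.2)

/-- The header of the message matrix is an identity in block `i` and zero elsewhere, so subtraction
clears exactly this block. -/
theorem cancel_header (i : Fin s) (X : Matrix (Fin (R i)) (Payload (len R z) k) K)
    (Y : Matrix (Fin B) (Position (len R z) k) K) (b : Fin B) (h : Header (len R z)) :
    C.cancel i X Y b (Sum.inl h) = if h.1 = i then 0 else Y b (Sum.inl h) := by
  obtain ⟨j, l⟩ := h
  simp only [cancel, Matrix.sub_apply, Matrix.mul_apply, Matrix.submatrix_apply, message,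
    Matrix.of_apply, Sum.elim_inl, mul_ite, mul_one, mul_zero, id_eq]
  split_ifs with hj
  · subst hj
    rw [Finset.sum_eq_single l]
    · simp
    · intro l' _ hl
      rw [if_neg]
      intro he
      rw [Sigma.mk.injEq] at he
      exact hl (eq_of_heq he.2).symm
    · intro h'; exact absurd (Finset.mem_univ _) h'
  · rw [Finset.sum_eq_zero, sub_zero]
    intro l' _
    rw [if_neg]
    intro he
    exact hj (congrArg Sigma.fst he)

theorem elt_sub (v v' : (∀ i, Fin (len R z i)) → K) :
    C.elt (fun d => v d - v' d) = C.elt v - C.elt v' := by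
  simp only [elt, sub_smul, Finset.sum_sub_distrib]

theorem elt_add (v v' : (∀ i, Fin (len R z i)) → K) :
    C.elt (fun d => v d + v' d) = C.elt v + C.elt v' := by
  simp only [elt, add_smul, Finset.sum_add_distrib]

theorem elt_sum {ι : Type*} (S : Finset ι) (a : ι → K) (v : ι → (∀ i, Fin (len R z i)) → K) :
    C.elt (fun d => ∑ x ∈ S, a x * v x d) = ∑ x ∈ S, a x • C.elt (v x) := by
  simp only [elt, Finset.sum_smul, Finset.smul_sum, mul_smul]
  rw [Finset.sum_comm]

variable [FiniteDimensional K L]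

theorem payload_cancel (i : Fin s) (X : Matrix (Fin (R i)) (Payload (len R z) k) K)
    (Y : Matrix (Fin B) (Position (len R z) k) K) (κ : Fin k) (b : Fin B) :
    C.payload (C.cancel i X Y) κ b = C.payload Y κ b -
      ∑ l, Y b (Sum.inl ⟨i, l⟩) • ∑ r, C.gen i l r * C.elt (fun d => X r (κ, d)) := by
  simp only [← elt_message]
  rw [← elt_sum, payload, payload, ← elt_sub]
  rfl

/-- The subtracted payload is the information polynomial of source `i` evaluated at the combined
point, again because powers are `K`-linear. The program cancels in this form and never has to unfold
a codeword. -/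
theorem payload_cancel_points (i : Fin s) (X : Matrix (Fin (R i)) (Payload (len R z) k) K)
    (Y : Matrix (Fin B) (Position (len R z) k) K) (κ : Fin k) (b : Fin B) :
    C.payload (C.cancel i X Y) κ b = C.payload Y κ b -
      ∑ r : Fin (R i), C.points Y b i ^ (C.q i ^ r.val) * C.elt (fun d => X r (κ, d)) := by
  rw [payload_cancel]
  congr 1
  simp only [points, pow_q_sum_smul_g, Finset.smul_sum, Finset.sum_mul]
  rw [Finset.sum_comm]
  exact Finset.sum_congr rfl fun r _ => Finset.sum_congr rfl fun l _ => by
    rw [gen_apply, smul_mul_assoc]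

theorem residual_header (δ : ∀ i, Matrix (Fin B) (Position (len R z) k) K →
      Matrix (Fin (R i)) (Payload (len R z) k) K) (Y : Matrix (Fin B) (Position (len R z) k) K)
    (m : ℕ) (b : Fin B) (h : Header (len R z)) :
    C.residual δ Y m b (Sum.inl h) = if h.1.val + m < s then Y b (Sum.inl h) else 0 := by
  induction m with
  | zero => rw [residual, if_pos (by have := h.1.2; omega)]
  | succ m ih =>
    rw [residual]
    split_ifs with h1 h2 h2
    · rw [cancel_header, ih, if_neg, if_pos (by omega)]
      rintro h3
      rw [h3, Fin.val_rev] at h2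
      simp only at h2
      omega
    · rw [cancel_header, ih]
      split_ifs with h3 h4
      · rfl
      · exfalso
        apply h3
        apply Fin.ext
        rw [Fin.val_rev]
        simp only
        omega
      · rfl
    · omega
    · rw [ih, if_neg (by omega)]

/-- Only blocks of sources already decoded have been cleared. So the combined points, and their
powers, can be computed once for all stages. -/
theorem points_residual (δ : ∀ i, Matrix (Fin B) (Position (len R z) k) K →
      Matrix (Fin (R i)) (Payload (len R z) k) K) (Y : Matrix (Fin B) (Position (len R z) k) K)
    (m : ℕ) (b : Fin B) {j : Fin s} (hj : j.val + m < s) :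
    C.points (C.residual δ Y m) b j = C.points Y b j := by
  rw [points, points]
  exact Finset.sum_congr rfl fun l _ => by rw [residual_header, if_pos (by exact hj)]

theorem residual_succ (δ : ∀ i, Matrix (Fin B) (Position (len R z) k) K →
      Matrix (Fin (R i)) (Payload (len R z) k) K) (Y : Matrix (Fin B) (Position (len R z) k) K)
    (i : Fin s) : C.residual δ Y (i.rev.val + 1) =
      C.cancel i (δ i (C.residual δ Y i.rev)) (C.residual δ Y i.rev) := by
  have key : ∀ j, j = i → C.cancel j (δ j (C.residual δ Y i.rev)) (C.residual δ Y i.rev) =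
      C.cancel i (δ i (C.residual δ Y i.rev)) (C.residual δ Y i.rev) := by
    rintro _ rfl; rfl
  rw [residual, dif_pos i.rev.2]
  exact key _ (Fin.rev_rev i)

/-- What is left of the payload when the last `m` sources have been decoded. -/
theorem residual_stage_succ (Y : Matrix (Fin B) (Position (len R z) k) K) (i : Fin s) (κ : Fin k)
    (b : Fin B) :
    C.payload (C.residual C.stage Y (i.rev.val + 1)) κ b =
      C.payload (C.residual C.stage Y i.rev) κ b -
        ∑ r : Fin (R i), C.points Y b i ^ (C.q i ^ r.val) *
          C.decodeCol i (C.points Y) (C.payload (C.residual C.stage Y i.rev) κ) r := by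
  have hi : i.val + i.rev.val < s := by rw [Fin.val_rev]; omega
  rw [residual_succ, payload_cancel_points, points_residual _ _ _ _ _ hi]
  congr 1
  refine Finset.sum_congr rfl fun r _ => ?_
  congr 1
  refine C.coords_ext fun c => ?_
  rw [coords_elt, stage, Matrix.of_apply, Equiv.apply_symm_apply]
  rw [decodeCol_congr _ fun b j hj => C.points_residual C.stage Y i.rev b (j := j) (by
    have : j.val ≤ i.val := hj
    omega)]

theorem stage_residual (Y : Matrix (Fin B) (Position (len R z) k) K) (i : Fin s) (r : Fin (R i))
    (κ : Fin k) (d : ∀ i, Fin (len R z i)) :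
    C.successive C.stage Y i r (κ, d) = C.coords (C.decodeCol i (C.points Y)
      (C.payload (C.residual C.stage Y i.rev) κ) r) (finPiFinEquiv d) := by
  have hi : i.val + i.rev.val < s := by rw [Fin.val_rev]; omega
  rw [successive, stage, Matrix.of_apply]
  rw [decodeCol_congr _ fun b j hj => C.points_residual C.stage Y i.rev b (j := j) (by
    have : j.val ≤ i.val := hj
    omega)]

theorem message_header (i : Fin s) (X : Matrix (Fin (R i)) (Payload (len R z) k) K)
    (l : Fin (len R z i)) (h : Header (len R z)) :
    C.message i X l (Sum.inl h) = if h = ⟨i, l⟩ then 1 else 0 := rfl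

/-- Successive decoding recovers the information of all sources. -/
theorem successive_eq {E : Type*} {S : Finset E} (hS : S.card ≤ z) (X : Info K R z k)
    {U : Fin B → E → K} {Z : E → Position (len R z) k → K} {Tr : Fin B → Header (len R z) → K}
    {Y : Matrix (Fin B) (Position (len R z) k) K}
    (hY : ∀ b p, Y b p = (∑ h : Header (len R z), Tr b h * C.message h.1 (X h.1) h.2 p) +
      ∑ e ∈ S, U b e * Z e p)
    (hgood : ∀ i, C.Decodable i Tr) : C.successive C.stage Y = X := by
  let x : Fin k → ∀ j, Fin (R j) → L := fun κ j r => C.elt fun d => X j r (κ, d)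
  -- The effective error of an edge: its injected payload minus the codewords that its forged header
  -- announces. With this choice the payload equation holds with the received header in place of the
  -- unknown transfer matrix.
  let ε : Fin k → E → L := fun κ e => C.elt (fun d => Z e (Sum.inr (κ, d))) -
    ∑ h, Z e (Sum.inl h) • C.codeword (x κ) h
  have hhead : ∀ b h, Y b (Sum.inl h) = Tr b h + ∑ e ∈ S, U b e * Z e (Sum.inl h) := by
    intro b h
    rw [hY]
    simp only [message_header, Sigma.eta, mul_ite, mul_one, mul_zero]
    rw [Finset.sum_ite_eq Finset.univ h, if_pos (Finset.mem_univ _)]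
  have hpay : ∀ κ b, C.payload Y κ b =
      (∑ h, Y b (Sum.inl h) • C.codeword (x κ) h) + ∑ e ∈ S, U b e • ε κ e := by
    intro κ b
    have h1 : C.payload Y κ b = (∑ h, Tr b h • C.codeword (x κ) h) +
        ∑ e ∈ S, U b e • C.elt (fun d => Z e (Sum.inr (κ, d))) := by
      rw [payload]
      simp only [hY]
      rw [elt_add, elt_sum, elt_sum]
      simp only [elt_message]
      rfl
    rw [h1]
    simp only [hhead, add_smul, Finset.sum_add_distrib, ε, smul_sub, Finset.sum_sub_distrib,
      Finset.sum_smul, Finset.smul_sum, mul_smul]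
    rw [Finset.sum_comm (s := Finset.univ) (t := S)]
    abel
  have hcol : ∀ (i : Fin s) κ,
      (∀ b, C.payload (C.residual C.stage Y i.rev) κ b =
        (∑ h : Header (len R z), if h.1 ≤ i then Y b (Sum.inl h) • C.codeword (x κ) h else 0) +
          ∑ e ∈ S, U b e • ε κ e) →
      C.decodeCol i (C.points Y) (C.payload (C.residual C.stage Y i.rev) κ) = x κ i := by
    intro i κ h
    exact C.decodeCol_eq (Y := fun b h => Y b (Sum.inl h)) (fun b j _ => rfl) h hS hhead (hgood i)
  -- The same errors on the same edges persist at every stage: cancellation uses the received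
  -- header, which already contains the forged parts, so it introduces no new error.
  have hres : ∀ m, ∀ hm : m < s, ∀ κ b, C.payload (C.residual C.stage Y m) κ b =
      (∑ h : Header (len R z), if h.1 ≤ Fin.rev ⟨m, hm⟩ then
        Y b (Sum.inl h) • C.codeword (x κ) h else 0) + ∑ e ∈ S, U b e • ε κ e := by
    intro m
    induction m with
    | zero =>
      intro hm κ b
      rw [residual, hpay]
      congr 1
      refine Finset.sum_congr rfl fun h _ => ?_
      rw [if_pos]
      rw [Fin.le_def, Fin.val_rev]
      have := h.1.2
      simp only
      omega
    | succ m ih =>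
      intro hm κ b
      have hm' : m < s := by omega
      set i : Fin s := Fin.rev ⟨m, hm'⟩ with hi
      have hrev : i.rev.val = m := by rw [hi, Fin.rev_rev]
      have h1 := C.residual_stage_succ Y i κ b
      have h2 := hcol i κ (by rw [hrev]; exact ih hm' κ)
      rw [h2, hrev, ih hm' κ b] at h1
      rw [h1]
      have h3 : ∑ r : Fin (R i), C.points Y b i ^ (C.q i ^ r.val) * x κ i r =
          ∑ h : Header (len R z), if h.1 = i then Y b (Sum.inl h) • C.codeword (x κ) h else 0 := by
        rw [Fintype.sum_sigma, Finset.sum_eq_single i]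
        · simp only [if_true, points, pow_q_sum_smul_g, codeword, Finset.smul_sum, Finset.sum_mul]
          rw [Finset.sum_comm]
          exact Finset.sum_congr rfl fun r _ => Finset.sum_congr rfl fun l _ => by
            rw [gen_apply, smul_mul_assoc]
        · intro j _ hj
          exact Finset.sum_eq_zero fun l _ => if_neg hj
        · intro h'; exact absurd (Finset.mem_univ _) h'
      rw [h3, add_sub_right_comm, ← Finset.sum_sub_distrib]
      congr 1
      refine Finset.sum_congr rfl fun h _ => ?_
      have hiv : i.val = s - (m + 1) := by rw [hi, Fin.val_rev]
      have hjv : (Fin.rev ⟨m + 1, hm⟩ : Fin s).val = s - (m + 1 + 1) := by rw [Fin.val_rev]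
      rcases lt_trichotomy h.1 i with hlt | heq | hgt
      · have : h.1.val < i.val := hlt
        rw [if_pos hlt.le, if_neg hlt.ne, sub_zero, if_pos]
        rw [Fin.le_def]; omega
      · have : h.1.val = i.val := congrArg Fin.val heq
        rw [if_pos heq.le, if_pos heq, sub_self, if_neg]
        rw [Fin.le_def]; omega
      · have : i.val < h.1.val := hgt
        rw [if_neg hgt.not_ge, if_neg hgt.ne', sub_zero, if_neg]
        rw [Fin.le_def]; omega
  funext i
  ext r c
  obtain ⟨κ, d⟩ := c
  rw [stage_residual, hcol i κ, coords_elt, Equiv.symm_apply_apply]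
  intro b
  have := hres i.rev i.rev.2 κ b
  simpa only [Fin.eta, Fin.rev_rev] using this

end Successive

end TowerCode
end NetCode
end

noncomputable section
open scoped Classical
namespace NetCode
namespace TowerCode

variable {K L : Type*} [Field K] [Fintype K] [Field L] [Algebra K L] {s : ℕ}
  {R : Fin s → ℕ} {z : ℕ} (C : TowerCode K L (len R z)) [FiniteDimensional K L]

/-! ### The probability that all stages are decodable -/

theorem stageVec_of_lt {i j : Fin s} (h : j < i) (l : Fin (len R z j)) :
    C.stageVec i ⟨j, l⟩ = ∑ r, (⟨C.gen j l r, C.gen_mem_of_lt h l r⟩ : C.F i.castSucc) •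
      Pi.single (M := fun _ : C.StageIdx i => C.F i.castSucc) (Sum.inl ⟨⟨j, h⟩, r⟩) 1 := by
  funext x
  rw [Finset.sum_apply]
  simp only [Pi.smul_apply, Pi.single_apply, smul_eq_mul, mul_ite, mul_one, mul_zero, stageVec]
  rcases x with ⟨⟨j', hj'⟩, r'⟩ | l'
  · simp only [Sum.elim_inl]
    by_cases hjj : j' = j
    · subst hjj
      rw [Finset.sum_eq_single l, Finset.sum_eq_single r']
      · simp
      · intro b _ hb
        rw [if_neg]
        intro he
        simp only [Sum.inl.injEq, Sigma.mk.injEq, heq_eq_eq, true_and] at he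
        exact hb he.symm
      · intro h'; exact absurd (Finset.mem_univ _) h'
      · intro b _ hb
        rw [if_neg]
        intro he
        simp only [Sigma.mk.injEq, heq_eq_eq, true_and] at he
        exact hb he.symm
      · intro h'; exact absurd (Finset.mem_univ _) h'
    · rw [Finset.sum_eq_zero, Finset.sum_eq_zero]
      · intro b _
        rw [if_neg]
        intro he
        simp only [Sum.inl.injEq, Sigma.mk.injEq, Subtype.mk.injEq] at he
        exact hjj he.1
      · intro b _
        rw [if_neg]
        intro he
        exact hjj (congrArg Sigma.fst he).symm
  · simp only [Sum.elim_inr, reduceCtorEq, if_false, Finset.sum_const_zero]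
    rw [if_neg]
    intro he
    exact h.ne (congrArg Sigma.fst he)

theorem stageVec_self (i : Fin s) (l : Fin (len R z i)) :
    C.stageVec i ⟨i, l⟩ =
      Pi.single (M := fun _ : C.StageIdx i => C.F i.castSucc) (Sum.inr l) 1 := by
  funext x
  simp only [Pi.single_apply, stageVec]
  rcases x with ⟨⟨j', hj'⟩, r'⟩ | l'
  · simp only [Sum.elim_inl, reduceCtorEq, if_false]
    refine Finset.sum_eq_zero fun b _ => ?_
    rw [if_neg]
    intro he
    exact hj'.ne (congrArg Sigma.fst he).symm
  · simp only [Sum.elim_inr, Sum.inr.injEq, Sigma.mk.injEq, heq_eq_eq, true_and]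
    simp only [eq_comm]

/-- The source to which a coordinate of stage `i` belongs. -/
def owner (i : Fin s) : C.StageIdx i → Fin s := Sum.elim (fun p => p.1.1) fun _ => i

/-- The packets of some sources span the coordinates that belong to these sources. -/
theorem single_mem_span (i : Fin s) (Q : Set (Fin s)) (x : C.StageIdx i) (hx : C.owner i x ∈ Q) :
    Pi.single (M := fun _ : C.StageIdx i => C.F i.castSucc) x 1 ∈
      Submodule.span (C.F i.castSucc) (C.stageVec i '' {h | h.1 ∈ Q}) := by
  by_contra hn
  -- A functional that vanishes on the packets but not on the coordinate would, for an earlier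
  -- source `j`, be a linearized polynomial with `R j` coefficients and `n j ≥ R j` independent
  -- zeros. For source `i` the coordinate is itself a packet.
  obtain ⟨f, hf, hle⟩ := Submodule.exists_le_ker_of_notMem hn
  have hzero : ∀ h : Header (len R z), h.1 ∈ Q → f (C.stageVec i h) = 0 := fun h hh =>
    hle (Submodule.subset_span ⟨h, hh, rfl⟩)
  rcases x with ⟨⟨j, hj⟩, r⟩ | l
  · have hjQ : j ∈ Q := hx
    have hker : ∀ l, C.linPoly j (fun r => if hr : r < R j then
        ((f (Pi.single (Sum.inl ⟨⟨j, hj⟩, ⟨r, hr⟩⟩) 1) : C.F i.castSucc) : L) else 0) (R j)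
        (C.g j l) ∈ (⊥ : Submodule (C.F j.castSucc) L) := by
      intro l
      rw [Submodule.mem_bot, linPoly_apply, Finset.sum_range]
      have h1 := congrArg (C.F i.castSucc).val (hzero ⟨j, l⟩ hjQ)
      rw [C.stageVec_of_lt hj, map_sum, map_sum, map_zero] at h1
      rw [← h1]
      refine Finset.sum_congr rfl fun r _ => ?_
      rw [dif_pos r.2, map_smul, smul_eq_mul, map_mul, mul_comm]
      rfl
    have h2 := C.linPoly_coeff_eq_zero_of_mem j _ (R j) ⊥ (by simp [len]) hker r r.2
    rw [dif_pos r.2] at h2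
    exact hf (Subtype.ext h2)
  · apply hf
    rw [← stageVec_self]
    exact hzero _ hx

theorem card_owner_notMem (i : Fin s) (Q : Set (Fin s)) :
    (Finset.univ.filter fun x => C.owner i x ∉ Q).card =
      (∑ j : {j // j < i}, if j.1 ∉ Q then R j.1 else 0) + if i ∉ Q then len R z i else 0 := by
  rw [Finset.card_filter, Fintype.sum_sum_type, Fintype.sum_sigma]
  simp only [owner, Sum.elim_inl, Sum.elim_inr]
  congr 1
  · refine Finset.sum_congr rfl fun x _ => ?_
    by_cases h : x.1 ∈ Q <;> simp [h]
  · by_cases h : i ∈ Q <;> simp [h]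

/-- The packets of the sources in `Q` span all coordinates that these sources own; the rest is
counted. A missing earlier source costs `R j`, and source `i` costs `R i + 2 z`, so the extra `2 z`
occurs at most once. This is why the rate conditions ask for it once per set of sources. -/
theorem finrank_le_span (i : Fin s) (Q : Set (Fin s)) :
    Module.finrank (C.F i.castSucc) (C.StageIdx i → C.F i.castSucc) ≤
      Module.finrank (C.F i.castSucc)
        (Submodule.span (C.F i.castSucc) (C.stageVec i '' {h | h.1 ∈ Q})) +
      if ∀ j ≤ i, j ∈ Q then 0 else (∑ j : Fin s with j ≤ i ∧ j ∉ Q, R j) + 2 * z := by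
  have h1 : (Finset.univ.filter fun x => C.owner i x ∈ Q).card ≤ Module.finrank (C.F i.castSucc)
        (Submodule.span (C.F i.castSucc) (C.stageVec i '' {h | h.1 ∈ Q})) := by
    have hli := (Pi.basisFun (C.F i.castSucc) (C.StageIdx i)).linearIndependent.comp
      (Subtype.val : {x // C.owner i x ∈ Q} → C.StageIdx i) Subtype.val_injective
    rw [← Fintype.card_subtype, ← finrank_span_eq_card hli]
    refine Submodule.finrank_mono (Submodule.span_le.2 ?_)
    rintro _ ⟨x, rfl⟩
    simp only [Function.comp_apply, Pi.basisFun_apply]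
    exact C.single_mem_span i Q x.1 x.2
  have h2 := Finset.card_filter_add_card_filter_not (s := Finset.univ)
    (fun x : C.StageIdx i => C.owner i x ∈ Q)
  rw [Module.finrank_fintype_fun_eq_card, ← Finset.card_univ, ← h2, card_owner_notMem]
  refine add_le_add h1 ?_
  have hsum : (∑ j : {j // j < i}, if j.1 ∉ Q then R j.1 else 0) =
      ∑ j : Fin s with j < i ∧ j ∉ Q, R j := by
    rw [← Finset.sum_subtype (Finset.univ.filter fun j : Fin s => j < i) (by simp)
      (fun j => if j ∉ Q then R j else 0), ← Finset.sum_filter, Finset.filter_filter]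
  rw [hsum]
  by_cases h3 : i ∈ Q
  · rw [if_neg (not_not.2 h3), add_zero]
    split_ifs with h4
    · refine le_of_eq (Finset.sum_eq_zero fun j hj => ?_)
      simp only [Finset.mem_filter, Finset.mem_univ, true_and] at hj
      exact absurd (h4 j hj.1.le) hj.2
    · refine le_trans (Finset.sum_le_sum_of_subset ?_) (Nat.le_add_right _ _)
      intro j
      simp only [Finset.mem_filter, Finset.mem_univ, true_and]
      exact fun h => ⟨h.1.le, h.2⟩
  · rw [if_pos h3, if_neg fun h => h3 (h i le_rfl)]
    have : Finset.univ.filter (fun j : Fin s => j ≤ i ∧ j ∉ Q) =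
        insert i (Finset.univ.filter fun j : Fin s => j < i ∧ j ∉ Q) := by
      ext j
      simp only [Finset.mem_filter, Finset.mem_univ, true_and, Finset.mem_insert, le_iff_eq_or_lt]
      constructor
      · rintro ⟨rfl | h, h'⟩
        · exact Or.inl rfl
        · exact Or.inr ⟨h, h'⟩
      · rintro (rfl | ⟨h, h'⟩)
        · exact ⟨Or.inl rfl, h3⟩
        · exact ⟨Or.inr h, h'⟩
    rw [this, Finset.sum_insert (by simp)]
    simp only [len]
    omega

section Network

variable {V E : Type*} [Finite V] [Fintype E] (net : Network V E) (src : Fin s → V)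

/-- The coefficient of source packet `h` on edge `e`. -/
def transfer (_C : TowerCode K L (len R z)) (ω : Coeffs K (len R z) E) (e : E)
    (h : Header (len R z)) : K :=
  net.flow (fun h : Header (len R z) => src h.1) ω
    (fun h => (Pi.single h 1 : Header (len R z) → K)) 0 e h

theorem flow_eq_sum_transfer {A : Type*} [AddCommGroup A] [Module K A]
    (ω : Coeffs K (len R z) E) (μ : Header (len R z) → A) (e : E) :
    net.flow (fun h : Header (len R z) => src h.1) ω μ 0 e =
      ∑ h, C.transfer net src ω e h • μ h := by
  have h1 := net.map_flow (fun h : Header (len R z) => src h.1) ω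
    (fun h => (Pi.single h 1 : Header (len R z) → K)) 0 (Fintype.linearCombination K μ) e
  rw [Fintype.linearCombination_apply] at h1
  rw [show (∑ h, C.transfer net src ω e h • μ h) = _ from h1]
  congr 1
  · funext h
    rw [Fintype.linearCombination_apply_single, one_smul]
  · funext e
    simp

/-- Random coding is applied to the stage space over `F i.castSucc`. Of this space, a set `A` around
the sink lacks at most the coordinates of the sources outside `A`, and the rate condition for these
sources provides enough edges into `A`. -/
theorem ncard_not_decodable {t : V} {B : ℕ} (ord : Fin B ≃ {e : E // net.head e = t})
    (sinks : Set V) (ht : t ∈ sinks) (hsrc : ∀ i, src i ∉ sinks)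
    (hcut : ∀ I : Finset (Fin s), I.Nonempty →
      (((∑ i ∈ I, R i) + 2 * z : ℕ) : ℕ∞) ≤
        net.multicastCut (src '' (I : Set (Fin s))) sinks) (i : Fin s) :
    {ω : Coeffs K (len R z) E |
      ¬ C.Decodable i fun b => C.transfer net src ω (ord b)}.ncard * Nat.card K ≤
      Fintype.card E * Nat.card (Coeffs K (len R z) E) := by
  have h := net.card_span_ne_top (K := K) (𝕜 := C.F i.castSucc)
    (fun h : Header (len R z) => src h.1) (C.stageVec i) t
    (fun h he => hsrc h.1 (he ▸ ht)) ?_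
  · convert h using 3
    ext ω
    simp only [Decodable, Set.mem_ofPred_eq]
    simp only [← C.flow_eq_sum_transfer net src]
    rw [show (net.flow (fun h : Header (len R z) => src h.1) ω (C.stageVec i) 0 ''
      {e | net.head e = t}) = Set.range fun b => net.flow (fun h : Header (len R z) => src h.1) ω
        (C.stageVec i) 0 (ord b) from ?_]
    ext x
    constructor
    · rintro ⟨e, he, rfl⟩
      exact ⟨ord.symm ⟨e, he⟩, by simp⟩
    · rintro ⟨b, rfl⟩
      exact ⟨_, (ord b).2, rfl⟩
  · intro A hA
    refine (C.finrank_le_span i {j | src j ∈ A}).trans (Nat.add_le_add_left ?_ _)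
    split_ifs with hall
    · exact Nat.zero_le _
    · push Not at hall
      obtain ⟨j₀, hj₀, hj₀A⟩ := hall
      -- The relevant set consists of the sources up to `i` that lie outside `A`. The complement of
      -- `A` is then one of the cuts that separate them from `t`.
      have h1 := hcut (Finset.univ.filter fun j => j ≤ i ∧ j ∉ ({j | src j ∈ A} : Set (Fin s)))
        ⟨j₀, by simp only [Finset.mem_filter, Finset.mem_univ, true_and]; exact ⟨hj₀, hj₀A⟩⟩
      have h2 : net.multicastCut (src '' ((Finset.univ.filter fun j =>
          j ≤ i ∧ j ∉ ({j | src j ∈ A} : Set (Fin s)) : Finset (Fin s)) : Set (Fin s))) sinks ≤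
          {e : E | net.tail e ∈ Aᶜ ∧ net.head e ∉ Aᶜ}.encard := by
        refine (iInf₂_le t ht).trans ((iInf_le _ Aᶜ).trans ((iInf_le _ ?_).trans (iInf_le _ ?_)))
        · rintro _ ⟨j, hj, rfl⟩
          simp only [Finset.coe_filter, Finset.mem_univ, true_and] at hj
          exact hj.2
        · exact fun h => h hA
      have h3 := h1.trans h2
      rw [← Set.Finite.cast_ncard_eq (Set.toFinite _), Nat.cast_le] at h3
      convert h3 using 3
      ext e
      simp

end Network

end TowerCode
end NetCode
end

/-! ### The received matrix as a function of messages and injected packets -/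

noncomputable section
open scoped Classical
namespace NetCode
namespace TowerCode

variable {K L : Type*} [Field K] [Fintype K] [Field L] [Algebra K L] {s : ℕ}
  {R : Fin s → ℕ} {z : ℕ} (C : TowerCode K L (len R z)) [FiniteDimensional K L]
  {V E : Type*} [Finite V] [Fintype E] (net : Network V E) (src : Fin s → V)

/-- The coefficient of the packet that the adversary adds on edge `e'` in the packet of edge
`e`. -/
def injection (_C : TowerCode K L (len R z)) (ω : Coeffs K (len R z) E) (e e' : E) : K :=
  net.flow (fun h : Header (len R z) => src h.1) ω (fun _ => (0 : E → K))
    (fun e' => Pi.single e' 1) e e'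

/-- The network is run once on formal unit vectors, one for each source packet and one for each
injection. The actual packets are the image of this run under a linear map. -/
theorem packet_eq_sum {k : ℕ} (ω : Coeffs K (len R z) E) (X : Info K R z k)
    (Z : E → Position (len R z) k → K) (e : E) :
    C.packet net src ω X Z e =
      (∑ h : Header (len R z), C.transfer net src ω e h • C.message h.1 (X h.1) h.2) +
      ∑ e', C.injection net src ω e e' • Z e' := by
  let f : ((Header (len R z) → K) × (E → K)) →ₗ[K] (Position (len R z) k → K) :=
    LinearMap.coprod (Fintype.linearCombination K fun h => C.message h.1 (X h.1) h.2)
      (Fintype.linearCombination K Z)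
  have h1 := net.map_flow (fun h : Header (len R z) => src h.1) ω
    (fun h => ((Pi.single h 1, 0) : (Header (len R z) → K) × (E → K)))
    (fun e' => (0, Pi.single e' 1)) f e
  have h2 := net.map_flow (fun h : Header (len R z) => src h.1) ω
    (fun h => ((Pi.single h 1, 0) : (Header (len R z) → K) × (E → K)))
    (fun e' => (0, Pi.single e' 1)) (LinearMap.fst K _ _) e
  have h3 := net.map_flow (fun h : Header (len R z) => src h.1) ω
    (fun h => ((Pi.single h 1, 0) : (Header (len R z) → K) × (E → K)))
    (fun e' => (0, Pi.single e' 1)) (LinearMap.snd K _ _) e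
  have h4 : C.packet net src ω X Z e = net.flow (fun h : Header (len R z) => src h.1) ω
      (fun h => f (Pi.single h 1, 0)) (fun e' => f (0, Pi.single e' 1)) e := by
    simp only [f, LinearMap.coprod_apply, map_zero, add_zero, zero_add,
      Fintype.linearCombination_apply_single, one_smul]
    rfl
  rw [h4, ← h1, LinearMap.coprod_apply, Fintype.linearCombination_apply,
    Fintype.linearCombination_apply]
  congr 1
  · refine Finset.sum_congr rfl fun h _ => ?_
    rw [transfer]
    congr 1
    exact congrFun h2 h
  · refine Finset.sum_congr rfl fun e' _ => ?_
    rw [injection]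
    congr 1
    exact congrFun h3 e'

theorem received_eq {k B : ℕ} {t : V} (ord : Fin B ≃ {e : E // net.head e = t})
    (ω : Coeffs K (len R z) E) (X : Info K R z k) (Z : E → Position (len R z) k → K)
    (b : Fin B) (p : Position (len R z) k) :
    C.received net src ord ω X Z b p =
      (∑ h : Header (len R z), C.transfer net src ω (ord b) h * C.message h.1 (X h.1) h.2 p) +
      ∑ e' ∈ Finset.univ.filter (fun e => Z e ≠ 0), C.injection net src ω (ord b) e' * Z e' p := by
  rw [received, Matrix.of_apply, packet_eq_sum, Pi.add_apply, Finset.sum_apply, Finset.sum_apply]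
  congr 1
  refine (Finset.sum_subset (Finset.filter_subset _ _) ?_).symm
  intro e' _ he'
  simp only [Finset.mem_filter, Finset.mem_univ, true_and, not_not] at he'
  rw [he', smul_zero, Pi.zero_apply]

/-- Unless some source is not decodable from the transfer matrix, decoding succeeds. -/
theorem successive_received {k B : ℕ} {t : V} (ord : Fin B ≃ {e : E // net.head e = t})
    (ω : Coeffs K (len R z) E) (hω : ∀ i, C.Decodable i fun b => C.transfer net src ω (ord b))
    (X : Info K R z k) (Z : E → Position (len R z) k → K) (hZ : {e | Z e ≠ 0}.ncard ≤ z) :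
    C.successive C.stage (C.received net src ord ω X Z) = X := by
  refine C.successive_eq (S := Finset.univ.filter fun e => Z e ≠ 0)
    (U := fun b e' => C.injection net src ω (ord b) e') (Z := Z) ?_ X
    (C.received_eq net src ord ω X Z) hω
  rw [Set.ncard_eq_toFinset_card', Set.toFinset_ofPred] at hZ
  exact hZ

/-- A union bound over the stages. The event mentions only the local coefficients, so it is the same
for all information and all injections. -/
theorem le_uniform_decodable {B : ℕ} {t : V} (ord : Fin B ≃ {e : E // net.head e = t})
    (sinks : Set V) (ht : t ∈ sinks) (hsrc : ∀ i, src i ∉ sinks)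
    (hcut : ∀ I : Finset (Fin s), I.Nonempty →
      (((∑ i ∈ I, R i) + 2 * z : ℕ) : ℕ∞) ≤
        net.multicastCut (src '' (I : Set (Fin s))) sinks) [inst : Fintype (Coeffs K (len R z) E)] :
    ENNReal.ofReal (1 - (s : ℝ) * Fintype.card E / Fintype.card K) ≤
      (PMF.uniformOfFintype (Coeffs K (len R z) E)).toOuterMeasure
        {ω | ∀ i, C.Decodable i fun b => C.transfer net src ω (ord b)} := by
  rw [PMF.toOuterMeasure_uniformOfFintype_apply]
  set good : Set (Coeffs K (len R z) E) :=
    {ω | ∀ i, C.Decodable i fun b => C.transfer net src ω (ord b)} with hgood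
  have h1 : goodᶜ.ncard * Nat.card K ≤
      s * (Fintype.card E * Nat.card (Coeffs K (len R z) E)) := by
    have hsub : goodᶜ ⊆ ⋃ i ∈ (Finset.univ : Finset (Fin s)), {ω : Coeffs K (len R z) E |
        ¬ C.Decodable i fun b => C.transfer net src ω (ord b)} := by
      intro ω hω
      simp only [hgood, Set.mem_compl_iff, Set.mem_ofPred_eq, not_forall] at hω
      obtain ⟨i, hi⟩ := hω
      simp only [Set.mem_iUnion]
      exact ⟨i, Finset.mem_univ _, hi⟩
    calc goodᶜ.ncard * Nat.card K
        ≤ (∑ i : Fin s, {ω : Coeffs K (len R z) E |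
            ¬ C.Decodable i fun b => C.transfer net src ω (ord b)}.ncard) * Nat.card K := by
          refine Nat.mul_le_mul_right _ ((Set.ncard_le_ncard hsub (Set.toFinite _)).trans ?_)
          exact Finset.set_ncard_biUnion_le _ _
      _ ≤ ∑ _i : Fin s, Fintype.card E * Nat.card (Coeffs K (len R z) E) := by
          rw [Finset.sum_mul]
          exact Finset.sum_le_sum fun i _ =>
            C.ncard_not_decodable net src ord sinks ht hsrc hcut i
      _ = _ := by simp
  have h2 := Set.ncard_add_ncard_compl good (Set.toFinite _) (Set.toFinite _)
  rw [← Nat.card_eq_fintype_card (α := good), Nat.card_coe_set_eq,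
    ← Nat.card_eq_fintype_card (α := Coeffs K (len R z) E)]
  rw [Nat.card_eq_fintype_card (α := K)] at h1
  set Ω := Nat.card (Coeffs K (len R z) E) with hΩ
  have hΩ0 : 0 < Ω := Nat.card_pos
  have hq : 0 < Fintype.card K := Fintype.card_pos
  have hkey : (1 : ℝ) - (s : ℝ) * Fintype.card E / Fintype.card K ≤ good.ncard / Ω := by
    rw [le_div_iff₀ (by exact_mod_cast hΩ0), sub_mul, one_mul]
    have h1' : (goodᶜ.ncard : ℝ) * Fintype.card K ≤ s * (Fintype.card E * Ω) := by
      exact_mod_cast h1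
    have h2' : (good.ncard : ℝ) + goodᶜ.ncard = Ω := by exact_mod_cast h2
    have h3 : (goodᶜ.ncard : ℝ) ≤ (s : ℝ) * Fintype.card E / Fintype.card K * Ω := by
      rw [div_mul_eq_mul_div, le_div_iff₀ (by exact_mod_cast hq)]
      linarith
    linarith
  refine (ENNReal.ofReal_le_ofReal hkey).trans (le_of_eq ?_)
  rw [ENNReal.ofReal_div_of_pos (by exact_mod_cast hΩ0), ENNReal.ofReal_natCast,
    ENNReal.ofReal_natCast]

end TowerCode
end NetCode
end

noncomputable section
open scoped Classical
namespace NetCode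

/-! ### A structured language with arrays

Programs of this language work on arrays with four indices and never write integer cells other
than loop counters. -/

/-- Memory for arrays: array number, then four indices. -/
abbrev Mem (K : Type*) := ℕ → ℕ → ℕ → ℕ → ℕ → K

/-- Expressions for field elements that read array entries. -/
inductive AExp
  | zero
  | one
  | rd (a : ℕ) (i j l q : IntExp)
  | sub (x y : AExp)
  | mul (x y : AExp)
  | inv (x : AExp)

/-- The value of an expression. -/
def AExp.val {K : Type*} [Field K] (σ : ℕ → ℕ) (m : Mem K) : AExp → K
  | zero => 0
  | one => 1
  | rd a i j l q => m a (i.eval σ) (j.eval σ) (l.eval σ) (q.eval σ)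
  | sub x y => x.val σ m - y.val σ m
  | mul x y => x.val σ m * y.val σ m
  | inv x => (x.val σ m)⁻¹

/-- The arrays that an expression reads. -/
def AExp.reads : AExp → List ℕ
  | zero => []
  | one => []
  | rd a _ _ _ _ => [a]
  | sub x y => x.reads ++ y.reads
  | mul x y => x.reads ++ y.reads
  | inv x => x.reads

/-- Statements. In `asg a i j l q ls x` the sum of `x` over the ranges in `ls` is assigned; a range
is a counter together with the address of the cell that holds the number of rounds. The second
argument of `loop` is such an address, too. -/
inductive Stm
  | skip
  | asg (a : ℕ) (i j l q : IntExp) (ls : List (ℕ × IntExp)) (x : AExp)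
  | seq (P Q : Stm)
  | ifLt (a b : IntExp) (P Q : Stm)
  | ifZero (x : AExp) (P Q : Stm)
  | loop (r : ℕ) (e : IntExp) (P : Stm)

/-- Sums over ranges. -/
def sumOver {K : Type*} [Field K] : List (ℕ × IntExp) → (ℕ → ℕ) → ((ℕ → ℕ) → K) → K
  | [], σ, f => f σ
  | (r, e) :: ls, σ, f =>
    ∑ t ∈ Finset.range (σ (e.eval σ)), sumOver ls (Function.update σ r t) f

/-- The memory after one write. -/
def Mem.set {K : Type*} (m : Mem K) (a i j l q : ℕ) (v : K) : Mem K := fun a' i' j' l' q' =>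
  if a' = a ∧ i' = i ∧ j' = j ∧ l' = l ∧ q' = q then v else m a' i' j' l' q'

/-- The effect of a statement on the arrays; `σ` holds the integer cells. -/
def Stm.sem {K : Type*} [Field K] : Stm → (ℕ → ℕ) → Mem K → Mem K
  | skip, _, m => m
  | asg a i j l q ls x, σ, m =>
    m.set a (i.eval σ) (j.eval σ) (l.eval σ) (q.eval σ) (sumOver ls σ fun τ => x.val τ m)
  | seq P Q, σ, m => Q.sem σ (P.sem σ m)
  | ifLt a b P Q, σ, m => if a.eval σ < b.eval σ then P.sem σ m else Q.sem σ m
  | ifZero x P Q, σ, m => if x.val σ m = 0 then P.sem σ m else Q.sem σ m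
  | loop r e P, σ, m =>
    Nat.rec (motive := fun _ => Mem K) m (fun t m' => P.sem (Function.update σ r t) m')
      (σ (e.eval σ))

/-! #### Compilation -/

/-- An injective pairing of natural numbers. -/
def pairing (x y : ℕ) : ℕ := (x + y) * (x + y) + x

/-- The value lies between `(x + y) ^ 2` and `(x + y) ^ 2 + (x + y)`, hence strictly below the next
square. So it determines `x + y` and then `x`. -/
theorem pairing_injective {x y x' y' : ℕ} (h : pairing x y = pairing x' y') : x = x' ∧ y = y' := by
  unfold pairing at h
  have h1 : x + y = x' + y' := by
    rcases lt_trichotomy (x + y) (x' + y') with hlt | heq | hgt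
    · have : (x + y + 1) * (x + y + 1) ≤ (x' + y') * (x' + y') := Nat.mul_le_mul hlt hlt
      nlinarith
    · exact heq
    · have : (x' + y' + 1) * (x' + y' + 1) ≤ (x + y) * (x + y) := Nat.mul_le_mul hgt hgt
      nlinarith
  rw [h1] at h
  omega

/-- The number of an array entry. -/
def entry (a i j l q : ℕ) : ℕ := pairing a (pairing i (pairing j (pairing l q)))

theorem entry_injective {a i j l q a' i' j' l' q' : ℕ}
    (h : entry a i j l q = entry a' i' j' l' q') :
    a = a' ∧ i = i' ∧ j = j' ∧ l = l' ∧ q = q' := by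
  obtain ⟨h1, h⟩ := pairing_injective h
  obtain ⟨h2, h⟩ := pairing_injective h
  obtain ⟨h3, h⟩ := pairing_injective h
  obtain ⟨h4, h⟩ := pairing_injective h
  exact ⟨h1, h2, h3, h4, h⟩

/-- The pairing as an expression. -/
def pairingE (x y : IntExp) : IntExp := .add (.mul (.add x y) (.add x y)) x

/-- The address of an array entry; the arrays start at the address in cell 8. -/
def entryE (a : ℕ) (i j l q : IntExp) : IntExp :=
  .add (.cell (.lit 8)) (pairingE (.lit a) (pairingE i (pairingE j (pairingE l q))))

theorem entryE_eval (σ : ℕ → ℕ) (a : ℕ) (i j l q : IntExp) :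
    (entryE a i j l q).eval σ =
      σ 8 + entry a (i.eval σ) (j.eval σ) (l.eval σ) (q.eval σ) := rfl

/-- The address of the accumulator for sums. -/
def accE : IntExp := entryE 30 (.lit 0) (.lit 0) (.lit 0) (.lit 0)

/-- Compilation of expressions. -/
def AExp.compile : AExp → FldExp
  | zero => .zero
  | one => .one
  | rd a i j l q => .cell (entryE a i j l q)
  | sub x y => .sub x.compile y.compile
  | mul x y => .mul x.compile y.compile
  | inv x => .inv x.compile

/-- The program that adds the terms of a sum to the accumulator. -/
def sumProg (x : AExp) : List (ℕ × IntExp) → Prog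
  | [] => .setFld accE (.add (.cell accE) x.compile)
  | (r, e) :: ls => .loop r (.cell e) (sumProg x ls)

/-- Compilation of statements. -/
def Stm.compile : Stm → Prog
  | skip => .skip
  | asg a i j l q ls x =>
    .seq (.setFld accE .zero) (.seq (sumProg x ls) (.setFld (entryE a i j l q) (.cell accE)))
  | seq P Q => .seq P.compile Q.compile
  | ifLt a b P Q => .ifLt a b P.compile Q.compile
  | ifZero x P Q => .ifZero x.compile P.compile Q.compile
  | loop r e P => .loop r (.cell e) P.compile

/-- An expression whose value is at least 32, visibly. -/
def IntExp.large : IntExp → Bool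
  | lit c => decide (32 ≤ c)
  | add a _ => a.large
  | _ => false

/-- An expression that does not read the cells in `D`, all of which are below 32. -/
def IntExp.avoids (D : List ℕ) : IntExp → Bool
  | lit _ => true
  | cell (lit c) => !D.contains c
  | cell a => a.large && a.avoids D
  | add a b => a.avoids D && b.avoids D
  | sub a b => a.avoids D && b.avoids D
  | mul a b => a.avoids D && b.avoids D
  | div a b => a.avoids D && b.avoids D
  | log2 a => a.avoids D

theorem IntExp.large_eval {e : IntExp} (h : e.large = true) (σ : ℕ → ℕ) : 32 ≤ e.eval σ := by
  induction e with
  | lit c => simpa [large, eval] using h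
  | add a b iha _ => exact (iha (by simpa [large] using h)).trans (Nat.le_add_right _ _)
  | _ => simp [large] at h

theorem IntExp.avoids_cell {D : List ℕ} {a : IntExp} (h : (cell a).avoids D = true) :
    (∃ c, a = lit c ∧ c ∉ D) ∨ (a.large = true ∧ a.avoids D = true) := by
  cases a with
  | lit c => exact Or.inl ⟨c, rfl, by simpa [avoids] using h⟩
  | _ => exact Or.inr (by simpa only [avoids, Bool.and_eq_true] using h)

/-- Direct reads avoid `D` by inspection. Indirect reads are allowed only at addresses visibly at
least 32, whereas `D` lies below 32. -/
theorem IntExp.eval_congr {D : List ℕ} (hD : ∀ r ∈ D, r < 32) {e : IntExp}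
    (h : e.avoids D = true) {σ τ : ℕ → ℕ} (hag : ∀ a, a ∉ D → σ a = τ a) :
    e.eval σ = e.eval τ := by
  induction e with
  | lit c => rfl
  | cell a ih =>
    rcases avoids_cell h with ⟨c, rfl, hc⟩ | ⟨h1, h2⟩
    · exact hag c hc
    · simp only [eval]
      rw [ih h2]
      exact hag _ fun hm => absurd (hD _ hm) (not_lt.2 (large_eval h1 _))
  | log2 a ih => simp only [eval, ih h]
  | _ a b iha ihb =>
    simp only [avoids, Bool.and_eq_true] at h
    simp only [eval, iha h.1, ihb h.2]

/-- The expression does not read the cells in `D`, nor the array of the accumulator. -/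
def AExp.avoids (D : List ℕ) : AExp → Bool
  | zero => true
  | one => true
  | rd a i j l q => a != 30 && i.avoids D && j.avoids D && l.avoids D && q.avoids D
  | sub x y => x.avoids D && y.avoids D
  | mul x y => x.avoids D && y.avoids D
  | inv x => x.avoids D

/-- The ranges of a sum are well formed if the counters in `D` are free. -/
def sumOk (x : AExp) : List (ℕ × IntExp) → List ℕ → Bool
  | [], D => x.avoids D
  | (r, e) :: ls, D =>
    D.contains r && (IntExp.cell e).avoids D && sumOk x ls (D.filter (· != r))

/-- The statement is well formed if the counters in `D` are free. -/
def Stm.ok : Stm → List ℕ → Bool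
  | skip, _ => true
  | asg a i j l q ls x, D =>
    a != 30 && i.avoids D && j.avoids D && l.avoids D && q.avoids D && sumOk x ls D
  | seq P Q, D => P.ok D && Q.ok D
  | ifLt a b P Q, D => a.avoids D && b.avoids D && P.ok D && Q.ok D
  | ifZero x P Q, D => x.avoids D && P.ok D && Q.ok D
  | loop r e P, D => D.contains r && (IntExp.cell e).avoids D && P.ok (D.filter (· != r))

/-- The field cells from address `M` on hold the arrays. -/
def Represents {K : Type*} (M : ℕ) (f : ℕ → K) (m : Mem K) : Prop :=
  ∀ a, a ≠ 30 → ∀ i j l q, f (M + entry a i j l q) = m a i j l q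

/-! ### Compiled programs simulate the array semantics -/

section Simulation

variable {K : Type*} [Field K]

theorem Prog.run_loop_induct {P : Prog} {r : ℕ} {e : IntExp} (S : Store K)
    (I : ℕ → Store K → Prop) (h0 : I 0 S)
    (hs : ∀ t < e.eval S.int, ∀ S' : Store K, I t S' →
      I (t + 1) (P.run ⟨Function.update S'.int r t, S'.fld⟩).1) :
    I (e.eval S.int) ((Prog.loop r e P).run S).1 := by
  have key : ∀ n ≤ e.eval S.int, I n (Nat.rec (motive := fun _ => Store K × ℕ)
      (S, e.cost S.int + 1)
      (fun i A =>
        ((P.run ⟨Function.update A.1.int r i, A.1.fld⟩).1,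
          A.2 + (1 + i.size) + (P.run ⟨Function.update A.1.int r i, A.1.fld⟩).2)) n).1 := by
    intro n
    induction n with
    | zero => intro _; exact h0
    | succ n ih => intro hn; exact hs n hn _ (ih (by omega))
  exact key _ le_rfl

theorem Stm.sem_loop_induct {P : Stm} {r : ℕ} {e : IntExp} (σ : ℕ → ℕ) (m : Mem K)
    (I : ℕ → Mem K → Prop) (h0 : I 0 m)
    (hs : ∀ t < σ (e.eval σ), ∀ m', I t m' → I (t + 1) (P.sem (Function.update σ r t) m')) :
    I (σ (e.eval σ)) ((Stm.loop r e P).sem σ m) := by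
  have key : ∀ n ≤ σ (e.eval σ), I n (Nat.rec (motive := fun _ => Mem K) m
      (fun t m' => P.sem (Function.update σ r t) m') n) := by
    intro n
    induction n with
    | zero => intro _; exact h0
    | succ n ih => intro hn; exact hs n hn _ (ih (by omega))
  exact key _ le_rfl

/-- Two integer memories that differ at most in the cells in `D`. -/
def AgreeOff (D : List ℕ) (τ σ : ℕ → ℕ) : Prop := ∀ a, a ∉ D → τ a = σ a

/-- The machine leaves stale values in counters after a loop, while the semantics forgets them; `D`
lists the cells where the two may differ. Entering a loop sets its counter, which thereby leaves the
list. -/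
theorem AgreeOff.update {D : List ℕ} {τ σ : ℕ → ℕ} (h : AgreeOff D τ σ) (r t : ℕ) :
    AgreeOff (D.filter (· != r)) (Function.update τ r t) (Function.update σ r t) := by
  intro a ha
  rw [Function.update_apply, Function.update_apply]
  split_ifs with har
  · rfl
  · exact h a fun hm => ha (List.mem_filter.2 ⟨hm, by simpa using har⟩)

/-- On leaving a loop its counter becomes unreliable and returns to the list. -/
theorem AgreeOff.of_update {D : List ℕ} {τ σ : ℕ → ℕ} {r t : ℕ} (hr : r ∈ D)
    (h : AgreeOff (D.filter (· != r)) τ (Function.update σ r t)) : AgreeOff D τ σ := by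
  intro a ha
  rw [h a fun hm => ha (List.mem_filter.1 hm).1, Function.update_of_ne]
  rintro rfl
  exact ha hr

theorem AExp.compile_eval {D : List ℕ} (hD : ∀ r ∈ D, r < 32) (h8 : 8 ∉ D) {x : AExp}
    (h : x.avoids D = true) {τ σ : ℕ → ℕ} (hag : AgreeOff D τ σ) {f : ℕ → K} {m : Mem K}
    (hrep : Represents (σ 8) f m) : x.compile.eval τ f = x.val σ m := by
  induction x with
  | zero => rfl
  | one => rfl
  | rd a i j l q =>
    simp only [avoids, Bool.and_eq_true, bne_iff_ne, ne_eq] at h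
    obtain ⟨⟨⟨⟨ha, hi⟩, hj⟩, hl⟩, hq⟩ := h
    simp only [compile, FldExp.eval, entryE_eval, val]
    rw [hag 8 h8, IntExp.eval_congr hD hi hag, IntExp.eval_congr hD hj hag,
      IntExp.eval_congr hD hl hag, IntExp.eval_congr hD hq hag]
    exact hrep a ha _ _ _ _
  | inv x ih => simp only [compile, FldExp.eval, val, ih h]
  | _ x y ihx ihy =>
    simp only [avoids, Bool.and_eq_true] at h
    simp only [compile, FldExp.eval, val, ihx h.1, ihy h.2]

/-- Array 30 is reserved for the accumulator and is exempt from the representation, so partial sums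
disturb nothing. -/
theorem Represents.update_acc {M : ℕ} {f : ℕ → K} {m : Mem K} (h : Represents M f m) (v : K) :
    Represents M (Function.update f (M + entry 30 0 0 0 0) v) m := by
  intro a ha i j l q
  rw [Function.update_of_ne, h a ha]
  intro he
  exact ha (entry_injective (Nat.add_left_cancel he)).1

theorem Represents.update {M : ℕ} {f : ℕ → K} {m : Mem K} (h : Represents M f m)
    (a i j l q : ℕ) (v : K) :
    Represents M (Function.update f (M + entry a i j l q) v) (m.set a i j l q v) := by
  intro a' ha' i' j' l' q'
  rw [Function.update_apply, Mem.set]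
  by_cases he : a' = a ∧ i' = i ∧ j' = j ∧ l' = l ∧ q' = q
  · rw [if_pos he, if_pos]
    obtain ⟨rfl, rfl, rfl, rfl, rfl⟩ := he
    rfl
  · rw [if_neg he, if_neg, h a' ha']
    exact fun h' => he (entry_injective (Nat.add_left_cancel h'))

/-- The nested loops add one term after the other to the accumulator. No other array entry changes,
so every term is evaluated in the same memory `m`. -/
theorem sumProg_run {x : AExp} {m : Mem K} (ls : List (ℕ × IntExp)) :
    ∀ {D : List ℕ}, (∀ r ∈ D, r < 32) → 8 ∉ D → sumOk x ls D = true → ∀ {σ : ℕ → ℕ}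
      {S : Store K}, AgreeOff D S.int σ → Represents (σ 8) S.fld m →
      AgreeOff D ((sumProg x ls).run S).1.int σ ∧
      Represents (σ 8) ((sumProg x ls).run S).1.fld m ∧
      ((sumProg x ls).run S).1.fld (σ 8 + entry 30 0 0 0 0) =
        S.fld (σ 8 + entry 30 0 0 0 0) + sumOver ls σ fun τ => x.val τ m := by
  induction ls with
  | nil =>
    intro D hD h8 hok σ S hag hrep
    simp only [sumProg, Prog.run]
    have h1 : accE.eval S.int = σ 8 + entry 30 0 0 0 0 := by
      rw [accE, entryE_eval, hag 8 h8]; rfl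
    rw [h1]
    refine ⟨hag, hrep.update_acc _, ?_⟩
    rw [Function.update_self, FldExp.eval, FldExp.eval, h1, AExp.compile_eval hD h8 hok hag hrep]
    rfl
  | cons re ls ih =>
    obtain ⟨r, e⟩ := re
    intro D hD h8 hok σ S hag hrep
    simp only [sumOk, Bool.and_eq_true, List.contains_iff_mem] at hok
    obtain ⟨⟨hr, he⟩, hls⟩ := hok
    have hr8 : 8 ≠ r := fun h => h8 (h ▸ hr)
    have hev : (IntExp.cell e).eval S.int = (IntExp.cell e).eval σ := IntExp.eval_congr hD he hag
    have := Prog.run_loop_induct (P := sumProg x ls) (r := r) (e := .cell e) S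
      (fun t S' => AgreeOff D S'.int σ ∧ Represents (σ 8) S'.fld m ∧
        S'.fld (σ 8 + entry 30 0 0 0 0) = S.fld (σ 8 + entry 30 0 0 0 0) +
          ∑ t ∈ Finset.range t, sumOver ls (Function.update σ r t) fun τ => x.val τ m)
      ⟨hag, hrep, by simp⟩ ?_
    · rw [hev] at this
      exact this
    · rintro t - S' ⟨h1, h2, h3⟩
      have hσ8 : Function.update σ r t 8 = σ 8 := Function.update_of_ne hr8 _ _
      have h4 := ih (D := D.filter (· != r)) (fun r' hr' => hD r' (List.mem_filter.1 hr').1)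
        (fun h => h8 (List.mem_filter.1 h).1) hls (h1.update r t)
        (S := ⟨Function.update S'.int r t, S'.fld⟩) (by rw [hσ8]; exact h2)
      rw [hσ8] at h4
      refine ⟨h4.1.of_update hr, h4.2.1, ?_⟩
      rw [h4.2.2, Finset.sum_range_succ, ← add_assoc, ← h3]

/-- A compiled statement does what the statement means. -/
theorem Stm.compile_run (P : Stm) :
    ∀ {D : List ℕ}, (∀ r ∈ D, r < 32) → 8 ∉ D → P.ok D = true → ∀ {σ : ℕ → ℕ} {S : Store K}
      {m : Mem K}, AgreeOff D S.int σ → Represents (σ 8) S.fld m →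
      AgreeOff D (P.compile.run S).1.int σ ∧
      Represents (σ 8) (P.compile.run S).1.fld (P.sem σ m) := by
  induction P with
  | skip => intro D hD h8 hok σ S m hag hrep; exact ⟨hag, hrep⟩
  | asg a i j l q ls x =>
    intro D hD h8 hok σ S m hag hrep
    simp only [ok, Bool.and_eq_true, bne_iff_ne, ne_eq] at hok
    obtain ⟨⟨⟨⟨⟨ha, hi⟩, hj⟩, hl⟩, hq⟩, hls⟩ := hok
    have hacc : ∀ {S : Store K}, AgreeOff D S.int σ →
        accE.eval S.int = σ 8 + entry 30 0 0 0 0 := by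
      intro S hag
      rw [accE, entryE_eval, hag 8 h8]; rfl
    simp only [compile, Prog.run, FldExp.eval]
    rw [hacc hag]
    have h1 := sumProg_run ls hD h8 hls (σ := σ)
      (S := ⟨S.int, Function.update S.fld (σ 8 + entry 30 0 0 0 0) 0⟩) hag (hrep.update_acc 0)
    rw [hacc h1.1, h1.2.2, entryE_eval, h1.1 8 h8, IntExp.eval_congr hD hi h1.1,
      IntExp.eval_congr hD hj h1.1, IntExp.eval_congr hD hl h1.1, IntExp.eval_congr hD hq h1.1]
    refine ⟨h1.1, ?_⟩
    dsimp only
    rw [Function.update_self, zero_add]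
    exact h1.2.1.update _ _ _ _ _ _
  | seq P Q ihP ihQ =>
    intro D hD h8 hok σ S m hag hrep
    simp only [ok, Bool.and_eq_true] at hok
    have h1 := ihP hD h8 hok.1 hag hrep
    exact ihQ hD h8 hok.2 h1.1 h1.2
  | ifLt a b P Q ihP ihQ =>
    intro D hD h8 hok σ S m hag hrep
    simp only [ok, Bool.and_eq_true] at hok
    obtain ⟨⟨⟨ha, hb⟩, hP⟩, hQ⟩ := hok
    simp only [compile, Prog.run, sem]
    rw [IntExp.eval_congr hD ha hag, IntExp.eval_congr hD hb hag]
    split_ifs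
    · exact ihP hD h8 hP hag hrep
    · exact ihQ hD h8 hQ hag hrep
  | ifZero x P Q ihP ihQ =>
    intro D hD h8 hok σ S m hag hrep
    simp only [ok, Bool.and_eq_true] at hok
    obtain ⟨⟨hx, hP⟩, hQ⟩ := hok
    simp only [compile, Prog.run, sem]
    rw [AExp.compile_eval hD h8 hx hag hrep]
    split_ifs
    · exact ihP hD h8 hP hag hrep
    · exact ihQ hD h8 hQ hag hrep
  | loop r e P ih =>
    intro D hD h8 hok σ S m hag hrep
    simp only [ok, Bool.and_eq_true, List.contains_iff_mem] at hok
    obtain ⟨⟨hr, he⟩, hP⟩ := hok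
    have hr8 : 8 ≠ r := fun h => h8 (h ▸ hr)
    have hev : (IntExp.cell e).eval S.int = (IntExp.cell e).eval σ := IntExp.eval_congr hD he hag
    have := Prog.run_loop_induct (P := P.compile) (r := r) (e := .cell e) S
      (fun t S' => AgreeOff D S'.int σ ∧ Represents (σ 8) S'.fld
        (Nat.rec (motive := fun _ => Mem K) m
          (fun t m' => P.sem (Function.update σ r t) m') t)) ⟨hag, hrep⟩ ?_
    · rw [hev] at this
      exact this
    · rintro t - S' ⟨h1, h2⟩
      have hσ8 : Function.update σ r t 8 = σ 8 := Function.update_of_ne hr8 _ _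
      have h4 := ih (D := D.filter (· != r)) (fun r' hr' => hD r' (List.mem_filter.1 hr').1)
        (fun h => h8 (List.mem_filter.1 h).1) hP (h1.update r t)
        (S := ⟨Function.update S'.int r t, S'.fld⟩) (by rw [hσ8]; exact h2)
      rw [hσ8] at h4
      exact ⟨h4.1.of_update hr, h4.2⟩

end Simulation

theorem Stm.sem_ifLt_pos {K : Type*} [Field K] {a b : IntExp} {P Q : Stm} {σ : ℕ → ℕ} {m : Mem K}
    (h : a.eval σ < b.eval σ) : (Stm.ifLt a b P Q).sem σ m = P.sem σ m := if_pos h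

theorem Stm.sem_ifLt_neg {K : Type*} [Field K] {a b : IntExp} {P Q : Stm} {σ : ℕ → ℕ} {m : Mem K}
    (h : ¬ a.eval σ < b.eval σ) : (Stm.ifLt a b P Q).sem σ m = Q.sem σ m := if_neg h

/-! #### Frames and comprehensions -/

section Fill

variable {K : Type*} [Field K]

/-- The arrays to which a statement writes. -/
def Stm.writes : Stm → List ℕ
  | skip => []
  | asg a _ _ _ _ _ _ => [a]
  | seq P Q => P.writes ++ Q.writes
  | ifLt _ _ P Q => P.writes ++ Q.writes
  | ifZero _ P Q => P.writes ++ Q.writes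
  | loop _ _ P => P.writes

theorem Mem.set_of_ne (m : Mem K) {a a' : ℕ} (h : a' ≠ a) (i j l q : ℕ) (v : K) :
    m.set a i j l q v a' = m a' := by
  funext i' j' l' q'
  rw [Mem.set, if_neg fun h' => h h'.1]

/-- A statement leaves the arrays to which it does not write unchanged. -/
theorem Stm.sem_of_notMem {P : Stm} {a : ℕ} (h : a ∉ P.writes) (σ : ℕ → ℕ) (m : Mem K) :
    P.sem σ m a = m a := by
  induction P generalizing σ m with
  | skip => rfl
  | asg a' i j l q ls x => exact Mem.set_of_ne _ (by simpa [writes] using h) _ _ _ _ _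
  | seq P Q ihP ihQ =>
    simp only [writes, List.mem_append, not_or] at h
    rw [sem, ihQ h.2, ihP h.1]
  | ifLt x y P Q ihP ihQ =>
    simp only [writes, List.mem_append, not_or] at h
    rw [sem]
    split_ifs
    · exact ihP h.1 _ _
    · exact ihQ h.2 _ _
  | ifZero x P Q ihP ihQ =>
    simp only [writes, List.mem_append, not_or] at h
    rw [sem]
    split_ifs
    · exact ihP h.1 _ _
    · exact ihQ h.2 _ _
  | loop r e P ih =>
    exact sem_loop_induct σ m (fun _ m' => m' a = m a) rfl fun t _ m' hm' => by
      rw [ih h, hm']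

theorem AExp.val_congr {x : AExp} (σ : ℕ → ℕ) {m m' : Mem K} (h : ∀ a ∈ x.reads, m a = m' a) :
    x.val σ m = x.val σ m' := by
  induction x with
  | zero => rfl
  | one => rfl
  | rd a i j l q => simp only [val]; rw [h a (by simp [reads])]
  | inv x ih => simp only [val, ih h]
  | _ x y ihx ihy =>
    simp only [reads, List.mem_append] at h
    simp only [val, ihx fun a ha => h a (Or.inl ha), ihy fun a ha => h a (Or.inr ha)]

/-- One index of a comprehension: fixed, or running through a range. -/
inductive Dim
  | fix (e : IntExp)
  | run (r : ℕ) (e : IntExp)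

namespace Dim

/-- The index as an expression. -/
def idx : Dim → IntExp
  | fix e => e
  | run r _ => .cell (.lit r)

/-- Run a statement for all values of the index. -/
def wrap : Dim → Stm → Stm
  | fix _, P => P
  | run r e, P => .loop r e P

/-- The values of the index. -/
def mem (σ : ℕ → ℕ) : Dim → ℕ → Prop
  | fix e, t => t = e.eval σ
  | run _ e, t => t < σ (e.eval σ)

/-- The integer memory for one value of the index. -/
def upd (σ : ℕ → ℕ) : Dim → ℕ → ℕ → ℕ
  | fix _, _ => σ
  | run r _, t => Function.update σ r t

/-- The expression keeps its value while the index runs. -/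
def keeps (e : IntExp) : Dim → Bool
  | fix _ => true
  | run r _ => decide (r < 32) && e.avoids [r]

theorem eval_upd {d : Dim} {e : IntExp} (h : d.keeps e = true) (σ : ℕ → ℕ) (t : ℕ) :
    e.eval (d.upd σ t) = e.eval σ := by
  cases d with
  | fix _ => rfl
  | run r _ =>
    simp only [keeps, Bool.and_eq_true, decide_eq_true_eq] at h
    refine IntExp.eval_congr (D := [r]) (by simpa using h.1) h.2 fun a ha => ?_
    exact Function.update_of_ne (by simpa using ha) _ _

theorem idx_eval {d : Dim} {σ : ℕ → ℕ} {t : ℕ} (h : d.mem σ t) : d.idx.eval (d.upd σ t) = t := by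
  cases d with
  | fix _ => exact h.symm
  | run r _ => exact Function.update_self _ _ _

/-- The new value `v` of an entry is fixed in advance, and the hypothesis covers every memory that
agrees with `m` outside array `a`. So the state that earlier rounds left in `a` is immaterial, and
the written sets simply accumulate. -/
theorem sem_wrap {P : Stm} {a : ℕ} (d : Dim) (σ : ℕ → ℕ) (m : Mem K)
    (X : ℕ → ℕ → ℕ → ℕ → ℕ → Prop) (v : ℕ → ℕ → ℕ → ℕ → K)
    (h : ∀ t, d.mem σ t → ∀ m' : Mem K, (∀ a', a' ≠ a → m' a' = m a') →
      P.sem (d.upd σ t) m' = fun a' i j l q =>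
        if a' = a ∧ X t i j l q then v i j l q else m' a' i j l q) :
    (d.wrap P).sem σ m = fun a' i j l q =>
      if a' = a ∧ ∃ t, d.mem σ t ∧ X t i j l q then v i j l q else m a' i j l q := by
  cases d with
  | fix e =>
    rw [wrap]
    have := h _ rfl m fun _ _ => rfl
    simp only [upd] at this
    rw [this]
    simp only [mem, exists_eq_left]
  | run r e =>
    have := Stm.sem_loop_induct (P := P) (r := r) (e := e) σ m
      (fun n m' => m' = fun a' i j l q =>
        if a' = a ∧ ∃ t, t < n ∧ X t i j l q then v i j l q else m a' i j l q) ?_ ?_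
    · refine this.trans ?_
      funext a' i j l q
      exact if_congr Iff.rfl rfl rfl
    · simp
    · intro n hn m' hm'
      have h1 := h n hn m' fun a' ha' => by
        rw [hm']
        funext i j l q
        exact if_neg fun h => ha' h.1
      simp only [upd] at h1
      rw [h1, hm']
      funext a' i j l q
      by_cases ha : a' = a
      · simp only [ha, true_and]
        by_cases hX : X n i j l q
        · rw [if_pos hX, if_pos ⟨n, Nat.lt_succ_self n, hX⟩]
        · rw [if_neg hX]
          congr 1
          apply propext
          constructor
          · rintro ⟨t, ht, hXt⟩
            exact ⟨t, ht.trans (Nat.lt_succ_self n), hXt⟩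
          · rintro ⟨t, ht, hXt⟩
            rcases Nat.lt_succ_iff_lt_or_eq.1 ht with ht | rfl
            · exact ⟨t, ht, hXt⟩
            · exact absurd hXt hX
      · simp only [ha, false_and, if_false]

end Dim

/-- Assign all entries of an array in a product of four ranges. -/
def fill (a : ℕ) (d₁ d₂ d₃ d₄ : Dim) (ls : List (ℕ × IntExp)) (x : AExp) : Stm :=
  d₁.wrap (d₂.wrap (d₃.wrap (d₄.wrap (.asg a d₁.idx d₂.idx d₃.idx d₄.idx ls x))))

/-- The new values do not depend on the order of the assignments. -/
def fillOk (a : ℕ) (d₁ d₂ d₃ d₄ : Dim) (x : AExp) : Bool :=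
  !x.reads.contains a && d₂.keeps d₁.idx && d₃.keeps d₁.idx && d₄.keeps d₁.idx &&
    d₃.keeps d₂.idx && d₄.keeps d₂.idx && d₄.keeps d₃.idx

theorem sumOver_congr {f g : (ℕ → ℕ) → K} (h : ∀ σ, f σ = g σ) (ls : List (ℕ × IntExp))
    (σ : ℕ → ℕ) : sumOver ls σ f = sumOver ls σ g := by
  rw [show f = g from funext h]

/-- The assigned expression does not read array `a`, and inner counters do not disturb outer
indices. Therefore the nested loops amount to one simultaneous assignment evaluated in the old
memory. -/
theorem sem_fill {a : ℕ} {d₁ d₂ d₃ d₄ : Dim} {ls : List (ℕ × IntExp)} {x : AExp}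
    (hok : fillOk a d₁ d₂ d₃ d₄ x = true) (σ : ℕ → ℕ) (m : Mem K) :
    (fill a d₁ d₂ d₃ d₄ ls x).sem σ m = fun a' i j l q =>
      if a' = a ∧ d₁.mem σ i ∧ d₂.mem (d₁.upd σ i) j ∧ d₃.mem (d₂.upd (d₁.upd σ i) j) l ∧
          d₄.mem (d₃.upd (d₂.upd (d₁.upd σ i) j) l) q
      then sumOver ls (d₄.upd (d₃.upd (d₂.upd (d₁.upd σ i) j) l) q) fun τ => x.val τ m
      else m a' i j l q := by
  simp only [fillOk, Bool.and_eq_true, Bool.not_eq_true', List.contains_eq_mem,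
    decide_eq_false_iff_not] at hok
  obtain ⟨⟨⟨⟨⟨⟨hx, h12⟩, h13⟩, h14⟩, h23⟩, h24⟩, h34⟩ := hok
  set v : ℕ → ℕ → ℕ → ℕ → K := fun i j l q =>
    sumOver ls (d₄.upd (d₃.upd (d₂.upd (d₁.upd σ i) j) l) q) fun τ => x.val τ m with hv
  have key := Dim.sem_wrap (P := d₂.wrap (d₃.wrap (d₄.wrap
      (.asg a d₁.idx d₂.idx d₃.idx d₄.idx ls x)))) (a := a) d₁ σ m
    (fun t₁ i j l q => ∃ t₂, d₂.mem (d₁.upd σ t₁) t₂ ∧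
      ∃ t₃, d₃.mem (d₂.upd (d₁.upd σ t₁) t₂) t₃ ∧
      ∃ t₄, d₄.mem (d₃.upd (d₂.upd (d₁.upd σ t₁) t₂) t₃) t₄ ∧
        (i = t₁ ∧ j = t₂ ∧ l = t₃ ∧ q = t₄)) v ?_
  · rw [fill, key]
    funext a' i j l q
    congr 1
    apply propext
    constructor
    · rintro ⟨ha, t₁, h₁, t₂, h₂, t₃, h₃, t₄, h₄, rfl, rfl, rfl, rfl⟩
      exact ⟨ha, h₁, h₂, h₃, h₄⟩
    · rintro ⟨ha, h₁, h₂, h₃, h₄⟩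
      exact ⟨ha, i, h₁, j, h₂, l, h₃, q, h₄, rfl, rfl, rfl, rfl⟩
  · intro t₁ ht₁ m₁ hm₁
    refine Dim.sem_wrap d₂ _ m₁ _ v ?_
    intro t₂ ht₂ m₂ hm₂
    refine Dim.sem_wrap d₃ _ m₂ _ v ?_
    intro t₃ ht₃ m₃ hm₃
    refine Dim.sem_wrap d₄ _ m₃ _ v ?_
    intro t₄ ht₄ m₄ hm₄
    have hm : ∀ a' ∈ x.reads, m₄ a' = m a' := by
      intro a' ha'
      have : a' ≠ a := fun h => hx (h ▸ ha')
      rw [hm₄ a' this, hm₃ a' this, hm₂ a' this, hm₁ a' this]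
    have e₁ : d₁.idx.eval (d₄.upd (d₃.upd (d₂.upd (d₁.upd σ t₁) t₂) t₃) t₄) = t₁ := by
      rw [Dim.eval_upd h14, Dim.eval_upd h13, Dim.eval_upd h12, Dim.idx_eval ht₁]
    have e₂ : d₂.idx.eval (d₄.upd (d₃.upd (d₂.upd (d₁.upd σ t₁) t₂) t₃) t₄) = t₂ := by
      rw [Dim.eval_upd h24, Dim.eval_upd h23, Dim.idx_eval ht₂]
    have e₃ : d₃.idx.eval (d₄.upd (d₃.upd (d₂.upd (d₁.upd σ t₁) t₂) t₃) t₄) = t₃ := by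
      rw [Dim.eval_upd h34, Dim.idx_eval ht₃]
    rw [Stm.sem, e₁, e₂, e₃, Dim.idx_eval ht₄,
      sumOver_congr fun τ => AExp.val_congr (m' := m) τ hm]
    funext a' i j l q
    rw [Mem.set]
    split_ifs with h
    · obtain ⟨-, rfl, rfl, rfl, rfl⟩ := h; rfl
    · rfl

end Fill

end NetCode
end

noncomputable section
open scoped Classical
namespace NetCode

/-! ### Bounds for the number of steps -/

section Cost

theorem size_add_le (a b : ℕ) : (a + b).size ≤ a.size + b.size + 1 := by
  rw [Nat.size_le]
  have ha := Nat.lt_size_self a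
  have hb := Nat.lt_size_self b
  have h1 : 2 ^ a.size ≤ 2 ^ (a.size + b.size) := Nat.pow_le_pow_right (by norm_num) (by omega)
  have h2 : 2 ^ b.size ≤ 2 ^ (a.size + b.size) := Nat.pow_le_pow_right (by norm_num) (by omega)
  rw [pow_succ]
  omega

theorem size_mul_le (a b : ℕ) : (a * b).size ≤ a.size + b.size := by
  rw [Nat.size_le, pow_add]
  exact Nat.mul_lt_mul'' (Nat.lt_size_self a) (Nat.lt_size_self b)

/-- The expression is fixed, and every operation lengthens its result at most to the sum of the
lengths of its arguments plus one. So all lengths are a constant times that of the largest cell. -/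
theorem IntExp.cost_le (e : IntExp) : ∃ c, ∀ (m : ℕ → ℕ) (Q : ℕ), (∀ a, m a ≤ Q) →
    e.cost m ≤ c * (Q.size + 1) ∧ (e.eval m).size ≤ c * (Q.size + 1) := by
  induction e with
  | lit k =>
    refine ⟨1 + k.size, fun m Q _ => ⟨?_, ?_⟩⟩
    · exact Nat.le_mul_of_pos_right _ (Nat.succ_pos _)
    · exact (Nat.le_add_left _ _).trans (Nat.le_mul_of_pos_right _ (Nat.succ_pos _))
  | cell a ih =>
    obtain ⟨c, hc⟩ := ih
    refine ⟨c + 1, fun m Q hm => ⟨?_, ?_⟩⟩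
    · have h1 := (hc m Q hm).1
      have h2 := Nat.size_le_size (hm (a.eval m))
      simp only [cost]
      linarith
    · have h2 := Nat.size_le_size (hm (a.eval m))
      simp only [eval]
      nlinarith
  | add a b iha ihb =>
    obtain ⟨c, hc⟩ := iha
    obtain ⟨d, hd⟩ := ihb
    refine ⟨2 * c + 2 * d + 2, fun m Q hm => ?_⟩
    have h1 := hc m Q hm
    have h2 := hd m Q hm
    have h3 := size_add_le (a.eval m) (b.eval m)
    simp only [cost, eval]
    constructor <;> nlinarith
  | sub a b iha ihb =>
    obtain ⟨c, hc⟩ := iha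
    obtain ⟨d, hd⟩ := ihb
    refine ⟨2 * c + 2 * d + 2, fun m Q hm => ?_⟩
    have h1 := hc m Q hm
    have h2 := hd m Q hm
    have h3 := Nat.size_le_size (Nat.sub_le (a.eval m) (b.eval m))
    simp only [cost, eval]
    constructor <;> nlinarith
  | mul a b iha ihb =>
    obtain ⟨c, hc⟩ := iha
    obtain ⟨d, hd⟩ := ihb
    refine ⟨2 * c + 2 * d + 2, fun m Q hm => ?_⟩
    have h1 := hc m Q hm
    have h2 := hd m Q hm
    have h3 := size_mul_le (a.eval m) (b.eval m)
    simp only [cost, eval]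
    constructor <;> nlinarith
  | div a b iha ihb =>
    obtain ⟨c, hc⟩ := iha
    obtain ⟨d, hd⟩ := ihb
    refine ⟨2 * c + 2 * d + 2, fun m Q hm => ?_⟩
    have h1 := hc m Q hm
    have h2 := hd m Q hm
    have h3 := Nat.size_le_size (Nat.div_le_self (a.eval m) (b.eval m))
    simp only [cost, eval]
    constructor <;> nlinarith
  | log2 a iha =>
    obtain ⟨c, hc⟩ := iha
    refine ⟨2 * c + 2, fun m Q hm => ?_⟩
    have h1 := hc m Q hm
    have h3 := Nat.size_le_size (Nat.log_le_self 2 (a.eval m))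
    simp only [cost, eval]
    constructor <;> nlinarith

theorem FldExp.cost_le (x : FldExp) : ∃ c, ∀ (m : ℕ → ℕ) (Q : ℕ), (∀ a, m a ≤ Q) →
    x.cost m ≤ c * (Q.size + 1) := by
  induction x with
  | zero => exact ⟨1, fun m Q _ => by simp only [cost]; omega⟩
  | one => exact ⟨1, fun m Q _ => by simp only [cost]; omega⟩
  | cell a =>
    obtain ⟨c, hc⟩ := a.cost_le
    refine ⟨c + 1, fun m Q hm => ?_⟩
    have h1 := (hc m Q hm).1
    simp only [cost]
    nlinarith
  | inv x ih =>
    obtain ⟨c, hc⟩ := ih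
    refine ⟨c + 1, fun m Q hm => ?_⟩
    have h1 := hc m Q hm
    simp only [cost]
    nlinarith
  | _ x y ihx ihy =>
    obtain ⟨c, hc⟩ := ihx
    obtain ⟨d, hd⟩ := ihy
    refine ⟨c + d + 1, fun m Q hm => ?_⟩
    have h1 := hc m Q hm
    have h2 := hd m Q hm
    simp only [cost]
    nlinarith

variable {K : Type*} [Field K]

/-- During the run only numbers up to `Q` are written to the integer cells, and no loop makes more
than `T` rounds. -/
def Prog.Within (Q T : ℕ) : Prog → Store K → Prop
  | skip, _ => True
  | setInt _ e, S => e.eval S.int ≤ Q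
  | setFld _ _, _ => True
  | seq P P', S => P.Within Q T S ∧ P'.Within Q T (P.run S).1
  | ifLt a b P P', S => if a.eval S.int < b.eval S.int then P.Within Q T S else P'.Within Q T S
  | ifZero x P P', S => if x.eval S.int S.fld = 0 then P.Within Q T S else P'.Within Q T S
  | loop r e P, S => e.eval S.int ≤ T ∧ ∀ i < e.eval S.int,
      P.Within Q T ⟨Function.update ((loop r (.lit i) P).run S).1.int r i,
        ((loop r (.lit i) P).run S).1.fld⟩

theorem Prog.rounds_fst (r : ℕ) (P : Prog) (S : Store K) (n x y : ℕ) :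
    (Nat.rec (motive := fun _ => Store K × ℕ) (S, x)
      (fun i A =>
        ((P.run ⟨Function.update A.1.int r i, A.1.fld⟩).1,
          A.2 + (1 + i.size) + (P.run ⟨Function.update A.1.int r i, A.1.fld⟩).2)) n).1 =
    (Nat.rec (motive := fun _ => Store K × ℕ) (S, y)
      (fun i A =>
        ((P.run ⟨Function.update A.1.int r i, A.1.fld⟩).1,
          A.2 + (1 + i.size) + (P.run ⟨Function.update A.1.int r i, A.1.fld⟩).2)) n).1 := by
  induction n with
  | zero => rfl
  | succ n ih => simp only [ih]

/-- The memory after some rounds does not depend on how the number of rounds was computed. Loops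
with literal bounds can thus name the intermediate states. -/
theorem Prog.run_loop_eq (r : ℕ) (e : IntExp) (P : Prog) (S : Store K) :
    ((loop r e P).run S).1 = ((loop r (.lit (e.eval S.int)) P).run S).1 :=
  rounds_fst r P S _ _ _

theorem Prog.run_loop_succ (r : ℕ) (i : ℕ) (P : Prog) (S : Store K) :
    ((loop r (.lit (i + 1)) P).run S).1 =
      (P.run ⟨Function.update ((loop r (.lit i) P).run S).1.int r i,
        ((loop r (.lit i) P).run S).1.fld⟩).1 := by
  have h := rounds_fst r P S i ((IntExp.lit i).cost S.int + 1)
    ((IntExp.lit (i + 1)).cost S.int + 1)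
  simp only [Prog.run, IntExp.eval]
  rw [h]

theorem Prog.run_loop_zero (r : ℕ) (P : Prog) (S : Store K) :
    ((loop r (.lit 0) P).run S).1 = S := rfl

theorem update_le {m : ℕ → ℕ} {Q : ℕ} (hm : ∀ a, m a ≤ Q) (r : ℕ) {i : ℕ} (hi : i ≤ Q) (a : ℕ) :
    Function.update m r i a ≤ Q := by
  rw [Function.update_apply]
  split_ifs
  · exact hi
  · exact hm a

/-- Assignments are bounded by `Q` by definition, and counters stay below `T`, which is at most `Q`.
-/
theorem Prog.Within.int_le {Q T : ℕ} (hT : T ≤ Q) (P : Prog) :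
    ∀ {S : Store K}, (∀ a, S.int a ≤ Q) → P.Within Q T S → ∀ a, (P.run S).1.int a ≤ Q := by
  induction P with
  | skip => exact fun hS _ => hS
  | setInt x e => exact fun hS h => update_le hS _ h
  | setFld _ _ => exact fun hS _ => hS
  | seq P P' ih ih' => exact fun hS h => ih' (ih hS h.1) h.2
  | ifLt a b P P' ih ih' =>
    intro S hS h
    simp only [Within] at h
    simp only [Prog.run]
    split_ifs at h ⊢
    · exact ih hS h
    · exact ih' hS h
  | ifZero x P P' ih ih' =>
    intro S hS h
    simp only [Within] at h
    simp only [Prog.run]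
    split_ifs at h ⊢
    · exact ih hS h
    · exact ih' hS h
  | loop r e P ih =>
    intro S hS h
    rw [run_loop_eq]
    have key : ∀ n ≤ e.eval S.int, ∀ a, ((loop r (.lit n) P).run S).1.int a ≤ Q := by
      intro n
      induction n with
      | zero => intro _; exact hS
      | succ n ihn =>
        intro hn
        rw [run_loop_succ]
        exact ih (update_le (ihn (by omega)) r ((show n ≤ T from (by have := h.1; omega)).trans hT))
          (h.2 n hn)
    exact key _ le_rfl

theorem Prog.loop_cost_le {r : ℕ} {e : IntExp} {P : Prog} {S : Store K} {Z : ℕ}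
    (h : ∀ i < e.eval S.int, (P.run ⟨Function.update ((loop r (.lit i) P).run S).1.int r i,
        ((loop r (.lit i) P).run S).1.fld⟩).2 + (1 + i.size) ≤ Z) :
    ((loop r e P).run S).2 ≤ e.cost S.int + 1 + e.eval S.int * Z := by
  have key : ∀ (n : ℕ), n ≤ e.eval S.int →
      (Nat.rec (motive := fun _ => Store K × ℕ) (S, e.cost S.int + 1)
      (fun i A =>
        ((P.run ⟨Function.update A.1.int r i, A.1.fld⟩).1,
          A.2 + (1 + i.size) + (P.run ⟨Function.update A.1.int r i, A.1.fld⟩).2)) n).2 ≤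
      e.cost S.int + 1 + n * Z ∧
      (Nat.rec (motive := fun _ => Store K × ℕ) (S, e.cost S.int + 1)
      (fun i A =>
        ((P.run ⟨Function.update A.1.int r i, A.1.fld⟩).1,
          A.2 + (1 + i.size) + (P.run ⟨Function.update A.1.int r i, A.1.fld⟩).2)) n).1 =
        ((loop r (.lit n) P).run S).1 := by
    intro n
    induction n with
    | zero => intro _; simp [run_loop_zero]
    | succ n ih =>
      intro hn
      obtain ⟨h1, h2⟩ := ih (by omega)
      refine ⟨?_, ?_⟩
      · dsimp only at h1 h2 ⊢
        rw [h2]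
        have := h n hn
        rw [Nat.succ_mul]
        omega
      · rw [run_loop_succ]
        dsimp only at h2 ⊢
        rw [h2]
  exact (key _ le_rfl).1

/-- The number of steps is bounded by a polynomial in the number of rounds of the loops, times the
size of the numbers. -/
theorem Prog.cost_le (P : Prog) : ∃ c d : ℕ, ∀ (K : Type*) [Field K] (S : Store K) (Q T : ℕ),
    T ≤ Q → (∀ a, S.int a ≤ Q) → P.Within Q T S →
    (P.run S).2 ≤ c * (Q.size + 1) * (T + 1) ^ d := by
  have mono : ∀ {c c' d d' x T : ℕ}, c ≤ c' → d ≤ d' →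
      c * x * (T + 1) ^ d ≤ c' * x * (T + 1) ^ d' := fun hc hd =>
    Nat.mul_le_mul (Nat.mul_le_mul_right _ hc) (Nat.pow_le_pow_right (Nat.succ_pos _) hd)
  -- Adding the exponents bounds both branches at once; taking their maximum is not worth the
  -- trouble.
  have comb : ∀ {c c' e d d' x T A B E : ℕ}, A ≤ c * (x + 1) * (T + 1) ^ d →
      B ≤ c' * (x + 1) * (T + 1) ^ d' → E ≤ e * (x + 1) →
      A + B + E ≤ (c + c' + e) * (x + 1) * (T + 1) ^ (d + d') := by
    intro c c' e d d' x T A B E hA hB hE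
    have h1 := hA.trans (mono (x := x + 1) (T := T) (le_refl c) (Nat.le_add_right d d'))
    have h2 := hB.trans (mono (x := x + 1) (T := T) (le_refl c') (Nat.le_add_left d' d))
    have h3 : e * (x + 1) ≤ e * (x + 1) * (T + 1) ^ (d + d') :=
      Nat.le_mul_of_pos_right _ (Nat.pow_pos (Nat.succ_pos _))
    calc A + B + E ≤ _ := Nat.add_le_add (Nat.add_le_add h1 h2) (hE.trans h3)
      _ = _ := by ring
  induction P with
  | skip =>
    refine ⟨1, 0, fun K _ S Q T _ _ _ => ?_⟩
    simp only [run, pow_zero, mul_one, one_mul]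
    omega
  | setInt a e =>
    obtain ⟨c, hc⟩ := a.cost_le
    obtain ⟨c', hc'⟩ := e.cost_le
    refine ⟨c + c' + 1, 0, fun K _ S Q T _ hS _ => ?_⟩
    have h1 := (hc _ Q hS).1
    have h2 := (hc' _ Q hS).1
    simp only [run, pow_zero, mul_one]
    nlinarith
  | setFld a x =>
    obtain ⟨c, hc⟩ := a.cost_le
    obtain ⟨c', hc'⟩ := x.cost_le
    refine ⟨c + c' + 1, 0, fun K _ S Q T _ hS _ => ?_⟩
    have h1 := (hc _ Q hS).1
    have h2 := hc' _ Q hS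
    simp only [run, pow_zero, mul_one]
    nlinarith
  | seq P P' ih ih' =>
    obtain ⟨c, d, hc⟩ := ih
    obtain ⟨c', d', hc'⟩ := ih'
    refine ⟨c + c' + 1, d + d', fun K _ S Q T hT hS h => ?_⟩
    exact comb (hc K S Q T hT hS h.1) (hc' K _ Q T hT (h.1.int_le hT P hS) h.2) (by omega)
  | ifLt a b P P' ih ih' =>
    obtain ⟨c, d, hc⟩ := ih
    obtain ⟨c', d', hc'⟩ := ih'
    obtain ⟨ea, hea⟩ := a.cost_le
    obtain ⟨eb, heb⟩ := b.cost_le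
    refine ⟨c + c' + (ea + eb + 1), d + d', fun K _ S Q T hT hS h => ?_⟩
    have h1 := (hea _ Q hS).1
    have h2 := (heb _ Q hS).1
    simp only [Within] at h
    simp only [run]
    split_ifs at h ⊢
    · have := comb (hc K S Q T hT hS h) (Nat.zero_le (c' * (Q.size + 1) * (T + 1) ^ d'))
        (E := S.int |> fun m => a.cost m + b.cost m + 1) (e := ea + eb + 1) (by
          dsimp only; nlinarith)
      dsimp only at this
      omega
    · have := comb (Nat.zero_le (c * (Q.size + 1) * (T + 1) ^ d)) (hc' K S Q T hT hS h)
        (E := S.int |> fun m => a.cost m + b.cost m + 1) (e := ea + eb + 1) (by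
          dsimp only; nlinarith)
      dsimp only at this
      omega
  | ifZero x P P' ih ih' =>
    obtain ⟨c, d, hc⟩ := ih
    obtain ⟨c', d', hc'⟩ := ih'
    obtain ⟨ea, hea⟩ := x.cost_le
    refine ⟨c + c' + (ea + 1), d + d', fun K _ S Q T hT hS h => ?_⟩
    have h1 := hea _ Q hS
    simp only [Within] at h
    simp only [run]
    split_ifs at h ⊢
    · have := comb (hc K S Q T hT hS h) (Nat.zero_le (c' * (Q.size + 1) * (T + 1) ^ d'))
        (E := S.int |> fun m => x.cost m + 1) (e := ea + 1) (by dsimp only; nlinarith)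
      dsimp only at this
      omega
    · have := comb (Nat.zero_le (c * (Q.size + 1) * (T + 1) ^ d)) (hc' K S Q T hT hS h)
        (E := S.int |> fun m => x.cost m + 1) (e := ea + 1) (by dsimp only; nlinarith)
      dsimp only at this
      omega
  | loop r e P ih =>
    obtain ⟨c, d, hc⟩ := ih
    obtain ⟨ee, hee⟩ := e.cost_le
    -- A loop multiplies by at most `T` rounds, hence one more power. The extra unit in `c + 1` pays
    -- for writing the counter.
    refine ⟨(c + 1) + 0 + (ee + 1), (d + 1) + 0, fun K _ S Q T hT hS h => ?_⟩
    have h1 := (hee _ Q hS).1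
    have hround : ∀ i < e.eval S.int,
        (P.run ⟨Function.update ((loop r (.lit i) P).run S).1.int r i,
          ((loop r (.lit i) P).run S).1.fld⟩).2 + (1 + i.size) ≤
        (c + 1) * (Q.size + 1) * (T + 1) ^ d := by
      intro i hi
      have hiQ : i ≤ Q := by have := h.1; omega
      -- The state before round `i` is that of a shortened loop, which obeys the same bounds. So its
      -- integers are at most `Q`.
      have hw : (loop r (.lit i) P).Within Q T S := by
        refine ⟨?_, fun j hj => h.2 j ?_⟩
        · have := h.1; simp only [IntExp.eval]; omega
        · simp only [IntExp.eval] at hj; omega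
      have h2 := hc K _ Q T hT (update_le (hw.int_le hT _ hS) r hiQ) (h.2 i hi)
      have h3 := Nat.size_le_size hiQ
      have h4 : Q.size + 1 ≤ (Q.size + 1) * (T + 1) ^ d :=
        Nat.le_mul_of_pos_right _ (Nat.pow_pos (Nat.succ_pos _))
      calc _ ≤ c * (Q.size + 1) * (T + 1) ^ d + (Q.size + 1) * (T + 1) ^ d := by omega
        _ = _ := by ring
    have h5 := loop_cost_le hround
    have h6 : e.eval S.int * ((c + 1) * (Q.size + 1) * (T + 1) ^ d) ≤
        (c + 1) * (Q.size + 1) * (T + 1) ^ (d + 1) := by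
      calc _ ≤ (T + 1) * ((c + 1) * (Q.size + 1) * (T + 1) ^ d) :=
            Nat.mul_le_mul_right _ (h.1.trans (Nat.le_succ _))
        _ = _ := by ring
    have h7 := comb (c' := 0) (d' := 0) (B := 0) h6 (Nat.zero_le _)
      (E := e.cost S.int + 1) (e := ee + 1) (by nlinarith)
    omega

/-- The program writes no integer cells except counters, and reads its numbers of rounds from
integer cells. -/
def Prog.Tame : Prog → Prop
  | skip => True
  | setInt _ _ => False
  | setFld _ _ => True
  | seq P P' => P.Tame ∧ P'.Tame
  | ifLt _ _ P P' => P.Tame ∧ P'.Tame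
  | ifZero _ P P' => P.Tame ∧ P'.Tame
  | loop _ e P => (∃ a, e = .cell a) ∧ P.Tame

/-- A number of rounds is the content of a cell, hence at most `T`, and the counters written stay
below it. So the bound for the cells reproduces itself without any knowledge of what the program
computes. -/
theorem Prog.Tame.within {P : Prog} (hP : P.Tame) {T : ℕ} :
    ∀ {S : Store K}, (∀ a, S.int a ≤ T) → P.Within T T S := by
  induction P with
  | skip => exact fun _ => trivial
  | setInt _ _ => exact hP.elim
  | setFld _ _ => exact fun _ => trivial
  | seq P P' ih ih' => exact fun hS => ⟨ih hP.1 hS, ih' hP.2 ((ih hP.1 hS).int_le le_rfl P hS)⟩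
  | ifLt a b P P' ih ih' =>
    intro S hS
    simp only [Within]
    split_ifs
    · exact ih hP.1 hS
    · exact ih' hP.2 hS
  | ifZero x P P' ih ih' =>
    intro S hS
    simp only [Within]
    split_ifs
    · exact ih hP.1 hS
    · exact ih' hP.2 hS
  | loop r e P ih =>
    obtain ⟨⟨a, rfl⟩, hP⟩ := hP
    intro S hS
    have hn : (IntExp.cell a).eval S.int ≤ T := hS _
    refine ⟨hn, ?_⟩
    have key : ∀ n < (IntExp.cell a).eval S.int, P.Within T T
          ⟨Function.update ((loop r (.lit n) P).run S).1.int r n,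
            ((loop r (.lit n) P).run S).1.fld⟩ ∧
        ∀ b, ((loop r (.lit n) P).run S).1.int b ≤ T := by
      intro n
      induction n with
      | zero =>
        intro _
        exact ⟨ih hP (update_le hS r (Nat.zero_le _)), hS⟩
      | succ n ihn =>
        intro hlt
        obtain ⟨h1, h2⟩ := ihn (by omega)
        have h3 : ∀ b, ((loop r (.lit (n + 1)) P).run S).1.int b ≤ T := by
          rw [run_loop_succ]
          exact h1.int_le le_rfl P (update_le h2 r (by omega))
        exact ⟨ih hP (update_le h3 r (by omega)), h3⟩
    exact fun n h => (key n h).1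

theorem sumProg_tame (x : AExp) (ls : List (ℕ × IntExp)) : (sumProg x ls).Tame := by
  induction ls with
  | nil => trivial
  | cons re ls ih => exact ⟨⟨_, rfl⟩, ih⟩

theorem Stm.compile_tame (P : Stm) : P.compile.Tame := by
  induction P with
  | skip => trivial
  | asg a i j l q ls x => exact ⟨trivial, sumProg_tame x ls, trivial⟩
  | seq P Q ih ih' => exact ⟨ih, ih'⟩
  | ifLt _ _ P Q ih ih' => exact ⟨ih, ih'⟩
  | ifZero _ P Q ih ih' => exact ⟨ih, ih'⟩
  | loop r e P ih => exact ⟨⟨_, rfl⟩, ih⟩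

end Cost

end NetCode
end

noncomputable section
open scoped Classical
namespace NetCode

/-! ### The programs for systems of linear equations -/

/-- The content of an integer cell with a fixed address. -/
abbrev ctr (r : ℕ) : IntExp := .cell (.lit r)

/-- The index zero. -/
abbrev fix0 : Dim := .fix (.lit 0)

/-- Read a one-dimensional array. -/
abbrev rd1 (a : ℕ) (q : IntExp) : AExp := .rd a (.lit 0) (.lit 0) (.lit 0) q

/-- Copy vector number `ctr 22` to array 14, and what is in array 13 for it to array 15. -/
def takePivot : Stm :=
  .seq (fill 14 fix0 fix0 fix0 (.run 23 (.lit 10)) [] (.rd 12 (ctr 22) (.lit 0) (.lit 0) (ctr 23)))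
    (fill 15 fix0 fix0 fix0 fix0 [] (rd1 13 (ctr 22)))

/-- One step of elimination for the vectors in array 12, with the row `(ctr 21, ctr 24)` of
array 11. -/
def elimProg : Stm :=
  .seq (fill 13 fix0 fix0 fix0 (.run 22 (.lit 10)) [(23, .lit 10)]
    (.mul (.rd 11 (ctr 21) (ctr 24) (.lit 0) (ctr 23)) (.rd 12 (ctr 22) (.lit 0) (.lit 0)
        (ctr 23))))
  (.seq (fill 15 fix0 fix0 fix0 fix0 [] .zero)
  (.seq (.loop 22 (.lit 10) (.ifZero (rd1 13 (ctr 22)) .skip takePivot))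
  (.seq (fill 19 (.run 22 (.lit 10)) fix0 fix0 (.run 23 (.lit 10)) []
    (.sub (.rd 12 (ctr 22) (.lit 0) (.lit 0) (ctr 23))
      (.mul (.mul (rd1 13 (ctr 22)) (.inv (rd1 15 (.lit 0)))) (rd1 14 (ctr 23)))))
  (fill 12 (.run 22 (.lit 10)) fix0 fix0 (.run 23 (.lit 10)) []
    (.rd 19 (ctr 22) (.lit 0) (.lit 0) (ctr 23))))))

/-- Write the unit vectors to array 12. -/
def unitProg : Stm :=
  .seq (fill 12 (.run 22 (.lit 10)) fix0 fix0 (.run 23 (.lit 10)) [] .zero)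
    (fill 12 (.run 22 (.lit 10)) fix0 fix0 (.fix (ctr 22)) [] .one)

/-- Write generators of the solution space of the system in array 11 to array 12; the cell with
address `e` holds the number of rows over the top field. -/
def kernelProg (e : IntExp) : Stm :=
  .seq unitProg (.loop 21 e (.loop 24 (.lit 5) elimProg))

/-- Copy vector number `ctr 22` to array `a`. -/
def takeVector (a : ℕ) : Stm :=
  fill a fix0 fix0 fix0 (.run 24 (.lit 10)) [] (.rd 12 (ctr 22) (.lit 0) (.lit 0) (ctr 24))

/-- Copy to array `a` the last vector in array 12 that does not vanish on the unknowns from the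
start of the last group on; the cell `cnt` holds the number of these unknowns. -/
def selectProg (a cnt : ℕ) : Stm :=
  .seq (fill a fix0 fix0 fix0 (.run 24 (.lit 10)) [] .zero)
    (.loop 22 (.lit 10) (.loop 23 (.lit cnt)
      (.ifZero (.rd 12 (ctr 22) (.lit 0) (.lit 0) (.add (ctr 11) (ctr 23))) .skip (takeVector a))))

section Kernel

variable {K : Type*} [Field K] {U : ℕ}

/-- Array 12 holds the vectors `V`. -/
def HoldsVectors (m : Mem K) (V : Fin U → Fin U → K) : Prop := ∀ v u : Fin U, m 12 v 0 0 u = V v u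

theorem unitProg_sem {σ : ℕ → ℕ} (hU : σ 10 = U) (m : Mem K) :
    HoldsVectors (unitProg.sem σ m) (fun v u : Fin U => if u = v then 1 else 0) := by
  intro v u
  rw [unitProg, Stm.sem, sem_fill (by decide), sem_fill (by decide)]
  simp [Dim.mem, Dim.upd, sumOver, AExp.val, IntExp.eval, hU, Fin.ext_iff]

/-- Array 13 receives the products of the row with all vectors. The scan leaves the last vector with
nonzero product in array 14 and the product in array 15. Array 19 buffers the new vectors, since a
comprehension must not read the array that it writes. -/
theorem elimProg_sem {σ : ℕ → ℕ} (hU : σ 10 = U) {m : Mem K} {V : Fin U → Fin U → K}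
    (hV : HoldsVectors m V) {a : Fin U → K} (ha : ∀ u : Fin U, m 11 (σ 21) (σ 24) 0 u = a u) :
    HoldsVectors (elimProg.sem σ m) (elimStep a V) := by
  rw [elimProg, Stm.sem]
  set m₁ := (fill 13 fix0 fix0 fix0 (.run 22 (.lit 10)) [(23, .lit 10)]
    (.mul (.rd 11 (ctr 21) (ctr 24) (.lit 0) (ctr 23))
      (.rd 12 (ctr 22) (.lit 0) (.lit 0) (ctr 23)))).sem σ m with hm₁
  have ht : ∀ v : Fin U, m₁ 13 0 0 0 v = ∑ u, a u * V v u := by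
    intro v
    rw [hm₁, sem_fill (by decide)]
    simp only [Dim.mem, Dim.upd, sumOver, AExp.val, IntExp.eval, Function.update_apply, hU, v.2,
      and_self, if_true]
    rw [show (if (10 : ℕ) = 22 then v.val else U) = U from rfl, Finset.sum_range]
    refine Finset.sum_congr rfl fun u _ => ?_
    rw [← ha u, ← hV v u]
    rfl
  have hV₁ : HoldsVectors m₁ V := fun v u => by
    rw [hm₁, Stm.sem_of_notMem (by decide)]; exact hV v u
  clear_value m₁
  rw [Stm.sem]
  set m₂ := (fill 15 fix0 fix0 fix0 fix0 [] .zero).sem σ m₁ with hm₂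
  have hτ : m₂ 15 0 0 0 0 = 0 := by
    rw [hm₂, sem_fill (by decide)]
    simp [Dim.mem, sumOver, AExp.val, IntExp.eval]
  have ht₂ : ∀ v : Fin U, m₂ 13 0 0 0 v = ∑ u, a u * V v u := fun v => by
    rw [hm₂, Stm.sem_of_notMem (by decide)]; exact ht v
  have hV₂ : HoldsVectors m₂ V := fun v u => by
    rw [hm₂, Stm.sem_of_notMem (by decide)]; exact hV₁ v u
  clear_value m₂
  rw [Stm.sem]
  set m₃ := (Stm.loop 22 (.lit 10) (.ifZero (rd1 13 (ctr 22)) .skip takePivot)).sem σ m₂ with hm₃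
  have ht₃ : ∀ v : Fin U, m₃ 13 0 0 0 v = ∑ u, a u * V v u := fun v => by
    rw [hm₃, Stm.sem_of_notMem (by decide)]; exact ht₂ v
  have hV₃ : HoldsVectors m₃ V := fun v u => by
    rw [hm₃, Stm.sem_of_notMem (by decide)]; exact hV₂ v u
  -- The outcome of the scan, phrased with the loop bound so that it is the loop invariant at its
  -- last round: either the last pivot so far has been stored, or all products so far vanish.
  have hpiv : (∃ p : Fin U, p.val < σ 10 ∧ ∑ u, a u * V p u ≠ 0 ∧
      (∀ v : Fin U, v.val < σ 10 → p < v → ¬ ∑ u, a u * V v u ≠ 0) ∧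
      m₃ 15 0 0 0 0 = ∑ u, a u * V p u ∧ ∀ u : Fin U, m₃ 14 0 0 0 u = V p u) ∨
      ((∀ v : Fin U, v.val < σ 10 → ∑ u, a u * V v u = 0) ∧ m₃ 15 0 0 0 0 = 0) := by
    have := Stm.sem_loop_induct (r := 22) (e := .lit 10)
      (P := .ifZero (rd1 13 (ctr 22)) .skip takePivot) σ m₂
      (fun t m' => (∀ v : Fin U, m' 13 0 0 0 v = ∑ u, a u * V v u) ∧ HoldsVectors m' V ∧
        ((∃ p : Fin U, p.val < t ∧ ∑ u, a u * V p u ≠ 0 ∧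
          (∀ v : Fin U, v.val < t → p < v → ¬ ∑ u, a u * V v u ≠ 0) ∧
          m' 15 0 0 0 0 = ∑ u, a u * V p u ∧ ∀ u : Fin U, m' 14 0 0 0 u = V p u) ∨
          ((∀ v : Fin U, v.val < t → ∑ u, a u * V v u = 0) ∧ m' 15 0 0 0 0 = 0)))
      ⟨ht₂, hV₂, Or.inr ⟨fun v hv => absurd hv (Nat.not_lt_zero _), hτ⟩⟩ ?_
    · exact this.2.2
    · intro t htU m' ⟨h1, h2, h3⟩
      simp only [IntExp.eval, hU] at htU
      have htv : (rd1 13 (ctr 22)).val (Function.update σ 22 t) m' = ∑ u, a u * V ⟨t, htU⟩ u := by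
        rw [← h1 ⟨t, htU⟩]; rfl
      rw [Stm.sem, htv]
      split_ifs with hz
      · refine ⟨h1, h2, ?_⟩
        rcases h3 with ⟨p, hp, hpn, hpl, hp'⟩ | ⟨hall, h0⟩
        · refine Or.inl ⟨p, hp.trans (Nat.lt_succ_self t), hpn, fun v hv hpv => ?_, hp'⟩
          rcases Nat.lt_succ_iff_lt_or_eq.1 hv with hv | hv
          · exact hpl v hv hpv
          · rw [show v = ⟨t, htU⟩ from Fin.ext hv]; exact not_not.2 hz
        · refine Or.inr ⟨fun v hv => ?_, h0⟩
          rcases Nat.lt_succ_iff_lt_or_eq.1 hv with hv | hv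
          · exact hall v hv
          · rw [show v = ⟨t, htU⟩ from Fin.ext hv]; exact hz
      · refine ⟨fun v => ?_, fun v u => ?_, Or.inl ⟨⟨t, htU⟩, Nat.lt_succ_self t, hz, ?_, ?_, ?_⟩⟩
        · rw [Stm.sem_of_notMem (by decide)]; exact h1 v
        · rw [Stm.sem_of_notMem (by decide)]; exact h2 v u
        · intro v hv hpv
          have : t < v.val := hpv
          omega
        · rw [takePivot, Stm.sem, sem_fill (by decide)]
          simp only [Dim.mem, Dim.upd, sumOver, IntExp.eval, and_self, if_true]
          rw [← htv, AExp.val_congr]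
          intro b hb
          rw [Stm.sem_of_notMem]
          simp only [AExp.reads, List.mem_singleton] at hb
          subst hb
          decide
        · intro u
          rw [takePivot, Stm.sem, Stm.sem_of_notMem (a := 14) (by decide), sem_fill (by decide)]
          rw [← h2 ⟨t, htU⟩ u]
          simp [Dim.mem, Dim.upd, sumOver, AExp.val, IntExp.eval, hU]
  clear_value m₃
  intro v u
  rw [Stm.sem, sem_fill (by decide), sem_fill (by decide)]
  simp only [Dim.mem, Dim.upd, sumOver, AExp.val, IntExp.eval, Function.update_apply, hU, v.2,
    true_and]
  norm_num [hU]
  rw [hV₃ v u, ht₃ v]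
  unfold elimStep
  rcases hpiv with ⟨p, -, hpn, hpl, hp1, hp2⟩ | ⟨hall, h0⟩
  · have hex : ∃ v, ∑ u, a u * V v u ≠ 0 := ⟨p, hpn⟩
    rw [dif_pos hex, lastSat_eq hex hpn fun v' hv' => hpl v' (by rw [hU]; exact v'.2) hv', hp1, hp2]
  -- Without a pivot, array 14 may hold anything. It does no harm because it is multiplied by a
  -- product that vanishes.
  · rw [dif_neg, hall v (by rw [hU]; exact v.2)]
    · ring
    · rintro ⟨v', hv'⟩
      exact hv' (hall v' (by rw [hU]; exact v'.2))

theorem kernelProg_sem {n₁ n₂ : ℕ} {e : IntExp} {σ : ℕ → ℕ} (hU : σ 10 = U) (hN : σ 5 = n₂)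
    (he : σ (e.eval σ) = n₁) {m : Mem K} {a : Fin n₁ → Fin n₂ → Fin U → K}
    (ha : ∀ i j u, m 11 (i : Fin n₁) (j : Fin n₂) 0 (u : Fin U) = a i j u) :
    HoldsVectors ((kernelProg e).sem σ m) (kernelOf a) := by
  rw [kernelProg, Stm.sem]
  have h0 := unitProg_sem (K := K) hU m
  have ha0 : ∀ i j u, unitProg.sem σ m 11 (i : Fin n₁) (j : Fin n₂) 0 (u : Fin U) = a i j u := by
    intro i j u
    rw [Stm.sem_of_notMem (by decide)]; exact ha i j u
  set m₀ := unitProg.sem σ m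
  clear_value m₀
  have := Stm.sem_loop_induct (r := 21) (e := e) (P := .loop 24 (.lit 5) elimProg) σ m₀
    (fun t m' => (∀ i j u, m' 11 (i : Fin n₁) (j : Fin n₂) 0 (u : Fin U) = a i j u) ∧
      HoldsVectors m' (iterUpTo (fun i V => iterUpTo (fun j V => elimStep (a i j) V) V n₂)
        (fun v u => if u = v then 1 else 0) t)) ⟨ha0, h0⟩ ?_
  · rw [he] at this
    exact this.2
  · intro t ht m' ⟨h1, h2⟩
    rw [he] at ht
    have hin := Stm.sem_loop_induct (r := 24) (e := .lit 5) (P := elimProg)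
      (Function.update σ 21 t) m'
      (fun x m'' => (∀ i j u, m'' 11 (i : Fin n₁) (j : Fin n₂) 0 (u : Fin U) = a i j u) ∧
        HoldsVectors m'' (iterUpTo (fun j V => elimStep (a ⟨t, ht⟩ j) V)
          (iterUpTo (fun i V => iterUpTo (fun j V => elimStep (a i j) V) V n₂)
            (fun v u => if u = v then 1 else 0) t) x)) ⟨h1, h2⟩ ?_
    · rw [show Function.update σ 21 t ((IntExp.lit 5).eval (Function.update σ 21 t)) = n₂ from hN]
        at hin
      refine ⟨hin.1, ?_⟩
      have := iterUpTo_succ (fun i V => iterUpTo (fun j V => elimStep (a i j) V) V n₂)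
        (fun v u => if u = v then 1 else 0) ⟨t, ht⟩
      dsimp only at this
      rw [this]
      exact hin.2
    · intro x hx m'' ⟨h3, h4⟩
      replace hx : x < n₂ := hN ▸ hx
      refine ⟨fun i j u => ?_, ?_⟩
      · rw [Stm.sem_of_notMem (by decide)]; exact h3 i j u
      · have := iterUpTo_succ (fun j V => elimStep (a ⟨t, ht⟩ j) V)
          (iterUpTo (fun i V => iterUpTo (fun j V => elimStep (a i j) V) V n₂)
            (fun v u => if u = v then 1 else 0) t) ⟨x, hx⟩
        dsimp only at this
        rw [this]
        exact elimProg_sem (σ := Function.update (Function.update σ 21 t) 24 x) hU h4 fun u => h3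
            ⟨t, ht⟩ ⟨x, hx⟩ u

/-- The outer loop overwrites its result at every vector with a nonzero entry in the window, so the
last such vector survives. Within one vector the copy may happen several times, always with the same
effect. -/
theorem selectProg_sem {b cnt : ℕ} (hb : b ≠ 12) {σ : ℕ → ℕ} (hU : σ 10 = U)
    (hcnt : cnt < 22) (hle : σ 11 + σ cnt ≤ U) {m : Mem K} {V : Fin U → Fin U → K}
    (hV : HoldsVectors m V) (u : Fin U) :
    (selectProg b cnt).sem σ m b 0 0 0 u =
      selectFrom (fun u : Fin U => σ 11 ≤ u.val ∧ u.val < σ 11 + σ cnt) V u := by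
  have hok : ∀ x : AExp, x.reads = [12] ∨ x.reads = [] →
      fillOk b fix0 fix0 fix0 (.run 24 (.lit 10)) x = true := by
    intro x hx
    have h1 : (!x.reads.contains b) = true := by
      rcases hx with hx | hx <;> simp [hx, hb]
    rw [fillOk, h1]
    decide
  have hnot : ∀ x ls, 12 ∉ (fill b fix0 fix0 fix0 (.run 24 (.lit 10)) ls x).writes := by
    intro x ls
    simp only [fill, Dim.wrap, Stm.writes, List.mem_singleton]
    exact fun h => hb h.symm
  set J : Fin U → Prop := fun u => σ 11 ≤ u.val ∧ u.val < σ 11 + σ cnt with hJ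
  rw [selectProg, Stm.sem]
  set m₀ := (fill b fix0 fix0 fix0 (.run 24 (.lit 10)) [] .zero).sem σ m with hm₀
  have hz : ∀ u : Fin U, m₀ b 0 0 0 u = 0 := by
    intro u
    rw [hm₀, sem_fill (hok _ (Or.inr rfl))]
    simp [Dim.mem, Dim.upd, sumOver, AExp.val, IntExp.eval, hU]
  have hV₀ : HoldsVectors m₀ V := fun v u => by
    rw [hm₀, Stm.sem_of_notMem (hnot _ _)]; exact hV v u
  clear_value m₀
  have htake : ∀ (τ : ℕ → ℕ) (m' : Mem K) (v : Fin U), τ 10 = U → τ 22 = v → HoldsVectors m' V →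
      HoldsVectors ((takeVector b).sem τ m') V ∧
      ∀ u : Fin U, (takeVector b).sem τ m' b 0 0 0 u = V v u := by
    intro τ m' v h10 h22 h2
    refine ⟨fun v u => ?_, fun u => ?_⟩
    · rw [takeVector, Stm.sem_of_notMem (hnot _ _)]; exact h2 v u
    · rw [takeVector, sem_fill (hok _ (Or.inl rfl)), ← h2 v u]
      simp [Dim.mem, Dim.upd, sumOver, AExp.val, IntExp.eval, h10, h22]
  let Q : ℕ → Mem K → Prop := fun t m' =>
    (∃ p : Fin U, p.val < t ∧ (∃ u, J u ∧ V p u ≠ 0) ∧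
      (∀ v : Fin U, v.val < t → p < v → ¬ ∃ u, J u ∧ V v u ≠ 0) ∧
      ∀ u : Fin U, m' b 0 0 0 u = V p u) ∨
    ((∀ v : Fin U, v.val < t → ¬ ∃ u, J u ∧ V v u ≠ 0) ∧ ∀ u : Fin U, m' b 0 0 0 u = 0)
  have hmain := Stm.sem_loop_induct (r := 22) (e := .lit 10)
    (P := .loop 23 (.lit cnt) (.ifZero (.rd 12 (ctr 22) (.lit 0) (.lit 0)
      (.add (ctr 11) (ctr 23))) .skip (takeVector b))) σ m₀
    (fun t m' => HoldsVectors m' V ∧ Q t m')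
    ⟨hV₀, Or.inr ⟨fun v hv => absurd hv (Nat.not_lt_zero _), hz⟩⟩ ?_
  · rw [show σ ((IntExp.lit 10).eval σ) = U from hU] at hmain
    rw [selectFrom]
    rcases hmain.2 with ⟨p, -, hp, hpl, hpu⟩ | ⟨hall, h0⟩
    · rw [dif_pos ⟨p, hp⟩, lastSat_eq ⟨p, hp⟩ hp fun v hv => hpl v v.2 hv]
      exact hpu u
    · rw [dif_neg fun ⟨v, hv⟩ => hall v v.2 hv]
      exact h0 u
  · intro t ht m' ⟨h1, h2⟩
    replace ht : t < U := hU ▸ ht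
    have hσ : ∀ c, c < 22 → Function.update σ 22 t c = σ c := fun c hc =>
      Function.update_of_ne hc.ne _ _
    have hin := Stm.sem_loop_induct (r := 23) (e := .lit cnt)
      (P := .ifZero (.rd 12 (ctr 22) (.lit 0) (.lit 0)
        (.add (ctr 11) (ctr 23))) .skip (takeVector b)) (Function.update σ 22 t) m'
      -- Either a nonzero entry has been met and vector `t` is in place, or none has and the result
      -- of the previous vectors is untouched.
      (fun x m'' => HoldsVectors m'' V ∧
        (((∃ y < x, ∃ h : σ 11 + y < U, V ⟨t, ht⟩ ⟨σ 11 + y, h⟩ ≠ 0) ∧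
          ∀ u : Fin U, m'' b 0 0 0 u = V ⟨t, ht⟩ u) ∨
        ((∀ y < x, ∀ h : σ 11 + y < U, V ⟨t, ht⟩ ⟨σ 11 + y, h⟩ = 0) ∧ Q t m'')))
      ⟨h1, Or.inr ⟨fun y hy => absurd hy (Nat.not_lt_zero _), h2⟩⟩ ?_
    · rw [show Function.update σ 22 t ((IntExp.lit cnt).eval (Function.update σ 22 t)) = σ cnt from
        hσ cnt hcnt] at hin
      refine ⟨hin.1, ?_⟩
      rcases hin.2 with ⟨⟨y, hy, hyU, hne⟩, hu⟩ | ⟨hall, hQ⟩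
      · refine Or.inl ⟨⟨t, ht⟩, Nat.lt_succ_self t, ⟨⟨σ 11 + y, hyU⟩, ⟨?_, ?_⟩, hne⟩, ?_, hu⟩
        · exact Nat.le_add_right _ _
        · exact Nat.add_lt_add_left hy _
        · intro v hv hpv
          have : t < v.val := hpv
          omega
      · have hno : ¬ ∃ u, J u ∧ V ⟨t, ht⟩ u ≠ 0 := by
          rintro ⟨u, ⟨hu1, hu2⟩, hne⟩
          have h3 : σ 11 + (u.val - σ 11) = u.val := by omega
          apply hne
          have := hall (u.val - σ 11) (by omega) (by rw [h3]; exact u.2)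
          rw [← this]
          congr 1
          exact Fin.ext h3.symm
        have hstep : ∀ v : Fin U, v.val < t + 1 → v.val < t ∨ v = ⟨t, ht⟩ := fun v hv =>
          (Nat.lt_succ_iff_lt_or_eq.1 hv).imp id fun h => Fin.ext h
        rcases hQ with ⟨p, hp, hpn, hpl, hp'⟩ | ⟨hall', h0⟩
        · refine Or.inl ⟨p, hp.trans (Nat.lt_succ_self t), hpn, fun v hv hpv => ?_, hp'⟩
          rcases hstep v hv with hv | rfl
          · exact hpl v hv hpv
          · exact hno
        · refine Or.inr ⟨fun v hv => ?_, h0⟩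
          rcases hstep v hv with hv | rfl
          · exact hall' v hv
          · exact hno
    · intro x hx m'' ⟨h3, h4⟩
      replace hx : x < σ cnt := (hσ cnt hcnt) ▸ hx
      have hxU : σ 11 + x < U := by omega
      set τ := Function.update (Function.update σ 22 t) 23 x with hτ
      have hread : (AExp.rd 12 (ctr 22) (.lit 0) (.lit 0) (.add (ctr 11) (ctr 23))).val τ m'' =
          V ⟨t, ht⟩ ⟨σ 11 + x, hxU⟩ := by
        rw [← h3]; rfl
      have hxs : ∀ y, y < x + 1 → y < x ∨ y = x := fun y hy => Nat.lt_succ_iff_lt_or_eq.1 hy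
      rw [Stm.sem, hread]
      split_ifs with h0
      · refine ⟨h3, ?_⟩
        rcases h4 with ⟨⟨y, hy, hyU, hne⟩, hu⟩ | ⟨hall, hQ⟩
        · exact Or.inl ⟨⟨y, hy.trans (Nat.lt_succ_self x), hyU, hne⟩, hu⟩
        · refine Or.inr ⟨fun y hy hyU => ?_, hQ⟩
          rcases hxs y hy with hy | rfl
          · exact hall y hy hyU
          · exact h0
      · have h5 := htake τ m'' ⟨t, ht⟩ hU rfl h3
        exact ⟨h5.1, Or.inl ⟨⟨x, Nat.lt_succ_self x, hxU, h0⟩, h5.2⟩⟩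

end Kernel

end NetCode
end

noncomputable section
open scoped Classical
namespace NetCode

/-! ### The programs for the arithmetic of the top field

An element of the top field is held by its coordinates in the product basis. Array 7 is the
accumulator of these programs, array 8 is work space, array 6 holds the Frobenius maps. -/

/-- The address of the number of packets of source `j`. -/
abbrev lenAddr (j : IntExp) : IntExp := .add (.lit 32) (.add (ctr 0) j)

/-- The structure constant with indices `x`, `y`, `c`. -/
abbrev structE (x y c : IntExp) : AExp :=
  rd1 1 (.add (.mul (.add (.mul x (ctr 5)) y) (ctr 5)) c)

/-- Copy array 8 to the accumulator. -/
def moveProg : Stm := fill 7 fix0 fix0 fix0 (.run 29 (.lit 5)) [] (rd1 8 (ctr 29))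

/-- Write basis element number `ctr 16` to the accumulator. -/
def unitElt : Stm :=
  .seq (fill 7 fix0 fix0 fix0 (.run 29 (.lit 5)) [] .zero)
    (fill 7 fix0 fix0 fix0 (.fix (ctr 16)) [] .one)

/-- Apply Frobenius map number `ph` to the accumulator. -/
def frobProg (ph : IntExp) : Stm :=
  .seq (fill 8 fix0 fix0 fix0 (.run 29 (.lit 5)) [(30, .lit 5)]
    (.mul (rd1 7 (ctr 30)) (.rd 6 ph (ctr 30) (.lit 0) (ctr 29)))) moveProg

/-- Write the iterated images of the accumulator under Frobenius map number `ph` to array `a`. -/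
def powersProg (a : ℕ) (i j ph cnt : IntExp) : Stm :=
  .loop 27 cnt (.seq (fill a (.fix i) (.fix j) (.fix (ctr 27)) (.run 29 (.lit 5)) []
    (rd1 7 (ctr 29))) (frobProg ph))

/-- Square the accumulator. -/
def squareProg : Stm :=
  .seq (fill 8 fix0 fix0 fix0 (.run 29 (.lit 5)) [(30, .lit 5), (31, .lit 5)]
    (.mul (.mul (rd1 7 (ctr 30)) (rd1 7 (ctr 31))) (structE (ctr 30) (ctr 31) (ctr 29)))) moveProg

/-- Multiply the accumulator by basis element number `ctr 16`. -/
def scaleProg : Stm :=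
  .seq (fill 8 fix0 fix0 fix0 (.run 29 (.lit 5)) [(30, .lit 5)]
    (.mul (rd1 7 (ctr 30)) (structE (ctr 30) (ctr 16) (ctr 29)))) moveProg

/-- The address of binary digit number `j` of the size of the base field. -/
abbrev bitAddr (j : IntExp) : IntExp :=
  .add (.lit 32) (.add (ctr 0) (.add (ctr 0) (.add (ctr 0) j)))

/-- Write the Frobenius map of the base field to array 6. -/
def baseFrobProg : Stm :=
  .loop 16 (.lit 5) (.seq unitElt (.seq
    (.loop 17 (.lit 9) (.seq squareProg
      (.ifLt (.lit 0) (.cell (bitAddr (.sub (.sub (ctr 9) (.lit 1)) (ctr 17)))) scaleProg .skip)))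
    (fill 6 fix0 (.fix (ctr 16)) fix0 (.run 29 (.lit 5)) [] (rd1 7 (ctr 29)))))

/-- Write the Frobenius maps of the tower to array 6. -/
def towerFrobProg : Stm :=
  .loop 18 (.lit 0) (.loop 16 (.lit 5) (.seq unitElt (.seq
    (powersProg 22 (.lit 0) (.lit 0) (ctr 18) (lenAddr (ctr 18)))
    (fill 6 (.fix (.add (ctr 18) (.lit 1))) (.fix (ctr 16)) fix0 (.run 29 (.lit 5)) []
      (rd1 7 (ctr 29))))))

namespace TowerCode

variable {K L : Type*} [Field K] [Fintype K] [Field L] [Algebra K L] {s : ℕ}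
  {R : Fin s → ℕ} {z : ℕ} (C : TowerCode K L (len R z)) [FiniteDimensional K L]

/-- An array entry holds the coordinates of an element of the top field. -/
def HoldsElt (m : Mem K) (a i j l : ℕ) (x : L) : Prop :=
  ∀ c : Fin (∏ i, len R z i), m a i j l c = C.coords x c

/-- Array 1 starts with the structure constants. -/
def HoldsStruct (m : Mem K) : Prop :=
  ∀ x y c : Fin (∏ i, len R z i),
    m 1 0 0 0 ((x * (∏ i, len R z i) + y) * (∏ i, len R z i) + c) =
      C.coords (C.prodBasis x * C.prodBasis y) c

/-- Matrix number `t` in array 6 is that of the map `f`. -/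
def HoldsMap (m : Mem K) (t : ℕ) (f : L →ₐ[K] L) : Prop :=
  ∀ a : Fin (∏ i, len R z i), C.HoldsElt m 6 t a 0 (f (C.prodBasis a))

/-- The power map with the `t`-th field of the tower as fixed field. -/
def frobNat (_C : TowerCode K L (len R z)) (t : ℕ) : L →ₐ[K] L :=
  FiniteField.frobeniusAlgHom K L ^ (∏ l : Fin s with l.val < t, len R z l)

theorem frobNat_val (i : Fin s) : C.frobNat i = C.frob i := rfl

theorem frobNat_zero (x : L) : C.frobNat 0 x = x ^ Fintype.card K := by
  rw [frobNat, frobeniusAlgHom_pow_apply]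
  simp

/-- Going up one step of the tower multiplies the degree by `n i`. So the next power map is the `n
i`-fold iterate of the present one. -/
theorem frobNat_succ (i : Fin s) : C.frobNat (i + 1) = C.frobNat i ^ len R z i := by
  rw [frobNat, frobNat, ← pow_mul]
  congr 1
  have : Finset.univ.filter (fun l : Fin s => l.val < i.val + 1) =
      insert i (Finset.univ.filter fun l : Fin s => l.val < i.val) := by
    ext l
    simp only [Finset.mem_filter, Finset.mem_univ, true_and, Finset.mem_insert, Fin.ext_iff]
    omega
  rw [this, Finset.prod_insert (by simp), mul_comm]

variable {C}

theorem HoldsElt.congr {m m' : Mem K} {a i j l : ℕ} {x : L} (h : C.HoldsElt m a i j l x)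
    (hm : m' a = m a) : C.HoldsElt m' a i j l x := fun c => by rw [hm]; exact h c

theorem HoldsStruct.congr {m m' : Mem K} (h : C.HoldsStruct m)
    (hm : m' 1 = m 1) : C.HoldsStruct m' := fun x y c => by rw [hm]; exact h x y c

theorem HoldsMap.congr {m m' : Mem K} {t : ℕ} {f : L →ₐ[K] L} (h : C.HoldsMap m t f)
    (hm : m' 6 = m 6) : C.HoldsMap m' t f := fun a => (h a).congr hm

section Programs

variable {σ : ℕ → ℕ} {m : Mem K}

theorem moveProg_sem (hN : σ 5 = ∏ i, len R z i) {x : L} (hx : C.HoldsElt m 8 0 0 0 x) :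
    C.HoldsElt (moveProg.sem σ m) 7 0 0 0 x := by
  intro c
  rw [moveProg, sem_fill (by decide), ← hx c]
  simp [Dim.mem, Dim.upd, sumOver, AExp.val, IntExp.eval, hN]

theorem unitElt_sem (hN : σ 5 = ∏ i, len R z i) {c : Fin (∏ i, len R z i)} (hc : σ 16 = c) :
    C.HoldsElt (unitElt.sem σ m) 7 0 0 0 (C.prodBasis c) := by
  intro c'
  rw [unitElt, Stm.sem, sem_fill (by decide), sem_fill (by decide), coords_prodBasis]
  simp [Dim.mem, Dim.upd, sumOver, AExp.val, IntExp.eval, hN, hc, Fin.ext_iff]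

theorem frobProg_sem (hN : σ 5 = ∏ i, len R z i) {ph : IntExp} (hph : ph.avoids [29, 30] = true)
    {f : L →ₐ[K] L}
    (hf : C.HoldsMap m (ph.eval σ) f) {x : L} (hx : C.HoldsElt m 7 0 0 0 x) :
    C.HoldsElt ((frobProg ph).sem σ m) 7 0 0 0 (f x) := by
  rw [frobProg, Stm.sem]
  refine moveProg_sem hN fun c => ?_
  rw [sem_fill rfl, coords_algHom]
  simp only [Dim.mem, Dim.upd, sumOver, AExp.val, IntExp.eval, Function.update_apply, hN, c.2,
    and_self, if_true]
  rw [show (if (5 : ℕ) = 29 then c.val else ∏ i, len R z i) = ∏ i, len R z i from rfl,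
    Finset.sum_range]
  refine Finset.sum_congr rfl fun a _ => ?_
  rw [← hx a, ← hf a c]
  have : ph.eval (Function.update (Function.update σ 29 c) 30 a) = ph.eval σ := by
    refine IntExp.eval_congr (D := [29, 30]) (by decide) hph fun b hb => ?_
    simp only [List.mem_cons, List.not_mem_nil, or_false, not_or] at hb
    rw [Function.update_of_ne hb.2, Function.update_of_ne hb.1]
  rw [this]
  rfl

theorem squareProg_sem (hN : σ 5 = ∏ i, len R z i) (hS : C.HoldsStruct m) {x : L}
    (hx : C.HoldsElt m 7 0 0 0 x) :
    C.HoldsElt (squareProg.sem σ m) 7 0 0 0 (x * x) := by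
  rw [squareProg, Stm.sem]
  refine moveProg_sem hN fun c => ?_
  rw [sem_fill (by decide), coords_mul]
  simp only [Dim.mem, Dim.upd, sumOver, AExp.val, IntExp.eval, Function.update_apply, hN, c.2,
    and_self, if_true]
  norm_num [hN]
  rw [Finset.sum_range]
  refine Finset.sum_congr rfl fun a _ => ?_
  rw [Finset.sum_range]
  refine Finset.sum_congr rfl fun b _ => ?_
  rw [← hx a, ← hx b, ← hS a b c]

theorem scaleProg_sem (hN : σ 5 = ∏ i, len R z i) (hS : C.HoldsStruct m) {b : Fin (∏ i,
    len R z i)} (hb : σ 16 = b) {x : L}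
    (hx : C.HoldsElt m 7 0 0 0 x) :
    C.HoldsElt (scaleProg.sem σ m) 7 0 0 0 (x * C.prodBasis b) := by
  rw [scaleProg, Stm.sem]
  refine moveProg_sem hN fun c => ?_
  rw [sem_fill (by decide), coords_mul]
  simp only [Dim.mem, Dim.upd, sumOver, AExp.val, IntExp.eval, Function.update_apply, hN, c.2,
    and_self, if_true]
  norm_num [hN, hb]
  rw [Finset.sum_range]
  refine Finset.sum_congr rfl fun a _ => ?_
  rw [Finset.sum_eq_single b, coords_prodBasis, if_pos rfl, mul_one, ← hx a, ← hS a b c]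
  · intro b' _ hne
    rw [coords_prodBasis, if_neg hne, mul_zero, zero_mul]
  · exact fun h => absurd (Finset.mem_univ _) h

/-- Three facts are needed later: the final accumulator, which builds the next Frobenius map, the
stored list of iterates, and that other slices of the array survive. -/
theorem powersProg_sem (hN : σ 5 = ∏ i, len R z i) {a : ℕ} {i j ph cnt : IntExp} (ha : a ∉ [6, 7,
    8])
    (hi : i.avoids [27, 29, 30] = true) (hj : j.avoids [27, 29, 30] = true)
    (hph : ph.avoids [27, 29, 30] = true) (hph' : ph.avoids [29, 30] = true)
    (hi' : i.avoids [29] = true) (hj' : j.avoids [29] = true) {f : L →ₐ[K] L}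
    (hf : C.HoldsMap m (ph.eval σ) f) {x : L} (hx : C.HoldsElt m 7 0 0 0 x) :
    C.HoldsElt ((powersProg a i j ph cnt).sem σ m) 7 0 0 0 ((f ^ σ (cnt.eval σ)) x) ∧
    (∀ l < σ (cnt.eval σ), C.HoldsElt ((powersProg a i j ph cnt).sem σ m) a (i.eval σ) (j.eval σ) l
      ((f ^ l) x)) ∧
    ∀ i' j', ¬ (i' = i.eval σ ∧ j' = j.eval σ) →
      (powersProg a i j ph cnt).sem σ m a i' j' = m a i' j' := by
  simp only [List.mem_cons, List.not_mem_nil, or_false, not_or] at ha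
  have hup : ∀ {e : IntExp} (t : ℕ), e.avoids [27, 29, 30] = true →
      e.eval (Function.update σ 27 t) = e.eval σ := by
    intro e t he
    refine IntExp.eval_congr (D := [27, 29, 30]) (by decide) he fun b hb => ?_
    simp only [List.mem_cons, List.not_mem_nil, or_false, not_or] at hb
    rw [Function.update_of_ne hb.1]
  have hok : fillOk a (.fix i) (.fix j) (.fix (ctr 27)) (.run 29 (.lit 5)) (rd1 7 (ctr 29)) =
      true := by
    simp [fillOk, Dim.keeps, Dim.idx, AExp.reads, IntExp.avoids, hi', hj', ha.2.1]
  have := Stm.sem_loop_induct (r := 27) (e := cnt)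
    (P := .seq (fill a (.fix i) (.fix j) (.fix (ctr 27)) (.run 29 (.lit 5)) []
      (rd1 7 (ctr 29))) (frobProg ph)) σ m
    (fun n m' => C.HoldsMap m' (ph.eval σ) f ∧ C.HoldsElt m' 7 0 0 0 ((f ^ n) x) ∧
      (∀ l < n, C.HoldsElt m' a (i.eval σ) (j.eval σ) l ((f ^ l) x)) ∧
      ∀ i' j', ¬ (i' = i.eval σ ∧ j' = j.eval σ) → m' a i' j' = m a i' j')
    ⟨hf, by simpa using hx, fun l hl => absurd hl (Nat.not_lt_zero _), fun _ _ _ => rfl⟩ ?_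
  · exact this.2
  · intro n _ m' ⟨h1, h2, h3, h4⟩
    rw [Stm.sem]
    set m₁ := (fill a (.fix i) (.fix j) (.fix (ctr 27)) (.run 29 (.lit 5)) []
      (rd1 7 (ctr 29))).sem (Function.update σ 27 n) m' with hm₁
    have hfr : ∀ a', a' ≠ a → m₁ a' = m' a' := fun a' ha' =>
      Stm.sem_of_notMem (by simpa [fill, Dim.wrap, Stm.writes] using ha') _ _
    have hm₁a : ∀ i' j' l c, m₁ a i' j' l c =
        if (i' = i.eval σ ∧ j' = j.eval σ) ∧ l = n ∧ c < ∏ i, len R z i then m' 7 0 0 0 c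
        else m' a i' j' l c := by
      intro i' j' l c
      rw [hm₁, sem_fill hok]
      simp only [Dim.mem, Dim.upd, sumOver, AExp.val, hup n hi, hup n hj, true_and,
        and_assoc]
      simp [IntExp.eval, hN]
    have hfin : (frobProg ph).sem (Function.update σ 27 n) m₁ a = m₁ a :=
      Stm.sem_of_notMem (by
        simp [frobProg, moveProg, fill, Dim.wrap, Stm.writes, ha.2.1, ha.2.2]) _ _
    refine ⟨?_, ?_, ?_, ?_⟩
    · refine h1.congr ?_
      rw [Stm.sem_of_notMem (by simp [frobProg, moveProg, fill, Dim.wrap, Stm.writes]),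
        hfr 6 (Ne.symm ha.1)]
    · rw [pow_succ', AlgHom.mul_apply]
      refine frobProg_sem (by rw [← hN]; rfl) hph' ?_ (h2.congr (hfr 7 (Ne.symm ha.2.1)))
      rw [hup n hph]
      exact h1.congr (hfr 6 (Ne.symm ha.1))
    · intro l hl c
      rw [hfin, hm₁a]
      split_ifs with h
      · rw [h.2.1]; exact h2 c
      · rcases Nat.lt_succ_iff_lt_or_eq.1 hl with hl | hl
        · exact h3 l hl c
        · exact absurd ⟨⟨rfl, rfl⟩, hl, c.2⟩ h
    · intro i' j' hij
      funext l c
      rw [hfin, hm₁a, if_neg fun h => hij h.1, h4 i' j' hij]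

/-- The cells that hold the binary digits of the size of the base field. -/
def HoldsBits (K : Type*) [Fintype K] (s : ℕ) (σ : ℕ → ℕ) : Prop :=
  σ 9 = Nat.log 2 (Fintype.card K) ∧ ∀ j ≤ Nat.log 2 (Fintype.card K),
    σ (32 + (s + (s + (s + j)))) = Fintype.card K / 2 ^ j % 2

/-- Square and multiply, from the leading binary digit down, so that the exponent `|K|` costs only
logarithmically many multiplications. It is done for each basis element, and linearity gives the
whole map. -/
theorem baseFrobProg_sem (hN : σ 5 = ∏ i, len R z i) (h0 : σ 0 = s) (hbits : HoldsBits K s σ)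
    (hS : C.HoldsStruct m) :
    C.HoldsMap (baseFrobProg.sem σ m) 0 (C.frobNat 0) := by
  set p := Fintype.card K with hp
  set ℓ := Nat.log 2 p with hℓ
  have hp0 : p ≠ 0 := Fintype.card_ne_zero
  have := Stm.sem_loop_induct (r := 16) (e := .lit 5)
    (P := .seq unitElt (.seq
    (.loop 17 (.lit 9) (.seq squareProg
      (.ifLt (.lit 0) (.cell (bitAddr (.sub (.sub (ctr 9) (.lit 1)) (ctr 17)))) scaleProg .skip)))
    (fill 6 fix0 (.fix (ctr 16)) fix0 (.run 29 (.lit 5)) [] (rd1 7 (ctr 29))))) σ m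
    (fun n m' => C.HoldsStruct m' ∧ ∀ a : Fin (∏ i, len R z i), a.val < n →
      C.HoldsElt m' 6 0 a 0 (C.prodBasis a ^ p)) ⟨hS, fun a ha => absurd ha (Nat.not_lt_zero _)⟩ ?_
  · intro a
    rw [frobNat_zero]
    exact this.2 a (by rw [show σ ((IntExp.lit 5).eval σ) = _ from hN]; exact a.2)
  · intro t ht m' ⟨h1, h2⟩
    replace ht : t < ∏ i, len R z i := hN ▸ ht
    set τ := Function.update σ 16 t with hτ
    have hNτ : τ 5 = ∏ i, len R z i := hN
    rw [Stm.sem, Stm.sem]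
    set m₁ := unitElt.sem τ m' with hm₁
    have hs₁ : C.HoldsStruct m₁ := h1.congr (Stm.sem_of_notMem (by decide) _ _)
    have hx₁ : C.HoldsElt m₁ 7 0 0 0 (C.prodBasis ⟨t, ht⟩) := unitElt_sem hNτ rfl
    have h6₁ : m₁ 6 = m' 6 := Stm.sem_of_notMem (by decide) _ _
    clear_value m₁
    -- After `n` rounds the exponent is made of the leading digits of `|K|`, starting with the
    -- leading one for `n = 0`. The guard `n ≤ ℓ` keeps the truncated subtraction honest.
    have hpow := Stm.sem_loop_induct (r := 17) (e := .lit 9) (P := .seq squareProg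
        (.ifLt (.lit 0) (.cell (bitAddr (.sub (.sub (ctr 9) (.lit 1)) (ctr 17)))) scaleProg .skip))
      τ m₁ (fun n m'' => n ≤ ℓ → C.HoldsStruct m'' ∧ m'' 6 = m' 6 ∧
        C.HoldsElt m'' 7 0 0 0 (C.prodBasis ⟨t, ht⟩ ^ (p / 2 ^ (ℓ - n)))) ?_ ?_
    · rw [show τ ((IntExp.lit 9).eval τ) = ℓ from hbits.1] at hpow
      obtain ⟨h3, h4, h5⟩ := hpow le_rfl
      rw [Nat.sub_self, pow_zero, Nat.div_one] at h5
      refine ⟨h3.congr (Stm.sem_of_notMem (by decide) _ _), fun a ha c => ?_⟩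
      rw [sem_fill (by decide)]
      simp only [Dim.mem, Dim.upd, sumOver, AExp.val, IntExp.eval, Function.update_apply, hNτ, c.2,
        true_and, and_true]
      split_ifs with hat
      · have hat' : a = ⟨t, ht⟩ := Fin.ext hat
        rw [hat', ← h5 c]
      · rw [h4]
        exact h2 a (lt_of_le_of_ne (Nat.lt_succ_iff.1 ha) hat) c
    · intro _
      refine ⟨hs₁, h6₁, ?_⟩
      have : p / 2 ^ (ℓ - 0) = 1 := by
        rw [Nat.sub_zero]
        refine Nat.div_eq_of_lt_le ?_ ?_
        · rw [one_mul]; exact Nat.pow_log_le_self 2 hp0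
        · have := Nat.lt_pow_succ_log_self (b := 2) (by norm_num) p
          rw [pow_succ, ← hℓ] at this
          omega
      rw [this, pow_one]
      exact hx₁
    · intro n hn m'' ih hnℓ
      obtain ⟨h3, h4, h5⟩ := ih (by omega)
      have hNn : Function.update τ 17 n 5 = ∏ i, len R z i := hN
      rw [Stm.sem]
      have hsq := squareProg_sem (σ := Function.update τ 17 n) hNn h3 h5
      set m₂ := squareProg.sem (Function.update τ 17 n) m'' with hm₂
      have hs₂ : C.HoldsStruct m₂ := h3.congr (Stm.sem_of_notMem (by decide) _ _)
      have h6₂ : m₂ 6 = m' 6 := (Stm.sem_of_notMem (by decide) _ _).trans h4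
      clear_value m₂
      have hbit : (IntExp.cell (bitAddr (.sub (.sub (ctr 9) (.lit 1)) (ctr 17)))).eval
          (Function.update τ 17 n) = p / 2 ^ (ℓ - (n + 1)) % 2 := by
        have h6 := hbits.2 (ℓ - (n + 1)) (Nat.sub_le _ _)
        rw [← h6]
        simp only [IntExp.eval]
        have e0 : Function.update τ 17 n 0 = s := h0
        have e9 : Function.update τ 17 n 9 = ℓ := hbits.1
        have e17 : Function.update τ 17 n 17 = n := Function.update_self _ _ _
        rw [e0, e9, e17, Function.update_of_ne (by omega), hτ, Function.update_of_ne (by omega)]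
        congr 4
        omega
      have hhalf : p / 2 ^ (ℓ - n) = p / 2 ^ (ℓ - (n + 1)) / 2 := by
        rw [Nat.div_div_eq_div_mul, ← pow_succ, show ℓ - (n + 1) + 1 = ℓ - n by omega]
      rw [hhalf, ← pow_add] at hsq
      set d := p / 2 ^ (ℓ - (n + 1)) with hd
      by_cases hpos : 0 < d % 2
      · rw [Stm.sem_ifLt_pos (by rw [hbit]; exact hpos)]
        refine ⟨hs₂.congr (Stm.sem_of_notMem (by decide) _ _),
          (Stm.sem_of_notMem (by decide) _ _).trans h6₂, ?_⟩
        have h7 := scaleProg_sem (σ := Function.update τ 17 n) hNn hs₂ (b := ⟨t, ht⟩) rfl hsq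
        rw [← pow_succ, show d / 2 + d / 2 + 1 = d by omega] at h7
        exact h7
      · rw [Stm.sem_ifLt_neg (by rw [hbit]; exact hpos), Stm.sem]
        refine ⟨hs₂, h6₂, ?_⟩
        rw [show d / 2 + d / 2 = d by omega] at hsq
        exact hsq

/-- Map number `n + 1` is obtained by applying map number `n` to each basis element as often as
source `n` has packets. The list of iterates in array 22 is discarded. -/
theorem towerFrobProg_sem (hN : σ 5 = ∏ i, len R z i) (h0 : σ 0 = s) (hlen : ∀ j : Fin s, σ (32 +
    (s + j)) = len R z j)
    (hbase : C.HoldsMap m 0 (C.frobNat 0)) (i : Fin s) :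
    C.HoldsMap (towerFrobProg.sem σ m) i (C.frob i) := by
  have := Stm.sem_loop_induct (r := 18) (e := .lit 0)
    (P := .loop 16 (.lit 5) (.seq unitElt (.seq
      (powersProg 22 (.lit 0) (.lit 0) (ctr 18) (lenAddr (ctr 18)))
      (fill 6 (.fix (.add (ctr 18) (.lit 1))) (.fix (ctr 16)) fix0 (.run 29 (.lit 5)) []
        (rd1 7 (ctr 29)))))) σ m
    (fun n m' => ∀ t ≤ n, C.HoldsMap m' t (C.frobNat t)) ?_ ?_
  · rw [← frobNat_val]
    exact this i (by rw [show σ ((IntExp.lit 0).eval σ) = s from h0]; exact i.2.le)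
  · intro t ht
    rw [Nat.le_zero.1 ht]
    exact hbase
  · intro n hn m' hm'
    replace hn : n < s := h0 ▸ hn
    set τ := Function.update σ 18 n with hτ
    have hin := Stm.sem_loop_induct (r := 16) (e := .lit 5)
      (P := .seq unitElt (.seq
        (powersProg 22 (.lit 0) (.lit 0) (ctr 18) (lenAddr (ctr 18)))
        (fill 6 (.fix (.add (ctr 18) (.lit 1))) (.fix (ctr 16)) fix0 (.run 29 (.lit 5)) []
          (rd1 7 (ctr 29))))) τ m'
      (fun x m'' => (∀ t ≤ n, C.HoldsMap m'' t (C.frobNat t)) ∧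
        ∀ a : Fin (∏ i, len R z i), a.val < x →
          C.HoldsElt m'' 6 (n + 1) a 0 (C.frobNat (n + 1) (C.prodBasis a)))
      ⟨hm', fun a ha => absurd ha (Nat.not_lt_zero _)⟩ ?_
    · intro t ht
      rcases Nat.le_succ_iff.1 ht with ht | rfl
      · exact hin.1 t ht
      · intro a
        exact hin.2 a (by rw [show τ ((IntExp.lit 5).eval τ) = _ from hN]; exact a.2)
    · intro x hx m'' ⟨h1, h2⟩
      replace hx : x < ∏ i, len R z i := hN ▸ hx
      set υ := Function.update τ 16 x with hυ
      have hNυ : υ 5 = ∏ i, len R z i := hN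
      rw [Stm.sem, Stm.sem]
      set m₁ := unitElt.sem υ m'' with hm₁
      have hx₁ : C.HoldsElt m₁ 7 0 0 0 (C.prodBasis ⟨x, hx⟩) := unitElt_sem hNυ rfl
      have h6₁ : m₁ 6 = m'' 6 := Stm.sem_of_notMem (by decide) _ _
      clear_value m₁
      have hp := powersProg_sem (a := 22) (i := .lit 0) (j := .lit 0) (ph := ctr 18)
        (cnt := lenAddr (ctr 18)) hNυ (by decide) (by decide) (by decide) (by decide) (by decide)
        (by decide) (by decide) (f := C.frobNat n) ((h1 n le_rfl).congr h6₁) hx₁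
      have hcnt : υ ((lenAddr (ctr 18)).eval υ) = len R z ⟨n, hn⟩ := by
        rw [← hlen ⟨n, hn⟩]
        simp only [IntExp.eval]
        have e0 : υ 0 = s := h0
        have e18 : υ 18 = n := rfl
        rw [e0, e18, hυ, Function.update_of_ne (by omega), hτ, Function.update_of_ne (by omega)]
      rw [hcnt, ← C.frobNat_succ ⟨n, hn⟩] at hp
      replace hp := hp.1
      have h6₂ : (powersProg 22 (.lit 0) (.lit 0) (ctr 18) (lenAddr (ctr 18))).sem υ m₁ 6 =
        m'' 6 := (Stm.sem_of_notMem (by decide) _ _).trans h6₁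
      set m₂ := (powersProg 22 (.lit 0) (.lit 0) (ctr 18) (lenAddr (ctr 18))).sem υ m₁
      clear_value m₂
      have key : ∀ t (a c : Fin (∏ i, len R z i)),
          (fill 6 (.fix (.add (ctr 18) (.lit 1))) (.fix (ctr 16)) fix0 (.run 29 (.lit 5)) []
            (rd1 7 (ctr 29))).sem υ m₂ 6 t a 0 c =
          if t = n + 1 ∧ a.val = x then m₂ 7 0 0 0 c else m'' 6 t a 0 c := by
        intro t a c
        rw [sem_fill (by decide), ← h6₂]
        have e18 : υ 18 = n := rfl
        have e16 : υ 16 = x := rfl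
        simp only [Dim.mem, Dim.upd, sumOver, AExp.val, IntExp.eval, e18, e16, hNυ, c.2, true_and,
          and_true, Function.update_self]
      refine ⟨fun t ht a c => ?_, fun a ha c => ?_⟩
      · rw [key, if_neg (by omega)]
        exact h1 t ht a c
      · rw [key]
        split_ifs with h
        · rw [hp c, show a = ⟨x, hx⟩ from Fin.ext h.2]
        · refine h2 a (lt_of_le_of_ne (Nat.lt_succ_iff.1 ha) fun h' => h ⟨rfl, h'⟩) c

end Programs

end TowerCode

end NetCode
end

noncomputable section
open scoped Classical
namespace NetCode

/-! ### The programs for the powers of what has been received -/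

/-- The address of the prefix sum of the numbers of packets up to source `j`. -/
abbrev preAddr (j : IntExp) : IntExp := .add (.lit 32) (.add (ctr 0) (.add (ctr 0) j))

/-- The position in array 1 at which the evaluation points start. -/
abbrev pointBase : IntExp :=
  .add (.mul (.mul (ctr 5) (ctr 5)) (ctr 5)) (.mul (ctr 6) (ctr 5))

/-- The position in array 1 at which the received packets start. -/
abbrev packetBase : IntExp := .add pointBase (.mul (ctr 6) (ctr 5))

/-- Position `pos` of packet `b`. -/
abbrev packetE (b pos : IntExp) : AExp :=
  rd1 1 (.add packetBase (.add (.mul b (ctr 15)) pos))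

/-- The element that packet `ctr 16` combines from the evaluation points of source `ctr 18`. -/
def pointsProg : Stm :=
  fill 7 fix0 fix0 fix0 (.run 29 (.lit 5)) [(30, lenAddr (ctr 18))]
    (.mul (packetE (ctr 16) (.add (.cell (preAddr (ctr 18))) (ctr 30)))
      (rd1 1 (.add pointBase
        (.add (.mul (.add (.cell (preAddr (ctr 18))) (ctr 30)) (ctr 5)) (ctr 29)))))

/-- Write the powers of these elements to array 9. -/
def pointPowersProg : Stm :=
  .loop 16 (.lit 4) (.loop 18 (.lit 0)
    (.seq pointsProg (powersProg 9 (ctr 16) (ctr 18) (ctr 18) (lenAddr (ctr 18)))))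

/-- Copy the payloads to array 4. -/
def payloadProg : Stm :=
  fill 4 (.run 16 (.lit 4)) (.run 17 (.lit 1)) fix0 (.run 29 (.lit 5)) []
    (packetE (ctr 16) (.add (ctr 6) (.add (.mul (ctr 17) (ctr 5)) (ctr 29))))

/-- The number of the source that is decoded in round `ctr 19`. -/
abbrev srcE : IntExp := .sub (.sub (ctr 0) (.lit 1)) (ctr 19)

/-- Write the powers of the basis elements for the current source to array 18. -/
def basisPowersProg : Stm :=
  .loop 16 (.lit 5) (.seq unitElt (powersProg 18 (ctr 16) (.lit 0) srcE (.lit 14)))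

/-- Write the powers of the payload block `ctr 20` for the current source to array 10. -/
def payloadPowersProg : Stm :=
  .loop 16 (.lit 4) (.seq
    (fill 7 fix0 fix0 fix0 (.run 29 (.lit 5)) [] (.rd 4 (ctr 16) (ctr 20) (.lit 0) (ctr 29)))
    (powersProg 10 (ctr 16) (.lit 0) srcE (.lit 14)))

/-- The sum of the first `t` values. -/
def prefixSum {s : ℕ} (f : Fin s → ℕ) (t : ℕ) : ℕ :=
  ∑ l ∈ Finset.range t, if h : l < s then f ⟨l, h⟩ else 0

theorem prefixSum_succ {s : ℕ} (f : Fin s → ℕ) (i : Fin s) :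
    prefixSum f (i + 1) = prefixSum f i + f i := by
  rw [prefixSum, Finset.sum_range_succ, dif_pos i.2, prefixSum]

theorem prefixSum_top {s : ℕ} (f : Fin s → ℕ) : prefixSum f s = ∑ i, f i := by
  rw [prefixSum, Finset.sum_range]
  exact Finset.sum_congr rfl fun i _ => by rw [dif_pos i.2]

theorem finSigmaFinEquiv_val {s : ℕ} (f : Fin s → ℕ) (i : Fin s) (l : Fin (f i)) :
    (finSigmaFinEquiv ⟨i, l⟩ : Fin (∑ i, f i)).val = prefixSum f i + l := by
  rw [finSigmaFinEquiv_apply, prefixSum, Finset.sum_range]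
  congr 1
  exact Finset.sum_congr rfl fun j _ => by
    rw [dif_pos (j.2.trans i.2)]
    rfl

namespace TowerCode

variable {K L : Type*} [Field K] [Fintype K] [Field L] [Algebra K L] {s : ℕ}
  {R : Fin s → ℕ} {z : ℕ} (C : TowerCode K L (len R z)) [FiniteDimensional K L]

/-- The integer cells hold the parameters. -/
structure Env (C : TowerCode K L (len R z)) (k B : ℕ) (σ : ℕ → ℕ) : Prop where
  c0 : σ 0 = s
  c1 : σ 1 = k
  c2 : σ 2 = z
  c4 : σ 4 = B
  c5 : σ 5 = ∏ i, len R z i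
  c6 : σ 6 = ∑ i, len R z i
  c7 : σ 7 = C.width
  c10 : σ 10 = C.unknowns
  c11 : σ 11 = s * C.width * ∏ i, len R z i
  c12 : σ 12 = (z + 1) * ∏ i, len R z i
  c13 : σ 13 = 1
  c14 : σ 14 = z + 1
  c15 : σ 15 = (∑ i, len R z i) + k * ∏ i, len R z i
  rate : ∀ j : Fin s, σ (32 + j) = R j
  num : ∀ j : Fin s, σ (32 + (s + j)) = len R z j
  pre : ∀ j : Fin s, σ (32 + (s + (s + j))) = prefixSum (len R z) j

/-- Parameters occupy the cells below 16 and from 32 on; the cells from 16 to 31 are counters. -/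
theorem Env.update {C : TowerCode K L (len R z)} {k B : ℕ} {σ : ℕ → ℕ} (h : C.Env k B σ) {r : ℕ}
    (hr : 16 ≤ r) (hr' : r < 32)
    (t : ℕ) : C.Env k B (Function.update σ r t) := by
  have h1 : ∀ c, c < 16 → Function.update σ r t c = σ c := fun c hc =>
    Function.update_of_ne (by omega) _ _
  have h2 : ∀ c, 32 ≤ c → Function.update σ r t c = σ c := fun c hc =>
    Function.update_of_ne (by omega) _ _
  constructor
  case rate => exact fun j => (h2 _ (by omega)).trans (h.rate j)
  case num => exact fun j => (h2 _ (by omega)).trans (h.num j)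
  case pre => exact fun j => (h2 _ (by omega)).trans (h.pre j)
  all_goals rw [h1 _ (by norm_num)]
  exacts [h.c0, h.c1, h.c2, h.c4, h.c5, h.c6, h.c7, h.c10, h.c11, h.c12, h.c13, h.c14, h.c15]

/-- The input in array 1. -/
structure HoldsInput {k B : ℕ} (Y : Matrix (Fin B) (Position (len R z) k) K) (m : Mem K) :
    Prop where
  struct : C.HoldsStruct m
  point : ∀ (j : Fin s) (l : Fin (len R z j)) (c : Fin (∏ i, len R z i)),
    m 1 0 0 0 ((∏ i, len R z i) * (∏ i, len R z i) * (∏ i, len R z i) +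
      (∑ i, len R z i) * (∏ i, len R z i) +
      ((prefixSum (len R z) j + l) * (∏ i, len R z i) + c)) = C.coords (C.g j l) c
  header : ∀ (b : Fin B) (j : Fin s) (l : Fin (len R z j)),
    m 1 0 0 0 ((∏ i, len R z i) * (∏ i, len R z i) * (∏ i, len R z i) +
      (∑ i, len R z i) * (∏ i, len R z i) + (∑ i, len R z i) * (∏ i, len R z i) +
      (b * ((∑ i, len R z i) + k * ∏ i, len R z i) + (prefixSum (len R z) j + l))) =
      Y b (Sum.inl ⟨j, l⟩)
  body : ∀ (b : Fin B) (κ : Fin k) (c : Fin (∏ i, len R z i)),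
    m 1 0 0 0 ((∏ i, len R z i) * (∏ i, len R z i) * (∏ i, len R z i) +
      (∑ i, len R z i) * (∏ i, len R z i) + (∑ i, len R z i) * (∏ i, len R z i) +
      (b * ((∑ i, len R z i) + k * ∏ i, len R z i) +
        ((∑ i, len R z i) + (κ * (∏ i, len R z i) + c)))) =
      Y b (Sum.inr (κ, finPiFinEquiv.symm c))

variable {C} {k B : ℕ} {σ : ℕ → ℕ} {m : Mem K}

theorem HoldsInput.congr {Y : Matrix (Fin B) (Position (len R z) k) K} {m' : Mem K}
    (h : C.HoldsInput Y m) (hm : m' 1 = m 1) : C.HoldsInput Y m' := by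
  constructor
  · exact h.struct.congr hm
  · rw [hm]; exact h.point
  · rw [hm]; exact h.header
  · rw [hm]; exact h.body

/-- The Frobenius maps in array 6. -/
def HoldsMaps (C : TowerCode K L (len R z)) (m : Mem K) : Prop :=
  ∀ i : Fin s, C.HoldsMap m i (C.frob i)

theorem pointsProg_sem (hE : C.Env k B σ) {Y : Matrix (Fin B) (Position (len R z) k) K}
    (hY : C.HoldsInput Y m) {b : Fin B} (hb : σ 16 = b) {j : Fin s} (hj : σ 18 = j) :
    C.HoldsElt (pointsProg.sem σ m) 7 0 0 0 (C.points Y b j) := by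
  intro c
  rw [pointsProg, sem_fill (by decide), points, coords_sum]
  simp only [Dim.mem, Dim.upd, sumOver, AExp.val, IntExp.eval, hE.c5, c.2, and_self, if_true]
  have hE' := hE.update (r := 29) (by norm_num) (by norm_num) c
  have e0 : Function.update σ 29 c.val 0 = s := hE.c0
  have e18 : Function.update σ 29 c.val 18 = j := hj
  rw [e0, e18, hE'.num, Finset.sum_range]
  refine Finset.sum_congr rfl fun l _ => ?_
  have hE'' := hE'.update (r := 30) (by norm_num) (by norm_num) l
  set τ := Function.update (Function.update σ 29 c.val) 30 l.val with hτ
  have f16 : τ 16 = b := hb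
  have f18 : τ 18 = j := hj
  have f29 : τ 29 = c := rfl
  have f30 : τ 30 = l := rfl
  rw [hE''.c0, f16, f18, f29, f30, hE''.pre, hE''.c5, hE''.c6, hE''.c15, coords_smul,
    ← hY.point, ← hY.header]

theorem lenAddr_eval (hE : C.Env k B σ) {r : ℕ} {j : Fin s} (hj : σ r = j) :
    σ ((lenAddr (ctr r)).eval σ) = len R z j := by
  simp only [IntExp.eval]
  rw [hE.c0, hj, hE.num]

/-- All powers below `n j` are stored. This covers the `R j` powers used for an earlier source, the
`R i + z` used for the current one, and those used for its cancellation. -/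
theorem pointPowersProg_sem (hE : C.Env k B σ) {Y : Matrix (Fin B) (Position (len R z) k) K}
    (hY : C.HoldsInput Y m) (hF : C.HoldsMaps m) (b : Fin B) (j : Fin s) {l : ℕ}
    (hl : l < len R z j) :
    C.HoldsElt (pointPowersProg.sem σ m) 9 b j l (C.points Y b j ^ (C.q j ^ l)) := by
  have := Stm.sem_loop_induct (r := 16) (e := .lit 4) (P := .loop 18 (.lit 0)
    (.seq pointsProg (powersProg 9 (ctr 16) (ctr 18) (ctr 18) (lenAddr (ctr 18))))) σ m
    (fun t m' => C.HoldsInput Y m' ∧ C.HoldsMaps m' ∧ ∀ (b : Fin B) (j : Fin s) (l : ℕ),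
      b.val < t → l < len R z j → C.HoldsElt m' 9 b j l (C.points Y b j ^ (C.q j ^ l)))
    ⟨hY, hF, fun b j l hb => absurd hb (Nat.not_lt_zero _)⟩ ?_
  · exact this.2.2 b j l (by rw [show σ ((IntExp.lit 4).eval σ) = _ from hE.c4]; exact b.2) hl
  · intro t ht m' ⟨h1, h2, h3⟩
    replace ht : t < B := hE.c4 ▸ ht
    set τ := Function.update σ 16 t with hτ
    have hEτ : C.Env k B τ := hE.update (by norm_num) (by norm_num) t
    have hin := Stm.sem_loop_induct (r := 18) (e := .lit 0)
      (P := .seq pointsProg (powersProg 9 (ctr 16) (ctr 18) (ctr 18) (lenAddr (ctr 18)))) τ m'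
      (fun x m'' => C.HoldsInput Y m'' ∧ C.HoldsMaps m'' ∧
        (∀ (b : Fin B) (j : Fin s) (l : ℕ), b.val < t → l < len R z j →
          C.HoldsElt m'' 9 b j l (C.points Y b j ^ (C.q j ^ l))) ∧
        ∀ (j : Fin s) (l : ℕ), j.val < x → l < len R z j →
          C.HoldsElt m'' 9 t j l (C.points Y ⟨t, ht⟩ j ^ (C.q j ^ l)))
      ⟨h1, h2, h3, fun j l hj => absurd hj (Nat.not_lt_zero _)⟩ ?_
    · obtain ⟨g1, g2, g3, g4⟩ := hin
      refine ⟨g1, g2, fun b j l hb hl => ?_⟩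
      rcases Nat.lt_succ_iff_lt_or_eq.1 hb with hb | hb
      · exact g3 b j l hb hl
      · obtain rfl : b = ⟨t, ht⟩ := Fin.ext hb
        exact g4 j l (by rw [show τ ((IntExp.lit 0).eval τ) = s from hEτ.c0]; exact j.2) hl
    · intro x hx m'' ⟨g1, g2, g3, g4⟩
      replace hx : x < s := hEτ.c0 ▸ hx
      set υ := Function.update τ 18 x with hυ
      have hEυ : C.Env k B υ := hEτ.update (by norm_num) (by norm_num) x
      rw [Stm.sem]
      have hp := pointsProg_sem hEυ g1 (b := ⟨t, ht⟩) rfl (j := ⟨x, hx⟩) rfl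
      set m₁ := pointsProg.sem υ m'' with hm₁
      have hm1 : m₁ 1 = m'' 1 := Stm.sem_of_notMem (by decide) _ _
      have hm6 : m₁ 6 = m'' 6 := Stm.sem_of_notMem (by decide) _ _
      have hm9 : m₁ 9 = m'' 9 := Stm.sem_of_notMem (by decide) _ _
      clear_value m₁
      obtain ⟨-, q1, q2⟩ := powersProg_sem (a := 9) (i := ctr 16) (j := ctr 18) (ph := ctr 18)
        (cnt := lenAddr (ctr 18)) hEυ.c5 (by decide) (by decide) (by decide) (by decide)
        (by decide) (by decide) (by decide) (f := C.frob ⟨x, hx⟩) ((g2 ⟨x, hx⟩).congr hm6) hp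
      have e16 : (ctr 16).eval υ = t := rfl
      have e18 : (ctr 18).eval υ = x := rfl
      rw [lenAddr_eval hEυ (j := ⟨x, hx⟩) rfl] at q1
      rw [e16, e18] at q1 q2
      simp only [frob_pow_apply] at q1
      have keep : ∀ (b' j' l : ℕ) (x' : L), ¬ (b' = t ∧ j' = x) → C.HoldsElt m'' 9 b' j' l x' →
          C.HoldsElt ((powersProg 9 (ctr 16) (ctr 18) (ctr 18) (lenAddr (ctr 18))).sem υ m₁)
            9 b' j' l x' := by
        intro b' j' l x' hne h c
        rw [q2 b' j' hne, hm9]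
        exact h c
      refine ⟨g1.congr ((Stm.sem_of_notMem (by decide) _ _).trans hm1),
        fun i => (g2 i).congr ((Stm.sem_of_notMem (by decide) _ _).trans hm6),
        fun b j l hb hl => keep _ _ _ _ (by omega) (g3 b j l hb hl), fun j l hj hl => ?_⟩
      rcases Nat.lt_succ_iff_lt_or_eq.1 hj with hj | hj
      · exact keep _ _ _ _ (by omega) (g4 j l hj hl)
      · obtain rfl : j = ⟨x, hx⟩ := Fin.ext hj
        exact q1 l hl

theorem coords_payload (Y : Matrix (Fin B) (Position (len R z) k) K) (κ : Fin k) (b : Fin B)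
    (c : Fin (∏ i, len R z i)) :
    C.coords (C.payload Y κ b) c = Y b (Sum.inr (κ, finPiFinEquiv.symm c)) := by
  rw [payload, coords_elt]

theorem payloadProg_sem (hE : C.Env k B σ) {Y : Matrix (Fin B) (Position (len R z) k) K}
    (hY : C.HoldsInput Y m) (b : Fin B) (κ : Fin k) :
    C.HoldsElt (payloadProg.sem σ m) 4 b κ 0 (C.payload Y κ b) := by
  intro c
  rw [payloadProg, sem_fill (by decide), coords_payload, ← hY.body]
  have hE₁ := hE.update (r := 16) (by norm_num) (by norm_num) b
  have hE₂ := hE₁.update (r := 17) (by norm_num) (by norm_num) κ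
  have hE₃ := hE₂.update (r := 29) (by norm_num) (by norm_num) c
  have f16 : Function.update (Function.update (Function.update σ 16 b.val) 17 κ.val) 29 c.val 16 =
    b.val := rfl
  have f17 : Function.update (Function.update (Function.update σ 16 b.val) 17 κ.val) 29 c.val 17 =
    κ.val := rfl
  have f29 : Function.update (Function.update (Function.update σ 16 b.val) 17 κ.val) 29 c.val 29 =
    c.val := rfl
  simp only [Dim.mem, Dim.upd, sumOver, AExp.val, IntExp.eval, hE.c4, hE₁.c1, hE₂.c5, b.2, κ.2, c.2,
    and_self, if_true, hE₃.c5, hE₃.c6, hE₃.c15, f16, f17, f29]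

theorem srcE_eval (hE : C.Env k B σ) {i : Fin s} (hi : σ 19 + i.val + 1 = s) :
    srcE.eval σ = i := by
  simp only [IntExp.eval]
  rw [hE.c0]
  omega

/-- These powers are the coefficients with which unknown coordinates enter the quotient system.
Sources are decoded from the last to the first, so round `σ 19` belongs to source `s - 1 - σ 19`. -/
theorem basisPowersProg_sem (hE : C.Env k B σ) {i : Fin s} (hi : σ 19 + i.val + 1 = s)
    (hF : C.HoldsMaps m) (a : Fin (∏ i, len R z i)) {l : ℕ} (hl : l < z + 1) :
    C.HoldsElt (basisPowersProg.sem σ m) 18 a 0 l (C.prodBasis a ^ (C.q i ^ l)) := by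
  have := Stm.sem_loop_induct (r := 16) (e := .lit 5)
    (P := .seq unitElt (powersProg 18 (ctr 16) (.lit 0) srcE (.lit 14))) σ m
    (fun t m' => C.HoldsMaps m' ∧ ∀ (a : Fin (∏ i, len R z i)) (l : ℕ), a.val < t → l < z + 1 →
      C.HoldsElt m' 18 a 0 l (C.prodBasis a ^ (C.q i ^ l)))
    ⟨hF, fun b l hb => absurd hb (Nat.not_lt_zero _)⟩ ?_
  · exact this.2 a l (by rw [show σ ((IntExp.lit 5).eval σ) = _ from hE.c5]; exact a.2) hl
  · intro t ht m' ⟨h1, h2⟩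
    replace ht : t < ∏ i, len R z i := hE.c5 ▸ ht
    set τ := Function.update σ 16 t with hτ
    have hEτ : C.Env k B τ := hE.update (by norm_num) (by norm_num) t
    rw [Stm.sem]
    have hp : C.HoldsElt (unitElt.sem τ m') 7 0 0 0 (C.prodBasis ⟨t, ht⟩) :=
      unitElt_sem hEτ.c5 rfl
    set m₁ := unitElt.sem τ m' with hm₁
    have hm6 : m₁ 6 = m' 6 := Stm.sem_of_notMem (by decide) _ _
    have hm18 : m₁ 18 = m' 18 := Stm.sem_of_notMem (by decide) _ _
    clear_value m₁
    have hsrc : srcE.eval τ = i := srcE_eval hEτ hi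
    obtain ⟨-, q1, q2⟩ := powersProg_sem (a := 18) (i := ctr 16) (j := .lit 0) (ph := srcE)
      (cnt := .lit 14) hEτ.c5 (by decide) (by decide) (by decide) (by decide)
      (by decide) (by decide) (by decide) (f := C.frob i)
      (by rw [hsrc]; exact (h1 i).congr hm6) hp
    have e16 : (ctr 16).eval τ = t := rfl
    rw [show τ ((IntExp.lit 14).eval τ) = z + 1 from hEτ.c14] at q1
    rw [e16] at q1 q2
    simp only [frob_pow_apply] at q1
    refine ⟨fun i => (h1 i).congr ((Stm.sem_of_notMem (by decide) _ _).trans hm6),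
      fun a l ha hl => ?_⟩
    rcases Nat.lt_succ_iff_lt_or_eq.1 ha with ha | ha
    · intro c
      rw [q2 a 0 (by omega), hm18]
      exact h2 a l ha hl c
    · obtain rfl : a = ⟨t, ht⟩ := Fin.ext ha
      exact q1 l hl

theorem payloadPowersProg_sem (hE : C.Env k B σ) {i : Fin s} (hi : σ 19 + i.val + 1 = s)
    (hF : C.HoldsMaps m) {κ : ℕ} (hκ : σ 20 = κ) {w : Fin B → L}
    (hw : ∀ b : Fin B, C.HoldsElt m 4 b κ 0 (w b)) (b : Fin B) {l : ℕ} (hl : l < z + 1) :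
    C.HoldsElt (payloadPowersProg.sem σ m) 10 b 0 l (w b ^ (C.q i ^ l)) := by
  have := Stm.sem_loop_induct (r := 16) (e := .lit 4)
    (P := .seq (fill 7 fix0 fix0 fix0 (.run 29 (.lit 5)) []
      (.rd 4 (ctr 16) (ctr 20) (.lit 0) (ctr 29)))
      (powersProg 10 (ctr 16) (.lit 0) srcE (.lit 14))) σ m
    (fun t m' => C.HoldsMaps m' ∧ (∀ b : Fin B, C.HoldsElt m' 4 b κ 0 (w b)) ∧
      ∀ (b : Fin B) (l : ℕ), b.val < t → l < z + 1 →
      C.HoldsElt m' 10 b 0 l (w b ^ (C.q i ^ l)))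
    ⟨hF, hw, fun b l hb => absurd hb (Nat.not_lt_zero _)⟩ ?_
  · exact this.2.2 b l (by rw [show σ ((IntExp.lit 4).eval σ) = _ from hE.c4]; exact b.2) hl
  · intro t ht m' ⟨h1, h1', h2⟩
    replace ht : t < B := hE.c4 ▸ ht
    set τ := Function.update σ 16 t with hτ
    have hEτ : C.Env k B τ := hE.update (by norm_num) (by norm_num) t
    rw [Stm.sem]
    have hp : C.HoldsElt ((fill 7 fix0 fix0 fix0 (.run 29 (.lit 5)) []
      (.rd 4 (ctr 16) (ctr 20) (.lit 0) (ctr 29))).sem τ m') 7 0 0 0 (w ⟨t, ht⟩) := by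
      intro c
      rw [sem_fill (by decide), ← h1' ⟨t, ht⟩ c]
      simp only [Dim.mem, Dim.upd, sumOver, AExp.val, IntExp.eval, hEτ.c5, c.2, and_self, if_true]
      have e20 : Function.update τ 29 c.val 20 = κ := hκ
      rw [e20]
      rfl
    set m₁ := (fill 7 fix0 fix0 fix0 (.run 29 (.lit 5)) []
      (.rd 4 (ctr 16) (ctr 20) (.lit 0) (ctr 29))).sem τ m' with hm₁
    have hm6 : m₁ 6 = m' 6 := Stm.sem_of_notMem (by decide) _ _
    have hm4 : m₁ 4 = m' 4 := Stm.sem_of_notMem (by decide) _ _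
    have hm10 : m₁ 10 = m' 10 := Stm.sem_of_notMem (by decide) _ _
    clear_value m₁
    have hsrc : srcE.eval τ = i := srcE_eval hEτ hi
    obtain ⟨-, q1, q2⟩ := powersProg_sem (a := 10) (i := ctr 16) (j := .lit 0) (ph := srcE)
      (cnt := .lit 14) hEτ.c5 (by decide) (by decide) (by decide) (by decide)
      (by decide) (by decide) (by decide) (f := C.frob i)
      (by rw [hsrc]; exact (h1 i).congr hm6) hp
    have e16 : (ctr 16).eval τ = t := rfl
    rw [show τ ((IntExp.lit 14).eval τ) = z + 1 from hEτ.c14] at q1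
    rw [e16] at q1 q2
    simp only [frob_pow_apply] at q1
    refine ⟨fun i => (h1 i).congr ((Stm.sem_of_notMem (by decide) _ _).trans hm6),
      fun b => (h1' b).congr ((Stm.sem_of_notMem (by decide) _ _).trans hm4),
      fun a l ha hl => ?_⟩
    rcases Nat.lt_succ_iff_lt_or_eq.1 ha with ha | ha
    · intro c
      rw [q2 a 0 (by omega), hm10]
      exact h2 a l ha hl c
    · obtain rfl : a = ⟨t, ht⟩ := Fin.ext ha
      exact q1 l hl

end TowerCode

end NetCode
end

noncomputable section
open scoped Classical
namespace NetCode

/-! ### The programs for the decoding of one column -/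

/-- The number of the slot of unknown `ctr 22` among all slots. -/
abbrev slotE : IntExp := .div (ctr 22) (ctr 5)

/-- The group of unknown `ctr 22`. -/
abbrev groupE : IntExp := .div slotE (ctr 7)

/-- The slot of unknown `ctr 22` in its group. -/
abbrev indexE : IntExp := .sub slotE (.mul groupE (ctr 7))

/-- The coordinate number of unknown `ctr 22`. -/
abbrev coordE : IntExp := .sub (ctr 22) (.mul slotE (ctr 5))

/-- The rate of source `j`. -/
abbrev rateE (j : IntExp) : IntExp := .cell (.add (.lit 32) j)

/-- Write the coordinates of an element to row `ctr 21` and column `ctr 22` of array 11. -/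
abbrev entryProg (ls : List (ℕ × IntExp)) (x : AExp) : Stm :=
  fill 11 (.fix (ctr 21)) (.run 23 (.lit 5)) fix0 (.fix (ctr 22)) ls x

/-- An entry that vanishes. -/
abbrev zeroEntry : Stm := entryProg [] .zero

/-- An entry for the powers of what is combined from evaluation points. -/
abbrev pointEntry : Stm := entryProg [(30, .lit 5)]
  (.mul (structE coordE (ctr 30) (ctr 23)) (.rd 9 (ctr 21) groupE indexE (ctr 30)))

/-- An entry for the powers of the payload. -/
abbrev payloadEntry : Stm := entryProg [(30, .lit 5)]
  (.mul (structE coordE (ctr 30) (ctr 23)) (.rd 10 (ctr 21) (.lit 0) indexE (ctr 30)))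

/-- An entry of the system of key equations. -/
def keyEntry : Stm :=
  .ifLt groupE srcE (.ifLt indexE (rateE groupE) pointEntry zeroEntry)
    (.ifLt srcE groupE
      (.ifLt groupE (ctr 0) zeroEntry (.ifLt indexE (ctr 14) payloadEntry zeroEntry))
      (.ifLt indexE (.add (rateE srcE) (ctr 2)) pointEntry zeroEntry))

/-- An entry for the product of a coefficient of the denominator and an unknown coefficient of the
quotient. -/
abbrev productEntry : Stm := entryProg [(30, .lit 5), (31, .lit 5)]
  (.mul (.mul (structE (ctr 30) (ctr 31) (ctr 23))
    (rd1 16 (.add (.add (ctr 11) (.mul (.sub (ctr 21) indexE) (ctr 5))) (ctr 30))))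
    (.rd 18 coordE (.lit 0) (.sub (ctr 21) indexE) (ctr 31)))

/-- An entry for a coefficient of the numerator. -/
abbrev numeratorEntry : Stm := entryProg []
  (rd1 16 (.add (.mul (.add (.mul srcE (ctr 7)) (ctr 21)) (ctr 5)) (ctr 23)))

/-- An entry of the system of equations for the quotient. -/
def quotEntry : Stm :=
  .ifLt groupE (.lit 1)
    (.ifLt indexE (rateE srcE)
      (.ifLt (ctr 21) indexE zeroEntry
        (.ifLt (.sub (ctr 21) indexE) (ctr 14) productEntry zeroEntry)) zeroEntry)
    (.ifLt (ctr 22) (ctr 11) zeroEntry (.ifLt (ctr 11) (ctr 22) zeroEntry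
      (.ifLt (ctr 21) (.add (rateE srcE) (ctr 2)) numeratorEntry zeroEntry)))

/-- Run through all entries of the matrix in array 11. -/
def matrixProg (e : IntExp) (P : Stm) : Stm := .loop 21 e (.loop 22 (.lit 10) P)

/-- Solve the system with the entries `P` and write the solution to array `a`. -/
def solveProg (e : IntExp) (P : Stm) (a cnt : ℕ) : Stm :=
  .seq (matrixProg e P) (.seq (kernelProg e) (selectProg a cnt))

/-- Write the decoded column to array 20. -/
def scaleSolutionProg : Stm :=
  fill 20 (.run 16 (.add (.lit 32) srcE)) fix0 fix0 (.run 29 (.lit 5)) []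
    (.mul (rd1 17 (.add (.mul (ctr 16) (ctr 5)) (ctr 29))) (.inv (rd1 17 (ctr 11))))

/-- Copy the decoded column to array 5. -/
def keepProg : Stm :=
  fill 5 (.fix srcE) (.run 16 (.add (.lit 32) srcE)) (.fix (ctr 20)) (.run 29 (.lit 5)) []
    (.rd 20 (ctr 16) (.lit 0) (.lit 0) (ctr 29))

/-- Cancel the decoded column. -/
def cancelProg : Stm :=
  .seq (fill 23 (.run 16 (.lit 4)) fix0 fix0 (.run 29 (.lit 5))
    [(28, .add (.lit 32) srcE), (30, .lit 5), (31, .lit 5)]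
    (.mul (.mul (.rd 9 (ctr 16) srcE (ctr 28) (ctr 30)) (.rd 20 (ctr 28) (.lit 0) (.lit 0)
        (ctr 31)))
      (structE (ctr 30) (ctr 31) (ctr 29))))
  (.seq (fill 24 (.run 16 (.lit 4)) fix0 fix0 (.run 29 (.lit 5)) []
    (.sub (.rd 4 (ctr 16) (ctr 20) (.lit 0) (ctr 29)) (.rd 23 (ctr 16) (.lit 0) (.lit 0) (ctr 29))))
  (fill 4 (.run 16 (.lit 4)) (.fix (ctr 20)) fix0 (.run 29 (.lit 5)) []
    (.rd 24 (ctr 16) (.lit 0) (.lit 0) (ctr 29))))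

/-- Decode and cancel column `ctr 20` of the current source. -/
def columnProg : Stm :=
  .seq payloadPowersProg (.seq (solveProg (.lit 4) keyEntry 16 12)
    (.seq (solveProg (lenAddr srcE) quotEntry 17 13)
      (.seq scaleSolutionProg (.seq keepProg cancelProg))))

namespace TowerCode

variable {K L : Type*} [Field K] [Fintype K] [Field L] [Algebra K L] {s : ℕ}
  {R : Fin s → ℕ} {z : ℕ} {C : TowerCode K L (len R z)} [FiniteDimensional K L]
  {k B : ℕ} {σ : ℕ → ℕ} {m : Mem K}

/-- Group, slot and coordinate are the mixed radix digits of the unknown, recovered by division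
since the machine has no remainder operation. -/
theorem slotE_eval (hE : C.Env k B σ) {u : Fin C.unknowns} (hu : σ 22 = u) :
    groupE.eval σ = (C.slot u).1 ∧ indexE.eval σ = (C.slot u).2.1 ∧
      coordE.eval σ = (C.slot u).2.2 := by
  have h1 : u.val / (∏ i, len R z i) = (C.slot u).1 * C.width + (C.slot u).2.1 := by
    conv_lhs => rw [C.uix_slot u]
    rw [mul_comm, Nat.mul_add_div C.prod_len_pos, Nat.div_eq_of_lt (C.slot u).2.2.2, add_zero]
  have h2 : ((C.slot u).1 * C.width + (C.slot u).2.1) / C.width = (C.slot u).1.val := by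
    rw [mul_comm, Nat.mul_add_div C.width_pos, Nat.div_eq_of_lt (C.slot u).2.1.2, add_zero]
  simp only [IntExp.eval]
  rw [hu, hE.c5, hE.c7, h1, h2]
  refine ⟨rfl, by omega, ?_⟩
  conv_lhs => rw [C.uix_slot u]
  omega

theorem uix_lt (C : TowerCode K L (len R z)) {j m c : ℕ} (hj : j ≤ s) (hm : m < C.width)
    (hc : c < ∏ i, len R z i) : (j * C.width + m) * (∏ i, len R z i) + c < C.unknowns := by
  have h := (finProdFinEquiv (finProdFinEquiv
    ((⟨j, Nat.lt_succ_of_le hj⟩ : Fin (s + 1)), (⟨m, hm⟩ : Fin C.width)),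
    (⟨c, hc⟩ : Fin (∏ i, len R z i)))).2
  rwa [uix_val] at h

/-- A one-dimensional array holds a vector. -/
def HoldsVec (m : Mem K) (a : ℕ) {U : ℕ} (v : Fin U → K) : Prop := ∀ u : Fin U, m a 0 0 0 u = v u

theorem HoldsVec.coords_block {a : ℕ} {v : Fin C.unknowns → K} (hv : HoldsVec m a v) {j l : ℕ}
    (hj : j ≤ s) (hl : l < C.width) (c : Fin (∏ i, len R z i)) :
    C.coords (C.block v j l) c = m a 0 0 0 ((j * C.width + l) * (∏ i, len R z i) + c) := by
  rw [block, coords_sum_smul C fun c => if h : (j * C.width + l) * (∏ i, len R z i) + c.val <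
    C.unknowns then v ⟨_, h⟩ else 0, dif_pos (C.uix_lt hj hl c.2), ← hv]

/-- The statement writes the coordinates of `y` to row `b` and column `u` of the matrix in
array 11 and changes nothing else in it. -/
def WritesEntry (C : TowerCode K L (len R z)) (P : Stm) (σ : ℕ → ℕ) (m : Mem K) (b u : ℕ)
    (y : L) : Prop :=
  ∀ (b' : ℕ) (c : Fin (∏ i, len R z i)) (u' : ℕ),
    P.sem σ m 11 b' c 0 u' = if b' = b ∧ u' = u then C.coords y c else m 11 b' c 0 u'

/-- Each round writes one column segment of array 11 and reads only other arrays, which are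
unchanged. Entries already written are therefore neither used nor spoiled. -/
theorem matrixProg_sem (hE : C.Env k B σ) {e : IntExp} {n : ℕ} (he : σ (e.eval σ) = n)
    {P : Stm} (hP : ∀ a ∈ P.writes, a = 11) {T : Fin n → Fin C.unknowns → L}
    (h : ∀ (b : Fin n) (u : Fin C.unknowns) (m' : Mem K), (∀ a, a ≠ 11 → m' a = m a) →
      C.WritesEntry P (Function.update (Function.update σ 21 b) 22 u) m' b u (T b u)) :
    (∀ a, a ≠ 11 → (matrixProg e P).sem σ m a = m a) ∧
    ∀ (b : Fin n) (c : Fin (∏ i, len R z i)) (u : Fin C.unknowns),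
      (matrixProg e P).sem σ m 11 b c 0 u = C.coords (T b u) c := by
  have := Stm.sem_loop_induct (r := 21) (e := e) (P := .loop 22 (.lit 10) P) σ m
    (fun t m' => (∀ a, a ≠ 11 → m' a = m a) ∧
      ∀ (b : Fin n) (c : Fin (∏ i, len R z i)) (u : Fin C.unknowns), b.val < t →
        m' 11 b c 0 u = C.coords (T b u) c)
    ⟨fun _ _ => rfl, fun b c u hb => absurd hb (Nat.not_lt_zero _)⟩ ?_
  · rw [he] at this
    exact ⟨this.1, fun b c u => this.2 b c u b.2⟩
  · intro t ht m' ⟨h1, h2⟩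
    rw [he] at ht
    have hin := Stm.sem_loop_induct (r := 22) (e := .lit 10) (P := P) (Function.update σ 21 t) m'
      (fun x m'' => (∀ a, a ≠ 11 → m'' a = m a) ∧
        (∀ (b : Fin n) (c : Fin (∏ i, len R z i)) (u : Fin C.unknowns), b.val < t →
          m'' 11 b c 0 u = C.coords (T b u) c) ∧
        ∀ (c : Fin (∏ i, len R z i)) (u : Fin C.unknowns), u.val < x →
          m'' 11 t c 0 u = C.coords (T ⟨t, ht⟩ u) c)
      ⟨h1, h2, fun c u hu => absurd hu (Nat.not_lt_zero _)⟩ ?_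
    · rw [show Function.update σ 21 t ((IntExp.lit 10).eval (Function.update σ 21 t)) = _ from
        hE.c10] at hin
      refine ⟨hin.1, fun b c u hb => ?_⟩
      rcases Nat.lt_succ_iff_lt_or_eq.1 hb with hb | hb
      · exact hin.2.1 b c u hb
      · obtain rfl : b = ⟨t, ht⟩ := Fin.ext hb
        exact hin.2.2 c u u.2
    · intro x hx m'' ⟨g1, g2, g3⟩
      replace hx : x < C.unknowns := hE.c10 ▸ hx
      have hw := h ⟨t, ht⟩ ⟨x, hx⟩ m'' g1
      refine ⟨fun a ha => ?_, fun b c u hb => ?_, fun c u hu => ?_⟩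
      · rw [Stm.sem_of_notMem fun hm => ha (hP a hm), g1 a ha]
      · rw [hw b c u, if_neg (by simp only; omega), g2 b c u hb]
      · rw [hw t c u]
        split_ifs with hux
        · obtain rfl : u = ⟨x, hx⟩ := Fin.ext hux.2
          rfl
        · exact g3 c u (by simp only [true_and] at hux; omega)

theorem entryProg_sem (hN : σ 5 = ∏ i, len R z i) {ls : List (ℕ × IntExp)} {x : AExp}
    (hx : x.reads.contains 11 = false) {b u : ℕ} (hb : σ 21 = b) (hu : σ 22 = u) {y : L}
    (h : ∀ c : Fin (∏ i, len R z i),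
      sumOver ls (Function.update σ 23 c) (fun τ => x.val τ m) = C.coords y c) :
    C.WritesEntry (entryProg ls x) σ m b u y := by
  have hok : fillOk 11 (.fix (ctr 21)) (.run 23 (.lit 5)) fix0 (.fix (ctr 22)) x = true := by
    rw [fillOk, hx]
    decide
  intro b' c u'
  rw [entryProg, sem_fill hok]
  have e22 : Function.update σ 23 c.val 22 = u := hu
  simp only [Dim.mem, Dim.upd, IntExp.eval, hN, hb, c.2, true_and, e22]
  refine if_congr Iff.rfl (h c) rfl

theorem zeroEntry_sem (hN : σ 5 = ∏ i, len R z i) {b u : ℕ} (hb : σ 21 = b) (hu : σ 22 = u) :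
    C.WritesEntry zeroEntry σ m b u 0 :=
  entryProg_sem hN rfl hb hu fun c => (C.coords_zero c).symm

/-- When one factor is a basis element, one of the two sums over structure constants collapses.
Matrix entries of the key equation are products of this kind. -/
theorem coords_prodBasis_mul (a : Fin (∏ i, len R z i)) (y : L) (c : Fin (∏ i, len R z i)) :
    C.coords (C.prodBasis a * y) c =
      ∑ b, C.coords (C.prodBasis a * C.prodBasis b) c * C.coords y b := by
  rw [coords_mul, Finset.sum_eq_single a]
  · exact Finset.sum_congr rfl fun b _ => by
      rw [coords_prodBasis, if_pos rfl, one_mul, mul_comm]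
  · intro a' _ hne
    refine Finset.sum_eq_zero fun b _ => ?_
    rw [coords_prodBasis, if_neg hne, zero_mul, zero_mul]
  · exact fun h => absurd (Finset.mem_univ _) h

theorem pointEntry_sem (hE : C.Env k B σ) (hS : C.HoldsStruct m) {b : ℕ} {u : Fin C.unknowns}
    (hb : σ 21 = b) (hu : σ 22 = u) {y : L}
    (hy : C.HoldsElt m 9 b (C.slot u).1 (C.slot u).2.1 y) :
    C.WritesEntry pointEntry σ m b u (C.prodBasis (C.slot u).2.2 * y) := by
  refine entryProg_sem hE.c5 rfl hb hu fun c => ?_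
  have hE₁ := hE.update (r := 23) (by norm_num) (by norm_num) c
  simp only [sumOver]
  rw [show (IntExp.lit 5).eval (Function.update σ 23 c.val) = 5 from rfl, hE₁.c5,
    Finset.sum_range, coords_prodBasis_mul]
  refine Finset.sum_congr rfl fun x _ => ?_
  have hE₂ := hE₁.update (r := 30) (by norm_num) (by norm_num) x
  set τ := Function.update (Function.update σ 23 c.val) 30 x.val with hτ
  obtain ⟨h1, h2, h3⟩ := slotE_eval hE₂ (u := u) hu
  have e21 : τ 21 = b := hb
  simp only [AExp.val]
  rw [h1, h2]
  congr 1
  · rw [← hS]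
    simp only [IntExp.eval] at h3 ⊢
    rw [h3, hE₂.c5]
    rfl
  · simp only [IntExp.eval]
    rw [e21]
    exact hy x

theorem payloadEntry_sem (hE : C.Env k B σ) (hS : C.HoldsStruct m) {b : ℕ} {u : Fin C.unknowns}
    (hb : σ 21 = b) (hu : σ 22 = u) {y : L} (hy : C.HoldsElt m 10 b 0 (C.slot u).2.1 y) :
    C.WritesEntry payloadEntry σ m b u (C.prodBasis (C.slot u).2.2 * y) := by
  refine entryProg_sem hE.c5 rfl hb hu fun c => ?_
  have hE₁ := hE.update (r := 23) (by norm_num) (by norm_num) c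
  simp only [sumOver]
  rw [show (IntExp.lit 5).eval (Function.update σ 23 c.val) = 5 from rfl, hE₁.c5,
    Finset.sum_range, coords_prodBasis_mul]
  refine Finset.sum_congr rfl fun x _ => ?_
  have hE₂ := hE₁.update (r := 30) (by norm_num) (by norm_num) x
  set τ := Function.update (Function.update σ 23 c.val) 30 x.val with hτ
  obtain ⟨h1, h2, h3⟩ := slotE_eval hE₂ (u := u) hu
  have e21 : τ 21 = b := hb
  simp only [AExp.val]
  rw [h2]
  congr 1
  · rw [← hS]
    simp only [IntExp.eval] at h3 ⊢
    rw [h3, hE₂.c5]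
    rfl
  · simp only [IntExp.eval]
    rw [e21]
    exact hy x

theorem rateE_eval (hE : C.Env k B σ) {e : IntExp} {j : Fin s} (he : e.eval σ = j) :
    (rateE e).eval σ = R j := by
  have h : (rateE e).eval σ = σ (32 + e.eval σ) := rfl
  rw [h, he, hE.rate]

/-- The cascade of comparisons reproduces the cases of `keyCoeff`. The stored powers suffice since
`R j` and `R i + z` do not exceed the numbers of packets. -/
theorem keyEntry_sem (hE : C.Env k B σ) {i : Fin s} (hi : σ 19 + i.val + 1 = s)
    (hS : C.HoldsStruct m) {y : Fin B → Fin s → L} {w : Fin B → L}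
    (hy : ∀ b j l, l < len R z j → C.HoldsElt m 9 (b : Fin B) j l (y b j ^ (C.q j ^ l)))
    (hw : ∀ b l, l < z + 1 → C.HoldsElt m 10 (b : Fin B) 0 l (w b ^ (C.q i ^ l)))
    {b : Fin B} {u : Fin C.unknowns} (hb : σ 21 = b) (hu : σ 22 = u) :
    C.WritesEntry keyEntry σ m b u (C.keySystem i y w b u) := by
  obtain ⟨h1, h2, h3⟩ := slotE_eval hE hu
  have hsrc := srcE_eval hE hi
  have hzero : ∀ {x : L}, x = 0 →
      C.WritesEntry zeroEntry σ m b u (C.prodBasis (C.slot u).2.2 * x) := by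
    rintro x rfl
    rw [mul_zero]
    exact zeroEntry_sem hE.c5 hb hu
  have hz : (ctr 14).eval σ = z + 1 := hE.c14
  have hs : (ctr 0).eval σ = s := hE.c0
  have hri : (IntExp.add (rateE srcE) (ctr 2)).eval σ = R i + z := by
    have : (IntExp.add (rateE srcE) (ctr 2)).eval σ = (rateE srcE).eval σ + σ 2 := rfl
    rw [this, rateE_eval hE hsrc, hE.c2]
  rw [keySystem]
  unfold WritesEntry keyEntry
  by_cases hji : (C.slot u).1.val < i.val
  · have hjs : (C.slot u).1.val < s := hji.trans i.2
    have hrj := rateE_eval hE (j := ⟨_, hjs⟩) h1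
    rw [Stm.sem_ifLt_pos (by rw [h1, hsrc]; exact hji)]
    by_cases hm : (C.slot u).2.1.val < R ⟨_, hjs⟩
    · rw [Stm.sem_ifLt_pos (by rw [h2, hrj]; exact hm), keyCoeff, dif_pos hjs,
        if_pos (Or.inl ⟨hji, hm⟩)]
      exact pointEntry_sem hE hS hb hu (hy b ⟨_, hjs⟩ _ (by simp only [len]; omega))
    · rw [Stm.sem_ifLt_neg (by rw [h2, hrj]; exact hm)]
      refine hzero ?_
      rw [keyCoeff, dif_pos hjs, if_neg]
      rintro (h | h)
      · exact hm h.2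
      · exact hji.ne h.1
  · rw [Stm.sem_ifLt_neg (by rw [h1, hsrc]; exact hji)]
    by_cases hij : i.val < (C.slot u).1.val
    · rw [Stm.sem_ifLt_pos (by rw [h1, hsrc]; exact hij)]
      by_cases hjs : (C.slot u).1.val < s
      · rw [Stm.sem_ifLt_pos (by rw [h1, hs]; exact hjs)]
        refine hzero ?_
        rw [keyCoeff, dif_pos hjs, if_neg]
        rintro (h | h)
        · exact hji h.1
        · exact hij.ne' h.1
      · rw [Stm.sem_ifLt_neg (by rw [h1, hs]; exact hjs)]
        by_cases hm : (C.slot u).2.1.val < z + 1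
        · rw [Stm.sem_ifLt_pos (by rw [h2, hz]; exact hm), keyCoeff, dif_neg hjs, if_pos hm]
          exact payloadEntry_sem hE hS hb hu (hw b _ hm)
        · rw [Stm.sem_ifLt_neg (by rw [h2, hz]; exact hm)]
          refine hzero ?_
          rw [keyCoeff, dif_neg hjs, if_neg hm]
    · have hjeq : (C.slot u).1.val = i.val := by omega
      have hjs : (C.slot u).1.val < s := hjeq ▸ i.2
      have hjfin : (⟨(C.slot u).1.val, hjs⟩ : Fin s) = i := Fin.ext hjeq
      rw [Stm.sem_ifLt_neg (by rw [h1, hsrc]; exact hij)]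
      by_cases hm : (C.slot u).2.1.val < R i + z
      · rw [Stm.sem_ifLt_pos (by rw [h2, hri]; exact hm), keyCoeff, dif_pos hjs,
          if_pos (Or.inr ⟨hjeq, hm⟩)]
        exact pointEntry_sem hE hS hb hu (hy b ⟨_, hjs⟩ _ (by rw [hjfin]; simp only [len]; omega))
      · rw [Stm.sem_ifLt_neg (by rw [h2, hri]; exact hm)]
        refine hzero ?_
        rw [keyCoeff, dif_pos hjs, if_neg]
        rintro (h | h)
        · exact hji h.1
        · exact hm h.2

theorem productEntry_sem (hE : C.Env k B σ) (hS : C.HoldsStruct m) {ρ : ℕ} {u : Fin C.unknowns}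
    (hρ : σ 21 = ρ) (hu : σ 22 = u) {v : Fin C.unknowns → K} (hv : HoldsVec m 16 v) {x : L}
    (hlt : ρ - (C.slot u).2.1.val < C.width)
    (hx : C.HoldsElt m 18 (C.slot u).2.2 0 (ρ - (C.slot u).2.1.val) x) :
    C.WritesEntry productEntry σ m ρ u (C.block v s (ρ - (C.slot u).2.1.val) * x) := by
  refine entryProg_sem hE.c5 rfl hρ hu fun c => ?_
  have hE₁ := hE.update (r := 23) (by norm_num) (by norm_num) c
  simp only [sumOver]
  rw [show (IntExp.lit 5).eval (Function.update σ 23 c.val) = 5 from rfl, hE₁.c5,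
    Finset.sum_range, coords_mul]
  refine Finset.sum_congr rfl fun a _ => ?_
  have hE₂ := hE₁.update (r := 30) (by norm_num) (by norm_num) a
  rw [show (IntExp.lit 5).eval (Function.update (Function.update σ 23 c.val) 30 a.val) = 5 from rfl,
    hE₂.c5, Finset.sum_range]
  refine Finset.sum_congr rfl fun b _ => ?_
  have hE₃ := hE₂.update (r := 31) (by norm_num) (by norm_num) b
  set τ := Function.update (Function.update (Function.update σ 23 c.val) 30 a.val) 31 b.val with hτ
  obtain ⟨h1, h2, h3⟩ := slotE_eval hE₃ (u := u) hu
  have hsub : (IntExp.sub (ctr 21) indexE).eval τ = ρ - (C.slot u).2.1.val := by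
    have : (IntExp.sub (ctr 21) indexE).eval τ = τ 21 - indexE.eval τ := rfl
    rw [this, h2, show τ 21 = ρ from hρ]
  rw [hv.coords_block le_rfl hlt, ← hx b, mul_comm (m 16 0 0 0 _ * _), ← mul_assoc, ← hS]
  simp only [AExp.val]
  rw [h3, hsub]
  have e16 : (IntExp.add (.add (ctr 11) (.mul (.sub (ctr 21) indexE) (ctr 5))) (ctr 30)).eval τ =
      τ 11 + (IntExp.sub (ctr 21) indexE).eval τ * τ 5 + τ 30 := rfl
  rw [e16, hsub, hE₃.c11, hE₃.c5]
  have e30 : τ 30 = a := rfl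
  rw [e30, add_mul (s * C.width)]
  congr 2
  simp only [IntExp.eval]
  rw [hE₃.c5]
  rfl

theorem numeratorEntry_sem (hE : C.Env k B σ) {i : Fin s} (hi : σ 19 + i.val + 1 = s) {ρ u : ℕ}
    (hρ : σ 21 = ρ) (hu : σ 22 = u) {v : Fin C.unknowns → K} (hv : HoldsVec m 16 v)
    (hlt : ρ < C.width) : C.WritesEntry numeratorEntry σ m ρ u (C.block v i ρ) := by
  refine entryProg_sem hE.c5 rfl hρ hu fun c => ?_
  have hE₁ := hE.update (r := 23) (by norm_num) (by norm_num) c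
  set τ := Function.update σ 23 c.val with hτ
  rw [hv.coords_block i.2.le hlt]
  have hsrc : srcE.eval τ = i := srcE_eval hE₁ hi
  have e : (IntExp.add (.mul (.add (.mul srcE (ctr 7)) (ctr 21)) (ctr 5)) (ctr 23)).eval τ =
      (srcE.eval τ * τ 7 + τ 21) * τ 5 + τ 23 := rfl
  simp only [sumOver, AExp.val]
  rw [e, hsrc, hE₁.c7, hE₁.c5, show τ 21 = ρ from hρ, show τ 23 = c from rfl]
  rfl

/-- The order of the tests matters: `ρ` is compared with the slot before the truncated difference is
used. Equality with the scale unknown is tested by excluding both strict inequalities. -/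
theorem quotEntry_sem (hE : C.Env k B σ) {i : Fin s} (hi : σ 19 + i.val + 1 = s)
    (hS : C.HoldsStruct m) {v : Fin C.unknowns → K} (hv : HoldsVec m 16 v)
    (hβ : ∀ (a : Fin (∏ i, len R z i)) l, l < z + 1 →
      C.HoldsElt m 18 a 0 l (C.prodBasis a ^ (C.q i ^ l)))
    {ρ : Fin (len R z i)} {u : Fin C.unknowns} (hρ : σ 21 = ρ) (hu : σ 22 = u) :
    C.WritesEntry quotEntry σ m ρ u (C.quotSystem i v ρ u) := by
  obtain ⟨h1, h2, h3⟩ := slotE_eval hE hu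
  have hsrc := srcE_eval hE hi
  have hW := C.len_lt_width i
  have hzero : ∀ {x : L}, x = 0 → C.WritesEntry zeroEntry σ m ρ u x := by
    rintro x rfl
    exact zeroEntry_sem hE.c5 hρ hu
  have hz : (ctr 14).eval σ = z + 1 := hE.c14
  have hr := rateE_eval hE hsrc
  have hri : (IntExp.add (rateE srcE) (ctr 2)).eval σ = R i + z := by
    have : (IntExp.add (rateE srcE) (ctr 2)).eval σ = (rateE srcE).eval σ + σ 2 := rfl
    rw [this, hr, hE.c2]
  have hsub : (IntExp.sub (ctr 21) indexE).eval σ = ρ.val - (C.slot u).2.1.val := by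
    have : (IntExp.sub (ctr 21) indexE).eval σ = σ 21 - indexE.eval σ := rfl
    rw [this, h2, hρ]
  have e21 : (ctr 21).eval σ = ρ := hρ
  have e22 : (ctr 22).eval σ = u := hu
  have e11 : (ctr 11).eval σ = s * C.width * ∏ i, len R z i := hE.c11
  have e1 : (IntExp.lit 1).eval σ = 1 := rfl
  unfold WritesEntry quotEntry quotSystem
  by_cases hj : (C.slot u).1.val = 0
  · rw [Stm.sem_ifLt_pos (by rw [h1, hj, e1]; norm_num)]
    simp only [if_pos hj]
    by_cases hm : (C.slot u).2.1.val < R i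
    · rw [Stm.sem_ifLt_pos (by rw [h2, hr]; exact hm)]
      by_cases hle : ρ.val < (C.slot u).2.1.val
      · rw [Stm.sem_ifLt_pos (by rw [h2, e21]; exact hle)]
        exact hzero (if_neg fun h => absurd h.2.1 (not_le.2 hle))
      · rw [Stm.sem_ifLt_neg (by rw [h2, e21]; exact hle)]
        by_cases hd : ρ.val - (C.slot u).2.1.val < z + 1
        · rw [Stm.sem_ifLt_pos (by rw [hsub, hz]; exact hd)]
          simp only [if_pos (show (C.slot u).2.1.val < R i ∧ (C.slot u).2.1.val ≤ ρ.val ∧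
            ρ.val - (C.slot u).2.1.val < z + 1 from ⟨hm, not_lt.1 hle, hd⟩)]
          refine productEntry_sem hE hS hρ hu hv ?_ (hβ _ _ hd)
          have := ρ.2
          simp only [len] at this
          omega
        · rw [Stm.sem_ifLt_neg (by rw [hsub, hz]; exact hd)]
          exact hzero (if_neg fun h => hd h.2.2)
    · rw [Stm.sem_ifLt_neg (by rw [h2, hr]; exact hm)]
      exact hzero (if_neg fun h => hm h.1)
  · rw [Stm.sem_ifLt_neg (by rw [h1, e1]; omega)]
    simp only [if_neg hj]
    by_cases hlo : u.val < s * C.width * ∏ i, len R z i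
    · rw [Stm.sem_ifLt_pos (by rw [e22, e11]; exact hlo)]
      exact hzero (if_neg hlo.ne)
    · rw [Stm.sem_ifLt_neg (by rw [e22, e11]; exact hlo)]
      by_cases hhi : s * C.width * (∏ i, len R z i) < u.val
      · rw [Stm.sem_ifLt_pos (by rw [e22, e11]; exact hhi)]
        exact hzero (if_neg hhi.ne')
      · rw [Stm.sem_ifLt_neg (by rw [e22, e11]; exact hhi)]
        have hu' : u.val = s * C.width * ∏ i, len R z i := by omega
        simp only [if_pos hu']
        by_cases hm : ρ.val < R i + z
        · rw [Stm.sem_ifLt_pos (by rw [e21, hri]; exact hm)]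
          simp only [if_pos hm]
          refine numeratorEntry_sem hE hi hρ hu hv ?_
          have := ρ.2
          simp only [len] at this
          omega
        · rw [Stm.sem_ifLt_neg (by rw [e21, hri]; exact hm)]
          exact hzero (if_neg hm)

theorem solveProg_sem (hE : C.Env k B σ) {e : IntExp} {n : ℕ} (he : σ (e.eval σ) = n)
    {P : Stm} (hP : ∀ a ∈ P.writes, a = 11) {T : Fin n → Fin C.unknowns → L}
    (h : ∀ (b : Fin n) (u : Fin C.unknowns) (m' : Mem K), (∀ a, a ≠ 11 → m' a = m a) →
      C.WritesEntry P (Function.update (Function.update σ 21 b) 22 u) m' b u (T b u))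
    {a cnt c : ℕ} (ha : a ≠ 12) (hcnt : cnt < 22) (hc : σ cnt = c)
    (hle : s * C.width * (∏ i, len R z i) + c ≤ C.unknowns) :
    HoldsVec ((solveProg e P a cnt).sem σ m) a (C.solve T c) := by
  rw [solveProg, Stm.sem, Stm.sem]
  have h1 := (matrixProg_sem hE he hP h).2
  have h2 := kernelProg_sem (a := fun b c u => C.coords (T b u) c) hE.c10 hE.c5 he h1
  intro u
  rw [selectProg_sem ha hE.c10 hcnt (by rw [hE.c11, hc]; exact hle) h2 u, hE.c11, hc]
  rfl

theorem add_le_unknowns (C : TowerCode K L (len R z)) {c : ℕ} (hc : c ≤ C.width) :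
    s * C.width * (∏ i, len R z i) + c * (∏ i, len R z i) ≤ C.unknowns := by
  rw [← add_mul]
  refine Nat.mul_le_mul_right _ ?_
  rw [Nat.succ_mul]
  omega

/-- Besides the decoded column and the cancelled payload, two frame statements are recorded: other
columns of the output and of the payload are untouched. They allow the columns of a source to be
treated one at a time, each with its own cancellation. -/
theorem columnProg_sem (hE : C.Env k B σ) {i : Fin s} (hi : σ 19 + i.val + 1 = s)
    {κ : ℕ} (hκ : σ 20 = κ) (hS : C.HoldsStruct m) (hF : C.HoldsMaps m)
    {y : Fin B → Fin s → L} {w : Fin B → L}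
    (hy : ∀ b j l, l < len R z j → C.HoldsElt m 9 (b : Fin B) j l (y b j ^ (C.q j ^ l)))
    (hβ : ∀ (a : Fin (∏ i, len R z i)) l, l < z + 1 →
      C.HoldsElt m 18 a 0 l (C.prodBasis a ^ (C.q i ^ l)))
    (hw : ∀ b : Fin B, C.HoldsElt m 4 b κ 0 (w b)) :
    (∀ r : Fin (R i), C.HoldsElt (columnProg.sem σ m) 5 i r κ (C.decodeCol i y w r)) ∧
    (∀ b : Fin B, C.HoldsElt (columnProg.sem σ m) 4 b κ 0
      (w b - ∑ r : Fin (R i), y b i ^ (C.q i ^ r.val) * C.decodeCol i y w r)) ∧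
    (∀ i' r' κ', ¬ (i' = i.val ∧ κ' = κ) → columnProg.sem σ m 5 i' r' κ' = m 5 i' r' κ') ∧
    ∀ b' κ', κ' ≠ κ → columnProg.sem σ m 4 b' κ' 0 = m 4 b' κ' 0 := by
  have hW := C.len_lt_width i
  have hsrc := srcE_eval hE hi
  rw [columnProg, Stm.sem]
  -- the powers of the payload
  have hw₁ : ∀ b l, l < z + 1 → C.HoldsElt (payloadPowersProg.sem σ m) 10 (b : Fin B) 0 l
      (w b ^ (C.q i ^ l)) := fun b l hl => payloadPowersProg_sem hE hi hF hκ hw b hl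
  have f₁ : ∀ a, a ∉ payloadPowersProg.writes → payloadPowersProg.sem σ m a = m a :=
    fun a ha => Stm.sem_of_notMem ha _ _
  set m₁ := payloadPowersProg.sem σ m
  clear_value m₁
  have hS₁ : C.HoldsStruct m₁ := hS.congr (f₁ 1 (by decide))
  have h9₁ := f₁ 9 (by decide)
  have h18₁ := f₁ 18 (by decide)
  have h4₁ := f₁ 4 (by decide)
  have h5₁ := f₁ 5 (by decide)
  -- the key equation
  rw [Stm.sem]
  have hkey : HoldsVec ((solveProg (.lit 4) keyEntry 16 12).sem σ m₁) 16
      (C.keySolution i y w) := by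
    refine solveProg_sem hE (e := .lit 4) (n := B) hE.c4 (by decide) ?_ (by decide) (by decide)
      hE.c12 (C.add_le_unknowns (by simp only [len] at hW; omega))
    intro b u m' hm'
    refine keyEntry_sem (σ := Function.update (Function.update σ 21 b.val) 22 u.val) ((hE.update
        (by norm_num) (by norm_num) _).update (by norm_num)
      (by norm_num) _) hi (hS₁.congr (hm' 1 (by norm_num))) ?_ ?_ rfl rfl
    · exact fun b j l hl => (hy b j l hl).congr ((hm' 9 (by norm_num)).trans h9₁)
    · exact fun b l hl => (hw₁ b l hl).congr (hm' 10 (by norm_num))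
  have f₂ : ∀ a, a ∉ (solveProg (.lit 4) keyEntry 16 12).writes →
      (solveProg (.lit 4) keyEntry 16 12).sem σ m₁ a = m₁ a :=
    fun a ha => Stm.sem_of_notMem ha _ _
  set m₂ := (solveProg (.lit 4) keyEntry 16 12).sem σ m₁
  clear_value m₂
  have hS₂ : C.HoldsStruct m₂ := hS₁.congr (f₂ 1 (by decide))
  have h9₂ := (f₂ 9 (by decide)).trans h9₁
  have h18₂ := (f₂ 18 (by decide)).trans h18₁
  have h4₂ := (f₂ 4 (by decide)).trans h4₁
  have h5₂ := (f₂ 5 (by decide)).trans h5₁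
  -- the quotient
  rw [Stm.sem]
  have hquot : HoldsVec ((solveProg (lenAddr srcE) quotEntry 17 13).sem σ m₂) 17
      (C.solve (C.quotSystem i (C.keySolution i y w)) 1) := by
    refine solveProg_sem hE (n := len R z i) ?_ (by decide) ?_ (by decide) (by decide) hE.c13 ?_
    · have : (lenAddr srcE).eval σ = 32 + (σ 0 + srcE.eval σ) := rfl
      rw [this, hsrc, hE.c0, hE.num]
    · intro b u m' hm'
      refine quotEntry_sem (σ := Function.update (Function.update σ 21 b.val) 22 u.val)
          ((hE.update (by norm_num) (by norm_num) _).update (by norm_num)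
        (by norm_num) _) hi (hS₂.congr (hm' 1 (by norm_num))) ?_ ?_ rfl rfl
      · exact fun u => (congrFun (congrFun (congrFun (congrFun (hm' 16 (by norm_num)) 0) 0) 0)
          _).trans (hkey u)
      · exact fun a l hl => (hβ a l hl).congr ((hm' 18 (by norm_num)).trans h18₂)
    · refine le_trans (Nat.add_le_add_left ?_ _) (C.add_le_unknowns (c := 1) (by omega))
      rw [one_mul]
      exact C.prod_len_pos
  have f₃ : ∀ a, a ∉ (solveProg (lenAddr srcE) quotEntry 17 13).writes →
      (solveProg (lenAddr srcE) quotEntry 17 13).sem σ m₂ a = m₂ a :=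
    fun a ha => Stm.sem_of_notMem ha _ _
  set m₃ := (solveProg (lenAddr srcE) quotEntry 17 13).sem σ m₂
  clear_value m₃
  have hS₃ : C.HoldsStruct m₃ := hS₂.congr (f₃ 1 (by decide))
  have h9₃ := (f₃ 9 (by decide)).trans h9₂
  have h4₃ := (f₃ 4 (by decide)).trans h4₂
  have h5₃ := (f₃ 5 (by decide)).trans h5₂
  -- the decoded column
  rw [Stm.sem]
  have hrate : σ ((IntExp.add (.lit 32) srcE).eval σ) = R i := by
    have : (IntExp.add (.lit 32) srcE).eval σ = 32 + srcE.eval σ := rfl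
    rw [this, hsrc, hE.rate]
  have hx₄ : ∀ r : Fin (R i), C.HoldsElt (scaleSolutionProg.sem σ m₃) 20 r 0 0
      (C.decodeCol i y w r) := by
    intro r c
    have hr := r.2
    have hrW : r.val < C.width := by simp only [len] at hW; omega
    have hE₁ := hE.update (r := 16) (by norm_num) (by norm_num) r
    have hE₂ := hE₁.update (r := 29) (by norm_num) (by norm_num) c
    set τ := Function.update (Function.update σ 16 r.val) 29 c.val with hτ
    have hscale : C.scale (C.solve (C.quotSystem i (C.keySolution i y w)) 1) =
        m₃ 17 0 0 0 (s * C.width * ∏ i, len R z i) := by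
      have hlt := C.uix_lt (le_refl s) C.width_pos C.prod_len_pos
      rw [add_zero, add_zero] at hlt
      rw [scale, dif_pos hlt, ← hquot]
    rw [scaleSolutionProg, sem_fill (by decide), decodeCol]
    simp only
    rw [coords_smul, hscale, hquot.coords_block (Nat.zero_le _) hrW]
    simp only [Dim.mem, Dim.upd, sumOver, AExp.val, hrate, r.2, true_and]
    rw [← hτ]
    simp only [IntExp.eval, hE₁.c5, c.2, hE₂.c5, hE₂.c11]
    rw [show τ 16 = r from rfl, show τ 29 = c from rfl, zero_mul, zero_add, mul_comm]
    simp only [and_self, if_true]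
  have f₄ : ∀ a, a ∉ scaleSolutionProg.writes → scaleSolutionProg.sem σ m₃ a = m₃ a :=
    fun a ha => Stm.sem_of_notMem ha _ _
  set m₄ := scaleSolutionProg.sem σ m₃
  clear_value m₄
  have hS₄ : C.HoldsStruct m₄ := hS₃.congr (f₄ 1 (by decide))
  have h9₄ := (f₄ 9 (by decide)).trans h9₃
  have h4₄ := (f₄ 4 (by decide)).trans h4₃
  have h5₄ := (f₄ 5 (by decide)).trans h5₃
  rw [Stm.sem]
  have hkeep : ∀ i' r' κ' c, keepProg.sem σ m₄ 5 i' r' κ' c =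
      if i' = i.val ∧ r' < R i ∧ κ' = κ ∧ c < ∏ i, len R z i then m₄ 20 r' 0 0 c
      else m₄ 5 i' r' κ' c := by
    intro i' r' κ' c
    rw [keepProg, sem_fill (by decide)]
    have hE₁ := hE.update (r := 16) (by norm_num) (by norm_num) r'
    have e20 : Function.update σ 16 r' 20 = κ := hκ
    simp only [Dim.mem, Dim.upd, sumOver, AExp.val, hsrc, hrate, true_and]
    simp only [IntExp.eval, e20, hE₁.c5]
    rfl
  have f₅ : ∀ a, a ∉ keepProg.writes → keepProg.sem σ m₄ a = m₄ a :=
    fun a ha => Stm.sem_of_notMem ha _ _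
  set m₅ := keepProg.sem σ m₄
  clear_value m₅
  have hS₅ : C.HoldsStruct m₅ := hS₄.congr (f₅ 1 (by decide))
  have h9₅ := (f₅ 9 (by decide)).trans h9₄
  have h4₅ := (f₅ 4 (by decide)).trans h4₄
  have h20₅ := f₅ 20 (by decide)
  have h5₆ : cancelProg.sem σ m₅ 5 = m₅ 5 := Stm.sem_of_notMem (by decide) _ _
  -- the cancellation
  have hcan : ∀ b' κ' c, cancelProg.sem σ m₅ 4 b' κ' 0 c =
      if b' < B ∧ κ' = κ ∧ c < ∏ i, len R z i then
        m₅ 4 b' κ 0 c - ∑ r : Fin (R i), ∑ a : Fin (∏ i, len R z i), ∑ b : Fin (∏ i, len R z i),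
          m₅ 9 b' i r a * m₅ 20 r 0 0 b * m₅ 1 0 0 0
            ((a * (∏ i, len R z i) + b) * (∏ i, len R z i) + c)
      else m₅ 4 b' κ' 0 c := by
    intro b' κ' c
    rw [cancelProg, Stm.sem, Stm.sem]
    set m₆ := (fill 23 (.run 16 (.lit 4)) fix0 fix0 (.run 29 (.lit 5))
      [(28, .add (.lit 32) srcE), (30, .lit 5), (31, .lit 5)]
      (.mul (.mul (.rd 9 (ctr 16) srcE (ctr 28) (ctr 30))
        (.rd 20 (ctr 28) (.lit 0) (.lit 0) (ctr 31)))
        (structE (ctr 30) (ctr 31) (ctr 29)))).sem σ m₅ with hm₆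
    have h4₆ : m₆ 4 = m₅ 4 := Stm.sem_of_notMem (by decide) _ _
    have hsum : b' < B → c < (∏ i, len R z i) → m₆ 23 b' 0 0 c =
        ∑ r : Fin (R i), ∑ a : Fin (∏ i, len R z i), ∑ b : Fin (∏ i, len R z i),
          m₅ 9 b' i r a * m₅ 20 r 0 0 b * m₅ 1 0 0 0
            ((a * (∏ i, len R z i) + b) * (∏ i, len R z i) + c) := by
      intro hb' hc
      have hE₁ := hE.update (r := 16) (by norm_num) (by norm_num) b'
      have hE₂ := hE₁.update (r := 29) (by norm_num) (by norm_num) c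
      rw [hm₆, sem_fill (by decide)]
      refine (if_pos (by
        simp only [Dim.mem, Dim.upd, IntExp.eval, hE.c4, hE₁.c5, hb', hc, and_self])).trans ?_
      simp only [Dim.upd, sumOver]
      set τ := Function.update (Function.update σ 16 b') 29 c with hτ
      have hsrcτ : srcE.eval τ = i := srcE_eval hE₂ hi
      have hrateτ : τ ((IntExp.add (.lit 32) srcE).eval τ) = R i := by
        have : (IntExp.add (.lit 32) srcE).eval τ = 32 + srcE.eval τ := rfl
        rw [this, hsrcτ, hE₂.rate]
      rw [hrateτ, Finset.sum_range]
      refine Finset.sum_congr rfl fun r _ => ?_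
      have hE₃ := hE₂.update (r := 28) (by norm_num) (by norm_num) r
      rw [show (IntExp.lit 5).eval (Function.update τ 28 r.val) = 5 from rfl, hE₃.c5,
        Finset.sum_range]
      refine Finset.sum_congr rfl fun a _ => ?_
      have hE₄ := hE₃.update (r := 30) (by norm_num) (by norm_num) a
      rw [show (IntExp.lit 5).eval (Function.update (Function.update τ 28 r.val) 30 a.val) = 5
        from rfl, hE₄.c5, Finset.sum_range]
      refine Finset.sum_congr rfl fun b _ => ?_
      have hE₅ := hE₄.update (r := 31) (by norm_num) (by norm_num) b
      set υ := Function.update (Function.update (Function.update τ 28 r.val) 30 a.val) 31 b.val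
      have hsrcυ : srcE.eval υ = i := srcE_eval hE₅ hi
      simp only [AExp.val, hsrcυ]
      simp only [IntExp.eval, hE₅.c5]
      rfl
    clear_value m₆
    rw [sem_fill (by decide)]
    have hE₁ := hE.update (r := 16) (by norm_num) (by norm_num) b'
    have e20 : Function.update σ 16 b' 20 = κ := hκ
    have h4₇ : (fill 24 (.run 16 (.lit 4)) fix0 fix0 (.run 29 (.lit 5)) []
      (.sub (.rd 4 (ctr 16) (ctr 20) (.lit 0) (ctr 29))
        (.rd 23 (ctr 16) (.lit 0) (.lit 0) (ctr 29)))).sem σ m₆ 4 = m₅ 4 :=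
      (Stm.sem_of_notMem (by decide) _ _).trans h4₆
    beta_reduce
    rw [h4₇]
    simp only [Dim.mem, Dim.upd, IntExp.eval, e20, hE₁.c5, hE.c4, true_and]
    refine if_ctx_congr Iff.rfl (fun hcond => ?_) fun _ => rfl
    obtain ⟨hb', hκ', hc⟩ := hcond
    simp only [sumOver, AExp.val]
    rw [sem_fill (by decide)]
    have g16 : (ctr 16).eval (Function.update (Function.update σ 16 b') 29 c) = b' := rfl
    have g29 : (ctr 29).eval (Function.update (Function.update σ 16 b') 29 c) = c := rfl
    have g0 : (IntExp.lit 0).eval (Function.update (Function.update σ 16 b') 29 c) = 0 := rfl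
    have g20 : (ctr 20).eval (Function.update (Function.update σ 16 b') 29 c) = κ := hκ
    rw [g16, g29, g0]
    simp only [Dim.mem, Dim.upd, hE.c4, hE₁.c5, IntExp.eval, hb', hc, and_self, if_true,
      sumOver, AExp.val]
    have k20 : Function.update (Function.update σ 16 b') 29 c 20 = κ := hκ
    rw [k20, ← hsum hb' hc, ← h4₆]
    rfl
  refine ⟨fun r c => ?_, fun b c => ?_, fun i' r' κ' hne => ?_, fun b' κ' hne => ?_⟩
  · rw [h5₆, hkeep, if_pos ⟨rfl, r.2, rfl, c.2⟩]
    exact hx₄ r c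
  · rw [hcan, if_pos ⟨b.2, rfl, c.2⟩, coords_sub, h4₅, hw b c, coords_sum]
    congr 1
    refine Finset.sum_congr rfl fun r _ => ?_
    rw [coords_mul]
    refine Finset.sum_congr rfl fun a _ => Finset.sum_congr rfl fun a' _ => ?_
    rw [h9₅, h20₅, hx₄ r a', hS₅, hy b i r (by have := r.2; simp only [len]; omega) a]
  · funext c
    rw [h5₆, hkeep, if_neg fun h => hne ⟨h.1, h.2.2.1⟩, h5₄]
  · funext c
    rw [hcan, if_neg fun h => hne h.2.1, h4₅]

end TowerCode

end NetCode
end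

noncomputable section
open scoped Classical
namespace NetCode

/-! ### The decoding program -/

/-- Decode all sources, the last one first; the decoded columns are in array 5. -/
def decodeProg : Stm :=
  .loop 19 (.lit 0) (.seq basisPowersProg (.loop 20 (.lit 1) columnProg))

/-- The position of an output entry. -/
abbrev outputE : IntExp :=
  .add (.mul (.add (.sub (.cell (preAddr (ctr 16))) (.mul (.mul (.lit 2) (ctr 2)) (ctr 16)))
    (ctr 17)) (.mul (ctr 1) (ctr 5))) (.add (.mul (ctr 18) (ctr 5)) (ctr 19))

/-- Write the decoded columns to array 2 in the order of the output. -/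
def flattenProg : Stm :=
  .loop 16 (.lit 0) (.loop 17 (.add (.lit 32) (ctr 16)) (.loop 18 (.lit 1) (.loop 19 (.lit 5)
    (.asg 2 (.lit 0) (.lit 0) (.lit 0) outputE [] (.rd 5 (ctr 16) (ctr 17) (ctr 18) (ctr 19))))))

/-- The decoder between loading of the input and storing of the output. -/
def mainProg : Stm :=
  .seq baseFrobProg (.seq towerFrobProg (.seq pointPowersProg (.seq payloadProg
    (.seq decodeProg flattenProg))))

/-- At the start all cells from 16 to 31 are free counters; the check is a computation on the
syntax. -/
theorem mainProg_ok : mainProg.ok ((List.range 16).map (· + 16)) = true := by decide +kernel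

/-- The statement makes `good` true on `T` and never spoils it, as long as `keep` holds. -/
def Stm.Collects {K X : Type*} [Field K] (P : Stm) (σ : ℕ → ℕ) (keep : Mem K → Prop)
    (good : X → Mem K → Prop) (T : X → Prop) : Prop :=
  ∀ m, keep m → keep (P.sem σ m) ∧ (∀ x, good x m → good x (P.sem σ m)) ∧
    ∀ x, T x → good x (P.sem σ m)

theorem Stm.Collects.loop {K X : Type*} [Field K] {P : Stm} {σ : ℕ → ℕ} {keep : Mem K → Prop}
    {good : X → Mem K → Prop} {T : ℕ → X → Prop} {r : ℕ} {e : IntExp}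
    (h : ∀ t < σ (e.eval σ), P.Collects (Function.update σ r t) keep good (T t)) :
    (Stm.loop r e P).Collects σ keep good fun x => ∃ t < σ (e.eval σ), T t x := by
  intro m hm
  exact Stm.sem_loop_induct (r := r) (e := e) (P := P) σ m
    (fun t m' => keep m' ∧ (∀ x, good x m → good x m') ∧ ∀ x, (∃ t' < t, T t' x) → good x m')
    ⟨hm, fun _ h => h, fun x ⟨t', ht', _⟩ => absurd ht' (Nat.not_lt_zero _)⟩
    (fun t ht m' ⟨h1, h2, h3⟩ => by
      obtain ⟨g1, g2, g3⟩ := h t ht m' h1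
      refine ⟨g1, fun x hx => g2 x (h2 x hx), fun x ⟨t', ht', hx⟩ => ?_⟩
      rcases Nat.lt_succ_iff_lt_or_eq.1 ht' with ht' | rfl
      · exact g2 x (h3 x ⟨t', ht', hx⟩)
      · exact g3 x hx)

theorem Stm.Collects.mono {K X : Type*} [Field K] {P : Stm} {σ : ℕ → ℕ} {keep : Mem K → Prop}
    {good : X → Mem K → Prop} {T T' : X → Prop} (h : P.Collects σ keep good T)
    (hT : ∀ x, T' x → T x) : P.Collects σ keep good T' := fun m hm =>
  ⟨(h m hm).1, (h m hm).2.1, fun x hx => (h m hm).2.2 x (hT x hx)⟩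

theorem finProdFinEquiv_val {a b : ℕ} (x : Fin a) (y : Fin b) :
    (finProdFinEquiv (x, y)).val = x * b + y := by
  simp only [finProdFinEquiv_apply_val]
  ring

theorem payloadEquiv_val {s : ℕ} (n : Fin s → ℕ) (k : ℕ) (κ : Fin k) (d : ∀ i, Fin (n i)) :
    (payloadEquiv n k (κ, d)).val = κ * (∏ i, n i) + finPiFinEquiv d :=
  finProdFinEquiv_val _ _

/-- The position of an output entry. -/
def outputPos {s : ℕ} (R : Fin s → ℕ) (z k : ℕ) (x : (Σ i, Fin (R i)) × Payload (len R z) k) : ℕ :=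
  (finSigmaFinEquiv x.1 : Fin (∑ i, R i)) * (k * ∏ i, len R z i) + payloadEquiv (len R z) k x.2

/-- No write to the output overwrites the entry of another position, so results can be collected in
any order. -/
theorem outputPos_injective {s : ℕ} (R : Fin s → ℕ) (z k : ℕ) :
    Function.Injective (outputPos R z k) := by
  intro x y h
  have key : ∀ x, (finProdFinEquiv (finSigmaFinEquiv x.1, payloadEquiv (len R z) k x.2)).val =
      outputPos R z k x := fun x => finProdFinEquiv_val _ _
  have := finProdFinEquiv.injective (Fin.ext ((key x).trans (h.trans (key y).symm)))
  rw [Prod.mk.injEq] at this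
  exact Prod.ext (finSigmaFinEquiv.injective this.1) ((payloadEquiv (len R z) k).injective this.2)

/-- Offsets in the output count information rows, whereas the stored table counts packets.
Subtracting `2 z` per preceding source converts one into the other, so no second table is kept. -/
theorem prefixSum_len {s : ℕ} (R : Fin s → ℕ) (z : ℕ) {t : ℕ} (ht : t ≤ s) :
    prefixSum (len R z) t = prefixSum R t + 2 * z * t := by
  induction t with
  | zero => rfl
  | succ t ih =>
    have h := prefixSum_succ (len R z) ⟨t, ht⟩
    have h' := prefixSum_succ R ⟨t, ht⟩
    simp only at h h'
    rw [h, h', ih (by omega)]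
    simp only [len]
    ring

namespace TowerCode

variable {K L : Type*} [Field K] [Fintype K] [Field L] [Algebra K L] {s : ℕ}
  {R : Fin s → ℕ} {z : ℕ} {C : TowerCode K L (len R z)} [FiniteDimensional K L]
  {k B : ℕ} {σ : ℕ → ℕ} {m : Mem K}

/-- After `t` rounds the payload array holds the residual of successive decoding with `t` sources
removed, and the columns of the last `t` sources are in place. The powers in array 9 remain valid
throughout, because earlier header blocks are never changed. -/
theorem decodeProg_sem (hE : C.Env k B σ) {Y : Matrix (Fin B) (Position (len R z) k) K}
    (hS : C.HoldsStruct m) (hF : C.HoldsMaps m)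
    (hy : ∀ b j l, l < len R z j → C.HoldsElt m 9 (b : Fin B) j l (C.points Y b j ^ (C.q j ^ l)))
    (hw : ∀ (b : Fin B) (κ : Fin k), C.HoldsElt m 4 b κ 0 (C.payload Y κ b))
    (i : Fin s) (r : Fin (R i)) (κ : Fin k) :
    C.HoldsElt (decodeProg.sem σ m) 5 i r κ (C.decodeCol i (C.points Y)
      (C.payload (C.residual C.stage Y i.rev) κ) r) := by
  set dec : Fin s → Fin k → ∀ i, Fin (R i) → L := fun i' κ i r => C.decodeCol i (C.points Y)
      (C.payload (C.residual C.stage Y i'.rev) κ) r with hdec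
  have := Stm.sem_loop_induct (r := 19) (e := .lit 0)
    (P := .seq basisPowersProg (.loop 20 (.lit 1) columnProg)) σ m
    (fun t m' => C.HoldsStruct m' ∧ C.HoldsMaps m' ∧
      (∀ b j l, l < len R z j →
        C.HoldsElt m' 9 (b : Fin B) j l (C.points Y b j ^ (C.q j ^ l))) ∧
      (∀ (b : Fin B) (κ : Fin k),
        C.HoldsElt m' 4 b κ 0 (C.payload (C.residual C.stage Y t) κ b)) ∧
      ∀ (i : Fin s) (r : Fin (R i)) (κ : Fin k), s ≤ i + t →
        C.HoldsElt m' 5 i r κ (dec i κ i r))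
    ⟨hS, hF, hy, hw, fun i _ _ hi => absurd i.2 (by omega)⟩ ?_
  · rw [show σ ((IntExp.lit 0).eval σ) = _ from hE.c0] at this
    exact this.2.2.2.2 i r κ (by omega)
  · intro t ht m' ⟨h1, h2, h3, h4, h5⟩
    replace ht : t < s := hE.c0 ▸ ht
    have hEτ : C.Env k B (Function.update σ 19 t) := hE.update (by norm_num) (by norm_num) t
    set τ := Function.update σ 19 t with hτ
    obtain ⟨j, hj⟩ : ∃ j : Fin s, t = j.rev := ⟨Fin.rev ⟨t, ht⟩, by rw [Fin.rev_rev]⟩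
    have hjv : t + j.val + 1 = s := by rw [hj, Fin.val_rev]; omega
    have h19 : τ 19 + j.val + 1 = s := hjv
    rw [Stm.sem]
    have hβ := fun (a : Fin (∏ i, len R z i)) (l : ℕ) (hl : l < z + 1) =>
      basisPowersProg_sem (m := m') hEτ h19 h2 a hl
    have f₁ : ∀ a, a ∉ basisPowersProg.writes → basisPowersProg.sem τ m' a = m' a :=
      fun a ha => Stm.sem_of_notMem ha _ _
    set m₁ := basisPowersProg.sem τ m'
    clear_value m₁
    -- Within a round the payload is in a mixed state: columns before `x` are already cancelled, the
    -- others not yet. A column is decoded from its own block only.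
    have hin := Stm.sem_loop_induct (r := 20) (e := .lit 1) (P := columnProg) τ m₁
      (fun x m'' => C.HoldsStruct m'' ∧ C.HoldsMaps m'' ∧
        (∀ b j l, l < len R z j →
          C.HoldsElt m'' 9 (b : Fin B) j l (C.points Y b j ^ (C.q j ^ l))) ∧
        (∀ (a : Fin (∏ i, len R z i)) l, l < z + 1 →
          C.HoldsElt m'' 18 a 0 l (C.prodBasis a ^ (C.q j ^ l))) ∧
        (∀ (b : Fin B) (κ : Fin k), C.HoldsElt m'' 4 b κ 0
          (C.payload (C.residual C.stage Y (if κ.val < x then t + 1 else t)) κ b)) ∧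
        (∀ (i : Fin s) (r : Fin (R i)) (κ : Fin k), s ≤ i + t →
          C.HoldsElt m'' 5 i r κ (dec i κ i r)) ∧
        ∀ (r : Fin (R j)) (κ : Fin k), κ.val < x → C.HoldsElt m'' 5 j r κ (dec j κ j r))
      ⟨h1.congr (f₁ 1 (by decide)), fun i => (h2 i).congr (f₁ 6 (by decide)),
        fun b j l hl => (h3 b j l hl).congr (f₁ 9 (by decide)), hβ,
        fun b κ => by
          rw [if_neg (Nat.not_lt_zero _)]
          exact (h4 b κ).congr (f₁ 4 (by decide)),
        fun i r κ hi => (h5 i r κ hi).congr (f₁ 5 (by decide)),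
        fun _ κ hκ => absurd hκ (Nat.not_lt_zero _)⟩ ?_
    · rw [show τ ((IntExp.lit 1).eval τ) = _ from hEτ.c1] at hin
      obtain ⟨g1, g2, g3, -, g5, g6, g7⟩ := hin
      refine ⟨g1, g2, g3, fun b κ => ?_, fun i r κ hi => ?_⟩
      · have := g5 b κ
        rwa [if_pos κ.2] at this
      · rcases eq_or_ne i j with rfl | hne
        · exact g7 r κ κ.2
        · have : i.val ≠ j.val := fun h => hne (Fin.ext h)
          exact g6 i r κ (by omega)
    · intro x hx m'' ⟨g1, g2, g3, g4, g5, g6, g7⟩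
      replace hx : x < k := hEτ.c1 ▸ hx
      have hEυ : C.Env k B (Function.update τ 20 x) := hEτ.update (by norm_num) (by norm_num) x
      set υ := Function.update τ 20 x with hυ
      have hw₀ : ∀ b : Fin B, C.HoldsElt m'' 4 b x 0
          (C.payload (C.residual C.stage Y j.rev) ⟨x, hx⟩ b) := fun b => by
        have := g5 b ⟨x, hx⟩
        rwa [if_neg (lt_irrefl _), hj] at this
      obtain ⟨q1, q2, q3, q4⟩ := columnProg_sem hEυ (i := j) h19 (κ := x) rfl g1 g2 g3 g4 hw₀
      have f₂ : ∀ a, a ∉ columnProg.writes → columnProg.sem υ m'' a = m'' a :=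
        fun a ha => Stm.sem_of_notMem ha _ _
      set m₂ := columnProg.sem υ m''
      clear_value m₂
      have keep : ∀ (i : Fin s) (r : Fin (R i)) (κ : Fin k), ¬ (i = j ∧ κ.val = x) →
          C.HoldsElt m'' 5 i r κ (dec i κ i r) → C.HoldsElt m₂ 5 i r κ (dec i κ i r) := by
        intro i r κ hne h c
        rw [q3 i r κ fun h => hne ⟨Fin.ext h.1, h.2⟩]
        exact h c
      refine ⟨g1.congr (f₂ 1 (by decide)), fun i => (g2 i).congr (f₂ 6 (by decide)),
        fun b j l hl => (g3 b j l hl).congr (f₂ 9 (by decide)),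
        fun a l hl => (g4 a l hl).congr (f₂ 18 (by decide)), fun b κ => ?_,
        fun i r κ hi => keep i r κ (fun h => by have := h.1 ▸ hi; omega) (g6 i r κ hi),
        fun r κ hκ => ?_⟩
      · rcases eq_or_ne κ ⟨x, hx⟩ with rfl | hne
        · rw [if_pos (Nat.lt_succ_self _), hj, residual_stage_succ]
          exact q2 b
        · have hne' : κ.val ≠ x := fun h => hne (Fin.ext h)
          intro c
          rw [q4 b κ hne', g5 b κ c]
          have : κ.val < x + 1 ↔ κ.val < x := by omega
          simp only [this]
      · rcases eq_or_ne κ ⟨x, hx⟩ with rfl | hne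
        · exact q1 r
        · have hne' : κ.val ≠ x := fun h => hne (Fin.ext h)
          exact keep j r κ (fun h => hne' h.2) (g7 r κ (by omega))

/-- The targets are narrowed loop by loop until a single output entry is left. Each write makes one
entry correct and, positions being distinct, keeps all others correct. -/
theorem flattenProg_sem (hE : C.Env k B σ) {X : Info K R z k}
    (hX : ∀ i (r : Fin (R i)) (κ : Fin k) (c : Fin (∏ i, len R z i)),
      m 5 i r κ c = X i r (κ, finPiFinEquiv.symm c))
    (x : (Σ i, Fin (R i)) × Payload (len R z) k) :
    flattenProg.sem σ m 2 0 0 0 (outputPos R z k x) = X x.1.1 x.1.2 x.2 := by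
  set good : (Σ i, Fin (R i)) × Payload (len R z) k → Mem K → Prop := fun x m' =>
    m' 2 0 0 0 (outputPos R z k x) = X x.1.1 x.1.2 x.2 with hgood
  have key : flattenProg.Collects σ (fun m' => m' 5 = m 5) good fun _ => True := by
    rw [flattenProg]
    refine (Stm.Collects.loop (T := fun t x => x.1.1.val = t) fun t ht => ?_).mono
      fun x _ => ⟨x.1.1, x.1.1.2.trans_eq hE.c0.symm, rfl⟩
    replace ht : t < s := hE.c0 ▸ ht
    have hE₁ := hE.update (r := 16) (by norm_num) (by norm_num) t
    set τ₁ := Function.update σ 16 t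
    have e₁ : τ₁ ((IntExp.add (.lit 32) (ctr 16)).eval τ₁) = R ⟨t, ht⟩ := hE₁.rate ⟨t, ht⟩
    refine (Stm.Collects.loop (T := fun r x => x.1.1.val = t ∧ x.1.2.val = r)
      fun r hr => ?_).mono fun x hx => ⟨x.1.2, ?_, hx, rfl⟩
    · rw [e₁] at hr
      have hE₂ := hE₁.update (r := 17) (by norm_num) (by norm_num) r
      set τ₂ := Function.update τ₁ 17 r
      refine (Stm.Collects.loop (T := fun κ x =>
        (x.1.1.val = t ∧ x.1.2.val = r) ∧ x.2.1.val = κ) fun κ hκ => ?_).mono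
        fun x hx => ⟨x.2.1, x.2.1.2.trans_eq hE₂.c1.symm, hx, rfl⟩
      replace hκ : κ < k := hE₂.c1 ▸ hκ
      have hE₃ := hE₂.update (r := 18) (by norm_num) (by norm_num) κ
      set τ₃ := Function.update τ₂ 18 κ
      refine (Stm.Collects.loop (T := fun c x =>
        ((x.1.1.val = t ∧ x.1.2.val = r) ∧ x.2.1.val = κ) ∧ (finPiFinEquiv x.2.2).val = c)
        fun c hc => ?_).mono fun x hx => ⟨finPiFinEquiv x.2.2,
          (finPiFinEquiv x.2.2).2.trans_eq hE₃.c5.symm, hx, rfl⟩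
      replace hc : c < ∏ i, len R z i := hE₃.c5 ▸ hc
      have hE₄ := hE₃.update (r := 19) (by norm_num) (by norm_num) c
      set y : (Σ i, Fin (R i)) × Payload (len R z) k :=
        (⟨⟨t, ht⟩, ⟨r, hr⟩⟩, (⟨κ, hκ⟩, finPiFinEquiv.symm ⟨c, hc⟩)) with hy
      have hpos : outputE.eval (Function.update τ₃ 19 c) = outputPos R z k y := by
        set τ₄ := Function.update τ₃ 19 c with hτ₄
        have e16 : τ₄ 16 = t := rfl
        have e17 : τ₄ 17 = r := rfl
        have e18 : τ₄ 18 = κ := rfl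
        have e19 : τ₄ 19 = c := rfl
        have hpre := hE₄.pre ⟨t, ht⟩
        have hsum := prefixSum_len R z ht.le
        simp only at hpre
        simp only [IntExp.eval]
        rw [hE₄.c0, hE₄.c1, hE₄.c2, hE₄.c5, e16, e17, e18, e19, hpre, hsum, Nat.add_sub_cancel,
          outputPos, payloadEquiv_val, finSigmaFinEquiv_val, Equiv.apply_symm_apply]
      intro m' hm'
      have hval : (Stm.asg 2 (.lit 0) (.lit 0) (.lit 0) outputE []
          (.rd 5 (ctr 16) (ctr 17) (ctr 18) (ctr 19))).sem (Function.update τ₃ 19 c) m' =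
          m'.set 2 0 0 0 (outputPos R z k y) (X y.1.1 y.1.2 y.2) := by
        rw [← hpos]
        refine congrArg (m'.set 2 0 0 0 _) ?_
        refine Eq.trans ?_ (hX ⟨t, ht⟩ ⟨r, hr⟩ ⟨κ, hκ⟩ ⟨c, hc⟩)
        rw [← hm']
        rfl
      have hwrite : ∀ x, (m'.set 2 0 0 0 (outputPos R z k y) (X y.1.1 y.1.2 y.2)) 2 0 0 0
          (outputPos R z k x) = if x = y then X y.1.1 y.1.2 y.2 else
            m' 2 0 0 0 (outputPos R z k x) := fun x => by
        simp only [Mem.set, true_and, (outputPos_injective R z k).eq_iff]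
      rw [hval]
      refine ⟨hm', fun x hx => ?_, fun x hx => ?_⟩
      · simp only [hgood] at hx ⊢
        rw [hwrite]
        split_ifs with h
        · rw [h]
        · exact hx
      · have : x = y := by
          obtain ⟨⟨j, l⟩, ⟨a, d⟩⟩ := x
          obtain ⟨⟨⟨h1, h2⟩, h3⟩, h4⟩ := hx
          obtain rfl : j = ⟨t, ht⟩ := Fin.ext h1
          obtain rfl : l = ⟨r, hr⟩ := Fin.ext h2
          obtain rfl : a = ⟨κ, hκ⟩ := Fin.ext h3
          have : finPiFinEquiv d = ⟨c, hc⟩ := Fin.ext h4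
          rw [hy, ← this, Equiv.symm_apply_apply]
        simp only [hgood]
        rw [hwrite, if_pos this, this]
    · rw [e₁]
      obtain ⟨⟨j, l⟩, p⟩ := x
      obtain rfl : j = ⟨t, ht⟩ := Fin.ext hx
      exact l.2
  exact (key m rfl).2.2 x trivial

theorem mainProg_sem (hE : C.Env k B σ) (hbits : HoldsBits K s σ)
    {Y : Matrix (Fin B) (Position (len R z) k) K} (hY : C.HoldsInput Y m)
    (x : (Σ i, Fin (R i)) × Payload (len R z) k) :
    mainProg.sem σ m 2 0 0 0 (outputPos R z k x) =
      C.successive C.stage Y x.1.1 x.1.2 x.2 := by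
  rw [mainProg, Stm.sem, Stm.sem, Stm.sem, Stm.sem, Stm.sem]
  have h₁ := baseFrobProg_sem hE.c5 hE.c0 hbits hY.struct
  set m₁ := baseFrobProg.sem σ m with hm₁
  have hY₁ : C.HoldsInput Y m₁ := hY.congr (Stm.sem_of_notMem (by decide) _ _)
  clear_value m₁
  have h₂ : C.HoldsMaps (towerFrobProg.sem σ m₁) :=
    towerFrobProg_sem hE.c5 hE.c0 hE.num h₁
  set m₂ := towerFrobProg.sem σ m₁ with hm₂
  have hY₂ : C.HoldsInput Y m₂ := hY₁.congr (Stm.sem_of_notMem (by decide) _ _)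
  clear_value m₂
  have h₃ := fun b j l (hl : l < len R z j) => pointPowersProg_sem hE hY₂ h₂ b j hl
  set m₃ := pointPowersProg.sem σ m₂ with hm₃
  have hY₃ : C.HoldsInput Y m₃ := hY₂.congr (Stm.sem_of_notMem (by decide) _ _)
  have hF₃ : C.HoldsMaps m₃ := fun i => (h₂ i).congr (Stm.sem_of_notMem (by decide) _ _)
  clear_value m₃
  have h₄ := payloadProg_sem hE hY₃
  set m₄ := payloadProg.sem σ m₃ with hm₄
  have hY₄ : C.HoldsInput Y m₄ := hY₃.congr (Stm.sem_of_notMem (by decide) _ _)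
  have hF₄ : C.HoldsMaps m₄ := fun i => (hF₃ i).congr (Stm.sem_of_notMem (by decide) _ _)
  have h9₄ : m₄ 9 = m₃ 9 := Stm.sem_of_notMem (by decide) _ _
  clear_value m₄
  refine flattenProg_sem hE (fun i r κ c => ?_) x
  rw [stage_residual, Equiv.apply_symm_apply]
  exact decodeProg_sem hE hY₄.struct hF₄ (fun b j l hl => (h₃ b j l hl).congr h9₄) h₄ i r κ c

end TowerCode

end NetCode
end

noncomputable section
open scoped Classical
namespace NetCode

/-! ### The preparation of the parameters -/

section Hoare

variable {K : Type*} [Field K]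

theorem Prog.loop_within {Q T : ℕ} {P : Prog} {r : ℕ} {e : IntExp} (S : Store K)
    (I : ℕ → Store K → Prop) (h0 : I 0 S) (hT : e.eval S.int ≤ T)
    (hs : ∀ t < e.eval S.int, ∀ S' : Store K, I t S' →
      P.Within Q T ⟨Function.update S'.int r t, S'.fld⟩ ∧
        I (t + 1) (P.run ⟨Function.update S'.int r t, S'.fld⟩).1) :
    (loop r e P).Within Q T S ∧ I (e.eval S.int) ((loop r e P).run S).1 := by
  have key : ∀ n ≤ e.eval S.int, I n ((loop r (.lit n) P).run S).1 := by
    intro n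
    induction n with
    | zero => exact fun _ => h0
    | succ n ih =>
      intro hn
      rw [run_loop_succ]
      exact (hs n hn _ (ih (by omega))).2
  refine ⟨⟨hT, fun n hn => (hs n hn _ (key n hn.le)).1⟩, ?_⟩
  rw [run_loop_eq]
  exact key _ le_rfl

theorem Prog.Within.mono {Q Q' T : ℕ} (hQ : Q ≤ Q') (P : Prog) :
    ∀ {S : Store K}, P.Within Q T S → P.Within Q' T S := by
  induction P with
  | skip => exact fun _ => trivial
  | setInt _ _ => exact fun h => le_trans h hQ
  | setFld _ _ => exact fun _ => trivial
  | seq P P' ih ih' => exact fun h => ⟨ih h.1, ih' h.2⟩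
  | ifLt a b P P' ih ih' =>
    intro S h
    simp only [Within] at h ⊢
    split_ifs at h ⊢
    exacts [ih h, ih' h]
  | ifZero x P P' ih ih' =>
    intro S h
    simp only [Within] at h ⊢
    split_ifs at h ⊢
    exacts [ih h, ih' h]
  | loop r e P ih => exact fun h => ⟨h.1, fun i hi => ih (h.2 i hi)⟩

/-- Write values to several integer cells. -/
def setCells : List (ℕ × IntExp) → Prog
  | [] => .skip
  | (c, e) :: ls => .seq (.setInt (.lit c) e) (setCells ls)

/-- None of the expressions reads a cell that is assigned, so consecutive assignments act as a
simultaneous one, evaluated in `σ`. -/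
theorem setCells_run {D : List ℕ} {σ : ℕ → ℕ} {Q T : ℕ} {ls : List (ℕ × IntExp)} :
    ∀ {S : Store K}, (∀ r ∈ D, r < 32) → (∀ x ∈ ls, x.1 ∈ D) → (ls.map Prod.fst).Nodup →
      (∀ x ∈ ls, x.2.avoids D = true) → (∀ x ∈ ls, x.2.eval σ ≤ Q) → AgreeOff D S.int σ →
      (setCells ls).Within Q T S ∧ ((setCells ls).run S).1.fld = S.fld ∧
      (∀ x ∈ ls, ((setCells ls).run S).1.int x.1 = x.2.eval σ) ∧
      ∀ a, a ∉ ls.map Prod.fst → ((setCells ls).run S).1.int a = S.int a := by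
  induction ls with
  | nil => exact fun _ _ _ _ _ _ =>
      ⟨trivial, rfl, fun x hx => absurd hx (List.not_mem_nil), fun _ _ => rfl⟩
  | cons y ls ih =>
    intro S hD' hD hn hav hQ hag
    obtain ⟨c, e⟩ := y
    rw [List.map_cons, List.nodup_cons] at hn
    have he : e.eval S.int = e.eval σ :=
      IntExp.eval_congr hD' (hav _ (List.mem_cons_self)) hag
    have hc : c ∈ D := hD _ (List.mem_cons_self)
    obtain ⟨h1, h2, h3, h4⟩ := ih (S := ⟨Function.update S.int c (e.eval S.int), S.fld⟩) hD'
      (fun x hx => hD x (List.mem_cons_of_mem _ hx)) hn.2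
      (fun x hx => hav x (List.mem_cons_of_mem _ hx))
      (fun x hx => hQ x (List.mem_cons_of_mem _ hx))
      (fun a ha => by
        refine (Function.update_of_ne ?_ _ _).trans (hag a ha)
        rintro rfl
        exact ha hc)
    refine ⟨⟨?_, h1⟩, h2, fun x hx => ?_, fun a ha => ?_⟩
    · exact he.trans_le (hQ _ (List.mem_cons_self))
    · rcases List.mem_cons.1 hx with rfl | hx
      · refine (h4 c hn.1).trans ?_
        rw [← he]
        exact Function.update_self _ _ _
      · exact h3 x hx
    · rw [List.map_cons, List.mem_cons, not_or] at ha
      refine (h4 a ha.2).trans ?_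
      exact Function.update_of_ne ha.1 _ _

end Hoare

/-- Write the binary digits of the size of the base field, and clear the cell that held it. -/
def bitsProg : Prog :=
  .seq (.setInt (.lit 9) (.log2 (ctr 3))) (.loop 16 (.add (ctr 9) (.lit 1))
    (.seq (.setInt (bitAddr (ctr 16)) (.sub (ctr 3) (.mul (.div (ctr 3) (.lit 2)) (.lit 2))))
      (.setInt (.lit 3) (.div (ctr 3) (.lit 2)))))

/-- The number of packets of source `ctr 16`. -/
abbrev packetsE : IntExp := .add (rateE (ctr 16)) (.mul (.lit 2) (ctr 2))

/-- Write the numbers of packets, their prefix sums, their sum and their product. -/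
def shapeProg : Prog :=
  .seq (.setInt (.lit 5) (.lit 1)) (.seq (.setInt (.lit 6) (.lit 0)) (.loop 16 (ctr 0)
    (.seq (.setInt (lenAddr (ctr 16)) packetsE) (.seq (.setInt (preAddr (ctr 16)) (ctr 6))
      (.seq (.setInt (.lit 6) (.add (ctr 6) packetsE))
        (.setInt (.lit 5) (.mul (ctr 5) packetsE)))))))

/-- The cells for parameters and the expressions for their values. -/
def paramList : List (ℕ × IntExp) :=
  [(7, .add (ctr 6) (.lit 1)),
   (8, .add (.add (.add (.mul (.mul (ctr 5) (ctr 5)) (ctr 5)) (.mul (.lit 2) (.mul (ctr 6)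
       (ctr 5))))
      (.mul (ctr 4) (.add (ctr 6) (.mul (ctr 1) (ctr 5)))))
      (.mul (ctr 6) (.mul (ctr 1) (ctr 5)))),
   (10, .mul (.mul (.add (ctr 0) (.lit 1)) (.add (ctr 6) (.lit 1))) (ctr 5)),
   (11, .mul (.mul (ctr 0) (.add (ctr 6) (.lit 1))) (ctr 5)),
   (12, .mul (.add (ctr 2) (.lit 1)) (ctr 5)),
   (13, .lit 1),
   (14, .add (ctr 2) (.lit 1)),
   (15, .add (ctr 6) (.mul (ctr 1) (ctr 5)))]

/-- The product of the first `t` values. -/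
def prefixProd {s : ℕ} (f : Fin s → ℕ) (t : ℕ) : ℕ :=
  ∏ l ∈ Finset.range t, if h : l < s then f ⟨l, h⟩ else 1

theorem prefixProd_succ {s : ℕ} (f : Fin s → ℕ) (i : Fin s) :
    prefixProd f (i + 1) = prefixProd f i * f i := by
  rw [prefixProd, Finset.prod_range_succ, dif_pos i.2, prefixProd]

theorem prefixProd_top {s : ℕ} (f : Fin s → ℕ) : prefixProd f s = ∏ i, f i := by
  rw [prefixProd, Finset.prod_range]
  exact Finset.prod_congr rfl fun i _ => by rw [dif_pos i.2]

/-- All factors are at least one, so partial products never exceed the final one. Without this the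
intermediate values of the product cell would not be controlled. -/
theorem prefixProd_le {s : ℕ} {f : Fin s → ℕ} (hf : ∀ i, 1 ≤ f i) {t : ℕ} (ht : t ≤ s) :
    prefixProd f t ≤ ∏ i, f i := by
  rw [← prefixProd_top]
  refine Finset.prod_le_prod_of_subset_of_one_le' (Finset.range_subset_range.2 ht)
    fun l _ _ => ?_
  split_ifs
  exacts [hf _, le_rfl]

theorem prefixSum_le {s : ℕ} (f : Fin s → ℕ) {t : ℕ} (ht : t ≤ s) :
    prefixSum f t ≤ ∑ i, f i := by
  rw [← prefixSum_top]
  exact Finset.sum_le_sum_of_subset (Finset.range_subset_range.2 ht)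

/-- The size `|K|` is the only input that is not polynomially bounded in the parameters. Its digits
are extracted and its cell is halved down to zero. Afterwards all cells are at most `T`; the larger
bound `Q` is needed only during this phase. -/
theorem bitsProg_run {K : Type*} [Field K] [Fintype K] {S : Store K} {s Q T : ℕ}
    (h0 : S.int 0 = s) (h3 : S.int 3 = Fintype.card K) (hp : Fintype.card K ≤ Q) (hTQ : T ≤ Q)
    (hT : ∀ a, a ≠ 3 → S.int a ≤ T) (hlog : Nat.log 2 (Fintype.card K) + 1 ≤ T) :
    bitsProg.Within Q T S ∧ (bitsProg.run S).1.fld = S.fld ∧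
      TowerCode.HoldsBits K s (bitsProg.run S).1.int ∧ (∀ a, (bitsProg.run S).1.int a ≤ T) ∧
      ∀ a, a ≠ 3 → a ≠ 9 → a ≠ 16 → a < 32 + 3 * s → (bitsProg.run S).1.int a = S.int a := by
  set p := Fintype.card K with hpdef
  set S₁ : Store K := ⟨Function.update S.int 9 (Nat.log 2 p), S.fld⟩ with hS₁
  have hrun : ((Prog.setInt (.lit 9) (.log2 (ctr 3))).run S).1 = S₁ := by
    simp only [Prog.run, IntExp.eval, h3]
    rfl
  have h9 : (IntExp.add (ctr 9) (.lit 1)).eval S₁.int = Nat.log 2 p + 1 := rfl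
  have hmain := Prog.loop_within (Q := Q) (T := T) (r := 16) (e := .add (ctr 9) (.lit 1))
    (P := .seq (.setInt (bitAddr (ctr 16)) (.sub (ctr 3) (.mul (.div (ctr 3) (.lit 2)) (.lit 2))))
      (.setInt (.lit 3) (.div (ctr 3) (.lit 2)))) S₁
    (fun t S' => S'.fld = S.fld ∧ S'.int 3 = p / 2 ^ t ∧ S'.int 9 = Nat.log 2 p ∧
      (∀ j < t, S'.int (32 + (s + (s + (s + j)))) = p / 2 ^ j % 2) ∧ (∀ a, a ≠ 3 → S'.int a ≤ T) ∧
      ∀ a, a ≠ 3 → a ≠ 9 → a ≠ 16 → a < 32 + 3 * s → S'.int a = S.int a) ?_ ?_ ?_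
  · obtain ⟨hw, h1, h2, h4, h5, h6, h7⟩ := hmain
    rw [h9] at h2 h5
    have hrun' : (bitsProg.run S).1 = ((Prog.loop 16 (.add (ctr 9) (.lit 1))
      (.seq (.setInt (bitAddr (ctr 16)) (.sub (ctr 3) (.mul (.div (ctr 3) (.lit 2)) (.lit 2))))
      (.setInt (.lit 3) (.div (ctr 3) (.lit 2))))).run S₁).1 := by
      rw [← hrun]
      rfl
    rw [hrun']
    refine ⟨⟨?_, ?_⟩, h1, ⟨h4, fun j hj => h5 j (Nat.lt_succ_of_le hj)⟩, fun a => ?_, h7⟩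
    · simp only [Prog.Within, IntExp.eval, h3]
      omega
    · rw [hrun]
      exact hw
    · rcases eq_or_ne a 3 with rfl | ha
      -- One round more than the logarithm empties the cell.
      · rw [h2, Nat.div_eq_of_lt (Nat.lt_pow_succ_log_self (by norm_num) _)]
        exact Nat.zero_le _
      · exact h6 a ha
  · refine ⟨rfl, ?_, rfl, fun j hj => absurd hj (Nat.not_lt_zero _), fun a ha => ?_,
      fun a _ h9 _ _ => Function.update_of_ne h9 _ _⟩
    · rw [pow_zero, Nat.div_one]
      exact h3
    · simp only [hS₁, Function.update_apply]
      split_ifs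
      · omega
      · exact hT a ha
  · rw [h9]; exact hlog
  · intro t ht S' ⟨g1, g2, g3, g4, g5, g6⟩
    have e0 : S'.int 0 = s := (g6 0 (by norm_num) (by norm_num) (by norm_num) (by omega)).trans h0
    have hd : (p / 2 ^ t - p / 2 ^ t / 2 * 2) = p / 2 ^ t % 2 := by omega
    have hd2 : p / 2 ^ t / 2 = p / 2 ^ (t + 1) := by rw [Nat.div_div_eq_div_mul, pow_succ]
    have hle : p / 2 ^ t / 2 ≤ p := (Nat.div_le_self _ _).trans (Nat.div_le_self _ _)
    have hr : (Prog.run (.seq (.setInt (bitAddr (ctr 16))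
        (.sub (ctr 3) (.mul (.div (ctr 3) (.lit 2)) (.lit 2))))
        (.setInt (.lit 3) (.div (ctr 3) (.lit 2)))) ⟨Function.update S'.int 16 t, S'.fld⟩).1 =
        ⟨Function.update (Function.update (Function.update S'.int 16 t)
          (32 + (s + (s + (s + t)))) (p / 2 ^ t % 2)) 3 (p / 2 ^ (t + 1)), S'.fld⟩ := by
      have f0 : Function.update S'.int 16 t 0 = s := e0
      have f3 : Function.update S'.int 16 t 3 = p / 2 ^ t := g2
      have f16 : Function.update S'.int 16 t 16 = t := rfl
      simp only [Prog.run, IntExp.eval, f0, f3, f16, hd]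
      rw [Function.update_of_ne (by omega), f3, hd2]
    rw [hr]
    have f3 : Function.update S'.int 16 t 3 = p / 2 ^ t := g2
    have f0 : Function.update S'.int 16 t 0 = s := e0
    have f16 : Function.update S'.int 16 t 16 = t := rfl
    have hT1 : 1 ≤ T := by omega
    refine ⟨⟨?_, ?_⟩, g1, rfl, ?_, fun j hj => ?_, fun a ha => ?_, fun a h3 h9 h16 hlt => ?_⟩
    · simp only [Prog.Within, IntExp.eval, f3, hd]
      omega
    · simp only [Prog.Within, Prog.run, IntExp.eval, f3, f0, f16]
      rw [Function.update_of_ne (by omega), f3]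
      omega
    · simp only
      rw [Function.update_of_ne (by omega), Function.update_of_ne (by omega)]
      exact g3
    · simp only
      rw [Function.update_of_ne (by omega)]
      rcases Nat.lt_succ_iff_lt_or_eq.1 hj with hj | rfl
      · rw [Function.update_of_ne (by omega), Function.update_of_ne (by omega)]
        exact g4 j hj
      · rw [Function.update_self]
    · simp only [Function.update_apply, if_neg ha]
      rw [h9] at ht
      split_ifs
      · omega
      · omega
      · exact g5 a ha
    · simp only
      rw [Function.update_of_ne h3, Function.update_of_ne (by omega), Function.update_of_ne h16]
      exact g6 a h3 h9 h16 hlt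

/-- The tables of packet numbers and prefix sums fill the cells from `32 + s` to just below `32 + 3
* s`, between the rates and the binary digits, so neither neighbour is affected. -/
theorem shapeProg_run {K : Type*} [Field K] {S : Store K} {s : ℕ} {R : Fin s → ℕ} {z T : ℕ}
    (hpos : ∀ i, 1 ≤ len R z i)
    (h0 : S.int 0 = s) (h2 : S.int 2 = z) (hR : ∀ j : Fin s, S.int (32 + j) = R j)
    (hT : ∀ a, S.int a ≤ T) (hN : ∏ i, len R z i ≤ T) (hH : ∑ i, len R z i ≤ T) (h1T : 1 ≤ T) :
    shapeProg.Within T T S ∧ (shapeProg.run S).1.fld = S.fld ∧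
      (shapeProg.run S).1.int 5 = ∏ i, len R z i ∧ (shapeProg.run S).1.int 6 = ∑ i, len R z i ∧
      (∀ j : Fin s, (shapeProg.run S).1.int (32 + (s + j)) = len R z j) ∧
      (∀ j : Fin s, (shapeProg.run S).1.int (32 + (s + (s + j))) = prefixSum (len R z) j) ∧
      ∀ a, a ≠ 5 → a ≠ 6 → a ≠ 16 → (a < 32 + s ∨ 32 + 2 * s + s ≤ a) →
        (shapeProg.run S).1.int a = S.int a := by
  set body : Prog := .seq (.setInt (lenAddr (ctr 16)) packetsE)
    (.seq (.setInt (preAddr (ctr 16)) (ctr 6)) (.seq (.setInt (.lit 6) (.add (ctr 6) packetsE))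
        (.setInt (.lit 5) (.mul (ctr 5) packetsE)))) with hbody
  set S₁ : Store K := ⟨Function.update (Function.update S.int 5 1) 6 0, S.fld⟩ with hS₁
  have hrun : (shapeProg.run S).1 = ((Prog.loop 16 (ctr 0) body).run S₁).1 := rfl
  have e0 : (ctr 0).eval S₁.int = s := h0
  have hlenH : ∀ j : Fin s, len R z j ≤ T := fun j =>
    (Finset.single_le_sum (f := len R z) (fun _ _ => Nat.zero_le _) (Finset.mem_univ j)).trans hH
  have hmain := Prog.loop_within (Q := T) (T := T) (r := 16) (e := ctr 0) (P := body) S₁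
    (fun t S' => S'.fld = S.fld ∧ S'.int 5 = prefixProd (len R z) t ∧
      S'.int 6 = prefixSum (len R z) t ∧
      (∀ j : Fin s, j.val < t → S'.int (32 + (s + j)) = len R z j) ∧
      (∀ j : Fin s, j.val < t → S'.int (32 + (s + (s + j))) = prefixSum (len R z) j) ∧
      ∀ a, a ≠ 5 → a ≠ 6 → a ≠ 16 → (a < 32 + s ∨ 32 + 2 * s + s ≤ a) → S'.int a = S.int a)
    ?_ (by rw [e0, ← h0]; exact hT 0) ?_
  · obtain ⟨hw, g1, g2, g3, g4, g5, g6⟩ := hmain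
    rw [e0] at g2 g3 g4 g5
    rw [hrun]
    exact ⟨⟨h1T, Nat.zero_le _, hw⟩, g1, by rw [g2, prefixProd_top], by rw [g3, prefixSum_top],
      fun j => g4 j j.2, fun j => g5 j j.2, g6⟩
  · exact ⟨rfl, rfl, rfl, fun j hj => absurd hj (Nat.not_lt_zero _),
      fun j hj => absurd hj (Nat.not_lt_zero _), fun a h5 h6 _ _ => by
        simp only [hS₁]
        rw [Function.update_of_ne h6, Function.update_of_ne h5]⟩
  · intro t ht S' ⟨g1, g2, g3, g4, g5, g6⟩
    rw [e0] at ht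
    have k0 : S'.int 0 = s :=
      (g6 0 (by norm_num) (by norm_num) (by norm_num) (by omega)).trans h0
    have k2 : S'.int 2 = z :=
      (g6 2 (by norm_num) (by norm_num) (by norm_num) (by omega)).trans h2
    have kR : S'.int (32 + t) = R ⟨t, ht⟩ :=
      (g6 _ (by omega) (by omega) (by omega) (by omega)).trans (hR ⟨t, ht⟩)
    set n := len R z ⟨t, ht⟩ with hn
    have hn' : R ⟨t, ht⟩ + 2 * z = n := rfl
    have hs1 := prefixSum_succ (len R z) ⟨t, ht⟩
    have hp1 := prefixProd_succ (len R z) ⟨t, ht⟩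
    simp only at hs1 hp1
    set τ := Function.update S'.int 16 t with hτ
    have t0 : τ 0 = s := k0
    have t2 : τ 2 = z := k2
    have t5 : τ 5 = prefixProd (len R z) t := g2
    have t6 : τ 6 = prefixSum (len R z) t := g3
    have t16 : τ 16 = t := rfl
    have tR : τ (32 + t) = R ⟨t, ht⟩ := by rw [hτ, Function.update_of_ne (by omega), kR]
    set τ₁ := Function.update τ (32 + (s + t)) n with hτ₁
    set τ₂ := Function.update τ₁ (32 + (s + (s + t))) (prefixSum (len R z) t) with hτ₂
    set τ₃ := Function.update τ₂ 6 (prefixSum (len R z) (t + 1)) with hτ₃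
    set τ₄ := Function.update τ₃ 5 (prefixProd (len R z) (t + 1)) with hτ₄
    have u₁ : ∀ a, a < 32 + s → τ₁ a = τ a := fun a ha => Function.update_of_ne (by omega) _ _
    have u₂ : ∀ a, a < 32 + s → τ₂ a = τ a := fun a ha =>
      (Function.update_of_ne (by omega) _ _).trans (u₁ a ha)
    have u₃ : ∀ a, a ≠ 6 → a < 32 + s → τ₃ a = τ a := fun a h6 ha =>
      (Function.update_of_ne h6 _ _).trans (u₂ a ha)
    have v₀ : packetsE.eval τ = n := by
      simp only [IntExp.eval]
      rw [t16, tR, t2]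
    have v₂ : packetsE.eval τ₂ = n := by
      simp only [IntExp.eval]
      rw [u₂ 16 (by omega), u₂ 2 (by omega), t16, u₂ _ (by omega), tR, t2]
    have v₃ : packetsE.eval τ₃ = n := by
      simp only [IntExp.eval]
      rw [u₃ 16 (by norm_num) (by omega), u₃ 2 (by norm_num) (by omega), t16,
        u₃ _ (by omega) (by omega), tR, t2]
    have r₁ : ((Prog.setInt (lenAddr (ctr 16)) packetsE).run (⟨τ, S'.fld⟩ : Store K)).1 =
        ⟨τ₁, S'.fld⟩ := by
      simp only [Prog.run]
      rw [v₀]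
      simp only [IntExp.eval]
      rw [t0, t16]
    have r₂ : ((Prog.setInt (preAddr (ctr 16)) (ctr 6)).run (⟨τ₁, S'.fld⟩ : Store K)).1 =
        ⟨τ₂, S'.fld⟩ := by
      simp only [Prog.run, IntExp.eval]
      rw [u₁ 0 (by omega), u₁ 16 (by omega), u₁ 6 (by omega), t0, t16, t6]
    have w₆ : (IntExp.add (ctr 6) packetsE).eval τ₂ = prefixSum (len R z) (t + 1) := by
      rw [hs1, ← t6, ← hn, ← v₂, ← u₂ 6 (by omega)]
      rfl
    have w₅ : (IntExp.mul (ctr 5) packetsE).eval τ₃ = prefixProd (len R z) (t + 1) := by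
      rw [hp1, ← t5, ← hn, ← v₃, ← u₃ 5 (by norm_num) (by omega)]
      rfl
    have r₃ : ((Prog.setInt (.lit 6) (.add (ctr 6) packetsE)).run (⟨τ₂, S'.fld⟩ : Store K)).1 =
        ⟨τ₃, S'.fld⟩ := by
      simp only [Prog.run]
      rw [w₆]
      rfl
    have r₄ : ((Prog.setInt (.lit 5) (.mul (ctr 5) packetsE)).run (⟨τ₃, S'.fld⟩ : Store K)).1 =
        ⟨τ₄, S'.fld⟩ := by
      simp only [Prog.run]
      rw [w₅]
      rfl
    have hfin : (body.run (⟨τ, S'.fld⟩ : Store K)).1 = ⟨τ₄, S'.fld⟩ := by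
      rw [← r₄, ← r₃, ← r₂, ← r₁]
      rfl
    rw [hfin]
    refine ⟨⟨?_, ?_⟩, g1, rfl, ?_, fun j hj => ?_, fun j hj => ?_,
      fun a h5 h6 h16 ha => ?_⟩
    · exact v₀.trans_le (hlenH ⟨t, ht⟩)
    · rw [r₁]
      refine ⟨?_, ?_⟩
      · refine le_trans (le_of_eq ?_) ((prefixSum_le (len R z) ht.le).trans hH)
        exact (u₁ 6 (by omega)).trans t6
      · rw [r₂]
        refine ⟨w₆.trans_le ((prefixSum_le (len R z) ht).trans hH), ?_⟩
        rw [r₃]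
        exact w₅.trans_le ((prefixProd_le hpos ht).trans hN)
    · rfl
    · simp only
      rw [hτ₄, Function.update_of_ne (by omega), hτ₃, Function.update_of_ne (by omega), hτ₂,
        Function.update_of_ne (by omega), hτ₁]
      rcases Nat.lt_succ_iff_lt_or_eq.1 hj with hj | hj
      · rw [Function.update_of_ne (by omega), hτ, Function.update_of_ne (by omega)]
        exact g4 j hj
      · obtain rfl : j = ⟨t, ht⟩ := Fin.ext hj
        rw [Function.update_self]
    · simp only
      rw [hτ₄, Function.update_of_ne (by omega), hτ₃, Function.update_of_ne (by omega), hτ₂]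
      rcases Nat.lt_succ_iff_lt_or_eq.1 hj with hj | hj
      · rw [Function.update_of_ne (by omega), hτ₁, Function.update_of_ne (by omega), hτ,
          Function.update_of_ne (by omega)]
        exact g5 j hj
      · obtain rfl : j = ⟨t, ht⟩ := Fin.ext hj
        rw [Function.update_self]
    · simp only
      rw [hτ₄, Function.update_of_ne h5, hτ₃, Function.update_of_ne h6, hτ₂,
        Function.update_of_ne (by omega), hτ₁, Function.update_of_ne (by omega), hτ,
        Function.update_of_ne h16]
      exact g6 a h5 h6 h16 ha

end NetCode
end

noncomputable section
open scoped Classical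
namespace NetCode

/-! ### Input and output -/

theorem getD_rowMajor {K : Type*} [Zero K] {a b : ℕ} (A : Fin a → Fin b → K) (x : Fin a)
    (y : Fin b) :
    (rowMajor A).getD (x * b + y) 0 = A x y := by
  have h := (finProdFinEquiv (x, y)).2
  rw [finProdFinEquiv_val] at h
  have hxy : (⟨x * b + y, h⟩ : Fin (a * b)) = finProdFinEquiv (x, y) :=
    Fin.ext (finProdFinEquiv_val x y).symm
  rw [rowMajor, List.getD_eq_getElem _ _ (by simpa using h), List.getElem_ofFn, hxy,
    Equiv.symm_apply_apply]

theorem length_rowMajor {K : Type*} {a b : ℕ} (A : Fin a → Fin b → K) :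
    (rowMajor A).length = a * b := List.length_ofFn

/-- Copy the input to array 1. -/
def loadProg : Prog :=
  .loop 16 (ctr 8) (.setFld (entryE 1 (.lit 0) (.lit 0) (.lit 0) (ctr 16)) (.cell (ctr 16)))

/-- Copy array 2 to the first field cells. -/
def storeProg : Prog :=
  .loop 16 (ctr 8) (.setFld (ctr 16) (.cell (entryE 2 (.lit 0) (.lit 0) (.lit 0) (ctr 16))))

/-- The decoder. -/
def decoder : Prog :=
  .ifLt (.lit 0) (ctr 0) (.seq bitsProg (.seq shapeProg (.seq (setCells paramList)
    (.seq loadProg (.seq mainProg.compile storeProg))))) .skip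

theorem Prog.run_ifLt_pos {K : Type*} [Field K] {a b : IntExp} {P Q : Prog} {S : Store K}
    (h : a.eval S.int < b.eval S.int) : ((ifLt a b P Q).run S).1 = (P.run S).1 := by
  simp only [Prog.run]
  rw [if_pos h]

theorem Prog.run_seq {K : Type*} [Field K] {P Q : Prog} {S : Store K} :
    ((seq P Q).run S).1 = (Q.run (P.run S).1).1 := rfl

theorem Prog.within_ifLt_pos {K : Type*} [Field K] {a b : IntExp} {P P' : Prog} {S : Store K}
    {Q T : ℕ} (h : a.eval S.int < b.eval S.int) (hP : P.Within Q T S) :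
    (ifLt a b P P').Within Q T S := by
  rw [Within, if_pos h]
  exact hP

section Copy

variable {K : Type*} [Field K] {S : Store K} {M : ℕ}

theorem entry_flat_injective {a q q' : ℕ} (h : entry a 0 0 0 q = entry a 0 0 0 q') : q = q' :=
  (entry_injective h).2.2.2.2

/-- Input cells lie below `M` and array cells from `M` on, so the copy never overwrites what it
still has to read. -/
theorem loadProg_run (h8 : S.int 8 = M) :
    AgreeOff [16] (loadProg.run S).1.int S.int ∧
      ∀ q < M, (loadProg.run S).1.fld (M + entry 1 0 0 0 q) = S.fld q := by
  have := Prog.run_loop_induct (r := 16) (e := ctr 8)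
    (P := .setFld (entryE 1 (.lit 0) (.lit 0) (.lit 0) (ctr 16)) (.cell (ctr 16))) S
    (fun t S' => AgreeOff [16] S'.int S.int ∧ (∀ q < M, S'.fld q = S.fld q) ∧
      ∀ q < t, S'.fld (M + entry 1 0 0 0 q) = S.fld q)
    ⟨fun _ _ => rfl, fun _ _ => rfl, fun q hq => absurd hq (Nat.not_lt_zero _)⟩ ?_
  · rw [show (ctr 8).eval S.int = M from h8] at this
    exact ⟨this.1, this.2.2⟩
  · intro t ht S' ⟨h1, h2, h3⟩
    replace ht : t < M := h8 ▸ ht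
    have e8 : S'.int 8 = M := (h1 8 (by decide)).trans h8
    have ha : (entryE 1 (.lit 0) (.lit 0) (.lit 0) (ctr 16)).eval (Function.update S'.int 16 t) =
        M + entry 1 0 0 0 t := by
      rw [entryE_eval, Function.update_of_ne (by norm_num), e8]
      rfl
    simp only [Prog.run]
    rw [ha]
    refine ⟨fun a ha' => ?_, fun q hq => ?_, fun q hq => ?_⟩
    · rw [Function.update_of_ne (by simpa using ha')]
      exact h1 a ha'
    · rw [Function.update_of_ne (by omega)]
      exact h2 q hq
    · rw [Function.update_apply]
      split_ifs with h
      · rw [entry_flat_injective (Nat.add_left_cancel h)]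
        exact h2 t ht
      · refine h3 q ?_
        have : q ≠ t := by rintro rfl; exact h rfl
        omega

theorem storeProg_run (h8 : S.int 8 = M) :
    ∀ q < M, (storeProg.run S).1.fld q = S.fld (M + entry 2 0 0 0 q) := by
  have := Prog.run_loop_induct (r := 16) (e := ctr 8)
    (P := .setFld (ctr 16) (.cell (entryE 2 (.lit 0) (.lit 0) (.lit 0) (ctr 16)))) S
    (fun t S' => AgreeOff [16] S'.int S.int ∧ (∀ q, M ≤ q → S'.fld q = S.fld q) ∧
      ∀ q < t, S'.fld q = S.fld (M + entry 2 0 0 0 q))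
    ⟨fun _ _ => rfl, fun _ _ => rfl, fun q hq => absurd hq (Nat.not_lt_zero _)⟩ ?_
  · rw [show (ctr 8).eval S.int = M from h8] at this
    exact this.2.2
  · intro t ht S' ⟨h1, h2, h3⟩
    replace ht : t < M := h8 ▸ ht
    have e8 : S'.int 8 = M := (h1 8 (by decide)).trans h8
    have ha : (entryE 2 (.lit 0) (.lit 0) (.lit 0) (ctr 16)).eval (Function.update S'.int 16 t) =
        M + entry 2 0 0 0 t := by
      rw [entryE_eval, Function.update_of_ne (by norm_num), e8]
      rfl
    have e16 : (ctr 16).eval (Function.update S'.int 16 t) = t := rfl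
    simp only [Prog.run, FldExp.eval]
    rw [ha, e16]
    refine ⟨fun a ha' => ?_, fun q hq => ?_, fun q hq => ?_⟩
    · rw [Function.update_of_ne (by simpa using ha')]
      exact h1 a ha'
    · rw [Function.update_of_ne (by omega)]
      exact h2 q hq
    · rw [Function.update_apply]
      split_ifs with h
      · rw [h, h2 _ (Nat.le_add_right _ _)]
      · exact h3 q (by omega)

end Copy

namespace TowerCode

variable {K L : Type*} [Field K] [Fintype K] [Field L] [Algebra K L] {s : ℕ}
  {R : Fin s → ℕ} {z : ℕ} (C : TowerCode K L (len R z)) [FiniteDimensional K L]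
  {k B : ℕ} (Y : Matrix (Fin B) (Position (len R z) k) K)

/-- The number of field cells that are copied. -/
def memSize (_C : TowerCode K L (len R z)) (k B : ℕ) : ℕ :=
  (∏ i, len R z i) * (∏ i, len R z i) * (∏ i, len R z i) +
    2 * ((∑ i, len R z i) * ∏ i, len R z i) +
    B * ((∑ i, len R z i) + k * ∏ i, len R z i) + (∑ i, len R z i) * (k * ∏ i, len R z i)

/-- The input is a concatenation of lists of known lengths, and each part is found by dropping the
preceding ones. The coordinates of the step bases are only skipped: the decoder works in the product
basis throughout. -/
theorem input_holds {m : Mem K} (hm : ∀ q < C.memSize k B, m 1 0 0 0 q = (C.input Y).fld q) :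
    C.HoldsInput Y m := by
  set N := ∏ i, len R z i with hN
  set H := ∑ i, len R z i with hH
  have hsize : N * N * N + 2 * (H * N) + B * (H + k * N) ≤ C.memSize k B := Nat.le_add_right _ _
  set l₁ := rowMajor (fun (ab : Fin (N * N)) (c : Fin N) =>
    C.coords (C.prodBasis (finProdFinEquiv.symm ab).1 * C.prodBasis (finProdFinEquiv.symm ab).2) c)
    with hl₁
  set l₂ := rowMajor (fun (h : Fin H) (c : Fin N) =>
    C.coords (C.α (finSigmaFinEquiv.symm h).1 (finSigmaFinEquiv.symm h).2) c) with hl₂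
  set l₃ := rowMajor (fun (h : Fin H) (c : Fin N) =>
    C.coords (C.g (finSigmaFinEquiv.symm h).1 (finSigmaFinEquiv.symm h).2) c) with hl₃
  set l₄ := rowMajor (fun b c => Y b ((positionEquiv (len R z) k).symm c)) with hl₄
  have len₁ : l₁.length = N * N * N := length_rowMajor _
  have len₂ : l₂.length = H * N := length_rowMajor _
  have len₃ : l₃.length = H * N := length_rowMajor _
  have hfld : ∀ q, (C.input Y).fld q = (l₁ ++ l₂ ++ l₃ ++ l₄).getD q 0 := fun _ => rfl
  have g₁ : ∀ q < N * N * N, (C.input Y).fld q = l₁.getD q 0 := fun q hq => by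
    rw [hfld, List.getD_append _ _ _ _ (by simp only [List.length_append]; omega),
      List.getD_append _ _ _ _ (by simp only [List.length_append]; omega),
      List.getD_append _ _ _ _ (by omega)]
  have g₃ : ∀ q < H * N, (C.input Y).fld (N * N * N + H * N + q) = l₃.getD q 0 := fun q hq => by
    rw [hfld, List.getD_append _ _ _ _ (by simp only [List.length_append]; omega),
      List.getD_append_right _ _ _ _ (by simp only [List.length_append]; omega)]
    congr 1
    simp only [List.length_append]
    omega
  have g₄ : ∀ q, (C.input Y).fld (N * N * N + H * N + H * N + q) = l₄.getD q 0 := fun q => by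
    rw [hfld, List.getD_append_right _ _ _ _ (by simp only [List.length_append]; omega)]
    congr 1
    simp only [List.length_append]
    omega
  have b₁ : ∀ {x A : ℕ}, x < A → ∀ {D y : ℕ}, y < D → x * D + y < A * D := by
    intro x A hx D y hy
    have := Nat.mul_le_mul_right D (Nat.succ_le_of_lt hx)
    rw [Nat.succ_mul] at this
    omega
  have hpre : ∀ (j : Fin s) (l : Fin (len R z j)), prefixSum (len R z) j + l =
      (finSigmaFinEquiv ⟨j, l⟩ : Fin (∑ i, len R z i)).val :=
    fun j l => (finSigmaFinEquiv_val _ _ _).symm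
  have hbody : ∀ (b : Fin B) (x : Position (len R z) k),
      m 1 0 0 0 (N * N * N + H * N + H * N + (b * (H + k * N) + positionEquiv (len R z) k x)) =
        Y b x := by
    intro b x
    have hlt : b * (H + k * N) + positionEquiv (len R z) k x < B * (H + k * N) :=
      b₁ b.2 (positionEquiv (len R z) k x).2
    rw [hm _ (by omega), g₄, hl₄, getD_rowMajor, Equiv.symm_apply_apply]
  constructor
  · intro x y c
    have hlt : (x * N + y) * N + c < N * N * N := by
      have := b₁ (finProdFinEquiv (x, y)).2 c.2
      rwa [finProdFinEquiv_val] at this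
    refine (hm ((x * N + y) * N + c) (by omega)).trans ?_
    rw [g₁ _ hlt, ← finProdFinEquiv_val x y, hl₁, getD_rowMajor,
      Equiv.symm_apply_apply]
  · intro j l c
    have hlt : (finSigmaFinEquiv ⟨j, l⟩ : Fin (∑ i, len R z i)).val * N + c < H * N :=
      b₁ (finSigmaFinEquiv ⟨j, l⟩ : Fin (∑ i, len R z i)).2 c.2
    rw [hpre]
    refine (hm (N * N * N + H * N + ((finSigmaFinEquiv ⟨j, l⟩ : Fin (∑ i, len R z i)).val * N + c))
      (by omega)).trans ?_
    rw [g₃ _ hlt, hl₃, getD_rowMajor, Equiv.symm_apply_apply]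
  · intro b j l
    rw [hpre, ← hbody b]
    rfl
  · intro b κ c
    rw [← hbody b]
    congr 2
    have : (positionEquiv (len R z) k (Sum.inr (κ, finPiFinEquiv.symm c))).val =
        H + (payloadEquiv (len R z) k (κ, finPiFinEquiv.symm c)).val := rfl
    rw [this, payloadEquiv_val, Equiv.apply_symm_apply]

theorem input_zero : (C.input Y).int 0 = s := rfl

theorem input_rate (j : Fin s) : (C.input Y).int (32 + j) = R j := by
  simp only [input]
  rw [List.getD_append_right _ _ _ _ (by simp)]
  simp

/-- Cell 3 is excluded because it holds the size of the base field. -/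
theorem input_le {T : ℕ} (hs : s ≤ T) (hk : k ≤ T) (hz : z ≤ T) (hB : B ≤ T) (hR : ∀ i, R i ≤ T)
    (a : ℕ) (ha : a ≠ 3) : (C.input Y).int a ≤ T := by
  rcases lt_or_ge a 32 with h | h
  · simp only [input]
    rw [List.getD_append _ _ _ _ (by simpa using h)]
    interval_cases a <;> first | assumption | exact absurd rfl ha | exact Nat.zero_le _
  · simp only [input]
    rw [List.getD_append_right _ _ _ _ (by simpa using h), List.getD_eq_getElem?_getD,
      List.getElem?_ofFn]
    split_ifs
    · exact hR _
    · exact Nat.zero_le _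

/-- The decoder stays within the bounds for the integers and for the rounds of the loops, and its
output is the result of successive decoding. -/
theorem decoder_run (hs : 0 < s) {A T : ℕ} (hp2 : 2 ≤ Fintype.card K)
    (hA : A = B + k + (∑ i, len R z i) + (Fintype.card K).size) (hT : T = 6 * A ^ (3 * s + 4)) :
    decoder.Within (Fintype.card K + T) T (C.input Y) ∧
      (∀ a, (C.input Y).int a ≤ Fintype.card K + T) ∧ ∀ x, (decoder.run (C.input Y)).1.fld
          (outputPos R z k x) =
        C.successive C.stage Y x.1.1 x.1.2 x.2 := by
  have hlen : ∀ i, 1 ≤ len R z i := fun i => C.len_pos i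
  set p := Fintype.card K with hp
  set N := ∏ i, len R z i with hN
  set H := ∑ i, len R z i with hH
  -- the bounds
  have hN1 : 1 ≤ N := C.prod_len_pos
  have hlenH : ∀ i, len R z i ≤ H := fun i =>
    Finset.single_le_sum (f := len R z) (fun _ _ => Nat.zero_le _) (Finset.mem_univ i)
  have hsH : s ≤ H := by
    calc s = ∑ _i : Fin s, 1 := by simp
      _ ≤ H := Finset.sum_le_sum fun i _ => hlen i
  have hzH : 2 * z ≤ H := (Nat.le_add_left _ _).trans (hlenH ⟨0, hs⟩)
  have hRH : ∀ i, R i ≤ H := fun i => (Nat.le_add_right _ _).trans (hlenH i)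
  have hsize : 2 ≤ p.size := by
    have := Nat.size_le_size hp2
    exact this
  have hA2 : 2 ≤ A := by omega
  have hHA : H + 2 ≤ A := by omega
  have hkA : k ≤ A := by omega
  have hBA : B ≤ A := by omega
  have hNA : N ≤ A ^ s := by
    calc N ≤ ∏ _i : Fin s, A := Finset.prod_le_prod' fun i _ => (hlenH i).trans (by omega)
      _ = A ^ s := by simp
  have hpow : ∀ e ≤ 3 * s + 4, A ^ e ≤ A ^ (3 * s + 4) := fun e he =>
    Nat.pow_le_pow_right (by omega) he
  have hAT : A ≤ A ^ (3 * s + 4) := by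
    have := hpow 1 (by omega)
    rwa [pow_one] at this
  have hNT : N ≤ A ^ (3 * s + 4) := hNA.trans (hpow _ (by omega))
  -- The cube of `N` is at most `A ^ (3 * s)`, and every other product needs an exponent of at most
  -- `s + 2`. The memory size is the largest parameter: its parts take 1, 2, 2 and 1 copies of the
  -- common power, whence the factor 6 in `T`.
  have m1 : N * N * N ≤ A ^ (3 * s + 4) := by
    calc N * N * N ≤ A ^ s * A ^ s * A ^ s := by gcongr
      _ = A ^ (3 * s) := by ring
      _ ≤ _ := hpow _ (by omega)
  have m2 : H * N ≤ A ^ (3 * s + 4) := by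
    calc H * N ≤ A * A ^ s := by gcongr; omega
      _ = A ^ (s + 1) := by ring
      _ ≤ _ := hpow _ (by omega)
  have m3 : B * (H + k * N) ≤ 2 * A ^ (3 * s + 4) := by
    calc B * (H + k * N) ≤ A * (A + A * A ^ s) := by gcongr; omega
      _ = A ^ 2 + A ^ (s + 2) := by ring
      _ ≤ A ^ (3 * s + 4) + A ^ (3 * s + 4) := Nat.add_le_add (hpow _ (by omega)) (hpow _
          (by omega))
      _ = _ := by ring
  have m4 : H * (k * N) ≤ A ^ (3 * s + 4) := by
    calc H * (k * N) ≤ A * (A * A ^ s) := by gcongr; omega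
      _ = A ^ (s + 2) := by ring
      _ ≤ _ := hpow _ (by omega)
  have m5 : (s + 1) * (H + 1) * N ≤ A ^ (3 * s + 4) := by
    calc (s + 1) * (H + 1) * N ≤ A * A * A ^ s := by gcongr <;> omega
      _ = A ^ (s + 2) := by ring
      _ ≤ _ := hpow _ (by omega)
  have m6 : (z + 1) * N ≤ A ^ (3 * s + 4) := by
    calc (z + 1) * N ≤ A * A ^ s := by gcongr; omega
      _ = A ^ (s + 1) := by ring
      _ ≤ _ := hpow _ (by omega)
  have m7 : s * (H + 1) * N ≤ A ^ (3 * s + 4) :=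
    le_trans (by gcongr; omega) m5
  have m8 : H + k * N ≤ 2 * A ^ (3 * s + 4) := by
    calc H + k * N ≤ A + A * A ^ s := by gcongr; omega
      _ = A ^ 1 + A ^ (s + 1) := by ring
      _ ≤ A ^ (3 * s + 4) + A ^ (3 * s + 4) := Nat.add_le_add (hpow _ (by omega)) (hpow _
          (by omega))
      _ = _ := by ring
  have hlog : Nat.log 2 p + 1 ≤ T := by
    have : Nat.log 2 p < p.size := Nat.lt_size.2 (Nat.pow_log_le_self 2 (by omega))
    omega
  set W := A ^ (3 * s + 4) with hW
  -- the digits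
  have t₀ := C.input_le Y (T := T) (by omega) (by omega) (by omega) (by omega)
    (fun i => by have := hRH i; omega)
  obtain ⟨w₁, f₁, b₁, t₁, k₁⟩ := bitsProg_run (S := C.input Y) (s := s) (Q := p + T) (T := T) rfl
    rfl (Nat.le_add_right _ _) (Nat.le_add_left _ _) t₀ hlog
  have hpos : (decoder.run (C.input Y)).1 = (Prog.run (.seq bitsProg (.seq shapeProg
      (.seq (setCells paramList) (.seq loadProg (.seq mainProg.compile storeProg)))))
      (C.input Y)).1 := Prog.run_ifLt_pos hs
  set S₁ := (bitsProg.run (C.input Y)).1 with hS₁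
  -- the shape
  obtain ⟨w₂, f₂, c5, c6, num, pre, k₂⟩ := shapeProg_run (S := S₁) (s := s) (R := R) (z := z)
    (T := T) hlen (k₁ 0 (by norm_num) (by norm_num) (by norm_num) (by omega))
    (k₁ 2 (by norm_num) (by norm_num) (by norm_num) (by omega))
    (fun j => (k₁ _ (by omega) (by omega) (by omega) (by omega)).trans (C.input_rate Y j)) t₁
    (by omega) (by omega) (by omega)
  have t₂ := w₂.int_le le_rfl _ t₁
  rw [← hN] at c5
  rw [← hH] at c6
  set S₂ := (shapeProg.run S₁).1 with hS₂
  have i₂ : ∀ a, a ∉ [3, 5, 6, 9, 16] → a < 32 + s → S₂.int a = (C.input Y).int a :=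
      fun a ha hlt => by
    simp only [List.mem_cons, List.not_mem_nil, or_false, not_or] at ha
    rw [k₂ a ha.2.1 ha.2.2.1 ha.2.2.2.2 (Or.inl hlt),
      k₁ a ha.1 ha.2.2.2.1 ha.2.2.2.2 (by omega)]
  have e0 : S₂.int 0 = s := i₂ 0 (by decide) (by omega)
  have e1 : S₂.int 1 = k := i₂ 1 (by decide) (by omega)
  have e2 : S₂.int 2 = z := i₂ 2 (by decide) (by omega)
  have e4 : S₂.int 4 = B := i₂ 4 (by decide) (by omega)
  -- the parameters
  obtain ⟨w₃, f₃, p₃, k₃⟩ := setCells_run (K := K) (S := S₂) (D := paramList.map Prod.fst)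
    (σ := S₂.int) (Q := T) (T := T) (ls := paramList) (by decide)
    (fun x hx => List.mem_map_of_mem hx) (by decide) (by decide) (by
      simp only [paramList, List.forall_mem_cons, IntExp.eval, e0, e1, e2, e4, c5, c6]
      refine ⟨?_, ?_, ?_, ?_, ?_, ?_, ?_, ?_, fun _ h => absurd h List.not_mem_nil⟩ <;> omega)
    (fun _ _ => rfl)
  have t₃ := w₃.int_le le_rfl _ t₂
  set S₃ := ((setCells paramList).run S₂).1 with hS₃
  simp only [paramList, List.forall_mem_cons, IntExp.eval, e0, e1, e2, e4, c5, c6] at p₃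
  obtain ⟨p7, p8, p10, p11, p12, p13, p14, p15, -⟩ := p₃
  have k₃' : ∀ a, 16 ≤ a → S₃.int a = S₂.int a := fun a ha => k₃ a fun h => by
    simp only [paramList, List.map_cons, List.map_nil, List.mem_cons, List.not_mem_nil,
      or_false] at h
    omega
  have hE : C.Env k B S₃.int := by
    constructor
    case rate =>
      intro j
      have hj := j.2
      rw [k₃' _ (by omega), i₂ _ (by
        simp only [List.mem_cons, List.not_mem_nil, or_false]; omega) (by omega),
        C.input_rate Y j]
    case num => exact fun j => (k₃' _ (by omega)).trans (num j)
    case pre => exact fun j => (k₃' _ (by omega)).trans (pre j)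
    exacts [(k₃ 0 (by decide)).trans e0, (k₃ 1 (by decide)).trans e1, (k₃ 2 (by decide)).trans e2,
      (k₃ 4 (by decide)).trans e4, (k₃ 5 (by decide)).trans c5, (k₃ 6 (by decide)).trans c6, p7,
      p10, p11, p12, p13, p14, p15]
  have hM : S₃.int 8 = C.memSize k B := p8
  have hbits : HoldsBits K s S₃.int := by
    refine ⟨?_, fun j hj => ?_⟩
    · rw [k₃ 9 (by decide), k₂ 9 (by norm_num) (by norm_num) (by norm_num) (by omega)]
      exact b₁.1
    · rw [k₃' _ (by omega), k₂ _ (by omega) (by omega) (by omega) (by omega)]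
      exact b₁.2 j hj
  -- loading
  have w₄ : loadProg.Within T T S₃ := Prog.Tame.within (P := loadProg) ⟨⟨_, rfl⟩, trivial⟩ t₃
  have t₄ := w₄.int_le le_rfl _ t₃
  obtain ⟨a₄, l₄⟩ := loadProg_run hM
  set S₄ := (loadProg.run S₃).1 with hS₄
  set m : Mem K := fun a i j l q => S₄.fld (S₃.int 8 + entry a i j l q) with hm
  have hY : C.HoldsInput Y m := by
    refine C.input_holds Y fun q hq => ?_
    simp only [hm]
    rw [hM, l₄ q hq, f₃, f₂, f₁]
  -- decoding
  have w₅ : mainProg.compile.Within T T S₄ := (Stm.compile_tame _).within t₄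
  have t₅ := w₅.int_le le_rfl _ t₄
  obtain ⟨a₅, r₅⟩ := Stm.compile_run mainProg (D := (List.range 16).map (· + 16)) (by decide)
    (by decide) mainProg_ok (σ := S₃.int) (S := S₄) (m := m)
    (fun a ha => a₄ a fun h => ha (by rw [List.mem_singleton.1 h]; decide))
    (fun _ _ _ _ _ _ => rfl)
  set S₅ := (mainProg.compile.run S₄).1 with hS₅
  have w₆ : storeProg.Within T T S₅ := Prog.Tame.within (P := storeProg) ⟨⟨_, rfl⟩, trivial⟩ t₅
  have h8 : S₅.int 8 = C.memSize k B := (a₅ 8 (by decide)).trans hM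
  have r₆ := storeProg_run h8
  have hTQ : T ≤ p + T := Nat.le_add_left _ _
  refine ⟨?_, fun a => ?_, fun x => ?_⟩
  · exact Prog.within_ifLt_pos hs ⟨w₁, w₂.mono hTQ _, w₃.mono hTQ _, w₄.mono hTQ _, w₅.mono hTQ _,
      w₆.mono hTQ _⟩
  · rcases eq_or_ne a 3 with rfl | ha
    · exact Nat.le_add_right _ _
    · exact (t₀ a ha).trans hTQ
  · rw [hpos]
    have hlt : outputPos R z k x < C.memSize k B := by
      have h1 := (finSigmaFinEquiv x.1 : Fin (∑ i, R i)).2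
      have h2 : (payloadEquiv (len R z) k x.2).val < k * N := (payloadEquiv (len R z) k x.2).2
      have h3 : ∑ i, R i ≤ H := Finset.sum_le_sum fun i _ => Nat.le_add_right _ _
      have h4 := Nat.mul_le_mul_right (k * N) (Nat.succ_le_of_lt h1 |>.trans h3)
      rw [Nat.succ_mul] at h4
      have h5 : outputPos R z k x < H * (k * N) := by
        rw [outputPos]
        exact lt_of_lt_of_le (Nat.add_lt_add_left h2 _) h4
      exact h5.trans_le (Nat.le_add_left _ _)
    rw [Prog.run_seq, Prog.run_seq, Prog.run_seq, Prog.run_seq, Prog.run_seq, ← hS₁, ← hS₂, ← hS₃,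
      ← hS₄, ← hS₅, r₆ _ hlt]
    rw [← mainProg_sem hE hbits hY x, ← r₅ 2 (by norm_num) 0 0 0 _, hM]

/-- The number of steps of the decoder. -/
theorem decoder_cost.{u, v} : ∀ s : ℕ, ∃ a d : ℕ, ∀ (K : Type u) (L : Type v) [Field K]
    [Fintype K] [Field L]
    [Algebra K L] [FiniteDimensional K L] (R : Fin s → ℕ) (z k B : ℕ)
    (C : TowerCode K L (len R z)) (Y : Matrix (Fin B) (Position (len R z) k) K),
    (decoder.run (C.input Y)).2 ≤
      a * (B + k + (∑ i, len R z i) + Nat.size (Fintype.card K)) ^ d := by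
  obtain ⟨c, d, hcost⟩ := Prog.cost_le.{u} decoder
  intro s
  rcases Nat.eq_zero_or_pos s with rfl | hs
  -- Without sources the program stops after one comparison, whose cost is constant.
  · refine ⟨5, 0, fun K L _ _ _ _ _ R z k B C Y => ?_⟩
    rw [pow_zero, decoder, Prog.run, if_neg (by exact lt_irrefl _)]
    simp only [Prog.run, IntExp.cost, IntExp.eval, input_zero, Nat.size_zero]
    norm_num
  -- The bit length of the integer bound contributes at most `8 * W`, because that of `|K|` is part
  -- of `A`; the number of rounds contributes `7 * W` to the power `d`.
  · refine ⟨c * 8 * 7 ^ d, (3 * s + 4) * (d + 1), fun K L _ _ _ _ _ R z k B C Y => ?_⟩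
    have hp2 : 2 ≤ Fintype.card K := Fintype.one_lt_card
    set A := B + k + (∑ i, len R z i) + Nat.size (Fintype.card K) with hA
    set W := A ^ (3 * s + 4) with hW
    have hsize : 2 ≤ (Fintype.card K).size := Nat.size_le_size hp2
    have hA2 : 2 ≤ A := by omega
    have hAW : A ≤ W := Nat.le_self_pow (by omega) A
    obtain ⟨hw, hint, -⟩ := C.decoder_run Y hs hp2 hA (T := 6 * W) rfl
    clear_value W A
    have h1 := hcost K (C.input Y) _ _ (Nat.le_add_left _ _) hint hw
    have h2 := size_add_le (Fintype.card K) (6 * W)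
    have h3 : (6 * W).size ≤ 6 * W := Nat.size_le.2 Nat.lt_two_pow_self
    calc _ ≤ _ := h1
      _ ≤ c * (8 * W) * (7 * W) ^ d := by gcongr <;> omega
      _ = c * 8 * 7 ^ d * W ^ (d + 1) := by ring
      _ = _ := by rw [hW, ← pow_mul]

end TowerCode

end NetCode
end

theorem theorem3 :
    ∃ dec : NetCode.Prog, ∀ s : ℕ, ∃ a d : ℕ,
      ∀ (K L : Type*) [Field K] [Fintype K] [Field L] [Algebra K L] [FiniteDimensional K L]
        (R : Fin s → ℕ) (z k B : ℕ) (C : NetCode.TowerCode K L (NetCode.len R z)),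
      (∃ δ : ∀ i, Matrix (Fin B) (NetCode.Position (NetCode.len R z) k) K →
            Matrix (Fin (R i)) (NetCode.Payload (NetCode.len R z) k) K,
        ∀ Y : Matrix (Fin B) (NetCode.Position (NetCode.len R z) k) K,
          (dec.run (C.input Y)).1.Holds (C.successive δ Y) ∧
          (dec.run (C.input Y)).2 ≤
            a * (B + k + (∑ i, NetCode.len R z i) + Nat.size (Fintype.card K)) ^ d) ∧
      ∀ (V E : Type*) [Finite V] [Fintype E] [DecidableEq E] (net : NetCode.Network V E)
        (src : Fin s → V) (sinks : Set V),
        Function.Injective src → (∀ i, src i ∉ sinks) →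
        (∀ I : Finset (Fin s), I.Nonempty →
          (((∑ i ∈ I, R i) + 2 * z : ℕ) : ℕ∞) ≤ net.multicastCut (src '' (I : Set (Fin s))) sinks) →
        ∀ t ∈ sinks, ∀ ord : Fin B ≃ {e : E // net.head e = t},
          ENNReal.ofReal (1 - (s : ℝ) * Fintype.card E / Fintype.card K) ≤
            (PMF.uniformOfFintype
              (NetCode.TowerCode.Coeffs K (NetCode.len R z) E)).toOuterMeasure
              {ω | ∀ (X : NetCode.Info K R z k)
                  (Z : E → NetCode.Position (NetCode.len R z) k → K),
                  {e | Z e ≠ 0}.ncard ≤ z →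
                  (dec.run (C.input (C.received net src ord ω X Z))).1.Holds X} := by
  refine ⟨NetCode.decoder, fun s => ?_⟩
  obtain ⟨a, d, hcost⟩ := NetCode.TowerCode.decoder_cost s
  refine ⟨a, d, fun K L _ _ _ _ _ R z k B C => ?_⟩
  have hholds : ∀ Y : Matrix (Fin B) (NetCode.Position (NetCode.len R z) k) K,
      (NetCode.decoder.run (C.input Y)).1.Holds (C.successive C.stage Y) := fun Y i r c =>
    (C.decoder_run Y (Nat.zero_lt_of_lt i.2) Fintype.one_lt_card rfl rfl).2.2 (⟨i, r⟩, c)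
  refine ⟨⟨C.stage, fun Y => ⟨hholds Y, hcost K L R z k B C Y⟩⟩, ?_⟩
  intro V E _ _ _ net src sinks _ hsrc hcut t ht ord
  -- Once the coefficients make all stages decodable, recovery holds for all information and all
  -- admissible injections together, so the adversary may know the coefficients.
  refine (C.le_uniform_decodable net src ord sinks ht hsrc hcut).trans
    (MeasureTheory.measure_mono fun ω hω X Z hZ => ?_)
  have h := hholds (C.received net src ord ω X Z)
  rwa [C.successive_received net src ord ω hω X Z hZ] at h
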